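/- **Setting.** Let $M$ be a smooth manifold, possibly infinite dimensional (more generally a diffeological space; differential forms are compatible families of forms on the domains of smooth maps $\mathbb{R}^n\to M$, which on a manifold are the ordinary forms), with a smooth action of $\mathbb{T}=\mathbb{R}/\mathbb{Z}$ with Killing field $K$, and an open cover $\{U_\alpha\}$ by $\mathbb{T}$-invariant sets. Let $\mathcal{G}=(\{U_\alpha\},H,B_\alpha,A_{\alpha\beta})$ be a weak $\mathbb{T}$-invariant gerbe: $\mathbb{T}$-invariant complex forms $H\in\Omega^3(M)$, $B_\alpha\in\Omega^2(U_\alpha)$, $A_{\alpha\beta}\in\Omega^1(U_{\alpha\beta})$ with $H=dB_\alpha$, $B_\alpha-B_\beta=dA_{\alpha\beta}$, $A_{\alpha\beta}+A_{\beta\gamma}-A_{\alpha\gamma}=d\ln C_{\alpha\beta\gamma}$ for some smooth $C_{\alpha\beta\gamma}:U_{\alpha\beta\gamma}\to U(1)$, and $\iota_KA_{\alpha\beta}+\iota_KA_{\beta\gamma}-\iota_KA_{\alpha\gamma}\in 2\pi i\mathbb{Z}$ at every point. (Integrality of the periods of $\frac1{2\pi i}H$ is not needed.) Let $(\xi,\nabla^\xi)$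 be a $\mathbb{T}$-equivariant Hermitian line bundle with $\mathbb{T}$-invariant Hermitian connection, coupled with $\mathcal{G}$: in $\mathbb{T}$-invariant unitary frames $s_\alpha$ on $U_\alpha$ one has $\nabla^\xi s_\alpha=-\iota_KB_\alpha\, s_\alpha$, and the components of a section $f_\alpha s_\alpha=f_\beta s_\beta$ satisfy $f_\alpha=e^{-\iota_KA_{\alpha\beta}}f_\beta$. Let $\pi:S\xi\to M$ be the unit circle bundle with its commuting actions of $\mathbb{T}$ and $U(1)$. Write a point of $\pi^{-1}(U_\alpha)$ as $e^{2\pi i\theta_\alpha}s_\alpha$. Let $\Theta=2\pi i\,d\theta_\alpha-\pi^*\iota_KB_\alpha$ be the connection form, and let $v=-i\,\partial_s$, where $\partial_s$ generates the flow $e^{is}$ of $U(1)$, so that $\iota_v\Theta=1$. Let $u$ be an indeterminate of degree 2, put $$D=d-\iota_v-u\iota_K+\Theta+u^{-1}\pi^*H,$$ and $\widetilde\Omega^*(S\xi)=\{\omega\in\Omega^*(S\xi):\iota_v\omega=0,\ L_v\omega=-\omega\}$ (complex-valued forms). The map $f(\omega)=\gamma^{-1}\pi^*\omega$, with $\gamma$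 the tautological section of $\pi^*\xi$, identifies $\Omega^*(M,\xi)^{\mathbb{T}}$ with $\widetilde\Omega^*(S\xi)^{\mathbb{T}}$. Let $h_{\mathbb{T}}^*(M,\nabla^\xi:H)$ be the cohomology of $(\Omega^*(M,\xi)^{\mathbb{T}}[[u,u^{-1}]],\nabla^\xi-u\iota_K+u^{-1}H)$, where $[[u,u^{-1}]]$ denotes formal series infinite in both directions. Fix a complex Hilbert space $\mathfrak{H}$. Let $\mathfrak{I}$ be the trace class operators on $\mathfrak H$ and $U_{\mathfrak I}$ the group of unitary operators of the form identity + trace class. A $(\mathbb{T}\times U(1))$-equivariant gerbe module $E=\{E_\alpha\}$ consists of $(\mathbb{T}\times U(1))$-equivariant Hilbert bundles $E_\alpha\to\pi^{-1}(U_\alpha)$ with fibre $\mathfrak H$ and structure group $U_{\mathfrak I}$, and equivariant unitary isomorphisms $\phi_{\alpha\beta}:\hat L_{\alpha\beta}\otimes E_\beta\cong E_\alpha$, where $\hat L_{\alpha\beta}$ is the trivial line bundle with trivial lifted action and connection $d-\pi^*A_{\alpha\beta}$ (so its curvature is $\pi^*B_\beta-\pi^*B_\alpha$). On triple overlaps the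 $\phi_{\alpha\beta}$ are compatible with the connection-preserving isomorphisms $\hat L_{\alpha\beta}\otimes\hat L_{\beta\gamma}\cong\hat L_{\alpha\gamma}$ given by $C_{\alpha\beta\gamma}^{-1}$, for some choice of $C_{\alpha\beta\gamma}$ as above. A horizontal connection $\nabla^E$ on $E$ is a family of $(\mathbb{T}\times U(1))$-invariant connections $\nabla^{E_\alpha}$, locally $d+A^E$ with $A^E$ a 1-form with values in $\mathfrak I$, that are respected by the $\phi_{\alpha\beta}$ and satisfy $\nabla^{E_\alpha}_v=L_v$. Let $F^{E_\alpha}$ be the curvature and $\mu^{E_\alpha}_{v+uK}=L_{v+uK}-\nabla^{E_\alpha}_{v+uK}$ the moment. $K^0_{\mathbb T}(M,\nabla^\xi:\mathcal G)$ is the set of pairs $(E,E')$ of equivariant gerbe modules which admit horizontal connections, modulo the equivalence relation generated by: $(E,E')\sim(G,G')$ if $E\oplus G'\oplus N\cong E'\oplus G\oplus N$ as equivariant gerbe modules for some such module $N$. Isomorphisms preserve the $U_{\mathfrak I}$-structures up to constant unitary identifications of the model Hilbert spaces over each index $\alpha$. **Theorem.** (i) For horizontal connections $\nabla^E,\nabla^{E'}$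 on gerbe modules $E,E'$, the local forms $$e^{-u^{-1}\pi^*B_\alpha-2\pi i\theta_\alpha}\,\mathrm{Tr}\Big(e^{-u^{-1}(F^{E_\alpha}+\mu^{E_\alpha}_{v+uK})}-e^{-u^{-1}(F^{E'_\alpha}+\mu^{E'_\alpha}_{v+uK})}\Big)$$ on $\pi^{-1}(U_\alpha)$ glue to a unique global form $ch=ch_{\nabla^\xi:\mathcal G}(\nabla^E,\nabla^{E'})\in\Omega^*(S\xi)[[u,u^{-1}]]$. It is $\mathbb T$-invariant and satisfies $$\iota_v\,ch=0,\qquad L_v\,ch=-ch,\qquad D\,ch=0.$$ (ii) If $(\nabla_0^E,\nabla_0^{E'})$ and $(\nabla_1^E,\nabla_1^{E'})$ are two choices of horizontal connections on $(E,E')$, then the local forms $$e^{-u^{-1}\pi^*B_\alpha-2\pi i\theta_\alpha}\int_0^1\mathrm{Tr}\Big(-u^{-1}A^{E_\alpha}e^{-u^{-1}(F_t^{E_\alpha}+\mu^{E_\alpha}_{v+uK,t})}+u^{-1}A^{E'_\alpha}e^{-u^{-1}(F_t^{E'_\alpha}+\mu^{E'_\alpha}_{v+uK,t})}\Big)dt,$$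 with $A^{E_\alpha}=\nabla_1^{E_\alpha}-\nabla_0^{E_\alpha}$ and $F_t,\mu_t$ the curvature and moment of $(1-t)\nabla_0+t\nabla_1$ (and likewise for $E'$), glue to a $\mathbb T$-invariant form $cs\in\widetilde\Omega^*(S\xi)[[u,u^{-1}]]$, and $$ch_{\nabla^\xi:\mathcal G}(\nabla_1^E,\nabla_1^{E'})-ch_{\nabla^\xi:\mathcal G}(\nabla_0^E,\nabla_0^{E'})=D\,cs.$$ (iii) For every such $ch$ there is a closed $f^{-1}(ch)\in\Omega^*(M,\xi)^{\mathbb T}[[u,u^{-1}]]$, and there is a unique map $$Ch:K^0_{\mathbb T}(M,\nabla^\xi:\mathcal G)\to h^*_{\mathbb T}(M,\nabla^\xi:H),\qquad Ch(E,E')=\big[f^{-1}\big(ch_{\nabla^\xi:\mathcal G}(\nabla^E,\nabla^{E'})\big)\big]$$ for all $E,E'$ and all horizontal connections on them; that is, the exotic twisted equivariant Chern character is well defined. -/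

import Mathlib

open scoped ContDiff Topology InnerProductSpace
open Diffeology

universe u

noncomputable section

/-! ### Trace class operators and the unitary group `U_𝔍` -/

section TraceClassOperators

variable (H : Type*) [NormedAddCommGroup H] [InnerProductSpace ℂ H]

/-- `C` bounds `∑ |⟨fᵢ, T eᵢ⟩|` for all finite orthonormal families `e`, `f`;
the least such `C` is the trace norm of `T`. -/
def TraceBound {H : Type*} [NormedAddCommGroup H] [InnerProductSpace ℂ H]
    (T : H →L[ℂ] H) (C : ℝ) : Prop :=
  0 ≤ C ∧ ∀ (n : ℕ) (e f : Fin n → H), Orthonormal ℂ e → Orthonormal ℂ f →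
    ∑ i, ‖⟪f i, T (e i)⟫_ℂ‖ ≤ C

theorem TraceBound.add {H : Type*} [NormedAddCommGroup H] [InnerProductSpace ℂ H]
    {S T : H →L[ℂ] H} {C D : ℝ} (hS : TraceBound S C) (hT : TraceBound T D) :
    TraceBound (S + T) (C + D) := by
  refine ⟨add_nonneg hS.1 hT.1, fun n e f he hf => ?_⟩
  calc ∑ i, ‖⟪f i, (S + T) (e i)⟫_ℂ‖
      ≤ ∑ i, (‖⟪f i, S (e i)⟫_ℂ‖ + ‖⟪f i, T (e i)⟫_ℂ‖) := by
        refine Finset.sum_le_sum fun i _ => ?_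
        rw [add_apply, inner_add_right]
        exact norm_add_le _ _
    _ ≤ C + D := by
        rw [Finset.sum_add_distrib]
        exact add_le_add (hS.2 n e f he hf) (hT.2 n e f he hf)

theorem TraceBound.smul {H : Type*} [NormedAddCommGroup H] [InnerProductSpace ℂ H]
    {T : H →L[ℂ] H} {C : ℝ} (hT : TraceBound T C) (c : ℂ) :
    TraceBound (c • T) (‖c‖ * C) := by
  refine ⟨mul_nonneg (norm_nonneg _) hT.1, fun n e f he hf => ?_⟩
  have : ∀ i, ‖⟪f i, (c • T) (e i)⟫_ℂ‖ = ‖c‖ * ‖⟪f i, T (e i)⟫_ℂ‖ := fun i => by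
    rw [smul_apply, inner_smul_right, norm_mul]
  simp only [this, ← Finset.mul_sum]
  exact mul_le_mul_of_nonneg_left (hT.2 n e f he hf) (norm_nonneg _)

theorem TraceBound.zero {H : Type*} [NormedAddCommGroup H] [InnerProductSpace ℂ H] :
    TraceBound (0 : H →L[ℂ] H) 0 :=
  ⟨le_rfl, fun n e f _ _ => by simp⟩

theorem TraceBound.opNorm_le {H : Type*} [NormedAddCommGroup H] [InnerProductSpace ℂ H]
    {T : H →L[ℂ] H} {C : ℝ} (hT : TraceBound T C) : ‖T‖ ≤ C := by
  refine T.opNorm_le_bound hT.1 fun x => ?_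
  by_cases hx : x = 0
  · simp [hx]
  by_cases hy : T x = 0
  · simpa [hy] using mul_nonneg hT.1 (norm_nonneg x)
  have key := hT.2 1 (fun _ => ((‖x‖ : ℂ)⁻¹) • x) (fun _ => ((‖T x‖ : ℂ)⁻¹) • T x)
    ⟨fun _ => by rw [norm_smul, norm_inv, Complex.norm_real, norm_norm,
        inv_mul_cancel₀ (norm_ne_zero_iff.2 hx)],
      fun i j hij => (hij (Subsingleton.elim i j)).elim⟩
    ⟨fun _ => by rw [norm_smul, norm_inv, Complex.norm_real, norm_norm,
        inv_mul_cancel₀ (norm_ne_zero_iff.2 hy)],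
      fun i j hij => (hij (Subsingleton.elim i j)).elim⟩
  have hx' : 0 < ‖x‖ := norm_pos_iff.2 hx
  have hy' : 0 < ‖T x‖ := norm_pos_iff.2 hy
  have h2 : ‖x‖⁻¹ * ‖T x‖ ≤ C := by
    rw [Fin.sum_univ_one, map_smul, inner_smul_left, inner_smul_right, norm_mul, norm_mul,
      RCLike.norm_conj, norm_inv, norm_inv, Complex.norm_real, Complex.norm_real, norm_norm,
      norm_norm, inner_self_eq_norm_sq_to_K, norm_pow, RCLike.norm_ofReal, abs_norm] at key
    convert key using 1
    field_simp
  calc ‖T x‖ = (‖x‖⁻¹ * ‖T x‖) * ‖x‖ := by field_simp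
    _ ≤ C * ‖x‖ := mul_le_mul_of_nonneg_right h2 hx'.le

/-- The trace class operators, as a subspace of the bounded operators. -/
def traceClassSubmodule : Submodule ℂ (H →L[ℂ] H) where
  carrier := {T | ∃ C, TraceBound T C}
  zero_mem' := ⟨0, TraceBound.zero⟩
  add_mem' := fun ⟨C, hC⟩ ⟨D, hD⟩ => ⟨C + D, hC.add hD⟩
  smul_mem' := fun c _ ⟨C, hC⟩ => ⟨‖c‖ * C, hC.smul c⟩

/-- The space `𝔍` of trace class operators on `H`; it carries the trace norm. -/
def TraceClass : Type _ := traceClassSubmodule H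

instance : AddCommGroup (TraceClass H) := inferInstanceAs (AddCommGroup (traceClassSubmodule H))
instance : Module ℂ (TraceClass H) := inferInstanceAs (Module ℂ (traceClassSubmodule H))

variable {H}

/-- The bounded operator underlying a trace class operator. -/
def TraceClass.op (T : TraceClass H) : H →L[ℂ] H := T.1

/-- The trace norm. -/
instance : Norm (TraceClass H) := ⟨fun T => sInf {C | TraceBound T.op C}⟩

theorem TraceClass.bddBelow (T : TraceClass H) : BddBelow {C | TraceBound T.op C} :=
  ⟨0, fun _ h => h.1⟩

theorem TraceClass.norm_le {T : TraceClass H} {C : ℝ} (h : TraceBound T.op C) : ‖T‖ ≤ C :=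
  csInf_le T.bddBelow h

theorem TraceClass.bound (T : TraceClass H) : TraceBound T.op ‖T‖ := by
  have hne : {C | TraceBound T.op C}.Nonempty := T.2
  exact ⟨le_csInf hne fun _ h => h.1,
    fun n e f he hf => le_csInf hne fun _ h => h.2 n e f he hf⟩

theorem TraceClass.core : NormedSpace.Core ℂ (TraceClass H) where
  norm_nonneg T := T.bound.1
  norm_smul c T := by
    apply le_antisymm
    · exact TraceClass.norm_le (T.bound.smul c)
    · by_cases hc : c = 0
      · simpa [hc] using (c • T).bound.1
      · have h := TraceClass.norm_le (T := c⁻¹ • (c • T)) ((c • T).bound.smul c⁻¹)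
        rw [inv_smul_smul₀ hc, norm_inv] at h
        have hc' : 0 < ‖c‖ := norm_pos_iff.2 hc
        calc ‖c‖ * ‖T‖ ≤ ‖c‖ * (‖c‖⁻¹ * ‖c • T‖) := mul_le_mul_of_nonneg_left h hc'.le
          _ = ‖c • T‖ := by field_simp
  norm_triangle S T := TraceClass.norm_le (S.bound.add T.bound)
  norm_eq_zero_iff T := by
    constructor
    · intro h
      have := T.bound.opNorm_le
      rw [h] at this
      exact Subtype.ext (norm_le_zero_iff.1 this)
    · rintro rfl
      exact le_antisymm (TraceClass.norm_le TraceBound.zero) (TraceClass.bound 0).1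

instance : NormedAddCommGroup (TraceClass H) := NormedAddCommGroup.ofCore TraceClass.core
instance : NormedSpace ℂ (TraceClass H) := NormedSpace.ofCore TraceClass.core

/-- The continuous inclusion of the trace class operators into the bounded operators. -/
def TraceClass.incl : TraceClass H →L[ℝ] (H →L[ℂ] H) :=
  LinearMap.mkContinuous
    { toFun := TraceClass.op
      map_add' := fun _ _ => rfl
      map_smul' := fun _ _ => rfl } 1
    fun T => by rw [one_mul]; exact T.bound.opNorm_le

/-- The trace `∑ ⟨bᵢ, T bᵢ⟩` along a Hilbert basis `b`. -/
def opTrace [CompleteSpace H] (T : H →L[ℂ] H) : ℂ :=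
  let w := (exists_hilbertBasis ℂ H).choose
  let b : HilbertBasis w ℂ H := (exists_hilbertBasis ℂ H).choose_spec.choose
  ∑' i, ⟪b i, T (b i)⟫_ℂ

variable (H) in
/-- The group `U_𝔍` of unitary operators of the form identity + trace class operator. -/
def UnitaryTraceClass [CompleteSpace H] : Subgroup (unitary (H →L[ℂ] H)) where
  carrier := {U | (U : H →L[ℂ] H) - 1 ∈ traceClassSubmodule H}
  one_mem' := by
    show ((1 : unitary (H →L[ℂ] H)) : H →L[ℂ] H) - 1 ∈ traceClassSubmodule H
    simp
  mul_mem' := by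
    rintro U V ⟨C, hC⟩ ⟨D, hD⟩
    have : ((U * V : unitary (H →L[ℂ] H)) : H →L[ℂ] H) - 1
        = ((U : H →L[ℂ] H) - 1) * (V : H →L[ℂ] H) + ((V : H →L[ℂ] H) - 1) := by
      simp [sub_mul]
    refine ⟨C + D, ?_⟩
    rw [this]
    refine TraceBound.add ⟨hC.1, fun n e f he hf => ?_⟩ hD
    have hV : Orthonormal ℂ (fun i => (V : H →L[ℂ] H) (e i)) := by
      rw [orthonormal_iff_ite] at he ⊢
      intro i j
      rw [← ContinuousLinearMap.adjoint_inner_right, ← ContinuousLinearMap.star_eq_adjoint,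
        ← mul_apply_eq_comp, Unitary.coe_star_mul_self]
      exact he i j
    exact hC.2 n _ f hV hf
  inv_mem' := by
    rintro U ⟨C, hC⟩
    have : ((U⁻¹ : unitary (H →L[ℂ] H)) : H →L[ℂ] H) - 1 = star ((U : H →L[ℂ] H) - 1) := by
      rw [star_sub, star_one]
      rfl
    refine ⟨C, ?_⟩
    rw [this]
    refine ⟨hC.1, fun n e f he hf => ?_⟩
    have h := hC.2 n f e hf he
    refine le_trans (le_of_eq (Finset.sum_congr rfl fun i _ => ?_)) h
    rw [ContinuousLinearMap.star_eq_adjoint, ContinuousLinearMap.adjoint_inner_right,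
      norm_inner_symm]

/-- The operator of an element of `U_𝔍`. -/
def utcOp [CompleteSpace H] (g : UnitaryTraceClass H) : H →L[ℂ] H := g.1.1

/-- The trace class operator `g - 1` for `g ∈ U_𝔍`. -/
def utcSubOne [CompleteSpace H] (g : UnitaryTraceClass H) : TraceClass H :=
  ⟨utcOp g - 1, g.2⟩

end TraceClassOperators

/-! ### Differential forms

The manifolds of this development may be infinite dimensional, so smoothness is handled through
plots: a smooth structure on `X` is the datum of the smooth maps `ℝⁿ → X`, and a differential form
on `X` is the compatible family of its pullbacks along all such maps. On an ordinary manifold the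
family `p ↦ p^* w` and the form `w` determine each other. -/

section Forms

/-- The test space `ℝⁿ`. -/
abbrev Eu (n : ℕ) : Type := EuclideanSpace ℝ (Fin n)

/-- `F`-valued alternating `k`-forms on the vector space `ℝⁿ`. -/
abbrev Alt (n : ℕ) (F : Type*) [NormedAddCommGroup F] [NormedSpace ℝ F] (k : ℕ) : Type _ :=
  Eu n [⋀^Fin k]→L[ℝ] F

/-- Candidates for `F`-valued `k`-forms on `X`: `w n p x` stands for `(p^* w)ₓ`, where
`p : ℝⁿ → X`. Only values at plots `p` matter. -/
abbrev FormFamily (X F : Type*) [NormedAddCommGroup F] [NormedSpace ℝ F] (k : ℕ) : Type _ :=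
  ∀ n : ℕ, (Eu n → X) → Eu n → Alt n F k

/-- `w` is a smooth differential form on the open subset `W` of `X`: its values at the points of
the plots that lie in `W` are smooth and compatible with smooth changes of plots. -/
def IsFormOn {X F : Type*} [DiffeologicalSpace X] [NormedAddCommGroup F] [NormedSpace ℝ F] {k : ℕ}
    (W : Set X) (w : FormFamily X F k) : Prop :=
  (∀ (n : ℕ) (p : Eu n → X), IsPlot p → ∀ x, p x ∈ W → ContDiffAt ℝ ∞ (w n p) x) ∧
  ∀ (n m : ℕ) (p : Eu n → X) (h : Eu m → Eu n), IsPlot p → ContDiff ℝ ∞ h →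
    ∀ y, p (h y) ∈ W →
      w m (p ∘ h) y = (w n p (h y)).compContinuousLinearMap (fderiv ℝ h y)

/-- The form `w` on `W` is invariant under the action of the group element `t`. -/
def InvariantOn {G X F : Type*} [SMul G X] [DiffeologicalSpace X] [NormedAddCommGroup F]
    [NormedSpace ℝ F] {k : ℕ} (t : G) (W : Set X) (w : FormFamily X F k) : Prop :=
  ∀ (n : ℕ) (p : Eu n → X), IsPlot p → ∀ x, p x ∈ W → w n (fun y => t • p y) x = w n p x

/-- The exterior derivative. -/
def extD {X F : Type*} [NormedAddCommGroup F] [NormedSpace ℝ F] {k : ℕ}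
    (w : FormFamily X F k) : FormFamily X F (k + 1) :=
  fun n p x => extDeriv (w n p) x

/-- The exterior product of alternating forms with values in a normed algebra. -/
def wedge {n : ℕ} {F : Type*} [NormedRing F] [NormedAlgebra ℝ F] {p q k : ℕ} (h : p + q = k)
    (a : Alt n F p) (b : Alt n F q) : Alt n F k :=
  let c : Eu n [⋀^Fin k]→ₗ[ℝ] F :=
    ((LinearMap.mul' ℝ F).compAlternatingMap
      (a.toAlternatingMap.domCoprod b.toAlternatingMap)).domDomCongr
        (finSumFinEquiv.trans (finCongr h))
  { toMultilinearMap := c.toMultilinearMap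
    map_eq_zero_of_eq' := c.map_eq_zero_of_eq'
    cont := by
      have h1 : Continuous fun v : Fin k → Eu n => c v := by
        simp only [c, AlternatingMap.domDomCongr_apply, LinearMap.compAlternatingMap_apply]
        simp only [← AlternatingMap.coe_multilinearMap, AlternatingMap.domCoprod_coe,
          sum_apply, map_sum]
        refine continuous_finsetSum _ fun s _ => ?_
        induction s using Quotient.inductionOn' with
        | h s =>
          simp only [AlternatingMap.domCoprod.summand_mk'', smul_apply,
            MultilinearMap.domDomCongr_apply, MultilinearMap.domCoprod_apply,
            map_zsmul_unit, LinearMap.mul'_apply]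
          refine Continuous.const_smul ?_ _
          exact (a.cont.comp (by fun_prop)).mul (b.cont.comp (by fun_prop))
      exact h1 }

/-- The map `(t, x) ↦ fl t (p x)` on `ℝ × ℝⁿ = ℝⁿ⁺¹`. -/
def flowOut {X : Type*} (fl : ℝ → X → X) {n : ℕ} (p : Eu n → X) : Eu (n + 1) → X :=
  fun z => fl (z 0) (p (WithLp.toLp 2 fun i => z i.succ))

/-- The inclusion `x ↦ (0, x)` of `ℝⁿ` into `ℝ × ℝⁿ = ℝⁿ⁺¹`. -/
def zeroSlice (n : ℕ) : Eu n →L[ℝ] Eu (n + 1) :=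
  LinearMap.toContinuousLinearMap
    { toFun := fun x => WithLp.toLp 2 (Fin.cons 0 fun i => x i)
      map_add' := fun x y => by
        ext i
        refine Fin.cases ?_ (fun i => ?_) i <;> simp
      map_smul' := fun c x => by
        ext i
        refine Fin.cases ?_ (fun i => ?_) i <;> simp }

/-- The contraction of `w` with the vector field that generates the flow `fl`. -/
def contract {X F : Type*} [NormedAddCommGroup F] [NormedSpace ℝ F] (fl : ℝ → X → X) {k : ℕ}
    (w : FormFamily X F (k + 1)) : FormFamily X F k :=
  fun n p x => ((w (n + 1) (flowOut fl p) (zeroSlice n x)).curryLeft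
    (EuclideanSpace.single 0 1)).compContinuousLinearMap (zeroSlice n)

/-- The Lie derivative of `w` along the vector field that generates the flow `fl`. -/
def lieD {X F : Type*} [NormedAddCommGroup F] [NormedSpace ℝ F] (fl : ℝ → X → X) {k : ℕ}
    (w : FormFamily X F k) : FormFamily X F k :=
  fun n p x => deriv (fun t => w n (fun y => fl t (p y)) x) 0

/-- The logarithmic differential `c⁻¹ dc` of a function `c` with values in `U(1)`. -/
def dlog {n : ℕ} (c : Eu n → Circle) (x : Eu n) : Alt n ℂ 1 :=
  ContinuousAlternatingMap.ofSubsingleton ℝ (Eu n) ℂ 0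
    ((c x : ℂ)⁻¹ • fderiv ℝ (fun y => (c y : ℂ)) x)

/-- Formal power series in `u⁻¹` of inhomogeneous alternating forms on `ℝⁿ`:
`S j k` is the degree `k` part of the coefficient of `u⁻ʲ`. -/
abbrev Ser (n : ℕ) (F : Type*) [NormedAddCommGroup F] [NormedSpace ℝ F] : Type _ :=
  ℕ → ∀ k : ℕ, Alt n F k

/-- The unit series. -/
def Ser.one {n : ℕ} {F : Type*} [NormedRing F] [NormedAlgebra ℝ F] : Ser n F
  | 0, 0 => ContinuousAlternatingMap.constOfIsEmpty ℝ (Eu n) (Fin 0) 1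
  | _, _ => 0

/-- The exterior product of two series. -/
def Ser.mul {n : ℕ} {F : Type*} [NormedRing F] [NormedAlgebra ℝ F] (S T : Ser n F) : Ser n F :=
  fun j k => ∑ a ∈ Finset.HasAntidiagonal.antidiagonal j, ∑ b ∈ (Finset.HasAntidiagonal.antidiagonal k).attach,
    wedge (Finset.HasAntidiagonal.mem_antidiagonal.1 b.2) (S a.1 b.1.1) (T a.2 b.1.2)

/-- The powers of a series. -/
def Ser.pow {n : ℕ} {F : Type*} [NormedRing F] [NormedAlgebra ℝ F] (S : Ser n F) : ℕ → Ser n F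
  | 0 => Ser.one
  | m + 1 => Ser.mul (Ser.pow S m) S

/-- The exponential of a series. -/
def Ser.exp {n : ℕ} {F : Type*} [NormedRing F] [NormedAlgebra ℝ F] (S : Ser n F) : Ser n F :=
  fun j k => ∑' m : ℕ, ((m.factorial : ℝ)⁻¹) • Ser.pow S m j k

/-- The trace of a form with values in trace class operators. -/
def traceAlt {H : Type*} [NormedAddCommGroup H] [InnerProductSpace ℂ H] [CompleteSpace H]
    {n k : ℕ} (w : Alt n (H →L[ℂ] H) k) : Alt n ℂ k :=
  open scoped Classical in if h : ∃ τ : Alt n ℂ k, ∀ v, τ v = opTrace (w v) then h.choose else 0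

/-- Formal Laurent series in `u`, infinite in both directions, of inhomogeneous forms on `X`:
`W j k` is the degree `k` part of the coefficient of `uʲ`. -/
abbrev Laurent (X : Type*) : Type _ := ℤ → ∀ k : ℕ, FormFamily X ℂ k

/-- The elements of `Ω^*(W)[[u, u⁻¹]]`; each coefficient has finitely many nonzero degrees. -/
def IsLaurentOn {X : Type*} [DiffeologicalSpace X] (W : Set X) (w : Laurent X) : Prop :=
  (∀ j k, IsFormOn W (w j k)) ∧
  ∀ j, ∃ N, ∀ k ≥ N, ∀ (n : ℕ) (p : Eu n → X), IsPlot p → ∀ x, p x ∈ W → w j k n p x = 0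

end Forms

/-! ### `𝕋`-manifolds, gerbes, line bundles and circle bundles -/

section Geometry


/-- A map from `ℝⁿ` to the circle is smooth. -/
def SmoothCircleMap {n : ℕ} (c : Eu n → Circle) : Prop :=
  ContDiff ℝ ∞ fun x => (c x : ℂ)

/-- The circle `𝕋` acts smoothly on `M`. -/
def IsSmoothCircleAction (M : Type*) [DiffeologicalSpace M] [MulAction Circle M] : Prop :=
  ∀ (n : ℕ) (c : Eu n → Circle) (p : Eu n → M), SmoothCircleMap c → IsPlot p →
    IsPlot fun x => c x • p x

/-- The torus `𝕋 × U(1)` acts smoothly on `X`. -/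
def IsSmoothTorusAction (X : Type*) [DiffeologicalSpace X] [MulAction (Circle × Circle) X] :
    Prop :=
  ∀ (n : ℕ) (c d : Eu n → Circle) (p : Eu n → X), SmoothCircleMap c → SmoothCircleMap d →
    IsPlot p → IsPlot fun x => (c x, d x) • p x

/-- The flow of the Killing vector field `K` on a space with an action of `𝕋 = ℝ/ℤ`. -/
def flowK {M : Type*} [MulAction Circle M] (t : ℝ) (x : M) : M :=
  Circle.exp (2 * Real.pi * t) • x

/-- The flow of the Killing vector field `K` of the factor `𝕋` of `𝕋 × U(1)`. -/
def flowT {X : Type*} [MulAction (Circle × Circle) X] (t : ℝ) (x : X) : X :=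
  (Circle.exp (2 * Real.pi * t), (1 : Circle)) • x

/-- The flow `s ↦ e^{is}` of the factor `U(1)` of `𝕋 × U(1)`. -/
def flowU {X : Type*} [MulAction (Circle × Circle) X] (s : ℝ) (x : X) : X :=
  ((1 : Circle), Circle.exp s) • x

/-- The contraction `ι_v`, where `v = -i ∂/∂s` with `∂/∂s` the generator of the flow `e^{is}`. -/
def contractV {X : Type*} [MulAction (Circle × Circle) X] {k : ℕ} (w : FormFamily X ℂ (k + 1)) :
    FormFamily X ℂ k :=
  (-Complex.I) • contract flowU w

/-- The Lie derivative `L_v`, where `v = -i ∂/∂s` as in `contractV`. -/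
def lieV {X : Type*} [MulAction (Circle × Circle) X] {k : ℕ} (w : FormFamily X ℂ k) :
    FormFamily X ℂ k :=
  (-Complex.I) • lieD flowU w

/-- An open cover `{U_α}` by `𝕋`-invariant subsets; it makes `M` a good `𝕋`-manifold. -/
structure GoodCover (M : Type u) [DiffeologicalSpace M] [MulAction Circle M] (ι : Type u) where
  U : ι → Set M
  isOpen : ∀ α, IsOpen[dTopology] (U α)
  exists_mem : ∀ x, ∃ α, x ∈ U α
  smul_mem_iff : ∀ α (t : Circle) x, t • x ∈ U α ↔ x ∈ U α

variable {M : Type u} [DiffeologicalSpace M] [MulAction Circle M] {ι : Type u}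

/-- A function with values in `U(1)` is smooth on the open subset `W`. -/
def SmoothCircleOn (W : Set M) (c : M → Circle) : Prop :=
  ∀ (n : ℕ) (p : Eu n → M), IsPlot p → ∀ x, p x ∈ W → ContDiffAt ℝ ∞ (fun y => (c (p y) : ℂ)) x

/-- Functions `C_{αβγ}` with `A_{αβ} + A_{βγ} - A_{αγ} = d ln C_{αβγ}` on `U_{αβγ}`. -/
def IsGerbeCochain (𝒰 : GoodCover M ι) (A : ι → ι → FormFamily M ℂ 1)
    (C : ι → ι → ι → M → Circle) : Prop :=
  ∀ α β γ, SmoothCircleOn (𝒰.U α ∩ 𝒰.U β ∩ 𝒰.U γ) (C α β γ) ∧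
    ∀ (n : ℕ) (p : Eu n → M), IsPlot p → ∀ x, p x ∈ 𝒰.U α ∩ 𝒰.U β ∩ 𝒰.U γ →
      A α β n p x + A β γ n p x - A α γ n p x = dlog (fun y => C α β γ (p y)) x

/-- A weak `𝕋`-invariant gerbe `({U_α}, H, B_α, A_{αβ})` on `M`. -/
structure WeakInvariantGerbe (𝒰 : GoodCover M ι) where
  H : FormFamily M ℂ 3
  B : ι → FormFamily M ℂ 2
  A : ι → ι → FormFamily M ℂ 1
  isForm_H : IsFormOn Set.univ H
  isForm_B : ∀ α, IsFormOn (𝒰.U α) (B α)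
  isForm_A : ∀ α β, IsFormOn (𝒰.U α ∩ 𝒰.U β) (A α β)
  H_eq : ∀ α (n : ℕ) (p : Eu n → M), IsPlot p → ∀ x, p x ∈ 𝒰.U α → H n p x = extD (B α) n p x
  B_sub : ∀ α β (n : ℕ) (p : Eu n → M), IsPlot p → ∀ x, p x ∈ 𝒰.U α ∩ 𝒰.U β →
    B α n p x - B β n p x = extD (A α β) n p x
  exists_cochain : ∃ C, IsGerbeCochain 𝒰 A C
  invariant_H : ∀ t : Circle, InvariantOn t Set.univ H
  invariant_B : ∀ α (t : Circle), InvariantOn t (𝒰.U α) (B α)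
  invariant_A : ∀ α β (t : Circle), InvariantOn t (𝒰.U α ∩ 𝒰.U β) (A α β)
  contract_mem : ∀ α β γ (n : ℕ) (p : Eu n → M), IsPlot p →
    ∀ x, p x ∈ 𝒰.U α ∩ 𝒰.U β ∩ 𝒰.U γ → ∃ m : ℤ,
      (contract flowK (A α β) n p x + contract flowK (A β γ) n p x
        - contract flowK (A α γ) n p x) ![] = 2 * Real.pi * Complex.I * m

/-- A `𝕋`-equivariant Hermitian line bundle `ξ` on `M` with a `𝕋`-invariant Hermitian connection,
given in `𝕋`-invariant unitary frames `s_α` over the `U_α`: a section `f_α s_α` satisfies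
`f_α = g_{αβ} f_β` on `U_{αβ}`, and `∇^ξ s_α = η_α s_α`. -/
structure HermitianLineBundle (𝒰 : GoodCover M ι) where
  g : ι → ι → M → Circle
  η : ι → FormFamily M ℂ 1
  smooth_g : ∀ α β, SmoothCircleOn (𝒰.U α ∩ 𝒰.U β) (g α β)
  cocycle : ∀ α β γ x, x ∈ 𝒰.U α → x ∈ 𝒰.U β → x ∈ 𝒰.U γ → g α β x * g β γ x = g α γ x
  invariant_g : ∀ α β (t : Circle) x, x ∈ 𝒰.U α → x ∈ 𝒰.U β → g α β (t • x) = g α β x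
  isForm_η : ∀ α, IsFormOn (𝒰.U α) (η α)
  invariant_η : ∀ α (t : Circle), InvariantOn t (𝒰.U α) (η α)
  imaginary_η : ∀ α (n : ℕ) (p : Eu n → M), IsPlot p → ∀ x, p x ∈ 𝒰.U α →
    ∀ v, (η α n p x v).re = 0
  η_eq : ∀ α β (n : ℕ) (p : Eu n → M), IsPlot p → ∀ x, p x ∈ 𝒰.U α ∩ 𝒰.U β →
    η β n p x = η α n p x + dlog (fun y => g α β (p y)) x

/-- `(ξ, ∇^ξ)` and the gerbe are coupled: in the frames `s_α`, the connection forms are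
`-ι_K B_α` and the transition functions are `e^{-ι_K A_{αβ}}`. -/
def IsCoupled {𝒰 : GoodCover M ι} (L : HermitianLineBundle 𝒰) (𝒢 : WeakInvariantGerbe 𝒰) : Prop :=
  (∀ α (n : ℕ) (p : Eu n → M), IsPlot p → ∀ x, p x ∈ 𝒰.U α →
    L.η α n p x = -contract flowK (𝒢.B α) n p x) ∧
  ∀ α β (n : ℕ) (p : Eu n → M), IsPlot p → ∀ x, p x ∈ 𝒰.U α ∩ 𝒰.U β →
    (L.g α β (p x) : ℂ) = Complex.exp (-(contract flowK (𝒢.A α β) n p x ![]))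

/-- The circle bundle `Sξ`: a point over `x` is a unit vector of `ξ_x`, given by its coordinates
`y_α = e^{2πiθ_α}` in the frames `s_α`. -/
@[ext]
structure CircleBundle {𝒰 : GoodCover M ι} (L : HermitianLineBundle 𝒰) where
  base : M
  coord : ∀ α, base ∈ 𝒰.U α → Circle
  compat : ∀ α β (hα : base ∈ 𝒰.U α) (hβ : base ∈ 𝒰.U β),
    coord α hα = L.g α β base * coord β hβ

variable {𝒰 : GoodCover M ι} {L : HermitianLineBundle 𝒰}

/-- The coordinate `e^{2πiθ_α}` on `π⁻¹(U_α)`, extended by `1`. -/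
def CircleBundle.coordAt (α : ι) (s : CircleBundle L) : Circle :=
  open scoped Classical in if h : s.base ∈ 𝒰.U α then s.coord α h else 1

/-- A map to `Sξ` is smooth when its base point and its fibre coordinates are. -/
instance : DiffeologicalSpace (CircleBundle L) where
  plots n := {p | IsPlot (fun y => (p y).base) ∧
    ∀ α x, (p x).base ∈ 𝒰.U α → ContDiffAt ℝ ∞ (fun y => ((p y).coordAt α : ℂ)) x}
  constant_plots s := ⟨isPlot_const, fun _ _ _ => contDiffAt_const⟩
  plot_reparam := fun {n m p f} hp hf =>
    ⟨isPlot_reparam hp.1 hf, fun α x hx => (hp.2 α (f x) hx).comp x hf.contDiffAt⟩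
  locality := fun {n p} hp => by
    refine ⟨DiffeologicalSpace.locality fun x => ?_, fun α x hx => ?_⟩
    · obtain ⟨u, hu, hxu, h⟩ := hp x
      exact ⟨u, hu, hxu, fun hf hf' => (h hf hf').1⟩
    · obtain ⟨u, hu, hxu, h⟩ := hp x
      obtain ⟨ε, hε, hεu⟩ := Metric.isOpen_iff.1 hu x hxu
      have hf : ∀ z, OpenPartialHomeomorph.univBall x ε z ∈ u := fun z => hεu (by
        have := (OpenPartialHomeomorph.univBall x ε).map_source (x := z)
        rw [OpenPartialHomeomorph.univBall_source, OpenPartialHomeomorph.univBall_target _ hε]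
          at this
        exact this trivial)
      have h2 := (h hf OpenPartialHomeomorph.contDiff_univBall).2 α 0 (by
        simpa [OpenPartialHomeomorph.univBall_apply_zero] using hx)
      have h3 : ContDiffAt ℝ ∞ (OpenPartialHomeomorph.univBall x ε).symm x :=
        (OpenPartialHomeomorph.contDiffOn_univBall_symm).contDiffAt
          (Metric.isOpen_ball.mem_nhds (Metric.mem_ball_self hε))
      rw [← OpenPartialHomeomorph.univBall_symm_apply_center x ε] at h2
      refine (h2.comp x h3).congr_of_eventuallyEq ?_
      filter_upwards [Metric.isOpen_ball.mem_nhds (Metric.mem_ball_self hε)] with y hy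
      have : OpenPartialHomeomorph.univBall x ε ((OpenPartialHomeomorph.univBall x ε).symm y) = y :=
        (OpenPartialHomeomorph.univBall x ε).right_inv
          (OpenPartialHomeomorph.ball_subset_univBall_target x ε hy)
      simp [this]

/-- `𝕋` acts through its action on the base and the invariant frames, `U(1)` by multiplication. -/
instance : MulAction (Circle × Circle) (CircleBundle L) where
  smul h s :=
    { base := h.1 • s.base
      coord := fun α hα => h.2 * s.coord α ((𝒰.smul_mem_iff α h.1 s.base).1 hα)
      compat := fun α β hα hβ => by
        have hα' := (𝒰.smul_mem_iff α h.1 s.base).1 hα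
        have hβ' := (𝒰.smul_mem_iff β h.1 s.base).1 hβ
        rw [L.invariant_g α β h.1 s.base hα' hβ', s.compat α β hα' hβ']
        exact mul_left_comm _ _ _ }
  one_smul s := by
    refine CircleBundle.ext (one_smul Circle s.base) ?_
    refine Function.hfunext rfl fun α β hαβ => ?_
    cases hαβ
    refine Function.hfunext (congrArg (· ∈ 𝒰.U α) (one_smul Circle s.base)) fun h h' _ => ?_
    exact heq_of_eq (one_mul _)
  mul_smul a b s := by
    refine CircleBundle.ext (mul_smul a.1 b.1 s.base) ?_
    refine Function.hfunext rfl fun α β hαβ => ?_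
    cases hαβ
    refine Function.hfunext (congrArg (· ∈ 𝒰.U α) (mul_smul a.1 b.1 s.base)) fun h h' _ => ?_
    exact heq_of_eq (mul_assoc _ _ _)

/-- The projection `π : Sξ → M`, applied to a map into `Sξ`. -/
def proj {n : ℕ} (p : Eu n → CircleBundle L) : Eu n → M := fun y => (p y).base

/-- The preimage `π⁻¹(U_α)`. -/
def CircleBundle.over (L : HermitianLineBundle 𝒰) (α : ι) : Set (CircleBundle L) :=
  {s | s.base ∈ 𝒰.U α}

/-- The connection form `Θ = 2πi dθ_α + π^* η_α` on `Sξ`. -/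
def Theta (L : HermitianLineBundle 𝒰) : FormFamily (CircleBundle L) ℂ 1 := fun n p x =>
  let α := (𝒰.exists_mem (p x).base).choose
  dlog (fun y => (p y).coordAt α) x + L.η α n (proj p) x

/-- The operator `d - ι_v - u ι_K + Θ + u⁻¹ π^* H` on `Ω^*(Sξ)[[u, u⁻¹]]`. -/
def circleD (L : HermitianLineBundle 𝒰) (𝒢 : WeakInvariantGerbe 𝒰)
    (w : Laurent (CircleBundle L)) : Laurent (CircleBundle L) := fun j k n p x =>
  (match k with
    | 0 => 0
    | k + 1 => extD (w j k) n p x)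
  - contractV (w j (k + 1)) n p x
  - contract flowT (w (j - 1) (k + 1)) n p x
  + (match k with
    | 0 => 0
    | k + 1 => wedge (Nat.add_comm 1 k) (Theta L n p x) (w j k n p x))
  + (match k with
    | k + 3 => wedge (Nat.add_comm 3 k) (𝒢.H n (proj p) x) (w (j + 1) k n p x)
    | _ => 0)

/-- The elements of `Ω̃^*(Sξ)[[u, u⁻¹]]`: those with `ι_v w = 0` and `L_v w = -w`. -/
def InOmegaTilde (w : Laurent (CircleBundle L)) : Prop :=
  IsLaurentOn Set.univ w ∧
  ∀ j k (n : ℕ) (p : Eu n → CircleBundle L), IsPlot p → ∀ x,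
    contractV (w j (k + 1)) n p x = 0 ∧ lieV (w j k) n p x = -w j k n p x

/-- Invariance of an element of `Ω^*(Sξ)[[u, u⁻¹]]` under `𝕋`. -/
def IsTInvariant (w : Laurent (CircleBundle L)) : Prop :=
  ∀ (t : Circle) j k, InvariantOn (t, (1 : Circle)) Set.univ (w j k)

/-- The elements of `Ω^*(M, ξ)^𝕋[[u, u⁻¹]]`: the form with values in `ξ` is `w_α ⊗ s_α` on
`U_α`. -/
def IsInvariantXiForm (L : HermitianLineBundle 𝒰) (w : ι → Laurent M) : Prop :=
  (∀ α j k, IsFormOn (𝒰.U α) (w α j k)) ∧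
  (∀ j, ∃ N, ∀ k ≥ N, ∀ α (n : ℕ) (p : Eu n → M), IsPlot p → ∀ x, p x ∈ 𝒰.U α →
    w α j k n p x = 0) ∧
  (∀ α β j k (n : ℕ) (p : Eu n → M), IsPlot p → ∀ x, p x ∈ 𝒰.U α ∩ 𝒰.U β →
    w α j k n p x = (L.g α β (p x) : ℂ) • w β j k n p x) ∧
  ∀ α j k (t : Circle), InvariantOn t (𝒰.U α) (w α j k)

/-- The operator `∇^ξ - u ι_K + u⁻¹ H` on forms with values in `ξ`. -/
def xiD (L : HermitianLineBundle 𝒰) (𝒢 : WeakInvariantGerbe 𝒰) (w : ι → Laurent M) :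
    ι → Laurent M := fun α j k n p x =>
  (match k with
    | 0 => 0
    | k + 1 => extD (w α j k) n p x + wedge (Nat.add_comm 1 k) (L.η α n p x) (w α j k n p x))
  - contract flowK (w α (j - 1) (k + 1)) n p x
  + (match k with
    | k + 3 => wedge (Nat.add_comm 3 k) (𝒢.H n p x) (w α (j + 1) k n p x)
    | _ => 0)

/-- The closed elements of `Ω^*(M, ξ)^𝕋[[u, u⁻¹]]`. -/
def ClosedXiForm (L : HermitianLineBundle 𝒰) (𝒢 : WeakInvariantGerbe 𝒰) : Type _ :=
  {w : ι → Laurent M // IsInvariantXiForm L w ∧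
    ∀ α j k (n : ℕ) (p : Eu n → M), IsPlot p → ∀ x, p x ∈ 𝒰.U α → xiD L 𝒢 w α j k n p x = 0}

/-- Two closed elements differ by an exact one. -/
def XiCohomologous (L : HermitianLineBundle 𝒰) (𝒢 : WeakInvariantGerbe 𝒰)
    (w w' : ClosedXiForm L 𝒢) : Prop :=
  ∃ e, IsInvariantXiForm L e ∧ ∀ α j k (n : ℕ) (p : Eu n → M), IsPlot p → ∀ x, p x ∈ 𝒰.U α →
    w.1 α j k n p x - w'.1 α j k n p x = xiD L 𝒢 e α j k n p x

/-- The completed periodic exotic twisted `𝕋`-equivariant cohomology `h_𝕋^*(M, ∇^ξ : H)`. -/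
def ExoticCohomology (L : HermitianLineBundle 𝒰) (𝒢 : WeakInvariantGerbe 𝒰) : Type _ :=
  Quot (XiCohomologous L 𝒢)

/-- `w` corresponds to `ch` under `f : Ω^*(M, ξ) → Ω̃^*(Sξ)`, `f(w) = γ⁻¹ π^* w`, where `γ` is the
tautological section of `π^* ξ`; on `π⁻¹(U_α)` one has `γ = e^{2πiθ_α} π^* s_α`. -/
def MapsTo (w : ι → Laurent M) (ch : Laurent (CircleBundle L)) : Prop :=
  ∀ α j k (n : ℕ) (p : Eu n → CircleBundle L), IsPlot p → ∀ x, (p x).base ∈ 𝒰.U α →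
    ch j k n p x = ((p x).coordAt α : ℂ)⁻¹ • w α j k n (proj p) x

end Geometry

/-! ### Gerbe modules, exotic twisted K-theory and Chern character forms -/

section Modules


/-- A map from `ℝⁿ` to `U_𝔍` is smooth for the trace norm. -/
def SmoothUnitaryMap {H : Type*} [NormedAddCommGroup H] [InnerProductSpace ℂ H] [CompleteSpace H]
    {n : ℕ} (g : Eu n → UnitaryTraceClass H) : Prop :=
  ContDiff ℝ ∞ fun y => utcSubOne (g y)

/-- A `(𝕋 × U(1))`-equivariant Hilbert bundle `E` over the open subset `W` of `X`, with fibre `H`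
and structure group `U_𝔍`, given by its principal `U_𝔍`-bundle `Q` of frames; an element `q` of `Q`
stands for a unitary map from `H` to the fibre of `E` over `pr q`. -/
structure EquivariantHilbertBundle (X : Type u) [DiffeologicalSpace X]
    [MulAction (Circle × Circle) X] (H : Type u) [NormedAddCommGroup H] [InnerProductSpace ℂ H]
    [CompleteSpace H] (W : Set X) where
  Q : Type u
  [diffeology : DiffeologicalSpace Q]
  [torusAction : MulAction (Circle × Circle) Q]
  pr : Q → X
  act : Q → UnitaryTraceClass H → Q
  smooth_pr : DSmooth pr
  pr_mem : ∀ q, pr q ∈ W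
  act_one : ∀ q, act q 1 = q
  act_mul : ∀ q g h, act q (g * h) = act (act q g) h
  smooth_act : ∀ (n : ℕ) (q : Eu n → Q) (g : Eu n → UnitaryTraceClass H), IsPlot q →
    SmoothUnitaryMap g → IsPlot fun y => act (q y) (g y)
  pr_act : ∀ q g, pr (act q g) = pr q
  exists_unique_act : ∀ q q', pr q = pr q' → ∃! g, q' = act q g
  smooth_quotient : ∀ (n : ℕ) (q : Eu n → Q) (g : Eu n → UnitaryTraceClass H), IsPlot q →
    IsPlot (fun y => act (q y) (g y)) → SmoothUnitaryMap g
  -- local triviality: maps into `W` lift locally to `Q`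
  exists_lift : ∀ (n : ℕ) (p : Eu n → X), IsPlot p → ∀ x, p x ∈ W →
    ∃ q : Eu n → Q, IsPlot q ∧ ∀ᶠ y in 𝓝 x, pr (q y) = p y
  smooth_torusAction : IsSmoothTorusAction Q
  pr_smul : ∀ (t : Circle × Circle) q, pr (t • q) = t • pr q
  smul_act : ∀ (t : Circle × Circle) q g, t • act q g = act (t • q) g

attribute [instance] EquivariantHilbertBundle.diffeology EquivariantHilbertBundle.torusAction

variable {M : Type u} [DiffeologicalSpace M] [MulAction Circle M] {ι : Type u}
  {𝒰 : GoodCover M ι}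

/-- A `(𝕋 × U(1))`-equivariant gerbe module `{E_α}` for the gerbe `π^* 𝒢` on `Sξ`.
The isomorphisms `φ_{αβ} : L_{αβ} ⊗ E_β ≅ E_α` are given by their matrices with respect to the
invariant sections of the trivial bundles `L_{αβ}` and the frames of `E_α` and `E_β`. -/
structure GerbeModule (L : HermitianLineBundle 𝒰) (𝒢 : WeakInvariantGerbe 𝒰) (H : Type u)
    [NormedAddCommGroup H] [InnerProductSpace ℂ H] [CompleteSpace H] where
  E : ∀ α, EquivariantHilbertBundle (CircleBundle L) H (CircleBundle.over L α)
  φ : ∀ α β, (E α).Q → (E β).Q → unitary (H →L[ℂ] H)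
  φ_act : ∀ α β q r g h, (E α).pr q = (E β).pr r →
    φ α β ((E α).act q g) ((E β).act r h) = g.1⁻¹ * φ α β q r * h.1
  smooth_φ : ∀ α β (n : ℕ) (q : Eu n → (E α).Q) (r : Eu n → (E β).Q), IsPlot q → IsPlot r →
    (∀ y, (E α).pr (q y) = (E β).pr (r y)) →
    ContDiff ℝ ∞ fun y => (φ α β (q y) (r y) : H →L[ℂ] H)
  φ_smul : ∀ α β q r (t : Circle × Circle), (E α).pr q = (E β).pr r →
    φ α β (t • q) (t • r) = φ α β q r
  -- the isomorphisms `L_{αβ} ⊗ L_{βγ} ≅ L_{αγ}` are given by `C_{αβγ}⁻¹`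
  φ_comp : ∃ C, IsGerbeCochain 𝒰 𝒢.A C ∧ ∀ α β γ q r s, (E α).pr q = (E β).pr r →
    (E β).pr r = (E γ).pr s →
    (φ α β q r * φ β γ r s : H →L[ℂ] H)
      = (C α β γ ((E α).pr q).base : ℂ)⁻¹ • (φ α γ q s : H →L[ℂ] H)

variable {L : HermitianLineBundle 𝒰} {𝒢 : WeakInvariantGerbe 𝒰} {H : Type u}
  [NormedAddCommGroup H] [InnerProductSpace ℂ H] [CompleteSpace H]

/-- The form with values in bounded operators underlying a form with values in `𝔍`. -/
def opForm {X : Type*} {k : ℕ} (A : FormFamily X (TraceClass H) k) :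
    FormFamily X (H →L[ℂ] H) k :=
  fun n p x => TraceClass.incl.compContinuousAlternatingMap (A n p x)

/-- A horizontal gerbe module connection: `(𝕋 × U(1))`-invariant connections `∇^{E_α} = d + A_α`
with `A_α` in `Ω¹ ⊗ 𝔍`, given by the connection form on the frame bundle of `E_α`. -/
structure HorizontalConnection (E : GerbeModule L 𝒢 H) where
  A : ∀ α, FormFamily (E.E α).Q (TraceClass H) 1
  isForm : ∀ α, IsFormOn Set.univ (A α)
  gauge : ∀ α (n : ℕ) (q : Eu n → (E.E α).Q) (g : Eu n → UnitaryTraceClass H), IsPlot q →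
    SmoothUnitaryMap g → ∀ x v,
      opForm (A α) n (fun y => (E.E α).act (q y) (g y)) x v
        = utcOp (g x)⁻¹ * opForm (A α) n q x v * utcOp (g x)
          + utcOp (g x)⁻¹ * fderiv ℝ (fun y => utcOp (g y)) x (v 0)
  invariant : ∀ α (t : Circle × Circle), InvariantOn t Set.univ (A α)
  -- `∇_v = L_v`
  horizontal : ∀ α (n : ℕ) (q : Eu n → (E.E α).Q), IsPlot q → ∀ x,
    contract flowU (A α) n q x = 0
  -- `φ_{αβ}` respects the connections, where `L_{αβ}` carries `d - π^* A_{αβ}`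
  φ_parallel : ∀ α β (n : ℕ) (q : Eu n → (E.E α).Q) (r : Eu n → (E.E β).Q), IsPlot q →
    IsPlot r → (∀ y, (E.E α).pr (q y) = (E.E β).pr (r y)) → ∀ x v,
      fderiv ℝ (fun y => (E.φ α β (q y) (r y) : H →L[ℂ] H)) x (v 0)
        = (E.φ α β (q x) (r x) : H →L[ℂ] H) * opForm (A β) n r x v
          - opForm (A α) n q x v * (E.φ α β (q x) (r x) : H →L[ℂ] H)
          - 𝒢.A α β n (proj fun y => (E.E α).pr (q y)) x v •
              (E.φ α β (q x) (r x) : H →L[ℂ] H)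

/-- The block diagonal operator with blocks `T i`, applied to `x`. -/
def diagApply {m : ℕ} (T : Fin m → H →L[ℂ] H) (x : PiLp 2 fun _ : Fin m => H) :
    PiLp 2 fun _ : Fin m => H :=
  WithLp.toLp 2 fun i => T i (x i)

/-- An isomorphism `E₁ ⊕ ⋯ ⊕ Eₘ ≅ F₁ ⊕ ⋯ ⊕ Fₘ` of `(𝕋 × U(1))`-equivariant gerbe modules, given by
its matrices `Ψ_α` in the frames of the summands. It preserves the structure group `U_𝔍` of the
sums, after an identification `w_α` of their model Hilbert spaces. -/
structure SumIso {m : ℕ} (E F : Fin m → GerbeModule L 𝒢 H) where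
  w : ι → unitary ((PiLp 2 fun _ : Fin m => H) →L[ℂ] (PiLp 2 fun _ : Fin m => H))
  ψ : ∀ α, (∀ i, ((E i).E α).Q) → (∀ i, ((F i).E α).Q) →
    UnitaryTraceClass (PiLp 2 fun _ : Fin m => H)
  Ψ : ∀ α, (∀ i, ((E i).E α).Q) → (∀ i, ((F i).E α).Q) →
    unitary ((PiLp 2 fun _ : Fin m => H) →L[ℂ] (PiLp 2 fun _ : Fin m => H))
  Ψ_eq : ∀ α e f, Ψ α e f = w α * (ψ α e f).1
  smooth_ψ : ∀ α (n : ℕ) (e : Eu n → ∀ i, ((E i).E α).Q) (f : Eu n → ∀ i, ((F i).E α).Q)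
    (p : Eu n → CircleBundle L), (∀ i, IsPlot fun y => e y i) → (∀ i, IsPlot fun y => f y i) →
    (∀ y i, ((E i).E α).pr (e y i) = p y) → (∀ y i, ((F i).E α).pr (f y i) = p y) →
    SmoothUnitaryMap fun y => ψ α (e y) (f y)
  Ψ_act : ∀ α e f s (g h : Fin m → UnitaryTraceClass H), (∀ i, ((E i).E α).pr (e i) = s) →
    (∀ i, ((F i).E α).pr (f i) = s) → ∀ x,
    diagApply (fun i => utcOp (h i))
      ((Ψ α (fun i => ((E i).E α).act (e i) (g i)) (fun i => ((F i).E α).act (f i) (h i))).1 x)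
      = (Ψ α e f).1 (diagApply (fun i => utcOp (g i)) x)
  Ψ_smul : ∀ α e f s (t : Circle × Circle), (∀ i, ((E i).E α).pr (e i) = s) →
    (∀ i, ((F i).E α).pr (f i) = s) → Ψ α (fun i => t • e i) (fun i => t • f i) = Ψ α e f
  Ψ_φ : ∀ α β e f e' f' s, (∀ i, ((E i).E α).pr (e i) = s) → (∀ i, ((F i).E α).pr (f i) = s) →
    (∀ i, ((E i).E β).pr (e' i) = s) → (∀ i, ((F i).E β).pr (f' i) = s) → ∀ x,
    diagApply (fun i => ((F i).φ α β (f i) (f' i)).1) ((Ψ β e' f').1 x)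
      = (Ψ α e f).1 (diagApply (fun i => ((E i).φ α β (e i) (e' i)).1) x)

/-- The equivariant gerbe modules with horizontal connections, the connections being forgotten. -/
def ConnectibleModule (L : HermitianLineBundle 𝒰) (𝒢 : WeakInvariantGerbe 𝒰) (H : Type u)
    [NormedAddCommGroup H] [InnerProductSpace ℂ H] [CompleteSpace H] : Type _ :=
  {E : GerbeModule L 𝒢 H // Nonempty (HorizontalConnection E)}

/-- `(E, E') ∼ (G, G')` if `E ⊕ G' ⊕ K ≅ E' ⊕ G ⊕ K` for some `K`. -/
def StablyEquivalent (a b : ConnectibleModule L 𝒢 H × ConnectibleModule L 𝒢 H) : Prop :=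
  ∃ K : ConnectibleModule L 𝒢 H,
    Nonempty (SumIso ![a.1.1, b.2.1, K.1] ![a.2.1, b.1.1, K.1])

/-- The exotic twisted `𝕋`-equivariant K-theory `K_𝕋^0(M, ∇^ξ : 𝒢)`. -/
def ExoticK (L : HermitianLineBundle 𝒰) (𝒢 : WeakInvariantGerbe 𝒰) (H : Type u)
    [NormedAddCommGroup H] [InnerProductSpace ℂ H] [CompleteSpace H] : Type _ :=
  Quot (StablyEquivalent (L := L) (𝒢 := 𝒢) (H := H))

/-- The class of a pair of modules that admit horizontal connections. -/
def kClass {E E' : GerbeModule L 𝒢 H} (a : HorizontalConnection E) (a' : HorizontalConnection E') :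
    ExoticK L 𝒢 H :=
  Quot.mk _ (⟨E, ⟨a⟩⟩, ⟨E', ⟨a'⟩⟩)

/-- The equivariant curvature `u⁻¹ (F + μ_{v + uK})` of the connection with form `A` on a frame
bundle, along `q`. Here `F = dA + A ∧ A`, and the moment `μ_X = L_X - ∇_X` is `-ι_X A`; its part
`μ_v` vanishes for horizontal connections. -/
def eqCurvature {Q : Type u} [MulAction (Circle × Circle) Q]
    (A : FormFamily Q (TraceClass H) 1) {n : ℕ} (q : Eu n → Q) (x : Eu n) : Ser n (H →L[ℂ] H)
  | 0, 0 => -contract flowT (opForm A) n q x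
  | 1, 2 => extD (opForm A) n q x + wedge rfl (opForm A n q x) (opForm A n q x)
  | _, _ => 0

/-- The factor `exp(-u⁻¹ π^* B_α - 2πiθ_α)`, along `p`. -/
def scalarFactor (𝒢 : WeakInvariantGerbe 𝒰) (α : ι) {n : ℕ} (p : Eu n → CircleBundle L)
    (x : Eu n) : Ser n ℂ :=
  let b : Ser n ℂ := fun j k => match j, k with
    | 1, 2 => -𝒢.B α n (proj p) x
    | _, _ => 0
  ((p x).coordAt α : ℂ)⁻¹ • Ser.exp b

/-- The local expression `exp(-u⁻¹ π^* B_α - 2πiθ_α) Tr(exp(-u⁻¹ (F^{E_α} + μ_{v+uK}^{E_α})) -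
exp(-u⁻¹ (F^{E'_α} + μ_{v+uK}^{E'_α})))` in the frames `q`, `q'`. -/
def chLocal {E E' : GerbeModule L 𝒢 H} (a : HorizontalConnection E) (a' : HorizontalConnection E')
    (α : ι) {n : ℕ} (q : Eu n → (E.E α).Q) (q' : Eu n → (E'.E α).Q) (x : Eu n) : Ser n ℂ :=
  Ser.mul (scalarFactor 𝒢 α (fun y => (E.E α).pr (q y)) x) fun j k =>
    traceAlt (Ser.exp (-eqCurvature (a.A α) q x) j k - Ser.exp (-eqCurvature (a'.A α) q' x) j k)

/-- `ch` is the exotic twisted Chern character form `ch_{∇^ξ:𝒢}(∇^E, ∇^{E'})`. -/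
def IsChernForm {E E' : GerbeModule L 𝒢 H} (a : HorizontalConnection E)
    (a' : HorizontalConnection E') (ch : Laurent (CircleBundle L)) : Prop :=
  (∀ j k, IsFormOn Set.univ (ch j k)) ∧
  ∀ α (n : ℕ) (q : Eu n → (E.E α).Q) (q' : Eu n → (E'.E α).Q), IsPlot q → IsPlot q' →
    (∀ y, (E.E α).pr (q y) = (E'.E α).pr (q' y)) → ∀ x (j : ℤ) k,
      ch j k n (fun y => (E.E α).pr (q y)) x
        = if j ≤ 0 then chLocal a a' α q q' x (-j).toNat k else 0

/-- The interpolation `(1 - t) A₀ + t A₁`. -/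
def interpolate {X : Type*} {k : ℕ} (A₀ A₁ : FormFamily X (TraceClass H) k) (t : ℝ) :
    FormFamily X (TraceClass H) k :=
  (1 - t) • A₀ + t • A₁

/-- The series `-u⁻¹ (A₁ - A₀) exp(-u⁻¹ (F_t + μ_{v+uK,t}))`. -/
def transgression {Q : Type u} [MulAction (Circle × Circle) Q]
    (A₀ A₁ : FormFamily Q (TraceClass H) 1) (t : ℝ) {n : ℕ} (q : Eu n → Q) (x : Eu n) :
    Ser n (H →L[ℂ] H) :=
  let d : Ser n (H →L[ℂ] H) := fun j k => match j, k with
    | 1, 1 => -opForm (A₁ - A₀) n q x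
    | _, _ => 0
  Ser.mul d (Ser.exp (-eqCurvature (interpolate A₀ A₁ t) q x))

/-- The local expression of the Chern-Simons form: `exp(-u⁻¹ π^* B_α - 2πiθ_α)` times
`∫₀¹ Tr(-u⁻¹ A^{E_α} exp(-u⁻¹ (F_t + μ_t)) + u⁻¹ A^{E'_α} exp(-u⁻¹ (F'_t + μ'_t))) dt`. -/
def csLocal {E E' : GerbeModule L 𝒢 H} (a₀ a₁ : HorizontalConnection E)
    (a₀' a₁' : HorizontalConnection E') (α : ι) {n : ℕ} (q : Eu n → (E.E α).Q)
    (q' : Eu n → (E'.E α).Q) (x : Eu n) : Ser n ℂ :=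
  Ser.mul (scalarFactor 𝒢 α (fun y => (E.E α).pr (q y)) x) fun j k =>
    ∫ t in (0 : ℝ)..1, traceAlt (transgression (a₀.A α) (a₁.A α) t q x j k
      - transgression (a₀'.A α) (a₁'.A α) t q' x j k)

/-- `cs` is the form `cs(∇₀^E, ∇₀^{E'}; ∇₁^E, ∇₁^{E'})`. -/
def IsChernSimonsForm {E E' : GerbeModule L 𝒢 H} (a₀ a₁ : HorizontalConnection E)
    (a₀' a₁' : HorizontalConnection E') (cs : Laurent (CircleBundle L)) : Prop :=
  (∀ j k, IsFormOn Set.univ (cs j k)) ∧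
  ∀ α (n : ℕ) (q : Eu n → (E.E α).Q) (q' : Eu n → (E'.E α).Q), IsPlot q → IsPlot q' →
    (∀ y, (E.E α).pr (q y) = (E'.E α).pr (q' y)) → ∀ x (j : ℤ) k,
      cs j k n (fun y => (E.E α).pr (q y)) x
        = if j ≤ 0 then csLocal a₀ a₁ a₀' a₁' α q q' x (-j).toNat k else 0

end Modules

end

set_option linter.unusedSectionVars false
noncomputable section

section PermSum

variable {k : ℕ}

/-- A permutation of `Fin (k + 1)` is determined by the preimage of `0` and a permutation of the
remaining elements. -/
def permOfPreimageZero (x : Fin (k + 1) × Equiv.Perm (Fin k)) : Equiv.Perm (Fin (k + 1)) :=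
  Equiv.Perm.decomposeFin.symm (0, x.2) * x.1.cycleRange

theorem permOfPreimageZero_self (i : Fin (k + 1)) (e : Equiv.Perm (Fin k)) :
    permOfPreimageZero (i, e) i = 0 := by
  simp [permOfPreimageZero]

theorem permOfPreimageZero_succAbove (i : Fin (k + 1)) (e : Equiv.Perm (Fin k)) (j : Fin k) :
    permOfPreimageZero (i, e) (i.succAbove j) = (e j).succ := by
  simp [permOfPreimageZero, Fin.cycleRange_succAbove]

theorem sign_permOfPreimageZero (i : Fin (k + 1)) (e : Equiv.Perm (Fin k)) :
    Equiv.Perm.sign (permOfPreimageZero (i, e)) = (-1) ^ (i : ℕ) * Equiv.Perm.sign e := by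
  rw [permOfPreimageZero, Equiv.Perm.sign_mul, Fin.sign_cycleRange, mul_comm]
  congr 1
  simp [Equiv.Perm.decomposeFin.symm_sign]

theorem permOfPreimageZero_bijective : Function.Bijective (permOfPreimageZero (k := k)) := by
  rw [Fintype.bijective_iff_injective_and_card]
  constructor
  · rintro ⟨i, e⟩ ⟨i', e'⟩ h
    have hi : i = i' := by
      apply (permOfPreimageZero (i', e')).injective
      rw [permOfPreimageZero_self, ← h, permOfPreimageZero_self]
    subst hi
    congr 1
    ext j : 1
    apply Fin.succ_injective
    rw [← permOfPreimageZero_succAbove i, h, permOfPreimageZero_succAbove]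
  · simp [Fintype.card_perm, Nat.factorial_succ]

theorem cons_comp_permOfPreimageZero {E : Type*} (i : Fin (k + 1)) (e : Equiv.Perm (Fin k)) (x : E)
    (w : Fin k → E) :
    (fun j => (Fin.cons x w : Fin (k + 1) → E) (permOfPreimageZero (i, e) j))
      = i.insertNth x (fun j => w (e j)) := by
  funext j
  refine Fin.succAboveCases i ?_ (fun j => ?_) j
  · rw [permOfPreimageZero_self, Fin.insertNth_apply_same, Fin.cons_zero]
  · rw [permOfPreimageZero_succAbove, Fin.insertNth_apply_succAbove, Fin.cons_succ]

end PermSum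

section Wedge

variable {n : ℕ} {F : Type*} [NormedRing F] [NormedAlgebra ℝ F] {p q k : ℕ}

/-- The embedding of the first `p` indices. -/
def leftIdx (h : p + q = k) (i : Fin p) : Fin k := Fin.cast h (Fin.castAdd q i)

/-- The embedding of the last `q` indices. -/
def rightIdx (h : p + q = k) (i : Fin q) : Fin k := Fin.cast h (Fin.natAdd p i)

theorem factorial_smul_wedge (h : p + q = k) (a : Alt n F p) (b : Alt n F q) (v : Fin k → Eu n) :
    (p.factorial * q.factorial) • wedge h a b v
      = ∑ σ : Equiv.Perm (Fin k), Equiv.Perm.sign σ •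
          (a (fun i => v (σ (leftIdx h i))) * b (fun i => v (σ (rightIdx h i)))) := by
  subst h
  have key := congrArg (fun f => (LinearMap.mul' ℝ F) (f (v ∘ finSumFinEquiv)))
    (MultilinearMap.domCoprod_alternization_eq a.toAlternatingMap b.toAlternatingMap)
  simp only [Fintype.card_fin] at key
  refine Eq.trans ?_ (key.symm.trans ?_)
  · rw [AlternatingMap.smul_apply, map_nsmul]
    rfl
  · rw [MultilinearMap.alternatization_apply, map_sum]
    refine Fintype.sum_equiv (Equiv.permCongr finSumFinEquiv) _ _ fun σ => ?_
    rw [Equiv.Perm.sign_permCongr]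
    simp only [Units.smul_def, map_zsmul, MultilinearMap.domDomCongr_apply,
      MultilinearMap.domCoprod_apply, LinearMap.mul'_apply]
    congr 1
    simp [leftIdx, rightIdx]

theorem wedge_zero_zero (h : 0 + 0 = 0) (a b : Alt n F 0) (v : Fin 0 → Eu n) :
    wedge h a b v = a v * b v := by
  have := factorial_smul_wedge h a b v
  simp only [Nat.factorial_zero, mul_one, one_smul, Finset.univ_unique, Finset.sum_singleton] at this
  rw [this]
  simp [Subsingleton.elim _ v]

theorem succAbove_leftIdx (h : p + 1 + q = k + 1) (h' : p + q = k) (i : Fin (p + 1)) (j : Fin p) :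
    (leftIdx h i).succAbove (leftIdx h' j) = leftIdx h (i.succAbove j) := by
  ext
  simp only [leftIdx, Fin.succAbove, Fin.lt_def]
  simp
  split_ifs <;> simp

theorem succAbove_leftIdx_rightIdx (h : p + 1 + q = k + 1) (h' : p + q = k) (i : Fin (p + 1))
    (j : Fin q) :
    (leftIdx h i).succAbove (rightIdx h' j) = rightIdx h j := by
  ext
  simp only [leftIdx, rightIdx, Fin.succAbove, Fin.lt_def]
  simp
  split_ifs <;> simp <;> omega

theorem succAbove_rightIdx (h : p + (q + 1) = k + 1) (h' : p + q = k) (i : Fin (q + 1))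
    (j : Fin q) :
    (rightIdx h i).succAbove (rightIdx h' j) = rightIdx h (i.succAbove j) := by
  ext
  simp only [rightIdx, Fin.succAbove, Fin.lt_def]
  simp
  split_ifs <;> simp <;> omega

theorem succAbove_rightIdx_leftIdx (h : p + (q + 1) = k + 1) (h' : p + q = k) (i : Fin (q + 1))
    (j : Fin p) :
    (rightIdx h i).succAbove (leftIdx h' j) = leftIdx h j := by
  ext
  simp only [leftIdx, rightIdx, Fin.succAbove, Fin.lt_def]
  simp
  rw [if_pos (by omega)]
  simp

theorem insertNth_leftIdx_left {E : Type*} (h : p + 1 + q = k + 1) (h' : p + q = k)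
    (i : Fin (p + 1)) (x : E) (w : Fin k → E) :
    (fun j => (leftIdx h i).insertNth (α := fun _ => E) x w (leftIdx h j))
      = i.insertNth x (fun j => w (leftIdx h' j)) := by
  funext j
  refine Fin.succAboveCases i ?_ (fun j => ?_) j
  · rw [Fin.insertNth_apply_same, Fin.insertNth_apply_same]
  · rw [← succAbove_leftIdx h h', Fin.insertNth_apply_succAbove, Fin.insertNth_apply_succAbove]

theorem insertNth_leftIdx_right {E : Type*} (h : p + 1 + q = k + 1) (h' : p + q = k)
    (i : Fin (p + 1)) (x : E) (w : Fin k → E) :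
    (fun j => (leftIdx h i).insertNth (α := fun _ => E) x w (rightIdx h j))
      = fun j => w (rightIdx h' j) := by
  funext j
  rw [← succAbove_leftIdx_rightIdx h h' i, Fin.insertNth_apply_succAbove]

theorem insertNth_rightIdx_right {E : Type*} (h : p + (q + 1) = k + 1) (h' : p + q = k)
    (i : Fin (q + 1)) (x : E) (w : Fin k → E) :
    (fun j => (rightIdx h i).insertNth (α := fun _ => E) x w (rightIdx h j))
      = i.insertNth x (fun j => w (rightIdx h' j)) := by
  funext j
  refine Fin.succAboveCases i ?_ (fun j => ?_) j
  · rw [Fin.insertNth_apply_same, Fin.insertNth_apply_same]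
  · rw [← succAbove_rightIdx h h', Fin.insertNth_apply_succAbove, Fin.insertNth_apply_succAbove]

theorem insertNth_rightIdx_left {E : Type*} (h : p + (q + 1) = k + 1) (h' : p + q = k)
    (i : Fin (q + 1)) (x : E) (w : Fin k → E) :
    (fun j => (rightIdx h i).insertNth (α := fun _ => E) x w (leftIdx h j))
      = fun j => w (leftIdx h' j) := by
  funext j
  rw [← succAbove_rightIdx_leftIdx h h' i, Fin.insertNth_apply_succAbove]

theorem sum_fin_leftIdx_rightIdx {G : Type*} [AddCommMonoid G] (h : p + q = k) (f : Fin k → G) :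
    ∑ i, f i = ∑ i, f (leftIdx h i) + ∑ i, f (rightIdx h i) := by
  subst h
  exact Fin.sum_univ_add f

/-- The sum over all permutations in `factorial_smul_wedge`. -/
def permSum (h : p + q = k) (a : Alt n F p) (b : Alt n F q) (v : Fin k → Eu n) : F :=
  ∑ σ : Equiv.Perm (Fin k), Equiv.Perm.sign σ •
    (a (fun i => v (σ (leftIdx h i))) * b (fun i => v (σ (rightIdx h i))))

theorem permSum_cons (h : p + q = k + 1) (a : Alt n F p) (b : Alt n F q) (x : Eu n)
    (w : Fin k → Eu n) :
    permSum h a b (Fin.cons x w) = ∑ i : Fin (k + 1), ∑ e : Equiv.Perm (Fin k),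
      (-1 : ℤˣ) ^ i.val • Equiv.Perm.sign e •
        (a (fun j => Fin.insertNth (α := fun _ => Eu n) i x (fun l => w (e l)) (leftIdx h j))
          * b (fun j => Fin.insertNth (α := fun _ => Eu n) i x (fun l => w (e l)) (rightIdx h j))) := by
  rw [permSum, ← Fintype.sum_prod_type' (f := fun i e => (-1 : ℤˣ) ^ i.val • Equiv.Perm.sign e •
        (a (fun j => Fin.insertNth (α := fun _ => Eu n) i x (fun l => w (e l)) (leftIdx h j))
          * b (fun j => Fin.insertNth (α := fun _ => Eu n) i x (fun l => w (e l)) (rightIdx h j))))]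
  refine (Fintype.sum_bijective _ permOfPreimageZero_bijective _ _ fun y => ?_).symm
  rw [sign_permOfPreimageZero, mul_smul]
  simp only [← cons_comp_permOfPreimageZero]

theorem permSum_left_term (h : p + 1 + q = k + 1) (h' : p + q = k) (a : Alt n F (p + 1))
    (b : Alt n F q) (x : Eu n) (w : Fin k → Eu n) (i : Fin (p + 1)) :
    ∑ e : Equiv.Perm (Fin k),
      (-1 : ℤˣ) ^ (leftIdx h i : ℕ) • Equiv.Perm.sign e •
        (a (fun j => (leftIdx h i).insertNth (α := fun _ => Eu n) x (fun l => w (e l))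
            (leftIdx h j))
          * b (fun j => (leftIdx h i).insertNth (α := fun _ => Eu n) x (fun l => w (e l))
            (rightIdx h j)))
      = permSum h' (a.curryLeft x) b w := by
  refine Finset.sum_congr rfl fun e _ => ?_
  rw [insertNth_leftIdx_left h h', insertNth_leftIdx_right h h', a.map_insertNth,
    smul_comm, smul_mul_assoc]
  simp only [Units.smul_def, smul_smul]
  congr 1
  simp [leftIdx, ← mul_pow]

theorem permSum_right_term (h : p + (q + 1) = k + 1) (h' : p + q = k) (a : Alt n F p)
    (b : Alt n F (q + 1)) (x : Eu n) (w : Fin k → Eu n) (i : Fin (q + 1)) :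
    ∑ e : Equiv.Perm (Fin k),
      (-1 : ℤˣ) ^ (rightIdx h i : ℕ) • Equiv.Perm.sign e •
        (a (fun j => (rightIdx h i).insertNth (α := fun _ => Eu n) x (fun l => w (e l))
            (leftIdx h j))
          * b (fun j => (rightIdx h i).insertNth (α := fun _ => Eu n) x (fun l => w (e l))
            (rightIdx h j)))
      = (-1 : ℤ) ^ p • permSum h' a (b.curryLeft x) w := by
  rw [permSum, Finset.smul_sum]
  refine Finset.sum_congr rfl fun e _ => ?_
  rw [insertNth_rightIdx_left h h', insertNth_rightIdx_right h h', b.map_insertNth,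
    mul_smul_comm]
  simp only [Units.smul_def, smul_smul]
  congr 1
  simp only [rightIdx, Fin.val_cast, Fin.val_natAdd, Units.val_pow_eq_pow_val, Units.val_neg,
    Units.val_one, pow_add, Units.val_mul]
  have : ((-1 : ℤ) ^ (i : ℕ)) * (-1) ^ (i : ℕ) = 1 := by simp [← mul_pow]
  linear_combination ((-1) ^ p * ((Equiv.Perm.sign e : ℤˣ) : ℤ)) * this

theorem smul_wedge_eq_permSum (h : p + q = k) (a : Alt n F p) (b : Alt n F q) (v : Fin k → Eu n) :
    wedge h a b v = ((p.factorial * q.factorial : ℕ) : ℝ)⁻¹ • permSum h a b v := by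
  rw [permSum, ← factorial_smul_wedge, ← Nat.cast_smul_eq_nsmul ℝ, smul_smul, inv_mul_cancel₀,
    one_smul]
  positivity

/-- Contraction is a derivation of the exterior product. -/
theorem wedge_cons_succ_succ (h : p + 1 + (q + 1) = k + 1) (a : Alt n F (p + 1))
    (b : Alt n F (q + 1)) (x : Eu n) (w : Fin k → Eu n) :
    wedge h a b (Fin.cons x w) = wedge (by omega) (a.curryLeft x) b w
      + (-1 : ℤ) ^ (p + 1) • wedge (by omega) a (b.curryLeft x) w := by
  rw [smul_wedge_eq_permSum, permSum_cons, sum_fin_leftIdx_rightIdx h,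
    Finset.sum_congr rfl fun i _ => permSum_left_term h (by omega) a b x w i,
    Finset.sum_congr rfl fun i _ => permSum_right_term h (by omega) a b x w i,
    smul_wedge_eq_permSum, smul_wedge_eq_permSum]
  simp only [Finset.sum_const, Finset.card_univ, Fintype.card_fin, smul_add]
  simp only [← Nat.cast_smul_eq_nsmul ℝ, ← Int.cast_smul_eq_zsmul ℝ, smul_smul]
  have := Nat.factorial_ne_zero p
  have := Nat.factorial_ne_zero q
  congr 2
  · simp only [Nat.factorial_succ]; push_cast; field_simp
  · simp only [Nat.factorial_succ]; push_cast; field_simp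

theorem wedge_cons_succ_zero (h : p + 1 + 0 = k + 1) (a : Alt n F (p + 1))
    (b : Alt n F 0) (x : Eu n) (w : Fin k → Eu n) :
    wedge h a b (Fin.cons x w) = wedge (by omega) (a.curryLeft x) b w := by
  rw [smul_wedge_eq_permSum, permSum_cons, sum_fin_leftIdx_rightIdx h,
    Finset.sum_congr rfl fun i _ => permSum_left_term h (by omega) a b x w i,
    smul_wedge_eq_permSum]
  simp only [Finset.sum_const, Finset.card_univ, Fintype.card_fin, Finset.univ_eq_empty,
    Finset.sum_empty, add_zero]
  simp only [← Nat.cast_smul_eq_nsmul ℝ, smul_smul]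
  have := Nat.factorial_ne_zero p
  congr 1
  simp only [Nat.factorial_succ]; push_cast; field_simp

theorem wedge_cons_zero_succ (h : 0 + (q + 1) = k + 1) (a : Alt n F 0)
    (b : Alt n F (q + 1)) (x : Eu n) (w : Fin k → Eu n) :
    wedge h a b (Fin.cons x w) = wedge (by omega) a (b.curryLeft x) w := by
  rw [smul_wedge_eq_permSum, permSum_cons, sum_fin_leftIdx_rightIdx h,
    Finset.sum_congr rfl fun i _ => permSum_right_term h (by omega) a b x w i,
    smul_wedge_eq_permSum]
  simp only [Finset.sum_const, Finset.card_univ, Fintype.card_fin, Finset.univ_eq_empty,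
    Finset.sum_empty, zero_add, pow_zero, one_smul]
  simp only [← Nat.cast_smul_eq_nsmul ℝ, smul_smul]
  have := Nat.factorial_ne_zero q
  congr 1
  simp only [Nat.factorial_succ]; push_cast; field_simp

end Wedge
end

noncomputable section

section WedgeLinear

variable {n : ℕ} {F : Type*} [NormedRing F] [NormedAlgebra ℝ F] {p q k : ℕ}

theorem wedge_add_left (h : p + q = k) (a a' : Alt n F p) (b : Alt n F q) :
    wedge h (a + a') b = wedge h a b + wedge h a' b := by
  ext v
  simp only [smul_wedge_eq_permSum, ContinuousAlternatingMap.add_apply, permSum, add_mul, smul_add,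
    Finset.sum_add_distrib]

theorem wedge_add_right (h : p + q = k) (a : Alt n F p) (b b' : Alt n F q) :
    wedge h a (b + b') = wedge h a b + wedge h a b' := by
  ext v
  simp only [smul_wedge_eq_permSum, ContinuousAlternatingMap.add_apply, permSum, mul_add, smul_add,
    Finset.sum_add_distrib]

theorem wedge_smul_left (h : p + q = k) (c : ℝ) (a : Alt n F p) (b : Alt n F q) :
    wedge h (c • a) b = c • wedge h a b := by
  ext v
  simp only [smul_wedge_eq_permSum, ContinuousAlternatingMap.smul_apply, permSum, smul_mul_assoc,
    smul_comm _ c, Finset.smul_sum]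

theorem wedge_smul_right (h : p + q = k) (c : ℝ) (a : Alt n F p) (b : Alt n F q) :
    wedge h a (c • b) = c • wedge h a b := by
  ext v
  simp only [smul_wedge_eq_permSum, ContinuousAlternatingMap.smul_apply, permSum, mul_smul_comm,
    smul_comm _ c, Finset.smul_sum]

theorem wedge_zero_left (h : p + q = k) (b : Alt n F q) : wedge h (0 : Alt n F p) b = 0 := by
  simpa using wedge_smul_left h 0 0 b

theorem wedge_zero_right (h : p + q = k) (a : Alt n F p) : wedge h a (0 : Alt n F q) = 0 := by
  simpa using wedge_smul_right h 0 a 0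

theorem wedge_curry_succ_succ (h : p + 1 + (q + 1) = k + 1) (a : Alt n F (p + 1))
    (b : Alt n F (q + 1)) (x : Eu n) :
    (wedge h a b).curryLeft x = wedge (by omega) (a.curryLeft x) b
      + (-1 : ℤ) ^ (p + 1) • wedge (by omega) a (b.curryLeft x) := by
  ext w
  exact wedge_cons_succ_succ h a b x w

theorem wedge_curry_succ_zero (h : p + 1 + 0 = k + 1) (a : Alt n F (p + 1))
    (b : Alt n F 0) (x : Eu n) :
    (wedge h a b).curryLeft x = wedge (by omega) (a.curryLeft x) b := by
  ext w
  exact wedge_cons_succ_zero h a b x w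

theorem wedge_curry_zero_succ (h : 0 + (q + 1) = k + 1) (a : Alt n F 0)
    (b : Alt n F (q + 1)) (x : Eu n) :
    (wedge h a b).curryLeft x = wedge (by omega) a (b.curryLeft x) := by
  ext w
  exact wedge_cons_zero_succ h a b x w

theorem norm_curryLeft_apply_le {F : Type*} [NormedAddCommGroup F] [NormedSpace ℝ F]
    (a : Alt n F (k + 1)) (x : Eu n) : ‖a.curryLeft x‖ ≤ ‖a‖ * ‖x‖ := by
  have := a.curryLeft.le_opNorm x
  rwa [ContinuousAlternatingMap.norm_curryLeft] at this

theorem norm_le_of_curryLeft {F : Type*} [NormedAddCommGroup F] [NormedSpace ℝ F]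
    (a : Alt n F (k + 1)) {C : ℝ} (hC : 0 ≤ C) (h : ∀ x, ‖a.curryLeft x‖ ≤ C * ‖x‖) : ‖a‖ ≤ C := by
  rw [← ContinuousAlternatingMap.norm_curryLeft]
  exact a.curryLeft.opNorm_le_bound hC h

theorem norm_wedge_le : ∀ {k p q : ℕ} (h : p + q = k) (a : Alt n F p) (b : Alt n F q),
    ‖wedge h a b‖ ≤ 2 ^ k * (‖a‖ * ‖b‖)
  | 0, p, q, h, a, b => by
    obtain rfl : p = 0 := by omega
    obtain rfl : q = 0 := by omega
    refine ContinuousAlternatingMap.opNorm_le_bound _ (by positivity) fun v => ?_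
    rw [wedge_zero_zero]
    have ha := a.le_opNorm v
    have hb := b.le_opNorm v
    simp only [Finset.univ_eq_empty, Finset.prod_empty, mul_one, pow_zero, one_mul] at *
    exact (norm_mul_le _ _).trans (mul_le_mul ha hb (norm_nonneg _) (norm_nonneg _))
  | k + 1, 0, 0, h, a, b => by omega
  | k + 1, p + 1, 0, h, a, b => by
    refine norm_le_of_curryLeft _ (by positivity) fun x => ?_
    rw [wedge_curry_succ_zero]
    have h1 := norm_wedge_le (k := k) (by omega) (a.curryLeft x) b
    have h2 := norm_curryLeft_apply_le a x
    have h3 : 0 ≤ ‖a‖ * ‖b‖ * ‖x‖ := by positivity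
    calc _ ≤ _ := h1
      _ ≤ 2 ^ k * (‖a‖ * ‖x‖ * ‖b‖) := by gcongr
      _ ≤ 2 ^ (k + 1) * (‖a‖ * ‖b‖) * ‖x‖ := by
        rw [pow_succ]; nlinarith [mul_nonneg (pow_nonneg (zero_le_two (α := ℝ)) k) h3]
  | k + 1, 0, q + 1, h, a, b => by
    refine norm_le_of_curryLeft _ (by positivity) fun x => ?_
    rw [wedge_curry_zero_succ]
    have h1 := norm_wedge_le (k := k) (by omega) a (b.curryLeft x)
    have h2 := norm_curryLeft_apply_le b x
    have h3 : 0 ≤ ‖a‖ * ‖b‖ * ‖x‖ := by positivity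
    calc _ ≤ _ := h1
      _ ≤ 2 ^ k * (‖a‖ * (‖b‖ * ‖x‖)) := by gcongr
      _ ≤ 2 ^ (k + 1) * (‖a‖ * ‖b‖) * ‖x‖ := by
        rw [pow_succ]; nlinarith [mul_nonneg (pow_nonneg (zero_le_two (α := ℝ)) k) h3]
  | k + 1, p + 1, q + 1, h, a, b => by
    refine norm_le_of_curryLeft _ (by positivity) fun x => ?_
    rw [wedge_curry_succ_succ]
    have h1 := norm_wedge_le (k := k) (by omega) (a.curryLeft x) b
    have h1' := norm_wedge_le (k := k) (by omega) a (b.curryLeft x)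
    have h2 := norm_curryLeft_apply_le a x
    have h2' := norm_curryLeft_apply_le b x
    refine (norm_add_le _ _).trans ?_
    have h4 : ∀ y : Alt n F k, ‖(-1 : ℤ) ^ (p + 1) • y‖ = ‖y‖ := fun y => by
      rcases neg_one_pow_eq_or ℤ (p + 1) with h | h <;> simp [h]
    rw [h4]
    calc _ ≤ 2 ^ k * (‖a‖ * ‖x‖ * ‖b‖) + 2 ^ k * (‖a‖ * (‖b‖ * ‖x‖)) := by
          refine add_le_add (h1.trans ?_) (h1'.trans ?_) <;> gcongr
      _ = 2 ^ (k + 1) * (‖a‖ * ‖b‖) * ‖x‖ := by ring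

theorem alt_eq_zero_of_lt {F : Type*} [NormedAddCommGroup F] [NormedSpace ℝ F] (h : n < k)
    (a : Alt n F k) : a = 0 := by
  ext v
  refine a.toAlternatingMap.map_linearDependent v fun hv => ?_
  have := hv.fintype_card_le_finrank
  simp at this
  omega

end WedgeLinear

/-! ### The algebra of inhomogeneous alternating forms -/

/-- Inhomogeneous alternating forms on `ℝⁿ`. -/
structure Om (n : ℕ) (F : Type*) [NormedAddCommGroup F] [NormedSpace ℝ F] where
  coeff : ∀ k, Alt n F k

namespace Om

section Module

variable {n : ℕ} {F G : Type*} [NormedAddCommGroup F] [NormedSpace ℝ F] [NormedAddCommGroup G]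
  [NormedSpace ℝ G]

/-- Inhomogeneous forms are families of forms. -/
def equiv (n : ℕ) (F : Type*) [NormedAddCommGroup F] [NormedSpace ℝ F] :
    Om n F ≃ ∀ k, Alt n F k := ⟨coeff, mk, fun _ => rfl, fun _ => rfl⟩

instance : DFunLike (Om n F) ℕ (fun k => Alt n F k) := ⟨coeff, (equiv n F).injective⟩
instance : AddCommGroup (Om n F) := (equiv n F).addCommGroup
instance : Module ℝ (Om n F) := (equiv n F).module ℝ

@[simp] theorem mk_apply (f : ∀ k, Alt n F k) (k : ℕ) : (mk f) k = f k := rfl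
@[simp] theorem add_apply (a b : Om n F) (k : ℕ) : (a + b) k = a k + b k := rfl
@[simp] theorem sub_apply (a b : Om n F) (k : ℕ) : (a - b) k = a k - b k := rfl
@[simp] theorem neg_apply (a : Om n F) (k : ℕ) : (-a) k = -a k := rfl
@[simp] theorem zero_apply (k : ℕ) : (0 : Om n F) k = 0 := rfl
@[simp] theorem smul_apply (c : ℝ) (a : Om n F) (k : ℕ) : (c • a) k = c • a k := rfl

@[simp] theorem sum_apply {ι : Type*} (s : Finset ι) (f : ι → Om n F) (k : ℕ) :
    (∑ i ∈ s, f i) k = ∑ i ∈ s, f i k :=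
  map_sum ({ toFun := fun a => a k, map_zero' := rfl, map_add' := fun _ _ => rfl } :
    Om n F →+ Alt n F k) f s

@[ext] theorem ext {a b : Om n F} (h : ∀ k, a k = b k) : a = b := DFunLike.ext _ _ h

instance : Norm (Om n F) := ⟨fun a => 2 ^ n * ∑ k ∈ Finset.range (n + 1), ‖a k‖⟩

theorem norm_def (a : Om n F) : ‖a‖ = 2 ^ n * ∑ k ∈ Finset.range (n + 1), ‖a k‖ := rfl

theorem norm_apply_le (a : Om n F) (k : ℕ) : ‖a k‖ ≤ ‖a‖ := by
  by_cases hk : k ∈ Finset.range (n + 1)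
  · have h1 := Finset.single_le_sum (fun i _ => norm_nonneg (a i)) hk
    have h2 : (1 : ℝ) ≤ 2 ^ n := one_le_pow₀ one_le_two
    rw [norm_def]
    nlinarith [norm_nonneg (a k)]
  · rw [alt_eq_zero_of_lt (by simpa using hk) (a k), norm_zero, norm_def]
    positivity

theorem core : NormedSpace.Core ℝ (Om n F) where
  norm_nonneg a := by rw [norm_def]; positivity
  norm_smul c a := by
    simp only [norm_def, smul_apply, norm_smul, ← Finset.mul_sum]
    ring
  norm_triangle a b := by
    simp only [norm_def, ← mul_add, ← Finset.sum_add_distrib]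
    gcongr
    exact norm_add_le _ _
  norm_eq_zero_iff a := by
    constructor
    · intro h
      ext k : 1
      exact norm_le_zero_iff.1 (h ▸ norm_apply_le a k)
    · rintro rfl
      simp [norm_def]

instance : NormedAddCommGroup (Om n F) := NormedAddCommGroup.ofCore core
instance : NormedSpace ℝ (Om n F) := NormedSpace.ofCore core

/-- The component of degree `k`. -/
def proj (k : ℕ) : Om n F →L[ℝ] Alt n F k :=
  LinearMap.mkContinuous
    { toFun := fun a => a k
      map_add' := fun _ _ => rfl
      map_smul' := fun _ _ => rfl } 1 fun a => by rw [one_mul]; exact norm_apply_le a k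

@[simp] theorem proj_apply (k : ℕ) (a : Om n F) : proj k a = a k := rfl

/-- The inclusion of the forms of degree `k`, as a function. -/
def singleFun (k : ℕ) (a : Alt n F k) : Om n F := ⟨Pi.single k a⟩

theorem singleFun_same (k : ℕ) (a : Alt n F k) : singleFun k a k = a := Pi.single_eq_same k a

theorem singleFun_of_ne {k j : ℕ} (h : j ≠ k) (a : Alt n F k) : singleFun k a j = 0 :=
  Pi.single_eq_of_ne h a

theorem norm_singleFun_le (k : ℕ) (a : Alt n F k) : ‖singleFun k a‖ ≤ 2 ^ n * ‖a‖ := by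
  rw [norm_def]
  gcongr
  by_cases hk : k ∈ Finset.range (n + 1)
  · rw [Finset.sum_eq_single_of_mem k hk, singleFun_same]
    intro j _ hj
    rw [singleFun_of_ne hj, norm_zero]
  · rw [Finset.sum_eq_zero]
    · positivity
    · intro j hj
      rw [singleFun_of_ne (by rintro rfl; exact hk hj), norm_zero]

/-- The inclusion of the forms of degree `k`. -/
def single (k : ℕ) : Alt n F k →L[ℝ] Om n F :=
  LinearMap.mkContinuous
    { toFun := singleFun k
      map_add' := fun a b => congrArg mk (Pi.single_add k a b)
      map_smul' := fun c a => congrArg mk (Pi.single_smul k c a) } (2 ^ n) (norm_singleFun_le k)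

@[simp] theorem single_same (k : ℕ) (a : Alt n F k) : (single k a) k = a := singleFun_same k a

theorem single_of_ne {k j : ℕ} (h : j ≠ k) (a : Alt n F k) : (single k a) j = 0 :=
  singleFun_of_ne h a

theorem sum_single (a : Om n F) : ∑ k ∈ Finset.range (n + 1), single k (a k) = a := by
  ext j : 1
  by_cases hj : j ∈ Finset.range (n + 1)
  · rw [sum_apply, Finset.sum_eq_single_of_mem j hj, single_same]
    exact fun i _ hi => single_of_ne hi.symm _
  · rw [alt_eq_zero_of_lt (by simpa using hj) (a j), sum_apply]
    exact Finset.sum_eq_zero fun i hi => single_of_ne (by rintro rfl; exact hj hi) _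

/-- A linear map given by its components is continuous if they are. -/
def ofComponents {V : Type*} [NormedAddCommGroup V] [NormedSpace ℝ V]
    (f : ∀ k, V →L[ℝ] Alt n F k) : V →L[ℝ] Om n F :=
  ∑ k ∈ Finset.range (n + 1), (single k).comp (f k)

@[simp] theorem ofComponents_apply {V : Type*} [NormedAddCommGroup V] [NormedSpace ℝ V]
    (f : ∀ k, V →L[ℝ] Alt n F k) (v : V) (k : ℕ) : ofComponents f v k = f k v := by
  have h : (∑ j ∈ Finset.range (n + 1), single j (f j v) : Om n F) k = f k v := by
    rw [← mk_apply (fun k => f k v) k, ← sum_single (⟨fun k => f k v⟩ : Om n F)]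
    rfl
  rw [← h, ofComponents]
  simp

theorem contDiffAt_iff {V : Type*} [NormedAddCommGroup V] [NormedSpace ℝ V] {N : WithTop ℕ∞}
    {f : V → Om n F} {x : V} : ContDiffAt ℝ N f x ↔ ∀ k, ContDiffAt ℝ N (fun y => f y k) x := by
  constructor
  · intro h k
    exact (proj k).contDiff.contDiffAt.comp x h
  · intro h
    have : f = fun y => ∑ k ∈ Finset.range (n + 1), single k (f y k) :=
      funext fun y => (sum_single _).symm
    rw [this]
    exact ContDiffAt.sum fun k _ => (single (F := F) k).contDiff.contDiffAt.comp x (h k)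

instance [CompleteSpace F] : CompleteSpace (Om n F) := by
  refine Metric.complete_of_cauchySeq_tendsto fun s hs => ?_
  have h1 : ∀ k, ∃ l, Filter.Tendsto (fun m => s m k) Filter.atTop (𝓝 l) := fun k =>
    cauchySeq_tendsto_of_complete (hs.map (proj (F := F) k).uniformContinuous)
  choose l hl using h1
  refine ⟨(⟨l⟩ : Om n F), ?_⟩
  have : s = fun m => ∑ k ∈ Finset.range (n + 1), single k (s m k) :=
    funext fun y => (sum_single _).symm
  rw [this, ← sum_single (n := n) (⟨l⟩ : Om n F)]
  exact tendsto_finsetSum _ fun k _ => ((single k).continuous.tendsto _).comp (hl k)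

/-- Contraction with a vector. -/
def ctr (v : Eu n) : Om n F →L[ℝ] Om n F :=
  ofComponents fun k => ((ContinuousLinearMap.apply ℝ (Alt n F k) v).comp
    (ContinuousAlternatingMap.curryLeftLI (𝕜 := ℝ) (E := Eu n) (F := F)
      (n := k)).toContinuousLinearMap).comp (proj (k + 1))

@[simp] theorem ctr_apply (v : Eu n) (a : Om n F) (k : ℕ) : ctr v a k = (a (k + 1)).curryLeft v := by
  rw [ctr, ofComponents_apply]
  rfl

/-- The parity operator. -/
def par : Om n F →L[ℝ] Om n F := ofComponents fun k => ((-1 : ℝ) ^ k) • proj k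

theorem par_apply (a : Om n F) (k : ℕ) : par a k = (-1 : ℤ) ^ k • a k := by
  rw [par, ofComponents_apply]
  rcases neg_one_pow_eq_or ℤ k with h | h <;> rcases Nat.even_or_odd k with h' | h' <;>
    simp_all

/-- Composition with a continuous linear map. -/
def map (g : F →L[ℝ] G) : Om n F →L[ℝ] Om n G :=
  ofComponents fun k =>
    (ContinuousLinearMap.compContinuousAlternatingMapCLM ℝ (Eu n) F G (ι := Fin k) g).comp (proj k)

@[simp] theorem map_apply (g : F →L[ℝ] G) (a : Om n F) (k : ℕ) :
    map g a k = g.compContinuousAlternatingMap (a k) := by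
  rw [map, ofComponents_apply]
  rfl

/-- Pullback along a linear map. -/
def comap {m : ℕ} (h : Eu m →L[ℝ] Eu n) : Om n F →L[ℝ] Om m F :=
  ofComponents fun k =>
    (ContinuousAlternatingMap.compContinuousLinearMapCLM (ι := Fin k) h).comp (proj k)

@[simp] theorem comap_apply {m : ℕ} (h : Eu m →L[ℝ] Eu n) (a : Om n F) (k : ℕ) :
    comap h a k = (a k).compContinuousLinearMap h := by
  rw [comap, ofComponents_apply]
  rfl

end Module
end Om
end

noncomputable section

theorem alt_ext_succ {n k : ℕ} {F : Type*} [NormedAddCommGroup F] [NormedSpace ℝ F]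
    {f g : Alt n F (k + 1)} (h : ∀ v, f.curryLeft v = g.curryLeft v) : f = g := by
  ext v
  have := congrArg (fun w => w (Fin.tail v)) (h (v 0))
  rw [← Fin.cons_self_tail v]
  exact this

namespace Om

section Ring

variable {n : ℕ} {F : Type*} [NormedRing F] [NormedAlgebra ℝ F]

/-- The exterior product of two inhomogeneous forms. -/
def mul (a b : Om n F) : Om n F := ⟨fun k =>
  ∑ x ∈ (Finset.HasAntidiagonal.antidiagonal k).attach,
    wedge (Finset.HasAntidiagonal.mem_antidiagonal.1 x.2) (a x.1.1) (b x.1.2)⟩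

/-- The unit. -/
def one : Om n F := single 0 (ContinuousAlternatingMap.constOfIsEmpty ℝ (Eu n) (Fin 0) 1)

instance : Mul (Om n F) := ⟨mul⟩
instance : One (Om n F) := ⟨one⟩

/-- The exterior product of the components of two forms, or `0` if the degrees do not match. -/
def wdg (a b : Om n F) (k : ℕ) (x : ℕ × ℕ) : Alt n F k :=
  if h : x.1 + x.2 = k then wedge h (a x.1) (b x.2) else 0

theorem wdg_of_eq (a b : Om n F) {k p q : ℕ} (h : p + q = k) :
    wdg a b k (p, q) = wedge h (a p) (b q) := dif_pos h

theorem mul_apply_attach (a b : Om n F) (k : ℕ) :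
    (a * b) k = ∑ x ∈ (Finset.HasAntidiagonal.antidiagonal k).attach,
    wedge (Finset.HasAntidiagonal.mem_antidiagonal.1 x.2) (a x.1.1) (b x.1.2) := rfl

theorem mul_apply (a b : Om n F) (k : ℕ) :
    (a * b) k = ∑ x ∈ Finset.HasAntidiagonal.antidiagonal k, wdg a b k x := by
  rw [← Finset.sum_attach, mul_apply_attach]
  refine Finset.sum_congr rfl fun x _ => ?_
  rw [wdg, dif_pos]

theorem mul_apply_zero (a b : Om n F) (v : Fin 0 → Eu n) : (a * b) 0 v = a 0 v * b 0 v := by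
  rw [mul_apply, Finset.Nat.antidiagonal_zero, Finset.sum_singleton, wdg_of_eq a b (add_zero 0),
    wedge_zero_zero]

theorem one_apply_zero (v : Fin 0 → Eu n) : (1 : Om n F) 0 v = 1 := by
  change (single 0 _ : Om n F) 0 v = 1
  rw [single_same]
  rfl

theorem one_apply_of_ne {k : ℕ} (h : k ≠ 0) : (1 : Om n F) k = 0 :=
  single_of_ne h _

theorem ctr_one (v : Eu n) : ctr v (1 : Om n F) = 0 := by
  ext k : 1
  rw [ctr_apply, one_apply_of_ne k.succ_ne_zero]
  ext w
  simp

theorem par_one : par (1 : Om n F) = 1 := by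
  ext k : 1
  rw [par_apply]
  rcases k with _ | k
  · simp
  · rw [one_apply_of_ne k.succ_ne_zero, smul_zero]

theorem add_mul' (a b c : Om n F) : (a + b) * c = a * c + b * c := by
  ext k : 1
  simp only [mul_apply_attach, add_apply, wedge_add_left, Finset.sum_add_distrib]

theorem mul_add' (a b c : Om n F) : a * (b + c) = a * b + a * c := by
  ext k : 1
  simp only [mul_apply_attach, add_apply, wedge_add_right, Finset.sum_add_distrib]

theorem smul_mul' (r : ℝ) (a b : Om n F) : (r • a) * b = r • (a * b) := by
  ext k : 1
  simp only [mul_apply_attach, smul_apply, wedge_smul_left, Finset.smul_sum]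

theorem mul_smul' (r : ℝ) (a b : Om n F) : a * (r • b) = r • (a * b) := by
  ext k : 1
  simp only [mul_apply_attach, smul_apply, wedge_smul_right, Finset.smul_sum]

theorem zero_mul' (b : Om n F) : 0 * b = 0 := by simpa using smul_mul' 0 0 b

theorem mul_zero' (b : Om n F) : b * 0 = 0 := by simpa using mul_smul' 0 b 0

theorem neg_one_zpow_smul_wedge_left {p q k : ℕ} (h : p + q = k) (m : ℕ) (a : Alt n F p)
    (b : Alt n F q) : wedge h ((-1 : ℤ) ^ m • a) b = (-1 : ℤ) ^ m • wedge h a b := by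
  have h1 := wedge_smul_left h (-1) a b
  rcases neg_one_pow_eq_or ℤ m with h | h <;> simp_all

theorem neg_one_zpow_smul_wedge_right {p q k : ℕ} (h : p + q = k) (m : ℕ) (a : Alt n F p)
    (b : Alt n F q) : wedge h a ((-1 : ℤ) ^ m • b) = (-1 : ℤ) ^ m • wedge h a b := by
  have h1 := wedge_smul_right h (-1) a b
  rcases neg_one_pow_eq_or ℤ m with h | h <;> simp_all

theorem par_mul (a b : Om n F) : par (a * b) = par a * par b := by
  ext k : 1
  simp only [par_apply, mul_apply_attach, Finset.smul_sum]
  refine Finset.sum_congr rfl fun x _ => ?_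
  rw [neg_one_zpow_smul_wedge_left, neg_one_zpow_smul_wedge_right, smul_smul, ← pow_add]
  congr 2
  exact (Finset.HasAntidiagonal.mem_antidiagonal.1 x.2).symm

/-- Contraction is an odd derivation. -/
theorem ctr_mul (v : Eu n) (a b : Om n F) :
    ctr v (a * b) = ctr v a * b + par a * ctr v b := by
  ext k : 1
  let L : ℕ × ℕ → Alt n F k := fun x => match x with
    | (0, _) => 0
    | (p + 1, q) => wdg (ctr v a) b k (p, q)
  let R : ℕ × ℕ → Alt n F k := fun x => match x with
    | (_, 0) => 0
    | (p, q + 1) => wdg (par a) (ctr v b) k (p, q)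
  have key : ∀ x ∈ Finset.HasAntidiagonal.antidiagonal (k + 1),
      (wdg a b (k + 1) x).curryLeft v = L x + R x := by
    rintro ⟨p, q⟩ hx
    have hx : p + q = k + 1 := Finset.HasAntidiagonal.mem_antidiagonal.1 hx
    rw [wdg_of_eq a b hx]
    rcases p with _ | p
    · rcases q with _ | q
      · omega
      · rw [wedge_curry_zero_succ]
        simp only [L, R]
        rw [wdg_of_eq _ _ (by omega), ctr_apply, par_apply, pow_zero, one_smul]
        exact (zero_add _).symm
    · rcases q with _ | q
      · rw [wedge_curry_succ_zero]
        simp only [L, R]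
        rw [wdg_of_eq _ _ (by omega), ctr_apply]
        exact (add_zero _).symm
      · rw [wedge_curry_succ_succ]
        simp only [L, R]
        rw [wdg_of_eq _ _ (by omega), wdg_of_eq _ _ (by omega), ctr_apply, ctr_apply, par_apply,
          neg_one_zpow_smul_wedge_left]
  have hsum : ((a * b) (k + 1)).curryLeft v
      = ∑ x ∈ Finset.HasAntidiagonal.antidiagonal (k + 1), (wdg a b (k + 1) x).curryLeft v := by
    rw [mul_apply]
    ext w
    simp
  rw [ctr_apply, hsum, Finset.sum_congr rfl key, Finset.sum_add_distrib,
    Finset.Nat.sum_antidiagonal_succ (f := L), Finset.Nat.sum_antidiagonal_succ' (f := R),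
    add_apply, mul_apply, mul_apply]
  simp only [L, R, zero_add]

theorem one_mul_apply (k : ℕ) : ∀ a : Om n F, (1 * a) k = a k := by
  induction k with
  | zero =>
    intro a
    ext v
    rw [mul_apply_zero, one_apply_zero, one_mul]
  | succ k ih =>
    intro a
    refine alt_ext_succ fun v => ?_
    rw [← ctr_apply, ← ctr_apply, ctr_mul, ctr_one, par_one, zero_mul', zero_add, ih]

theorem mul_one_apply (k : ℕ) : ∀ a : Om n F, (a * 1) k = a k := by
  induction k with
  | zero =>
    intro a
    ext v
    rw [mul_apply_zero, one_apply_zero, mul_one]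
  | succ k ih =>
    intro a
    refine alt_ext_succ fun v => ?_
    rw [← ctr_apply, ← ctr_apply, ctr_mul, ctr_one, mul_zero', add_zero, ih]

theorem mul_assoc_apply (k : ℕ) : ∀ a b c : Om n F, (a * b * c) k = (a * (b * c)) k := by
  induction k with
  | zero =>
    intro a b c
    ext v
    simp only [mul_apply_zero, mul_assoc]
  | succ k ih =>
    intro a b c
    refine alt_ext_succ fun v => ?_
    rw [← ctr_apply, ← ctr_apply]
    simp only [ctr_mul, par_mul, add_mul', mul_add', add_apply, ih, add_assoc]

instance : Ring (Om n F) :=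
  { (inferInstance : AddCommGroup (Om n F)) with
    mul := mul
    one := one
    left_distrib := mul_add'
    right_distrib := add_mul'
    zero_mul := zero_mul'
    mul_zero := mul_zero'
    mul_assoc := fun a b c => ext fun k => mul_assoc_apply k a b c
    one_mul := fun a => ext fun k => one_mul_apply k a
    mul_one := fun a => ext fun k => mul_one_apply k a }

theorem norm_mul_le' (a b : Om n F) : ‖a * b‖ ≤ ‖a‖ * ‖b‖ := by
  have h1 : ∀ k ∈ Finset.range (n + 1), ‖(a * b) k‖
      ≤ 2 ^ n * ∑ x ∈ Finset.HasAntidiagonal.antidiagonal k, ‖a x.1‖ * ‖b x.2‖ := fun k hk => by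
    rw [mul_apply, Finset.mul_sum]
    refine norm_sum_le_of_le _ fun x hx => ?_
    rw [wdg_of_eq a b (Finset.HasAntidiagonal.mem_antidiagonal.1 hx)]
    refine (norm_wedge_le _ _ _).trans ?_
    gcongr
    · exact one_le_two
    · exact Nat.lt_succ_iff.1 (Finset.mem_range.1 hk)
  have h2 : ∑ k ∈ Finset.range (n + 1), ∑ x ∈ Finset.HasAntidiagonal.antidiagonal k,
      ‖a x.1‖ * ‖b x.2‖ ≤ (∑ p ∈ Finset.range (n + 1), ‖a p‖) *
        ∑ q ∈ Finset.range (n + 1), ‖b q‖ := by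
    rw [Finset.sum_mul_sum, ← Finset.sum_product', Finset.sum_sigma']
    rw [← Finset.sum_image (s := Finset.sigma (Finset.range (n + 1)) fun k =>
      Finset.HasAntidiagonal.antidiagonal k) (g := fun x => x.2)
      (f := fun x : ℕ × ℕ => ‖a x.1‖ * ‖b x.2‖)]
    · refine Finset.sum_le_sum_of_subset_of_nonneg ?_ fun _ _ _ => by positivity
      rintro ⟨p, q⟩ hx
      simp only [Finset.mem_image, Finset.mem_sigma, Finset.mem_range,
        Finset.HasAntidiagonal.mem_antidiagonal, Sigma.exists] at hx
      obtain ⟨k, ⟨p', q'⟩, ⟨h1, h2⟩, h3⟩ := hx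
      simp only [Prod.mk.injEq] at h2 h3
      simp only [Finset.mem_product, Finset.mem_range]
      omega
    · rintro ⟨k, x⟩ hx ⟨k', x'⟩ hx' h
      simp only [Finset.coe_sigma, Set.mem_sigma_iff, Finset.mem_coe,
        Finset.HasAntidiagonal.mem_antidiagonal] at hx hx' h
      obtain rfl : x = x' := h
      obtain rfl : k = k' := hx.2.symm.trans hx'.2
      rfl
  calc ‖a * b‖ ≤ 2 ^ n * ∑ k ∈ Finset.range (n + 1),
        2 ^ n * ∑ x ∈ Finset.HasAntidiagonal.antidiagonal k, ‖a x.1‖ * ‖b x.2‖ := by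
        rw [norm_def]
        gcongr with k hk
        exact h1 k hk
    _ ≤ 2 ^ n * (2 ^ n * ((∑ p ∈ Finset.range (n + 1), ‖a p‖) *
        ∑ q ∈ Finset.range (n + 1), ‖b q‖)) := by
        rw [← Finset.mul_sum]
        gcongr
    _ = ‖a‖ * ‖b‖ := by rw [norm_def, norm_def]; ring

instance : NormedRing (Om n F) :=
  { (inferInstance : NormedAddCommGroup (Om n F)), (inferInstance : Ring (Om n F)) with
    norm_mul_le := norm_mul_le' }

instance : NormedAlgebra ℝ (Om n F) :=
  { Algebra.ofModule smul_mul' mul_smul' with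
    norm_smul_le := norm_smul_le }

end Ring
end Om
end

noncomputable section

namespace Om

section Graded

variable {n : ℕ} {A B F G : Type*} [NormedAddCommGroup A] [NormedSpace ℝ A]
  [NormedAddCommGroup B] [NormedSpace ℝ B]

theorem par_par (a : Om n A) : par (par a) = a := by
  ext k : 1
  rw [par_apply, par_apply, smul_smul, ← mul_pow]
  simp

theorem par_ctr (v : Eu n) (a : Om n A) : par (ctr v a) = -ctr v (par a) := by
  ext k : 1
  rw [par_apply, ctr_apply, neg_apply, ctr_apply, par_apply, pow_succ]
  ext w
  rcases neg_one_pow_eq_or ℤ k with h | h <;> simp [h]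

theorem par_map [NormedAddCommGroup G] [NormedSpace ℝ G] (g : A →L[ℝ] G) (a : Om n A) :
    par (map g a) = map g (par a) := by
  ext k w
  rw [par_apply, map_apply, map_apply, par_apply]
  rcases neg_one_pow_eq_or ℤ k with h | h <;> simp [h]

theorem ctr_map [NormedAddCommGroup G] [NormedSpace ℝ G] (g : A →L[ℝ] G) (v : Eu n) (a : Om n A) :
    ctr v (map g a) = map g (ctr v a) := by
  ext k w
  simp

theorem ctr_comap {m : ℕ} (h : Eu m →L[ℝ] Eu n) (v : Eu m) (a : Om n A) :
    ctr v (comap h a) = comap h (ctr (h v) a) := by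
  ext k w
  simp only [ctr_apply, comap_apply, ContinuousAlternatingMap.curryLeft_apply_apply,
    ContinuousAlternatingMap.compContinuousLinearMap_apply]
  congr 1
  funext i
  refine Fin.cases ?_ (fun i => ?_) i <;> simp

theorem map_map {C : Type*} [NormedAddCommGroup C] [NormedSpace ℝ C] (g : B →L[ℝ] C)
    (f : A →L[ℝ] B) (a : Om n A) : map g (map f a) = map (g.comp f) a := by
  ext k w
  simp

theorem map_id (a : Om n A) : map (ContinuousLinearMap.id ℝ A) a = a := by
  ext k w
  simp

theorem ctr_ctr (v : Eu n) (a : Om n A) : ctr v (ctr v a) = 0 := by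
  ext k : 1
  rw [ctr_apply, ctr_apply]
  exact ContinuousAlternatingMap.curryLeft_same _ v

theorem map_comap [NormedAddCommGroup G] [NormedSpace ℝ G] {m : ℕ} (g : A →L[ℝ] G)
    (h : Eu m →L[ℝ] Eu n) (a : Om n A) : map g (comap h a) = comap h (map g a) := by
  ext k w
  simp

variable [NormedRing F] [NormedAlgebra ℝ F]

theorem comap_mul {m : ℕ} (h : Eu m →L[ℝ] Eu n) (a b : Om n F) :
    comap h (a * b) = comap h a * comap h b := by
  have par_comap : ∀ a : Om n F, par (comap h a) = comap h (par a) := fun a => by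
    ext k w
    rw [par_apply, comap_apply, comap_apply, par_apply]
    rcases neg_one_pow_eq_or ℤ k with h | h <;> simp [h]
  have : ∀ k, ∀ a b : Om n F, comap h (a * b) k = (comap h a * comap h b) k := by
    intro k
    induction k with
    | zero =>
      intro a b
      ext v
      simp [mul_apply_zero]
    | succ k ih =>
      intro a b
      refine alt_ext_succ fun v => ?_
      rw [← ctr_apply, ← ctr_apply, ctr_comap]
      simp only [ctr_mul, par_comap, map_add, add_apply, ih, ctr_comap]
  exact ext fun k => this k a b

theorem comap_one {m : ℕ} (h : Eu m →L[ℝ] Eu n) : comap h (1 : Om n F) = 1 := by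
  ext k v
  rcases k with _ | k
  · rw [comap_apply, ContinuousAlternatingMap.compContinuousLinearMap_apply, one_apply_zero,
      one_apply_zero]
  · rw [comap_apply, one_apply_of_ne k.succ_ne_zero, one_apply_of_ne k.succ_ne_zero]
    rfl

section Mixed

variable [NormedRing G] [NormedAlgebra ℝ G]

theorem map_mul_map (φ : A →L[ℝ] F) (ψ : B →L[ℝ] F) (g : F →L[ℝ] G) (α : A →L[ℝ] G)
    (β : B →L[ℝ] G) (h : ∀ x y, g (φ x * ψ y) = α x * β y) (a : Om n A) (b : Om n B) :
    map g (map φ a * map ψ b) = map α a * map β b := by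
  have : ∀ k, ∀ (a : Om n A) (b : Om n B),
      map g (map φ a * map ψ b) k = (map α a * map β b) k := by
    intro k
    induction k with
    | zero =>
      intro a b
      ext v
      simp [mul_apply_zero, h]
    | succ k ih =>
      intro a b
      refine alt_ext_succ fun v => ?_
      rw [← ctr_apply, ← ctr_apply, ctr_map]
      simp only [ctr_mul, par_map, map_add, add_apply, ih, ctr_map]
  exact ext fun k => this k a b

theorem map_mul (g : F →L[ℝ] G) (h : ∀ x y, g (x * y) = g x * g y) (a b : Om n F) :
    map g (a * b) = map g a * map g b := by
  have := map_mul_map (ContinuousLinearMap.id ℝ F) (ContinuousLinearMap.id ℝ F) g g g h a b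
  rwa [map_id, map_id] at this

theorem map_one (g : F →L[ℝ] G) (h : g 1 = 1) : map g (1 : Om n F) = 1 := by
  ext k v
  rcases k with _ | k
  · rw [map_apply, ContinuousLinearMap.compContinuousAlternatingMap_coe, Function.comp_apply,
      one_apply_zero, one_apply_zero, h]
  · rw [map_apply, one_apply_of_ne k.succ_ne_zero, one_apply_of_ne k.succ_ne_zero]
    simp

end Mixed

section Commute

variable [NormedAddCommGroup G] [NormedSpace ℝ G] (φ : A →L[ℝ] F) (ψ : B →L[ℝ] F) (g : F →L[ℝ] G)

theorem map_mul_comm_aux (h : ∀ x y, g (φ x * ψ y) = g (ψ y * φ x)) (k : ℕ) :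
    (∀ (a : Om n A) (b : Om n B), par a = a →
      map g (map φ a * map ψ b) k = map g (map ψ b * map φ a) k) ∧
    ∀ (a : Om n A) (b : Om n B), par a = -a →
      map g (map φ a * map ψ b) k = map g (map ψ (par b) * map φ a) k := by
  induction k with
  | zero =>
    constructor
    · intro a b _
      ext v
      simp [mul_apply_zero, h]
    · intro a b ha
      have h0 : a 0 = 0 := by
        have := DFunLike.congr_fun ha 0
        rw [par_apply, pow_zero, one_smul, neg_apply] at this
        have h2 : (2 : ℝ) • a 0 = 0 := by
          rw [two_smul]
          exact add_eq_zero_iff_eq_neg.2 this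
        exact (smul_eq_zero.1 h2).resolve_left two_ne_zero
      ext v
      simp [mul_apply_zero, h0]
  | succ k ih =>
    constructor
    · intro a b ha
      refine alt_ext_succ fun v => ?_
      rw [← ctr_apply, ← ctr_apply, ctr_map, ctr_map, ctr_mul, ctr_mul, par_map, par_map, ha,
        ctr_map, ctr_map, map_add, map_add, add_apply, add_apply, ih.1 _ _ ha,
        ih.2 _ _ (by rw [par_ctr, ha]), add_comm]
    · intro a b ha
      refine alt_ext_succ fun v => ?_
      rw [← ctr_apply, ← ctr_apply, ctr_map, ctr_map, ctr_mul, ctr_mul, par_map, par_map, ha,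
        ctr_map, ctr_map, map_add, map_add, add_apply, add_apply,
        ih.1 _ _ (by rw [par_ctr, ha, map_neg, neg_neg]), par_par, map_neg, neg_mul, map_neg,
        neg_apply, ih.2 a _ ha, par_ctr, map_neg, neg_mul, map_neg, neg_apply, neg_neg, ctr_map,
        add_comm]

theorem map_mul_comm_of_even (h : ∀ x y, g (φ x * ψ y) = g (ψ y * φ x)) {a : Om n A}
    (ha : par a = a) (b : Om n B) :
    map g (map φ a * map ψ b) = map g (map ψ b * map φ a) :=
  ext fun k => (map_mul_comm_aux φ ψ g h k).1 a b ha

theorem map_mul_comm_of_odd (h : ∀ x y, g (φ x * ψ y) = g (ψ y * φ x)) {a : Om n A}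
    (ha : par a = -a) (b : Om n B) :
    map g (map φ a * map ψ b) = map g (map ψ (par b) * map φ a) :=
  ext fun k => (map_mul_comm_aux φ ψ g h k).2 a b ha

end Commute

section Trace

variable [NormedAddCommGroup G] [NormedSpace ℝ G] {τ : F →L[ℝ] G}

theorem trace_mul_comm_of_even (h : ∀ x y, τ (x * y) = τ (y * x)) {a : Om n F}
    (ha : par a = a) (b : Om n F) : map τ (a * b) = map τ (b * a) := by
  have := map_mul_comm_of_even (.id ℝ F) (.id ℝ F) τ h ha b
  rwa [map_id, map_id] at this

theorem trace_mul_comm_of_odd (h : ∀ x y, τ (x * y) = τ (y * x)) {a b : Om n F}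
    (ha : par a = -a) (hb : par b = -b) : map τ (a * b) = -map τ (b * a) := by
  have := map_mul_comm_of_odd (.id ℝ F) (.id ℝ F) τ h ha b
  rwa [map_id, map_id, map_id, hb, neg_mul, map_neg] at this

end Trace

/-- The `i`-th coordinate form. -/
def coordForm (i : Fin n) : Om n ℝ :=
  single 1 (ContinuousAlternatingMap.ofSubsingleton ℝ (Eu n) ℝ 0 (EuclideanSpace.proj i))

/-- The `i`-th coordinate form with values in an algebra. -/
def coordFormIn (F : Type*) [NormedRing F] [NormedAlgebra ℝ F] (i : Fin n) : Om n F :=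
  map (Algebra.linearMap ℝ F).toContinuousLinearMap (coordForm i)

theorem par_single (k : ℕ) (a : Alt n A k) : par (single k a) = (-1 : ℤ) ^ k • single k a := by
  ext j : 1
  rw [par_apply]
  by_cases h : j = k
  · subst h
    rcases neg_one_pow_eq_or ℤ j with h | h <;> simp [h]
  · rcases neg_one_pow_eq_or ℤ k with h' | h' <;> simp [h', single_of_ne h]

theorem par_coordForm (i : Fin n) : par (coordForm i) = -coordForm i := by
  rw [coordForm, par_single]
  simp

theorem par_coordFormIn (i : Fin n) : par (coordFormIn F i) = -coordFormIn F i := by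
  rw [coordFormIn, par_map, par_coordForm, map_neg]

theorem coordFormIn_mul (i : Fin n) (b : Om n F) :
    coordFormIn F i * b = par b * coordFormIn F i := by
  have := map_mul_comm_of_odd (Algebra.linearMap ℝ F).toContinuousLinearMap
    (.id ℝ F) (.id ℝ F) (fun x y => by simpa using Algebra.commutes x y) (par_coordForm i) b
  rwa [map_id, map_id, map_id, map_id] at this

theorem coordFormIn_apply_zero (i : Fin n) : coordFormIn F i 0 = 0 := by
  rw [coordFormIn, map_apply, coordForm, single_of_ne (by decide)]
  ext
  simp

theorem ctr_coordFormIn (i : Fin n) (v : Eu n) : ctr v (coordFormIn F i) = v i • (1 : Om n F) := by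
  ext k w
  rcases k with _ | k
  · rw [ctr_apply, smul_apply, ContinuousAlternatingMap.smul_apply, one_apply_zero, coordFormIn,
      map_apply, coordForm, single_same]
    simp [Algebra.algebraMap_eq_smul_one]
  · rw [ctr_apply, smul_apply, one_apply_of_ne k.succ_ne_zero, coordFormIn, map_apply, coordForm,
      single_of_ne (by omega)]
    simp

end Graded

section Deriv

variable {n : ℕ} {F G : Type*} [NormedAddCommGroup F] [NormedSpace ℝ F]
  [NormedAddCommGroup G] [NormedSpace ℝ G]

/-- The exterior derivative as a function of the first derivative. -/
def dOp (f : Eu n →L[ℝ] Om n F) : Om n F := ⟨fun k => match k with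
  | 0 => 0
  | k + 1 => ContinuousAlternatingMap.alternatizeUncurryFin ((proj k).comp f)⟩

theorem dOp_apply_zero (f : Eu n →L[ℝ] Om n F) : dOp f 0 = 0 := rfl

theorem dOp_apply_succ (f : Eu n →L[ℝ] Om n F) (k : ℕ) :
    dOp f (k + 1) = ContinuousAlternatingMap.alternatizeUncurryFin ((proj k).comp f) := rfl

theorem dOp_add (f g : Eu n →L[ℝ] Om n F) : dOp (f + g) = dOp f + dOp g := by
  ext k : 1
  rcases k with _ | k
  · simp [dOp_apply_zero]
  · simp [dOp_apply_succ, ContinuousAlternatingMap.alternatizeUncurryFin_add]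

theorem dOp_comp_map (g : F →L[ℝ] G) (f : Eu n →L[ℝ] Om n F) :
    dOp ((map g).comp f) = map g (dOp f) := by
  ext k v
  rcases k with _ | k
  · simp [dOp_apply_zero]
  · simp [dOp_apply_succ, ContinuousAlternatingMap.alternatizeUncurryFin_apply]

theorem ctr_dOp (v : Eu n) (f : Eu n →L[ℝ] Om n F) :
    ctr v (dOp f) = f v - dOp ((ctr v).comp f) := by
  ext k w
  rw [ctr_apply, sub_apply, dOp_apply_succ, ContinuousAlternatingMap.curryLeft_apply_apply,
    ContinuousAlternatingMap.alternatizeUncurryFin_apply, Fin.sum_univ_succ]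
  rcases k with _ | k
  · simp [dOp_apply_zero]
  · rw [dOp_apply_succ, ContinuousAlternatingMap.sub_apply,
      ContinuousAlternatingMap.alternatizeUncurryFin_apply]
    simp only [Matrix.cons_val_zero, Matrix.cons_val_succ, Fin.val_zero, pow_zero, one_smul,
      Fin.val_succ, pow_succ, mul_neg, mul_one, neg_smul, Finset.sum_neg_distrib, sub_eq_add_neg]
    congr 1
    refine congrArg _ (Finset.sum_congr rfl fun i _ => ?_)
    congr 1
    simp only [ContinuousLinearMap.comp_apply, proj_apply, ctr_apply,
      ContinuousAlternatingMap.curryLeft_apply_apply]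
    congr 1
    funext j
    refine Fin.cases ?_ (fun j => ?_) j
    · simp [Fin.removeNth]
    · simp [Fin.removeNth]

end Deriv

section DerivRing

variable {n : ℕ} {F : Type*} [NormedRing F] [NormedAlgebra ℝ F]

theorem dOp_eq_sum (f : Eu n →L[ℝ] Om n F) :
    dOp f = ∑ i, coordFormIn F i * f (EuclideanSpace.single i 1) := by
  have : ∀ k, ∀ f : Eu n →L[ℝ] Om n F,
      dOp f k = (∑ i, coordFormIn F i * f (EuclideanSpace.single i 1) : Om n F) k := by
    intro k
    induction k with
    | zero =>
      intro f
      ext v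
      simp [dOp_apply_zero, mul_apply_zero, coordFormIn_apply_zero]
    | succ k ih =>
      intro f
      refine alt_ext_succ fun v => ?_
      rw [← ctr_apply, ← ctr_apply, ctr_dOp, sub_apply, ih, map_sum]
      simp only [ctr_mul, ctr_coordFormIn, par_coordFormIn, Finset.sum_add_distrib, neg_mul,
        Finset.sum_neg_distrib, add_apply, neg_apply, sub_eq_add_neg]
      congr 2
      conv_lhs => rw [← (EuclideanSpace.basisFun (Fin n) ℝ).sum_repr v, map_sum]
      simp
  exact ext fun k => this k f

end DerivRing

end Om
end

noncomputable section

section ExpDeriv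

variable {R : Type*} [NormedRing R] [NormedAlgebra ℝ R] [CompleteSpace R]

theorem hasSum_exp (S : R) : HasSum (fun m : ℕ => (m.factorial : ℝ)⁻¹ • S ^ m) (NormedSpace.exp S) :=
  NormedSpace.exp_series_hasSum_exp' S

theorem contDiff_exp_algebra : ContDiff ℝ ∞ (NormedSpace.exp : R → R) :=
  contDiff_iff_contDiffAt.2 fun S => (NormedSpace.exp_analytic (𝕂 := ℝ) S).contDiffAt

theorem norm_pow_le_max (S : R) {r : ℝ} (hr : 1 ≤ r) (h : ‖S‖ ≤ r) (m : ℕ) :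
    ‖S ^ m‖ ≤ max ‖(1 : R)‖ 1 * r ^ m := by
  rcases m with _ | m
  · simp
  · calc ‖S ^ (m + 1)‖ ≤ ‖S‖ ^ (m + 1) := norm_pow_le' S m.succ_pos
      _ ≤ 1 * r ^ (m + 1) := by rw [one_mul]; gcongr
      _ ≤ _ := by gcongr; exact le_max_right _ _

/-- The derivative of the exponential, as a series. -/
theorem exists_hasFDerivAt_exp (S : R) : ∃ L : R →L[ℝ] R, HasFDerivAt NormedSpace.exp L S ∧
    ∀ h, HasSum (fun m : ℕ => (m.factorial : ℝ)⁻¹ • ∑ i ∈ Finset.range m,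
      S ^ (m.pred - i) * h * S ^ i) (L h) := by
  let T : ℕ → R → R →L[ℝ] R := fun m x => (m.factorial : ℝ)⁻¹ •
    ∑ i ∈ Finset.range m, ((ContinuousLinearMap.mul ℝ R).flip (x ^ i)).comp
      (ContinuousLinearMap.mul ℝ R (x ^ (m.pred - i)))
  have hT : ∀ m x h, T m x h = (m.factorial : ℝ)⁻¹ • ∑ i ∈ Finset.range m,
      x ^ (m.pred - i) * h * x ^ i := fun m x h => by
    simp [T]
  set r : ℝ := ‖S‖ + 1 with hr
  set C : ℝ := max ‖(1 : R)‖ 1 with hC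
  have hr1 : 1 ≤ r := by have := norm_nonneg S; linarith
  have hC1 : 0 ≤ C := le_trans zero_le_one (le_max_right _ _)
  let w : ℕ → ℝ := fun m => C ^ 2 * ((2 * r) ^ m / m.factorial)
  have hw : Summable w := (Real.summable_pow_div_factorial (2 * r)).mul_left _
  have hbound : ∀ m, ∀ x ∈ Metric.ball (0 : R) r, ‖T m x‖ ≤ w m := fun m x hx => by
    refine ContinuousLinearMap.opNorm_le_bound _ (by positivity) fun h => ?_
    have hx' : ‖x‖ ≤ r := by simpa using (mem_ball_zero_iff.1 hx).le
    rw [hT, norm_smul, Real.norm_eq_abs, abs_of_nonneg (by positivity)]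
    have h1 : ‖∑ i ∈ Finset.range m, x ^ (m.pred - i) * h * x ^ i‖
        ≤ m * (C ^ 2 * r ^ m * ‖h‖) := by
      refine (norm_sum_le_of_le _ (f := fun i => x ^ (m.pred - i) * h * x ^ i)
        (n := fun _ => C ^ 2 * r ^ m * ‖h‖) fun i hi => ?_).trans ?_
      · have hi' := Finset.mem_range.1 hi
        calc _ ≤ ‖x ^ (m.pred - i)‖ * ‖h‖ * ‖x ^ i‖ :=
              (norm_mul_le _ _).trans (by gcongr; exact norm_mul_le _ _)
          _ ≤ (C * r ^ (m.pred - i)) * ‖h‖ * (C * r ^ i) := by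
            gcongr <;> exact norm_pow_le_max x hr1 hx' _
          _ = C ^ 2 * r ^ (m.pred - i + i) * ‖h‖ := by rw [pow_add]; ring
          _ ≤ C ^ 2 * r ^ m * ‖h‖ := by
            gcongr
            rw [Nat.pred_eq_sub_one]; omega
      · simp
    have h2 : (m : ℝ) ≤ 2 ^ m := by exact_mod_cast Nat.lt_two_pow_self.le
    calc _ ≤ (m.factorial : ℝ)⁻¹ * (m * (C ^ 2 * r ^ m * ‖h‖)) := by gcongr
      _ ≤ (m.factorial : ℝ)⁻¹ * (2 ^ m * (C ^ 2 * r ^ m * ‖h‖)) := by gcongr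
      _ = w m * ‖h‖ := by simp only [w, mul_pow]; ring
  have hS : S ∈ Metric.ball (0 : R) r := by simp [hr]
  have key := hasFDerivAt_tsum_of_isPreconnected (𝕜 := ℝ) (f := fun (m : ℕ) (x : R) =>
      (m.factorial : ℝ)⁻¹ • x ^ m) (f' := T) hw Metric.isOpen_ball
    ((convex_ball (0 : R) r).isPreconnected) (fun m x _ => ?_) hbound hS
    (hasSum_exp S).summable hS
  · refine ⟨∑' m, T m S, ?_, fun h => ?_⟩
    · have he : (NormedSpace.exp : R → R) = fun x => ∑' m : ℕ, (m.factorial : ℝ)⁻¹ • x ^ m :=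
        funext fun x => (hasSum_exp x).tsum_eq.symm
      rw [he]
      exact key
    · have hs : Summable fun m => T m S :=
        Summable.of_norm_bounded hw fun m => hbound m S hS
      have := hs.hasSum.mapL (ContinuousLinearMap.apply ℝ R h)
      simpa only [ContinuousLinearMap.apply_apply, hT] using this
  · refine HasFDerivAt.congr_fderiv ((hasFDerivAt_pow' (𝕜 := ℝ) m).fun_const_smul _) ?_
    ext h
    simp [hT]

/-- The derivative of the exponential at `S`. -/
def expDeriv (S : R) : R →L[ℝ] R := (exists_hasFDerivAt_exp S).choose

theorem hasFDerivAt_exp_algebra (S : R) : HasFDerivAt NormedSpace.exp (expDeriv S) S :=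
  (exists_hasFDerivAt_exp S).choose_spec.1

theorem hasSum_expDeriv (S h : R) : HasSum (fun m : ℕ => (m.factorial : ℝ)⁻¹ •
    ∑ i ∈ Finset.range m, S ^ (m.pred - i) * h * S ^ i) (expDeriv S h) :=
  (exists_hasFDerivAt_exp S).choose_spec.2 h

/-- A derivation acts on the exponential of `S` as the derivative of the exponential. -/
theorem derivation_exp {S : R} (δ : R →L[ℝ] R) (h1 : δ 1 = 0)
    (hS : ∀ b, δ (S * b) = δ S * b + S * δ b) :
    δ (NormedSpace.exp S) = expDeriv S (δ S) := by
  have hpow : ∀ m : ℕ, δ (S ^ m) = ∑ i ∈ Finset.range m, S ^ (m.pred - i) * δ S * S ^ i := by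
    intro m
    induction m with
    | zero => simpa using h1
    | succ m ih =>
      rw [pow_succ', hS, ih, Finset.sum_range_succ, add_comm, Finset.mul_sum]
      congr 1
      · refine Finset.sum_congr rfl fun i hi => ?_
        have := Finset.mem_range.1 hi
        rw [← mul_assoc, ← mul_assoc, ← pow_succ']
        congr 3
        simp only [Nat.pred_eq_sub_one]
        omega
      · simp
  refine HasSum.unique ((hasSum_exp S).mapL δ) ?_
  simpa only [map_smul, hpow] using hasSum_expDeriv S (δ S)

theorem mul_expDeriv_of_commute {S a : R} (h : Commute a S) (b : R) :
    a * expDeriv S b = expDeriv S (a * b) := by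
  refine HasSum.unique ((hasSum_expDeriv S b).mapL (ContinuousLinearMap.mul ℝ R a)) ?_
  have h2 : ∀ (m i : ℕ), a * (S ^ (m.pred - i) * b * S ^ i) = S ^ (m.pred - i) * (a * b) * S ^ i :=
    fun m i => by simp only [← mul_assoc, (h.pow_right _).eq]
  simpa only [map_smul, map_sum, ContinuousLinearMap.mul_apply', h2]
    using hasSum_expDeriv S (a * b)

theorem commute_exp_sub (S a : R) :
    a * NormedSpace.exp S - NormedSpace.exp S * a = expDeriv S (a * S - S * a) := by
  have := derivation_exp (S := S) (ContinuousLinearMap.mul ℝ R a -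
    (ContinuousLinearMap.mul ℝ R).flip a) (by simp) (fun b => by simp; noncomm_ring)
  simpa using this

theorem trace_expDeriv {G : Type*} [NormedAddCommGroup G] [NormedSpace ℝ G] {S : R} (τ : R →L[ℝ] G)
    (h : ∀ b, τ (S * b) = τ (b * S)) (b : R) :
    τ (expDeriv S b) = τ (b * NormedSpace.exp S) := by
  have hpow : ∀ (i : ℕ) (b : R), τ (S ^ i * b) = τ (b * S ^ i) := by
    intro i
    induction i with
    | zero => simp
    | succ i ih =>
      intro b
      rw [pow_succ, mul_assoc, ih, mul_assoc, h, mul_assoc, ← pow_succ]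
  have h1 := (hasSum_expDeriv S b).mapL τ
  have h2 : ∀ m : ℕ, τ ((m.factorial : ℝ)⁻¹ • ∑ i ∈ Finset.range m, S ^ (m.pred - i) * b * S ^ i)
      = ((m.factorial : ℝ)⁻¹ * m) • τ (b * S ^ m.pred) := by
    intro m
    rw [map_smul, map_sum, mul_smul]
    congr 1
    rw [Finset.sum_congr rfl (g := fun _ => τ (b * S ^ m.pred))]
    · simp [Nat.cast_smul_eq_nsmul]
    · intro i hi
      have := Finset.mem_range.1 hi
      rw [mul_assoc, hpow, mul_assoc, ← pow_add]
      congr 3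
      rw [Nat.pred_eq_sub_one]
      omega
  simp only [h2] at h1
  have h3 := ((hasSum_exp S).mapL (ContinuousLinearMap.mul ℝ R b)).mapL τ
  refine HasSum.unique h1 ((hasSum_nat_add_iff' 1).1 ?_)
  convert h3 using 1
  · funext m
    simp only [map_smul, ContinuousLinearMap.mul_apply', Nat.pred_eq_sub_one, Nat.add_sub_cancel]
    congr 1
    rw [Nat.factorial_succ]
    push_cast
    field_simp
  · simp

theorem exp_add_of_commute_real {x y : R} (h : Commute x y) :
    NormedSpace.exp (x + y) = NormedSpace.exp x * NormedSpace.exp y := by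
  let : NormedAlgebra ℚ R := NormedAlgebra.restrictScalars ℚ ℝ R
  exact NormedSpace.exp_add_of_commute h

theorem map_exp_real {R' : Type*} [NormedRing R'] [NormedAlgebra ℝ R'] [CompleteSpace R']
    (f : R →L[ℝ] R') (h1 : f 1 = 1) (hf : ∀ x y, f (x * y) = f x * f y) (x : R) :
    f (NormedSpace.exp x) = NormedSpace.exp (f x) := by
  have hp : ∀ m : ℕ, f (x ^ m) = f x ^ m := fun m => by
    induction m with
    | zero => simpa using h1
    | succ m ih => rw [pow_succ, hf, ih, pow_succ]
  refine HasSum.unique ((hasSum_exp x).mapL f) ?_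
  simpa only [map_smul, hp] using hasSum_exp (f x)

end ExpDeriv

namespace Om

section ExteriorDerivative

variable {n : ℕ} {F : Type*} [NormedAddCommGroup F] [NormedSpace ℝ F]

/-- The exterior derivative of an inhomogeneous form. -/
def d (f : Eu n → Om n F) (x : Eu n) : Om n F := dOp (fderiv ℝ f x)

theorem d_apply_zero (f : Eu n → Om n F) (x : Eu n) : d f x 0 = 0 := rfl

theorem d_apply_succ {f : Eu n → Om n F} {x : Eu n} (hf : DifferentiableAt ℝ f x) (k : ℕ) :
    d f x (k + 1) = extDeriv (fun y => f y k) x := by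
  rw [d, dOp_apply_succ, extDeriv]
  congr 1
  exact ((proj k).hasFDerivAt.comp x hf.hasFDerivAt).fderiv.symm

theorem d_add {f g : Eu n → Om n F} {x : Eu n} (hf : DifferentiableAt ℝ f x)
    (hg : DifferentiableAt ℝ g x) : d (fun y => f y + g y) x = d f x + d g x := by
  rw [d, fderiv_fun_add hf hg, dOp_add]
  rfl

theorem dOp_neg (f : Eu n →L[ℝ] Om n F) : dOp (-f) = -dOp f := by
  have := dOp_add f (-f)
  rw [add_neg_cancel] at this
  have h0 : dOp (0 : Eu n →L[ℝ] Om n F) = 0 := by simpa using dOp_add (0 : Eu n →L[ℝ] Om n F) 0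
  rw [h0] at this
  exact (neg_eq_of_add_eq_zero_right this.symm).symm

theorem d_neg (f : Eu n → Om n F) (x : Eu n) : d (fun y => -f y) x = -d f x := by
  rw [d, fderiv_fun_neg, dOp_neg]
  rfl

theorem d_sub {f g : Eu n → Om n F} {x : Eu n} (hf : DifferentiableAt ℝ f x)
    (hg : DifferentiableAt ℝ g x) : d (fun y => f y - g y) x = d f x - d g x := by
  simp only [sub_eq_add_neg]
  rw [d_add hf hg.fun_neg, d_neg]

theorem d_ctr {f : Eu n → Om n F} {x : Eu n} (hf : DifferentiableAt ℝ f x) (v : Eu n) :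
    d (fun y => ctr v (f y)) x = fderiv ℝ f x v - ctr v (d f x) := by
  rw [d, d, ctr_dOp, sub_sub_cancel]
  congr 1
  exact ((ctr v).hasFDerivAt.comp x hf.hasFDerivAt).fderiv

theorem d_map {G : Type*} [NormedAddCommGroup G] [NormedSpace ℝ G] (g : F →L[ℝ] G)
    {f : Eu n → Om n F} {x : Eu n} (hf : DifferentiableAt ℝ f x) :
    d (fun y => map g (f y)) x = map g (d f x) := by
  rw [d, d, ← dOp_comp_map]
  congr 1
  exact ((map g).hasFDerivAt.comp x hf.hasFDerivAt).fderiv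

theorem contDiffAt_dOp {V : Type*} [NormedAddCommGroup V] [NormedSpace ℝ V]
    {f : V → Eu n →L[ℝ] Om n F} {x : V} {N : WithTop ℕ∞} (hf : ContDiffAt ℝ N f x) :
    ContDiffAt ℝ N (fun y => dOp (f y)) x := by
  refine contDiffAt_iff.2 fun k => ?_
  rcases k with _ | k
  · exact contDiffAt_const
  · simp only [dOp_apply_succ, ← ContinuousAlternatingMap.alternatizeUncurryFinCLM_apply]
    exact (ContinuousAlternatingMap.alternatizeUncurryFinCLM ℝ (Eu n)
      F).contDiff.contDiffAt.comp x (contDiffAt_const.clm_comp hf)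

theorem _root_.ContDiffAt.om_d {f : Eu n → Om n F} {x : Eu n} (hf : ContDiffAt ℝ ∞ f x) :
    ContDiffAt ℝ ∞ (d f) x :=
  contDiffAt_dOp (hf.fderiv_right (m := ∞) (by exact_mod_cast le_top))

theorem d_d {f : Eu n → Om n F} {x : Eu n} (hf : ContDiffAt ℝ ∞ f x) : d (d f) x = 0 := by
  ext k : 1
  rcases k with _ | k
  · rfl
  rw [d_apply_succ (hf.om_d.differentiableAt (by simp)), zero_apply]
  rcases k with _ | k
  · simp only [d_apply_zero]
    ext v
    simp [extDeriv, ContinuousAlternatingMap.alternatizeUncurryFin_apply]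
  · have h : (fun y => d f y (k + 1)) =ᶠ[𝓝 x] extDeriv (fun y => f y k) := by
      have h1 : ∀ᶠ y in 𝓝 x, ContDiffAt ℝ 1 f y :=
        ((hf.of_le (by exact_mod_cast le_top)).eventually (by simp))
      filter_upwards [h1] with y hy
      exact d_apply_succ (hy.differentiableAt (by simp)) k
    rw [h.extDeriv_eq]
    exact extDeriv_extDeriv_apply (contDiffAt_iff.1 hf k) (by simpa using (by exact_mod_cast le_top : ((2 : ℕ∞) : WithTop ℕ∞) ≤ ∞))

end ExteriorDerivative

section Leibniz

variable {n : ℕ} {F : Type*} [NormedRing F] [NormedAlgebra ℝ F]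

theorem d_mul {f g : Eu n → Om n F} {x : Eu n} (hf : DifferentiableAt ℝ f x)
    (hg : DifferentiableAt ℝ g x) :
    d (fun y => f y * g y) x = d f x * g x + par (f x) * d g x := by
  rw [d, d, d, dOp_eq_sum, dOp_eq_sum, dOp_eq_sum, fderiv_fun_mul' hf hg, Finset.sum_mul,
    Finset.mul_sum, ← Finset.sum_add_distrib]
  refine Finset.sum_congr rfl fun i _ => ?_
  simp only [_root_.add_apply, _root_.smul_apply, smul_eq_mul, MulOpposite.smul_eq_mul_unop,
    MulOpposite.unop_op, mul_add]
  rw [← mul_assoc, ← mul_assoc, ← mul_assoc, coordFormIn_mul i (f x), add_comm]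

theorem par_exp [CompleteSpace F] {S : Om n F} (hS : par S = S) :
    par (NormedSpace.exp S) = NormedSpace.exp S := by
  have := map_exp_real (R := Om n F) (R' := Om n F) par par_one par_mul S
  rwa [hS] at this

theorem commute_coordFormIn {S : Om n F} (hS : par S = S) (i : Fin n) :
    Commute (coordFormIn F i) S := by
  rw [Commute, SemiconjBy, coordFormIn_mul, hS]

theorem d_exp [CompleteSpace F] {S : Eu n → Om n F} {x : Eu n} (hS : DifferentiableAt ℝ S x)
    (he : par (S x) = S x) : d (fun y => NormedSpace.exp (S y)) x = expDeriv (S x) (d S x) := by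
  have h1 : fderiv ℝ (fun y => NormedSpace.exp (S y)) x = (expDeriv (S x)).comp (fderiv ℝ S x) :=
    ((hasFDerivAt_exp_algebra (S x)).comp x hS.hasFDerivAt).fderiv
  rw [d, d, h1, dOp_eq_sum, dOp_eq_sum, map_sum]
  refine Finset.sum_congr rfl fun i _ => ?_
  exact mul_expDeriv_of_commute (commute_coordFormIn he i) _

theorem ctr_exp [CompleteSpace F] {S : Om n F} (he : par S = S) (v : Eu n) :
    ctr v (NormedSpace.exp S) = expDeriv S (ctr v S) :=
  derivation_exp (R := Om n F) (ctr v) (ctr_one v) fun b => by rw [ctr_mul, he]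

end Leibniz

end Om
end

noncomputable section

section ParametricIntegral

variable {V : Type*} [NormedAddCommGroup V] [NormedSpace ℝ V] [FiniteDimensional ℝ V]
  {W : Type*} [NormedAddCommGroup W] [NormedSpace ℝ W] [CompleteSpace W]

theorem contDiff_fderiv_param {f : ℝ → V → W} {m N : WithTop ℕ∞}
    (hf : ContDiff ℝ N (Function.uncurry f)) (h : m + 1 ≤ N) :
    ContDiff ℝ m fun z : ℝ × V => fderiv ℝ (f z.1) z.2 :=
  ContDiff.fderiv (n := m) (m := N) (f := fun (z : ℝ × V) => f z.1) (g := fun z => z.2)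
    (hf.comp (f := fun p : (ℝ × V) × V => (p.1.1, p.2)) (by fun_prop)) contDiff_snd h

theorem hasFDerivAt_integral_unitInterval {f : ℝ → V → W} (hf : ContDiff ℝ 1 (Function.uncurry f))
    (x : V) : HasFDerivAt (fun y => ∫ t in (0 : ℝ)..1, f t y) (∫ t in (0 : ℝ)..1, fderiv ℝ (f t) x) x := by
  have hd := (contDiff_fderiv_param (m := 0) hf (by simp)).continuous
  have hc : ∀ y, Continuous fun t => f t y := fun y =>
    hf.continuous.comp (f := fun t => (t, y)) (by fun_prop)
  obtain ⟨C, hC⟩ := ((isCompact_Icc (a := (0 : ℝ)) (b := 1)).prod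
    (isCompact_closedBall x 1)).exists_bound_of_continuousOn hd.continuousOn
  have hcd : Continuous fun t => fderiv ℝ (f t) x := hd.comp (g := fun z : ℝ × V => _)
    (f := fun t => (t, x)) (by fun_prop)
  refine (intervalIntegral.hasFDerivAt_integral_of_dominated_of_fderiv_le
    (F := fun y t => f t y) (F' := fun y t => fderiv ℝ (f t) y) (bound := fun _ => C)
    (s := Metric.ball x 1) (Metric.ball_mem_nhds x one_pos)
    (Filter.Eventually.of_forall fun y => (hc y).aestronglyMeasurable)
    ((hc x).intervalIntegrable 0 1) hcd.aestronglyMeasurable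
    (Filter.Eventually.of_forall fun t ht y hy => ?_) (by simp)
    (Filter.Eventually.of_forall fun t ht y hy => ?_))
  · rw [Set.uIoc_of_le zero_le_one] at ht
    exact hC (t, y) ⟨⟨ht.1.le, ht.2⟩, Metric.ball_subset_closedBall hy⟩
  · have : ContDiff ℝ 1 (f t) := hf.comp (f := fun y => (t, y)) (by fun_prop)
    exact (this.differentiable (by simp) y).hasFDerivAt

theorem contDiff_integral_unitInterval_nat (m : ℕ) : ∀ {W : Type u} [NormedAddCommGroup W]
    [NormedSpace ℝ W] [CompleteSpace W] {V : Type} [NormedAddCommGroup V] [NormedSpace ℝ V]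
    [FiniteDimensional ℝ V] {f : ℝ → V → W}, ContDiff ℝ ∞ (Function.uncurry f) →
    ContDiff ℝ m fun y => ∫ t in (0 : ℝ)..1, f t y := by
  induction m with
  | zero =>
    intro W _ _ _ V _ _ _ f hf
    refine contDiff_zero.2 (continuous_iff_continuousAt.2 fun x => ?_)
    exact (hasFDerivAt_integral_unitInterval (hf.of_le (by exact_mod_cast le_top)) x).continuousAt
  | succ m ih =>
    intro W _ _ _ V _ _ _ f hf
    have h1 := hasFDerivAt_integral_unitInterval (hf.of_le (m := 1) (by exact_mod_cast le_top))
    push_cast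
    refine contDiff_succ_iff_hasFDerivAt.2 ⟨_, ?_, h1⟩
    refine ih (f := fun t x => fderiv ℝ (f t) x) ?_
    exact contDiff_fderiv_param hf (by simp)

theorem contDiff_integral_unitInterval {W : Type u} [NormedAddCommGroup W]
    [NormedSpace ℝ W] [CompleteSpace W] {V : Type} [NormedAddCommGroup V] [NormedSpace ℝ V]
    [FiniteDimensional ℝ V] {f : ℝ → V → W} (hf : ContDiff ℝ ∞ (Function.uncurry f)) :
    ContDiff ℝ ∞ fun y => ∫ t in (0 : ℝ)..1, f t y :=
  contDiff_infty.2 fun m => contDiff_integral_unitInterval_nat m hf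

end ParametricIntegral

namespace Om

section

variable {n : ℕ} {F : Type*} [NormedAddCommGroup F] [NormedSpace ℝ F]

/-- The exterior derivative of jets as a continuous linear map. -/
def dOpL (n : ℕ) (F : Type*) [NormedAddCommGroup F] [NormedSpace ℝ F] :
    (Eu n →L[ℝ] Om n F) →L[ℝ] Om n F :=
  ofComponents fun k => match k with
    | 0 => 0
    | k + 1 => (ContinuousAlternatingMap.alternatizeUncurryFinCLM ℝ (Eu n) F).comp
        (ContinuousLinearMap.compL ℝ (Eu n) (Om n F) (Alt n F k) (proj k))

theorem dOpL_apply (f : Eu n →L[ℝ] Om n F) : dOpL n F f = dOp f := by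
  ext k : 1
  rw [dOpL, ofComponents_apply]
  rcases k with _ | k <;> rfl

theorem d_const (a : Om n F) (x : Eu n) : d (fun _ => a) x = 0 := by
  rw [d, fderiv_fun_const, ← dOpL_apply]
  exact map_zero _

theorem d_integral [CompleteSpace F] {f : ℝ → Eu n → Om n F}
    (hf : ContDiff ℝ ∞ (Function.uncurry f)) (x : Eu n) :
    d (fun y => ∫ t in (0 : ℝ)..1, f t y) x = ∫ t in (0 : ℝ)..1, d (f t) x := by
  have h1 := hasFDerivAt_integral_unitInterval (hf.of_le (m := 1) (by exact_mod_cast le_top)) x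
  have hd := (contDiff_fderiv_param (m := ∞) hf (by simp)).continuous
  have hcd : Continuous fun t => fderiv ℝ (f t) x := hd.comp (g := fun z : ℝ × Eu n => _)
    (f := fun t => (t, x)) (by fun_prop)
  rw [d, h1.fderiv, ← dOpL_apply]
  simp only [d, ← dOpL_apply]
  exact ((dOpL n F).intervalIntegral_comp_comm (hcd.intervalIntegrable 0 1)).symm

end

section ChernWeil

variable {n : ℕ} {R : Type*} [NormedRing R] [NormedAlgebra ℝ R]

theorem par_d {f : Eu n → Om n R} {x : Eu n} (hf : DifferentiableAt ℝ f x) :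
    par (d f x) = -d (fun y => par (f y)) x := by
  have h : fderiv ℝ (fun y => par (f y)) x = (par : Om n R →L[ℝ] Om n R).comp (fderiv ℝ f x) :=
    ((par : Om n R →L[ℝ] Om n R).hasFDerivAt.comp x hf.hasFDerivAt).fderiv
  rw [d, d, h, dOp_eq_sum, dOp_eq_sum, map_sum, ← Finset.sum_neg_distrib]
  refine Finset.sum_congr rfl fun i _ => ?_
  rw [par_mul, par_coordFormIn, neg_mul]
  rfl

/-- The negative of the equivariant curvature of the superconnection `d - ι_y + a`. -/
def curv (y : Eu n) (a : Eu n → Om n R) (x : Eu n) : Om n R :=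
  ctr y (a x) - d a x - a x * a x

theorem contDiff_d {f : Eu n → Om n R} (hf : ContDiff ℝ ∞ f) : ContDiff ℝ ∞ (d f) :=
  contDiff_iff_contDiffAt.2 fun x => (hf.contDiffAt (x := x)).om_d

theorem contDiff_curv (y : Eu n) {a : Eu n → Om n R} (ha : ContDiff ℝ ∞ a) :
    ContDiff ℝ ∞ (curv y a) :=
  (((ctr y).contDiff.comp ha).sub (contDiff_d ha)).sub (ha.mul ha)

theorem par_curv (y : Eu n) {a : Eu n → Om n R} (ha : ContDiff ℝ ∞ a)
    (hodd : ∀ x, par (a x) = -a x) (x : Eu n) : par (curv y a x) = curv y a x := by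
  have h : (fun z => par (a z)) = fun z => -a z := funext hodd
  rw [curv, map_sub, map_sub, par_ctr, par_d (ha.contDiffAt.differentiableAt (by simp)), par_mul,
    h, d_neg, hodd, map_neg, neg_neg, neg_neg, neg_mul_neg]

theorem bianchi {y : Eu n} {a : Eu n → Om n R} (ha : ContDiff ℝ ∞ a)
    (hodd : ∀ x, par (a x) = -a x) (hy : ∀ x, fderiv ℝ a x y = 0) (x : Eu n) :
    d (curv y a) x - ctr y (curv y a x) = curv y a x * a x - a x * curv y a x := by
  have hd : ∀ x, DifferentiableAt ℝ a x := fun x => ha.contDiffAt.differentiableAt (by simp)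
  have hdd : DifferentiableAt ℝ (d a) x :=
    (contDiff_d ha).contDiffAt.differentiableAt (by simp)
  have hc : DifferentiableAt ℝ (fun x => ctr y (a x)) x :=
    (ctr y).differentiableAt.comp x (hd x)
  have h1 : d (curv y a) x = -ctr y (d a x) - (d a x * a x - a x * d a x) := by
    have : curv y a = fun x => (ctr y (a x) - d a x) - a x * a x := rfl
    rw [this, d_sub (hc.fun_sub hdd) ((hd x).fun_mul (hd x)), d_sub hc hdd, d_d ha.contDiffAt,
      d_ctr (hd x), hy, d_mul (hd x) (hd x), hodd]
    noncomm_ring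
  have h2 : ctr y (curv y a x) = -ctr y (d a x) - (ctr y (a x) * a x - a x * ctr y (a x)) := by
    rw [curv, map_sub, map_sub, ctr_ctr, ctr_mul, hodd]
    noncomm_ring
  rw [h1, h2, curv]
  noncomm_ring

variable [CompleteSpace R]

theorem d_sub_ctr_exp_curv {y : Eu n} {a : Eu n → Om n R} (ha : ContDiff ℝ ∞ a)
    (hodd : ∀ x, par (a x) = -a x) (hy : ∀ x, fderiv ℝ a x y = 0) (x : Eu n) :
    d (fun z => NormedSpace.exp (curv y a z)) x - ctr y (NormedSpace.exp (curv y a x))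
      = NormedSpace.exp (curv y a x) * a x - a x * NormedSpace.exp (curv y a x) := by
  have he := par_curv y ha hodd
  rw [d_exp ((contDiff_curv y ha).contDiffAt.differentiableAt (by simp)) (he x), ctr_exp (he x),
    ← map_sub, bianchi ha hodd hy, ← neg_sub (a x * _), map_neg, ← commute_exp_sub, neg_sub]

theorem contDiff_exp_curv (y : Eu n) {a : Eu n → Om n R} (ha : ContDiff ℝ ∞ a) :
    ContDiff ℝ ∞ fun z => NormedSpace.exp (curv y a z) :=
  (contDiff_exp_algebra (R := Om n R)).comp (contDiff_curv y ha)

variable {G : Type*} [NormedAddCommGroup G] [NormedSpace ℝ G] {τ : R →L[ℝ] G}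

/-- The Chern character form of a connection is closed. -/
theorem d_trace_exp_curv (hτ : ∀ x y, τ (x * y) = τ (y * x)) {y : Eu n} {a : Eu n → Om n R}
    (ha : ContDiff ℝ ∞ a) (hodd : ∀ x, par (a x) = -a x) (hy : ∀ x, fderiv ℝ a x y = 0)
    (x : Eu n) :
    d (fun z => map τ (NormedSpace.exp (curv y a z))) x
      - ctr y (map τ (NormedSpace.exp (curv y a x))) = 0 := by
  rw [d_map τ ((contDiff_exp_curv y ha).contDiffAt.differentiableAt (by simp)), ctr_map, ← map_sub,
    d_sub_ctr_exp_curv ha hodd hy, map_sub,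
    trace_mul_comm_of_even hτ (par_exp (par_curv y ha hodd x)), sub_self]

/-- The straight path between two connections. -/
def path (a₀ a₁ : Eu n → Om n R) (s : ℝ) (x : Eu n) : Om n R := (1 - s) • a₀ x + s • a₁ x

variable {a₀ a₁ : Eu n → Om n R}

theorem contDiff_path (h₀ : ContDiff ℝ ∞ a₀) (h₁ : ContDiff ℝ ∞ a₁) (s : ℝ) :
    ContDiff ℝ ∞ (path a₀ a₁ s) :=
  (h₀.const_smul (1 - s)).add (h₁.const_smul s)

theorem par_path (h₀ : ∀ x, par (a₀ x) = -a₀ x) (h₁ : ∀ x, par (a₁ x) = -a₁ x) (s : ℝ) (x : Eu n) :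
    par (path a₀ a₁ s x) = -path a₀ a₁ s x := by
  rw [path, map_add, map_smul, map_smul, h₀, h₁, smul_neg, smul_neg, neg_add]

theorem fderiv_path (h₀ : ContDiff ℝ ∞ a₀) (h₁ : ContDiff ℝ ∞ a₁) (s : ℝ) (x : Eu n) :
    fderiv ℝ (path a₀ a₁ s) x = (1 - s) • fderiv ℝ a₀ x + s • fderiv ℝ a₁ x := by
  have d₀ : DifferentiableAt ℝ a₀ x := h₀.contDiffAt.differentiableAt (by simp)
  have d₁ : DifferentiableAt ℝ a₁ x := h₁.contDiffAt.differentiableAt (by simp)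
  exact ((d₀.hasFDerivAt.const_smul (1 - s)).add (d₁.hasFDerivAt.const_smul s)).fderiv

theorem d_path (h₀ : ContDiff ℝ ∞ a₀) (h₁ : ContDiff ℝ ∞ a₁) (s : ℝ) (x : Eu n) :
    d (path a₀ a₁ s) x = (1 - s) • d a₀ x + s • d a₁ x := by
  rw [d, fderiv_path h₀ h₁, ← dOpL_apply, map_add, map_smul, map_smul, dOpL_apply, dOpL_apply]
  rfl

/-- The integrand of the Chern–Simons form. -/
def trans (y : Eu n) (a₀ a₁ : Eu n → Om n R) (s : ℝ) (x : Eu n) : Om n R :=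
  -(a₁ x - a₀ x) * NormedSpace.exp (curv y (path a₀ a₁ s) x)

theorem contDiff_curv_path (y : Eu n) (h₀ : ContDiff ℝ ∞ a₀) (h₁ : ContDiff ℝ ∞ a₁) :
    ContDiff ℝ ∞ fun z : ℝ × Eu n => curv y (path a₀ a₁ z.1) z.2 := by
  have e₀ : ContDiff ℝ ∞ fun z : ℝ × Eu n => a₀ z.2 := h₀.comp contDiff_snd
  have e₁ : ContDiff ℝ ∞ fun z : ℝ × Eu n => a₁ z.2 := h₁.comp contDiff_snd
  have f₀ : ContDiff ℝ ∞ fun z : ℝ × Eu n => d a₀ z.2 := (contDiff_d h₀).comp contDiff_snd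
  have f₁ : ContDiff ℝ ∞ fun z : ℝ × Eu n => d a₁ z.2 := (contDiff_d h₁).comp contDiff_snd
  have hs : ContDiff ℝ ∞ fun z : ℝ × Eu n => 1 - z.1 := contDiff_const.sub contDiff_fst
  have ep : ContDiff ℝ ∞ fun z : ℝ × Eu n => path a₀ a₁ z.1 z.2 :=
    (hs.smul e₀).add (contDiff_fst.smul e₁)
  simp only [curv, d_path h₀ h₁]
  exact (((ctr y).contDiff.comp ep).sub ((hs.smul f₀).add (contDiff_fst.smul f₁))).sub (ep.mul ep)

theorem contDiff_trans (y : Eu n) (h₀ : ContDiff ℝ ∞ a₀) (h₁ : ContDiff ℝ ∞ a₁) :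
    ContDiff ℝ ∞ fun z : ℝ × Eu n => trans y a₀ a₁ z.1 z.2 :=
  ((h₁.sub h₀).comp contDiff_snd).neg.mul
    ((contDiff_exp_algebra (R := Om n R)).comp (contDiff_curv_path y h₀ h₁))

theorem hasDerivAt_curv_path (y : Eu n) (h₀ : ContDiff ℝ ∞ a₀) (h₁ : ContDiff ℝ ∞ a₁) (s : ℝ)
    (x : Eu n) : HasDerivAt (fun s => curv y (path a₀ a₁ s) x)
      (ctr y (a₁ x - a₀ x) - d (fun z => a₁ z - a₀ z) x
        - ((a₁ x - a₀ x) * path a₀ a₁ s x + path a₀ a₁ s x * (a₁ x - a₀ x))) s := by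
  have hlin : ∀ (W : Type _) [NormedAddCommGroup W] [NormedSpace ℝ W] (b₀ b₁ : W),
      HasDerivAt (fun s : ℝ => (1 - s) • b₀ + s • b₁) (b₁ - b₀) s := fun W _ _ b₀ b₁ => by
    have h := (((hasDerivAt_id s).const_sub 1).smul_const b₀).add
      ((hasDerivAt_id s).smul_const b₁)
    refine h.congr_deriv ?_
    rw [neg_smul, one_smul, one_smul]
    abel
  have h1 : HasDerivAt (fun s => path a₀ a₁ s x) (a₁ x - a₀ x) s := hlin _ _ _
  have h2 : HasDerivAt (fun s => d (path a₀ a₁ s) x) (d (fun z => a₁ z - a₀ z) x) s := by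
    simp only [d_path h₀ h₁]
    rw [d_sub (h₁.contDiffAt.differentiableAt (by simp))
      (h₀.contDiffAt.differentiableAt (by simp))]
    exact hlin _ _ _
  have h3 := (((ctr y).hasFDerivAt.comp_hasDerivAt s h1).sub h2).sub (h1.mul h1)
  exact h3

theorem hasDerivAt_trace_exp_curv (hτ : ∀ x y, τ (x * y) = τ (y * x)) (y : Eu n)
    (h₀ : ContDiff ℝ ∞ a₀) (h₁ : ContDiff ℝ ∞ a₁)
    (o₀ : ∀ x, par (a₀ x) = -a₀ x) (o₁ : ∀ x, par (a₁ x) = -a₁ x)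
    (y₀ : ∀ x, fderiv ℝ a₀ x y = 0) (y₁ : ∀ x, fderiv ℝ a₁ x y = 0) (s : ℝ) (x : Eu n) :
    HasDerivAt (fun s => map τ (NormedSpace.exp (curv y (path a₀ a₁ s) x)))
      (d (fun z => map τ (trans y a₀ a₁ s z)) x - ctr y (map τ (trans y a₀ a₁ s x))) s := by
  obtain ⟨b, hb⟩ : ∃ b : Eu n → Om n R, b = fun z => a₁ z - a₀ z := ⟨_, rfl⟩
  have hbz : ∀ z, a₁ z - a₀ z = b z := fun z => by rw [hb]
  have cb : ContDiff ℝ ∞ b := hb ▸ h₁.sub h₀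
  have db : DifferentiableAt ℝ b x := cb.contDiffAt.differentiableAt (by simp)
  have ob : ∀ z, par (b z) = -b z := fun z => by
    rw [← hbz, map_sub, o₀, o₁, neg_sub_neg, neg_sub]
  have cp := contDiff_path h₀ h₁ s
  have op := par_path o₀ o₁ s
  have yp : ∀ z, fderiv ℝ (path a₀ a₁ s) z y = 0 := fun z => by
    rw [fderiv_path h₀ h₁]
    simp [y₀, y₁]
  set S := curv y (path a₀ a₁ s) x with hS
  have heS : par S = S := par_curv y cp op x
  have ce := contDiff_exp_curv y cp
  have h1 := hasDerivAt_curv_path y h₀ h₁ s x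
  simp only [hbz] at h1
  have h2 := (map τ).hasFDerivAt.comp_hasDerivAt s
    ((hasFDerivAt_exp_algebra (R := Om n R) S).comp_hasDerivAt s h1)
  refine h2.congr_deriv ?_
  have htr : ∀ z, map τ (expDeriv S z) = map τ (z * NormedSpace.exp S) :=
    trace_expDeriv (R := Om n R) (map τ) fun z => trace_mul_comm_of_even hτ heS z
  have e1 : d (fun z => trans y a₀ a₁ s z) x
      = -(d b x * NormedSpace.exp S
        - b x * d (fun z => NormedSpace.exp (curv y (path a₀ a₁ s) z)) x) := by
    have : (fun z => trans y a₀ a₁ s z)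
        = fun z => -(b z * NormedSpace.exp (curv y (path a₀ a₁ s) z)) := by
      funext z
      rw [trans, hbz, neg_mul]
    rw [this, d_neg, d_mul db (ce.contDiffAt.differentiableAt (by simp)), ob]
    noncomm_ring
  have e2 : ctr y (trans y a₀ a₁ s x)
      = -(ctr y (b x) * NormedSpace.exp S - b x * ctr y (NormedSpace.exp S)) := by
    rw [trans, hbz, neg_mul, map_neg, ctr_mul, ob]
    noncomm_ring
  have e3 := d_sub_ctr_exp_curv cp op yp x
  rw [← hS] at e3
  have dt : DifferentiableAt ℝ (fun z => trans y a₀ a₁ s z) x :=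
    ((contDiff_trans y h₀ h₁).comp (f := fun z => (s, z)) (by fun_prop)).contDiffAt.differentiableAt
      (by simp)
  rw [d_map τ dt, ctr_map, ← map_sub, e1, e2, htr]
  have hodd : map τ (b x * NormedSpace.exp S * path a₀ a₁ s x)
      = -map τ (path a₀ a₁ s x * (b x * NormedSpace.exp S)) := by
    refine trace_mul_comm_of_odd hτ ?_ (op x)
    rw [par_mul, ob, par_exp heS, neg_mul]
  rw [sub_eq_iff_eq_add] at e3
  rw [e3]
  have : -(d b x * NormedSpace.exp S - b x * (NormedSpace.exp S * path a₀ a₁ s x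
      - path a₀ a₁ s x * NormedSpace.exp S + ctr y (NormedSpace.exp S)))
      - -(ctr y (b x) * NormedSpace.exp S - b x * ctr y (NormedSpace.exp S))
      = (ctr y (b x) - d b x - b x * path a₀ a₁ s x) * NormedSpace.exp S
        + b x * NormedSpace.exp S * path a₀ a₁ s x := by noncomm_ring
  rw [this, map_add, hodd, ← sub_eq_add_neg, ← map_sub]
  congr 1
  noncomm_ring

/-- The transgression formula. -/
theorem trace_exp_curv_sub [CompleteSpace G] (hτ : ∀ x y, τ (x * y) = τ (y * x)) (y : Eu n)
    (h₀ : ContDiff ℝ ∞ a₀) (h₁ : ContDiff ℝ ∞ a₁)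
    (o₀ : ∀ x, par (a₀ x) = -a₀ x) (o₁ : ∀ x, par (a₁ x) = -a₁ x)
    (y₀ : ∀ x, fderiv ℝ a₀ x y = 0) (y₁ : ∀ x, fderiv ℝ a₁ x y = 0) (x : Eu n) :
    map τ (NormedSpace.exp (curv y a₁ x)) - map τ (NormedSpace.exp (curv y a₀ x))
      = d (fun z => ∫ s in (0 : ℝ)..1, map τ (trans y a₀ a₁ s z)) x
        - ctr y (∫ s in (0 : ℝ)..1, map τ (trans y a₀ a₁ s x)) := by
  have hc : ContDiff ℝ ∞ (Function.uncurry fun s z => map τ (trans y a₀ a₁ s z)) :=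
    (map τ).contDiff.comp (contDiff_trans y h₀ h₁)
  have c1 : Continuous fun s => map τ (trans y a₀ a₁ s x) :=
    hc.continuous.comp (f := fun s => (s, x)) (by fun_prop)
  have c2 : Continuous fun s => d (fun z => map τ (trans y a₀ a₁ s z)) x := by
    have hd := (contDiff_fderiv_param (m := ∞) hc (by simp)).continuous
    simp only [d, ← dOpL_apply]
    exact (dOpL n G).continuous.comp (hd.comp (f := fun s => (s, x)) (by fun_prop))
  have c3 : Continuous fun s => ctr y (map τ (trans y a₀ a₁ s x)) := (ctr y).continuous.comp c1
  rw [d_integral hc, ← (ctr y).intervalIntegral_comp_comm (c1.intervalIntegrable 0 1),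
    ← intervalIntegral.integral_sub (c2.intervalIntegrable 0 1)
      (c3.intervalIntegrable 0 1)]
  have key := intervalIntegral.integral_eq_sub_of_hasDerivAt
    (fun s _ => hasDerivAt_trace_exp_curv hτ y h₀ h₁ o₀ o₁ y₀ y₁ s x)
    ((c2.sub c3).intervalIntegrable 0 1)
  refine Eq.trans ?_ key.symm
  have p0 : path a₀ a₁ 0 = a₀ := by funext z; simp [path]
  have p1 : path a₀ a₁ 1 = a₁ := by funext z; simp [path]
  rw [p0, p1]

end ChernWeil

end Om
end

noncomputable section

section TraceClassTheory

variable {H V : Type*} [NormedAddCommGroup H] [InnerProductSpace ℂ H]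
  [NormedAddCommGroup V] [InnerProductSpace ℂ V]

theorem TraceBound.sum_le {T : H →L[ℂ] H} {C : ℝ} (h : TraceBound T C) {ι : Type*} [Fintype ι]
    {e f : ι → H} (he : Orthonormal ℂ e) (hf : Orthonormal ℂ f) :
    ∑ i, ‖⟪f i, T (e i)⟫_ℂ‖ ≤ C := by
  have := h.2 _ (e ∘ (Fintype.equivFin ι).symm) (f ∘ (Fintype.equivFin ι).symm)
    (he.comp _ (Equiv.injective _)) (hf.comp _ (Equiv.injective _))
  rwa [← (Fintype.equivFin ι).symm.sum_comp]

theorem exists_orthonormalBasis_orthogonal_images {U : Type*} [NormedAddCommGroup U]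
    [InnerProductSpace ℂ U] [FiniteDimensional ℂ U] (T : U →ₗ[ℂ] U) :
    ∃ v : OrthonormalBasis (Fin (Module.finrank ℂ U)) ℂ U,
      ∀ i j, i ≠ j → ⟪T (v i), T (v j)⟫_ℂ = 0 := by
  have hs : (LinearMap.adjoint T * T).IsSymmetric := T.isSymmetric_adjoint_mul_self
  refine ⟨hs.eigenvectorBasis rfl, fun i j hij => ?_⟩
  have h1 := hs.apply_eigenvectorBasis rfl j
  rw [← LinearMap.adjoint_inner_right]
  rw [Module.End.mul_apply] at h1
  rw [h1, inner_smul_right, (hs.eigenvectorBasis rfl).orthonormal.2 hij, mul_zero]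

theorem TraceBound.sum_norm_le {T : H →L[ℂ] H} {C : ℝ} (h : TraceBound T C) (U : Submodule ℂ H)
    [FiniteDimensional ℂ U] {ι : Type*} [Fintype ι] {v : ι → U} (hv : Orthonormal ℂ v)
    (hw : ∀ i j, i ≠ j → ⟪U.orthogonalProjectionOnto (T (v i)),
      U.orthogonalProjectionOnto (T (v j))⟫_ℂ = 0) :
    ∑ i, ‖U.orthogonalProjectionOnto (T (v i))‖ ≤ C := by
  classical
  obtain ⟨w, hwd⟩ : ∃ w : ι → U, w = fun i => U.orthogonalProjectionOnto (T (v i)) := ⟨_, rfl⟩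
  have hwi : ∀ i, U.orthogonalProjectionOnto (T (v i)) = w i := fun i => by rw [hwd]
  simp only [hwi] at hw ⊢
  rw [(Finset.sum_filter_of_ne (p := fun i => w i ≠ 0)
    (fun i _ hi h2 => hi (by simp [h2]))).symm.trans
    (Finset.sum_subtype (p := fun i => w i ≠ 0) _ (by simp) _)]
  have he : Orthonormal ℂ fun i : {i // w i ≠ 0} => ((v i : U) : H) :=
    (hv.comp _ Subtype.val_injective).comp_linearIsometry U.subtypeₗᵢ
  have hn : ∀ i : {i // w i ≠ 0}, (‖w i‖ : ℂ) ≠ 0 := fun i => by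
    exact_mod_cast norm_ne_zero_iff.2 i.2
  have hf : Orthonormal ℂ fun i : {i // w i ≠ 0} => ((((‖w i‖ : ℂ)⁻¹ • w i : U)) : H) := by
    refine Orthonormal.comp_linearIsometry (v := fun i : {i // w i ≠ 0} => (‖w i‖ : ℂ)⁻¹ • w i)
      ⟨fun i => ?_, fun i j hij => ?_⟩ U.subtypeₗᵢ
    · rw [norm_smul, norm_inv, Complex.norm_real, norm_norm,
        inv_mul_cancel₀ (norm_ne_zero_iff.2 i.2)]
    · simp only [inner_smul_left, inner_smul_right]
      rw [hw _ _ (fun h => hij (Subtype.ext h)), mul_zero, mul_zero]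
  refine le_trans (le_of_eq (Finset.sum_congr rfl fun i _ => ?_)) (h.sum_le he hf)
  rw [← Submodule.inner_orthogonalProjectionOnto_eq_of_mem_left, hwi, inner_smul_left,
    inner_self_eq_norm_sq_to_K, norm_mul, norm_pow, RCLike.norm_conj, norm_inv, Complex.norm_real,
    norm_norm, RCLike.norm_ofReal, abs_norm]
  have := norm_ne_zero_iff.2 i.2
  field_simp

/-- The trace norm bounds sums over families which satisfy Bessel inequalities. -/
theorem TraceBound.sum_inner_le {T : H →L[ℂ] H} {C : ℝ} (h : TraceBound T C) {n : ℕ}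
    {α β : Fin n → H} {a b : ℝ} (ha : 0 ≤ a) (hb : 0 ≤ b)
    (hα : ∀ x, ∑ k, ‖⟪α k, x⟫_ℂ‖ ^ 2 ≤ (a * ‖x‖) ^ 2)
    (hβ : ∀ x, ∑ k, ‖⟪x, β k⟫_ℂ‖ ^ 2 ≤ (b * ‖x‖) ^ 2) :
    ∑ k, ‖⟪α k, T (β k)⟫_ℂ‖ ≤ a * b * C := by
  let U : Submodule ℂ H := Submodule.span ℂ (Set.range α ∪ Set.range β)
  have : FiniteDimensional ℂ U :=
    FiniteDimensional.span_of_finite ℂ ((Set.finite_range α).union (Set.finite_range β))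
  have hαU : ∀ k, α k ∈ U := fun k => Submodule.subset_span (Or.inl ⟨k, rfl⟩)
  have hβU : ∀ k, β k ∈ U := fun k => Submodule.subset_span (Or.inr ⟨k, rfl⟩)
  let T' : U →ₗ[ℂ] U := (U.orthogonalProjectionOnto.comp (T.comp U.subtypeL)).toLinearMap
  have hT' : ∀ x : U, T' x = U.orthogonalProjectionOnto (T x) := fun x => rfl
  obtain ⟨v, hv⟩ := exists_orthonormalBasis_orthogonal_images T'
  have hsum := h.sum_norm_le U v.orthonormal (fun i j hij => hv i j hij)
  have hexp : ∀ k, ⟪α k, T (β k)⟫_ℂ = ∑ i, ⟪((v i : U) : H), β k⟫_ℂ * ⟪α k, T' (v i)⟫_ℂ := by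
    intro k
    have h1 : ⟪α k, T (β k)⟫_ℂ = ⟪(⟨α k, hαU k⟩ : U), T' ⟨β k, hβU k⟩⟫_ℂ := by
      rw [hT', Submodule.inner_orthogonalProjectionOnto_eq_of_mem_left]
    rw [h1, ← v.sum_repr' ⟨β k, hβU k⟩, map_sum, inner_sum]
    refine Finset.sum_congr rfl fun i _ => ?_
    rw [map_smul, inner_smul_right]
    rfl
  calc ∑ k, ‖⟪α k, T (β k)⟫_ℂ‖
      ≤ ∑ k, ∑ i, ‖⟪((v i : U) : H), β k⟫_ℂ‖ * ‖⟪α k, T' (v i)⟫_ℂ‖ := by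
        refine Finset.sum_le_sum fun k _ => ?_
        rw [hexp]
        exact norm_sum_le_of_le _ fun i _ => norm_mul_le _ _
    _ = ∑ i, ∑ k, ‖⟪((v i : U) : H), β k⟫_ℂ‖ * ‖⟪α k, T' (v i)⟫_ℂ‖ := Finset.sum_comm
    _ ≤ ∑ i, a * b * ‖T' (v i)‖ := by
        refine Finset.sum_le_sum fun i _ => ?_
        refine (Real.sum_mul_le_sqrt_mul_sqrt _ _ _).trans ?_
        have h1 : √(∑ k, ‖⟪((v i : U) : H), β k⟫_ℂ‖ ^ 2) ≤ b := by
          refine Real.sqrt_le_iff.2 ⟨hb, (hβ _).trans (le_of_eq ?_)⟩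
          have h3 : ‖((v i : U) : H)‖ = 1 := v.orthonormal.1 i
          rw [h3, mul_one]
        have h2 : √(∑ k, ‖⟪α k, T' (v i)⟫_ℂ‖ ^ 2) ≤ a * ‖T' (v i)‖ :=
          Real.sqrt_le_iff.2 ⟨by positivity, hα _⟩
        calc _ ≤ b * (a * ‖T' (v i)‖) := by gcongr
          _ = _ := by ring
    _ ≤ a * b * C := by
        rw [← Finset.mul_sum]
        gcongr
        exact hsum

variable [CompleteSpace H] [CompleteSpace V]

/-- Conjugation with bounded operators does not leave the trace class. -/
theorem TraceBound.sandwich {T : H →L[ℂ] H} {C : ℝ} (h : TraceBound T C) (L : H →L[ℂ] V)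
    (R : V →L[ℂ] H) : TraceBound (L.comp (T.comp R)) (‖L‖ * ‖R‖ * C) := by
  refine ⟨mul_nonneg (by positivity) h.1, fun n e f he hf => ?_⟩
  have key := h.sum_inner_le (α := fun k => ContinuousLinearMap.adjoint L (f k))
    (β := fun k => R (e k)) (norm_nonneg L) (norm_nonneg R) (fun x => ?_) (fun x => ?_)
  · simp only [ContinuousLinearMap.adjoint_inner_left] at key
    exact key
  · simp only [ContinuousLinearMap.adjoint_inner_left]
    refine (hf.sum_inner_products_le _).trans ?_
    gcongr
    exact L.le_opNorm x
  · have h1 : ∀ k, ‖⟪x, R (e k)⟫_ℂ‖ = ‖⟪e k, ContinuousLinearMap.adjoint R x⟫_ℂ‖ := fun k => by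
      rw [← ContinuousLinearMap.adjoint_inner_left, norm_inner_symm]
    simp only [h1]
    refine (he.sum_inner_products_le _).trans ?_
    gcongr
    refine (ContinuousLinearMap.le_opNorm _ x).trans (le_of_eq ?_)
    rw [LinearIsometryEquiv.norm_map]

namespace TraceClass

@[ext] theorem ext {S T : TraceClass H} (h : S.op = T.op) : S = T := Subtype.ext h

@[simp] theorem op_add (S T : TraceClass H) : (S + T).op = S.op + T.op := rfl
@[simp] theorem op_smul (c : ℂ) (T : TraceClass H) : (c • T).op = c • T.op := rfl
@[simp] theorem op_sub (S T : TraceClass H) : (S - T).op = S.op - T.op := rfl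
@[simp] theorem op_neg (T : TraceClass H) : (-T).op = -T.op := rfl
@[simp] theorem op_zero : (0 : TraceClass H).op = 0 := rfl

/-- The map `T ↦ L T R` on trace class operators. -/
def sandwich (L : H →L[ℂ] V) (R : V →L[ℂ] H) : TraceClass H →L[ℂ] TraceClass V :=
  LinearMap.mkContinuous
    { toFun := fun T => ⟨L.comp (T.op.comp R), ⟨_, T.bound.sandwich L R⟩⟩
      map_add' := fun S T => ext (by
        show L.comp ((S + T).op.comp R) = L.comp (S.op.comp R) + L.comp (T.op.comp R)
        rw [op_add, ContinuousLinearMap.add_comp, ContinuousLinearMap.comp_add])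
      map_smul' := fun c T => ext (by
        show L.comp ((c • T).op.comp R) = c • L.comp (T.op.comp R)
        rw [op_smul, ContinuousLinearMap.smul_comp, ContinuousLinearMap.comp_smul]) }
    (‖L‖ * ‖R‖) fun T => norm_le (T.bound.sandwich L R)

@[simp] theorem op_sandwich (L : H →L[ℂ] V) (R : V →L[ℂ] H) (T : TraceClass H) :
    (sandwich L R T).op = L.comp (T.op.comp R) := rfl

theorem norm_sandwich_le (L : H →L[ℂ] V) (R : V →L[ℂ] H) (T : TraceClass H) :
    ‖sandwich L R T‖ ≤ ‖L‖ * ‖R‖ * ‖T‖ :=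
  norm_le (T.bound.sandwich L R)

theorem norm_op_le (T : TraceClass H) : ‖T.op‖ ≤ ‖T‖ := T.bound.opNorm_le

instance : CompleteSpace (TraceClass H) := by
  refine Metric.complete_of_cauchySeq_tendsto fun u hu => ?_
  have hlip : ∀ S T : TraceClass H, dist S.op T.op ≤ dist S T := fun S T => by
    rw [dist_eq_norm, dist_eq_norm, ← op_sub]
    exact norm_op_le _
  have hop : CauchySeq fun n => (u n).op := by
    rw [Metric.cauchySeq_iff] at hu ⊢
    intro ε hε
    obtain ⟨N, hN⟩ := hu ε hε
    exact ⟨N, fun m hm n hn => (hlip _ _).trans_lt (hN m hm n hn)⟩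
  obtain ⟨T, hT⟩ := cauchySeq_tendsto_of_complete hop
  have hb : ∀ ε > 0, ∃ N, ∀ n ≥ N, TraceBound (T - (u n).op) ε := by
    intro ε hε
    obtain ⟨N, hN⟩ := Metric.cauchySeq_iff.1 hu ε hε
    refine ⟨N, fun n hn => ⟨hε.le, fun k e f he hf => ?_⟩⟩
    have hlim : Filter.Tendsto (fun m => ∑ i, ‖⟪f i, ((u m).op - (u n).op) (e i)⟫_ℂ‖) Filter.atTop
        (𝓝 (∑ i, ‖⟪f i, (T - (u n).op) (e i)⟫_ℂ‖)) := by
      refine tendsto_finsetSum _ fun i _ => ?_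
      have hc : Continuous fun S : H →L[ℂ] H => ‖⟪f i, (S - (u n).op) (e i)⟫_ℂ‖ := by fun_prop
      exact (hc.tendsto T).comp hT
    refine le_of_tendsto hlim (Filter.eventually_atTop.2 ⟨N, fun m hm => ?_⟩)
    have h1 := (u m - u n).bound.2 k e f he hf
    rw [op_sub] at h1
    refine h1.trans ?_
    rw [← dist_eq_norm]
    exact (hN m hm n hn).le
  obtain ⟨N, hN⟩ := hb 1 one_pos
  have hT' : T ∈ traceClassSubmodule H := by
    have : T = (T - (u N).op) + (u N).op := (sub_add_cancel _ _).symm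
    rw [this]
    exact (traceClassSubmodule H).add_mem ⟨1, hN N le_rfl⟩ (u N).2
  obtain ⟨T', rfl⟩ : ∃ T' : TraceClass H, T'.op = T := ⟨⟨T, hT'⟩, rfl⟩
  refine ⟨T', Metric.tendsto_atTop.2 fun ε hε => ?_⟩
  obtain ⟨N, hN⟩ := hb (ε / 2) (by positivity)
  refine ⟨N, fun n hn => ?_⟩
  have h1 : TraceBound (T' - u n).op (ε / 2) := by
    rw [op_sub]
    exact hN n hn
  rw [dist_comm, dist_eq_norm]
  exact (norm_le h1).trans_lt (half_lt_self hε)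

theorem op_sum {ι : Type*} (s : Finset ι) (f : ι → TraceClass H) :
    (∑ i ∈ s, f i).op = ∑ i ∈ s, (f i).op := map_sum (incl (H := H)) f s

variable (H) in
theorem exists_opTrace_eq : ∃ (w : Set H) (b : HilbertBasis w ℂ H), ∀ T : H →L[ℂ] H,
    opTrace T = ∑' i, ⟪b i, T (b i)⟫_ℂ := ⟨_, _, fun _ => rfl⟩

theorem summable_inner (T : TraceClass H) {w : Set H} (b : HilbertBasis w ℂ H) :
    Summable (fun i => ‖⟪b i, T.op (b i)⟫_ℂ‖) ∧ ∑' i, ‖⟪b i, T.op (b i)⟫_ℂ‖ ≤ ‖T‖ := by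
  have h : ∀ s : Finset w, ∑ i ∈ s, ‖⟪b i, T.op (b i)⟫_ℂ‖ ≤ ‖T‖ := fun s => by
    rw [← Finset.sum_coe_sort]
    have := b.orthonormal.comp (Subtype.val : s → w) Subtype.val_injective
    exact T.bound.sum_le this this
  exact ⟨summable_of_sum_le (fun _ => norm_nonneg _) h,
    Real.tsum_le_of_sum_le (fun _ => norm_nonneg _) h⟩

/-- The trace as a continuous functional on the trace class operators. -/
def tr : TraceClass H →L[ℂ] ℂ :=
  LinearMap.mkContinuous
    { toFun := fun T => opTrace T.op
      map_add' := fun S T => by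
        obtain ⟨w, b, hb⟩ := exists_opTrace_eq H
        rw [hb, hb, hb, ← Summable.tsum_add (summable_inner S b).1.of_norm
          (summable_inner T b).1.of_norm]
        simp only [op_add, add_apply, inner_add_right]
      map_smul' := fun c T => by
        obtain ⟨w, b, hb⟩ := exists_opTrace_eq H
        rw [hb, hb, RingHom.id_apply, smul_eq_mul, ← tsum_mul_left]
        simp only [op_smul, smul_apply, inner_smul_right] } 1 fun T => by
    obtain ⟨w, b, hb⟩ := exists_opTrace_eq H
    rw [one_mul]
    show ‖opTrace T.op‖ ≤ _
    rw [hb]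
    exact (norm_tsum_le_tsum_norm (summable_inner T b).1).trans (summable_inner T b).2

theorem tr_apply (T : TraceClass H) : tr T = opTrace T.op := rfl

/-- The rank one operator `x ↦ ⟨a, x⟩ b`. -/
def rankOne (a b : H) : TraceClass H :=
  ⟨InnerProductSpace.rankOne ℂ b a, ‖a‖ * ‖b‖, by positivity, fun n e f he hf => by
    have h1 : ∀ i, ‖⟪f i, InnerProductSpace.rankOne ℂ b a (e i)⟫_ℂ‖
        = ‖⟪e i, a⟫_ℂ‖ * ‖⟪f i, b⟫_ℂ‖ := fun i => by
      rw [InnerProductSpace.rankOne_apply, inner_smul_right, norm_mul, norm_inner_symm]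
    simp only [h1]
    refine (Real.sum_mul_le_sqrt_mul_sqrt _ _ _).trans ?_
    gcongr
    · exact Real.sqrt_le_iff.2 ⟨norm_nonneg _, he.sum_inner_products_le _⟩
    · exact Real.sqrt_le_iff.2 ⟨norm_nonneg _, hf.sum_inner_products_le _⟩⟩

theorem op_rankOne (a b x : H) : (rankOne a b).op x = ⟪a, x⟫_ℂ • b :=
  InnerProductSpace.rankOne_apply ..

theorem tr_rankOne (a b : H) : tr (rankOne a b) = ⟪a, b⟫_ℂ := by
  obtain ⟨w, e, he⟩ := exists_opTrace_eq H
  rw [tr_apply, he]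
  simp only [op_rankOne, inner_smul_right]
  exact e.tsum_inner_mul_inner a b

theorem sandwich_rankOne (L : H →L[ℂ] V) (R : V →L[ℂ] H) (a b : H) :
    sandwich L R (rankOne a b) = rankOne (ContinuousLinearMap.adjoint R a) (L b) := by
  ext x
  rw [op_sandwich, ContinuousLinearMap.comp_apply, ContinuousLinearMap.comp_apply, op_rankOne,
    op_rankOne, map_smul, ContinuousLinearMap.adjoint_inner_left]

theorem exists_norm_sandwich_lt (T : TraceClass H) {ε : ℝ} (hε : 0 < ε) :
    ∃ (U : Submodule ℂ H) (_ : FiniteDimensional ℂ U),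
      ‖sandwich (Uᗮ.starProjection) (Uᗮ.starProjection) T‖ ≤ ε := by
  obtain ⟨n, e, f, he, hf, hef⟩ : ∃ (n : ℕ) (e f : Fin n → H), Orthonormal ℂ e ∧ Orthonormal ℂ f ∧
      ‖T‖ - ε ≤ ∑ i, ‖⟪f i, T.op (e i)⟫_ℂ‖ := by
    by_contra! hcon
    have h0 := hcon 0 Fin.elim0 Fin.elim0 (by simp [Orthonormal, Pairwise])
      (by simp [Orthonormal, Pairwise])
    have : ‖T‖ ≤ ‖T‖ - ε := norm_le ⟨by simpa using h0.le, fun n e f he hf => (hcon n e f he hf).le⟩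
    linarith
  let U : Submodule ℂ H := Submodule.span ℂ (Set.range e ∪ Set.range f)
  have heU : ∀ k, e k ∈ U := fun k => Submodule.subset_span (Or.inl ⟨k, rfl⟩)
  have hfU : ∀ k, f k ∈ U := fun k => Submodule.subset_span (Or.inr ⟨k, rfl⟩)
  have hfin : FiniteDimensional ℂ U :=
    FiniteDimensional.span_of_finite ℂ ((Set.finite_range e).union (Set.finite_range f))
  refine ⟨U, hfin, ?_⟩
  have hsum : ∀ {m : ℕ} (g : Fin n → H) (g' : Fin m → Uᗮ), (∀ k, g k ∈ U) → Orthonormal ℂ g →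
      Orthonormal ℂ g' → Orthonormal ℂ (Sum.elim g fun i => (g' i : H)) := by
    intro m g g' hgU hg hg'
    refine ⟨?_, ?_⟩
    · rintro (i | i)
      · exact hg.1 i
      · exact hg'.1 i
    · rintro (i | i) (j | j) hij
      · exact hg.2 fun h => hij (by rw [h])
      · exact (Submodule.mem_orthogonal _ _).1 (g' j).2 _ (hgU i)
      · exact (Submodule.mem_orthogonal' _ _).1 (g' i).2 _ (hgU j)
      · exact hg'.2 fun h => hij (by rw [h])
  have hT' : TraceBound (sandwich Uᗮ.orthogonalProjectionOnto Uᗮ.subtypeL T).op ε := by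
    refine ⟨hε.le, fun m e' f' he' hf' => ?_⟩
    have h1 := T.bound.sum_le (hsum e e' heU he he') (hsum f f' hfU hf hf')
    simp only [Fintype.sum_sum_type, Sum.elim_inl, Sum.elim_inr] at h1
    have h2 : ∑ i, ‖⟪f' i, (sandwich Uᗮ.orthogonalProjectionOnto Uᗮ.subtypeL T).op (e' i)⟫_ℂ‖
        = ∑ i, ‖⟪(f' i : H), T.op (e' i)⟫_ℂ‖ := by
      refine Finset.sum_congr rfl fun i _ => ?_
      rw [op_sandwich, ContinuousLinearMap.comp_apply, ContinuousLinearMap.comp_apply,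
        Submodule.inner_orthogonalProjectionOnto_eq_of_mem_left]
      rfl
    rw [h2]
    linarith
  have h3 : sandwich Uᗮ.starProjection Uᗮ.starProjection T
      = sandwich Uᗮ.subtypeL Uᗮ.orthogonalProjectionOnto
        (sandwich Uᗮ.orthogonalProjectionOnto Uᗮ.subtypeL T) := by
    ext x
    rfl
  rw [h3]
  refine (norm_sandwich_le _ _ _).trans ?_
  have h4 : ‖Uᗮ.subtypeL‖ ≤ 1 := Submodule.norm_subtypeL_le _
  have h5 : ‖Uᗮ.orthogonalProjectionOnto‖ ≤ 1 := Submodule.orthogonalProjectionOnto_norm_le _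
  calc _ ≤ 1 * 1 * ε := by
        gcongr
        exact norm_le hT'
    _ = ε := by ring

/-- A continuous functional on trace class operators is determined by its values on operators of
rank one. -/
theorem functional_eq_zero (Φ : TraceClass H →L[ℂ] ℂ) (h : ∀ a b, Φ (rankOne a b) = 0)
    (T : TraceClass H) : Φ T = 0 := by
  refine norm_le_zero_iff.1 (le_of_forall_pos_le_add fun ε hε => ?_)
  have hΦ : 0 < ‖Φ‖ + 1 := by positivity
  obtain ⟨U, hU, hUT⟩ := exists_norm_sandwich_lt T (ε := ε / (‖Φ‖ + 1)) (by positivity)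
  let v := stdOrthonormalBasis ℂ U
  have hP : ∀ x : H, U.starProjection x = ∑ i, ⟪(v i : H), x⟫_ℂ • (v i : H) := fun x => by
    rw [Submodule.starProjection_apply, ← v.sum_repr' (U.orthogonalProjectionOnto x)]
    push_cast
    refine Finset.sum_congr rfl fun i _ => ?_
    rw [Submodule.inner_orthogonalProjectionOnto_eq_of_mem_left]
  have hT : T = ∑ i, rankOne (ContinuousLinearMap.adjoint T.op (v i)) (v i)
      + ∑ i, rankOne ((v i : H)) (Uᗮ.starProjection (T.op (v i)))
      + sandwich Uᗮ.starProjection Uᗮ.starProjection T := by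
    ext x
    simp only [op_add, add_apply, op_sum, sum_apply, op_rankOne,
      ContinuousLinearMap.adjoint_inner_left, op_sandwich, ContinuousLinearMap.comp_apply]
    have h1 : ∑ i, ⟪(v i : H), x⟫_ℂ • Uᗮ.starProjection (T.op (v i))
        = Uᗮ.starProjection (T.op (U.starProjection x)) := by
      rw [hP, map_sum, map_sum]
      simp only [map_smul]
    have h2 : ∀ y, y = U.starProjection y + Uᗮ.starProjection y := fun y => by
      rw [Submodule.starProjection_orthogonal']
      simp
    rw [← hP, h1, add_assoc, ← map_add, ← map_add, ← h2, ← h2]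
  rw [hT, map_add, map_add, map_sum, map_sum]
  simp only [h, Finset.sum_const_zero, zero_add]
  refine (Φ.le_opNorm _).trans ?_
  calc ‖Φ‖ * _ ≤ ‖Φ‖ * (ε / (‖Φ‖ + 1)) := by gcongr
    _ ≤ (‖Φ‖ + 1) * (ε / (‖Φ‖ + 1)) := by gcongr; linarith
    _ = ε := by field_simp

theorem tr_sandwich (L : H →L[ℂ] V) (R : V →L[ℂ] H) (T : TraceClass H) :
    tr (sandwich L R T) = tr (sandwich (R.comp L) (ContinuousLinearMap.id ℂ H) T) := by
  rw [← sub_eq_zero]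
  refine functional_eq_zero (tr.comp (sandwich L R)
    - tr.comp (sandwich (R.comp L) (ContinuousLinearMap.id ℂ H))) (fun a b => ?_) T
  rw [sub_apply, ContinuousLinearMap.comp_apply, ContinuousLinearMap.comp_apply, sandwich_rankOne,
    sandwich_rankOne, tr_rankOne, tr_rankOne, ContinuousLinearMap.adjoint_inner_left]
  simp [ContinuousLinearMap.adjoint_id]

end TraceClass

end TraceClassTheory
end

noncomputable section

section TraceClassRing

variable {H : Type*} [NormedAddCommGroup H] [InnerProductSpace ℂ H] [CompleteSpace H]

namespace TraceClass

instance : Mul (TraceClass H) := ⟨fun S T => sandwich S.op (ContinuousLinearMap.id ℂ H) T⟩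

@[simp] theorem op_mul (S T : TraceClass H) : (S * T).op = S.op * T.op := rfl

instance : NonUnitalNormedRing (TraceClass H) :=
  { (inferInstance : NormedAddCommGroup (TraceClass H)) with
    mul := (· * ·)
    left_distrib := fun S T R => ext (by simp [mul_add])
    right_distrib := fun S T R => ext (by simp [add_mul])
    zero_mul := fun S => ext (by simp)
    mul_zero := fun S => ext (by simp)
    mul_assoc := fun S T R => ext (by simp [mul_assoc])
    norm_mul_le := fun S T => (norm_sandwich_le _ _ _).trans (by
      gcongr
      calc ‖S.op‖ * ‖ContinuousLinearMap.id ℂ H‖ ≤ ‖S‖ * 1 := by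
            gcongr
            · exact norm_op_le S
            · exact ContinuousLinearMap.norm_id_le
        _ = ‖S‖ := mul_one _) }

instance : IsScalarTower ℂ (TraceClass H) (TraceClass H) :=
  ⟨fun c S T => ext (by simp)⟩

instance : SMulCommClass ℂ (TraceClass H) (TraceClass H) :=
  ⟨fun c S T => ext (by simp)⟩

theorem tr_mul_comm (S T : TraceClass H) : tr (S * T) = tr (T * S) := by
  have h := tr_sandwich (ContinuousLinearMap.id ℂ H) S.op T
  have h1 : sandwich (ContinuousLinearMap.id ℂ H) S.op T = T * S := ext rfl
  rw [h1] at h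
  rw [h]
  rfl

end TraceClass

variable (H) in
/-- The unital Banach algebra generated by the trace class operators. -/
def UnitalTraceClass : Type _ := WithLp 1 (Unitization ℂ (TraceClass H))

instance : NormedRing (UnitalTraceClass H) :=
  inferInstanceAs (NormedRing (WithLp 1 (Unitization ℂ (TraceClass H))))
instance : NormedAlgebra ℂ (UnitalTraceClass H) :=
  inferInstanceAs (NormedAlgebra ℂ (WithLp 1 (Unitization ℂ (TraceClass H))))
instance : CompleteSpace (UnitalTraceClass H) :=
  inferInstanceAs (CompleteSpace (WithLp 1 (Unitization ℂ (TraceClass H))))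

namespace UnitalTraceClass

/-- The scalar part. -/
def fst : UnitalTraceClass H →L[ℝ] ℂ :=
  LinearMap.mkContinuous
    { toFun := fun x => (WithLp.ofLp x).fst
      map_add' := fun _ _ => rfl
      map_smul' := fun _ _ => rfl } 1 fun x => by
    rw [one_mul]
    exact (le_add_of_nonneg_right (norm_nonneg _)).trans (WithLp.unitization_norm_def _).ge

/-- The trace class part. -/
def snd : UnitalTraceClass H →L[ℝ] TraceClass H :=
  LinearMap.mkContinuous
    { toFun := fun x => (WithLp.ofLp x).snd
      map_add' := fun _ _ => rfl
      map_smul' := fun _ _ => rfl } 1 fun x => by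
    rw [one_mul]
    exact (le_add_of_nonneg_left (norm_nonneg (WithLp.ofLp x).fst)).trans
      (WithLp.unitization_norm_def _).ge

/-- The inclusion of the trace class operators. -/
def inr : TraceClass H →L[ℝ] UnitalTraceClass H :=
  LinearMap.mkContinuous
    { toFun := fun T => WithLp.toLp 1 (Unitization.inr T)
      map_add' := fun _ _ => by rw [Unitization.inr_add]; rfl
      map_smul' := fun c T => by
        rw [RingHom.id_apply, Unitization.inr_smul]; rfl } 1 fun T => by
    rw [one_mul]
    exact (WithLp.unitization_norm_inr T).le

@[simp] theorem fst_inr (T : TraceClass H) : fst (inr T) = 0 := rfl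
@[simp] theorem snd_inr (T : TraceClass H) : snd (inr T) = T := rfl
@[simp] theorem fst_one : fst (1 : UnitalTraceClass H) = 1 := rfl
@[simp] theorem snd_one : snd (1 : UnitalTraceClass H) = 0 := rfl
@[simp] theorem fst_mul (x y : UnitalTraceClass H) : fst (x * y) = fst x * fst y := rfl
theorem snd_mul (x y : UnitalTraceClass H) :
    snd (x * y) = fst x • snd y + fst y • snd x + snd x * snd y := rfl

variable (H) in
/-- The scalar operators. -/
def scalarOp : ℂ →L[ℝ] (H →L[ℂ] H) :=
  (ContinuousLinearMap.toSpanSingleton ℂ (1 : H →L[ℂ] H)).restrictScalars ℝ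

@[simp] theorem scalarOp_apply (c : ℂ) : scalarOp H c = c • (1 : H →L[ℂ] H) := rfl

/-- The action on the Hilbert space. -/
def op : UnitalTraceClass H →L[ℝ] (H →L[ℂ] H) := (scalarOp H).comp (fst (H := H)) + TraceClass.incl.comp (snd (H := H))

theorem op_apply (x : UnitalTraceClass H) : op x = fst x • (1 : H →L[ℂ] H) + (snd x).op := rfl

@[simp] theorem op_one : op (1 : UnitalTraceClass H) = 1 := by
  rw [op_apply, fst_one, snd_one, one_smul, TraceClass.op_zero, add_zero]

theorem op_mul (x y : UnitalTraceClass H) : op (x * y) = op x * op y := by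
  simp only [op_apply, fst_mul, snd_mul, TraceClass.op_add, TraceClass.op_smul, TraceClass.op_mul]
  simp only [mul_add, add_mul, smul_mul_assoc, mul_smul_comm, mul_one, one_mul]
  simp only [smul_add, smul_smul, mul_comm (fst y) (fst x)]
  abel

@[simp] theorem op_inr (T : TraceClass H) : op (inr T) = T.op := by simp [op_apply]

variable (H) in
/-- The trace of the trace class part. -/
def trace : UnitalTraceClass H →L[ℝ] ℂ := (TraceClass.tr.restrictScalars ℝ).comp snd

theorem trace_apply (x : UnitalTraceClass H) : trace H x = TraceClass.tr (snd x) := rfl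

theorem trace_mul_comm (x y : UnitalTraceClass H) : trace H (x * y) = trace H (y * x) := by
  rw [trace_apply, trace_apply, snd_mul, snd_mul]
  simp only [map_add]
  rw [TraceClass.tr_mul_comm, add_comm (TraceClass.tr (fst x • snd y))]

end UnitalTraceClass
end TraceClassRing

section Series

variable {n : ℕ} {F : Type*} [NormedAddCommGroup F] [NormedSpace ℝ F]

/-- The series with total form `w`, homogeneous for the grading by `k + δ - 2 j`. -/
def Ser.ofTotal (δ : ℕ) (w : Om n F) : Ser n F := fun j k => if k + δ = 2 * j then w k else 0

theorem Om.apply_eq_zero_of_par {w : Om n F} {δ : ℕ} (h : Om.par w = (-1 : ℤ) ^ δ • w) {k : ℕ}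
    (hk : ¬ Even (k + δ)) : w k = 0 := by
  have h1 := congrArg (fun a : Om n F => a k) h
  simp only [Om.par_apply] at h1
  have h2 : ((-1 : ℤ) ^ δ • w) k = (-1 : ℤ) ^ δ • w k := by
    rcases neg_one_pow_eq_or ℤ δ with h | h <;> simp [h]
  rw [h2] at h1
  rw [Nat.even_add] at hk
  have h3 : w k = -w k := by
    rcases Nat.even_or_odd k with hk' | hk' <;> rcases Nat.even_or_odd δ with hd | hd
    · exact absurd (by tauto) hk
    · rw [hk'.neg_one_pow, hd.neg_one_pow, one_smul, neg_one_smul] at h1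
      exact h1
    · rw [hk'.neg_one_pow, hd.neg_one_pow, one_smul, neg_one_smul] at h1
      exact h1.symm
    · rw [← Nat.not_even_iff_odd] at hk' hd
      exact absurd (by tauto) hk
  have h4 : (2 : ℝ) • w k = 0 := by
    rw [two_smul]
    nth_rewrite 1 [h3]
    simp
  simpa using h4

variable {R : Type*} [NormedRing R] [NormedAlgebra ℝ R]

theorem Ser.mul_ofTotal {δ ε : ℕ} {a b : Om n R} (ha : Om.par a = (-1 : ℤ) ^ δ • a)
    (hb : Om.par b = (-1 : ℤ) ^ ε • b) :
    Ser.mul (Ser.ofTotal δ a) (Ser.ofTotal ε b) = Ser.ofTotal (δ + ε) (a * b) := by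
  funext j k
  rw [Ser.mul, Finset.sum_comm, Ser.ofTotal, Om.mul_apply_attach]
  have key : ∀ x ∈ (Finset.HasAntidiagonal.antidiagonal k).attach,
      ∑ i ∈ Finset.HasAntidiagonal.antidiagonal j,
        wedge (Finset.HasAntidiagonal.mem_antidiagonal.1 x.2) (Ser.ofTotal δ a i.1 x.1.1)
          (Ser.ofTotal ε b i.2 x.1.2)
      = if k + (δ + ε) = 2 * j then
          wedge (Finset.HasAntidiagonal.mem_antidiagonal.1 x.2) (a x.1.1) (b x.1.2) else 0 := by
    rintro ⟨⟨p, q⟩, hx⟩ -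
    have hpq := Finset.HasAntidiagonal.mem_antidiagonal.1 hx
    simp only at hpq ⊢
    by_cases hp : Even (p + δ)
    swap
    · simp only [Ser.ofTotal, Om.apply_eq_zero_of_par ha hp, ite_self, wedge_zero_left,
        Finset.sum_const_zero]
    by_cases hq : Even (q + ε)
    swap
    · simp only [Ser.ofTotal, Om.apply_eq_zero_of_par hb hq, ite_self, wedge_zero_right,
        Finset.sum_const_zero]
    obtain ⟨p', hp'⟩ := hp
    obtain ⟨q', hq'⟩ := hq
    split_ifs with h
    · rw [Finset.sum_eq_single (p', q')]
      · rw [Ser.ofTotal, Ser.ofTotal, if_pos (by omega), if_pos (by omega)]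
      · rintro ⟨i, l⟩ hi hne
        have := Finset.HasAntidiagonal.mem_antidiagonal.1 hi
        simp only at this
        have hi' : ¬ p + δ = 2 * i := fun hpi => hne (by
          simp only [Prod.mk.injEq]
          omega)
        rw [Ser.ofTotal, if_neg hi', wedge_zero_left]
      · intro h'
        exact absurd (Finset.HasAntidiagonal.mem_antidiagonal.2 (by simp only; omega)) h'
    · refine Finset.sum_eq_zero ?_
      rintro ⟨i, l⟩ hi
      have := Finset.HasAntidiagonal.mem_antidiagonal.1 hi
      simp only at this
      by_cases hpi : p + δ = 2 * i
      · have hql : ¬ q + ε = 2 * l := by omega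
        simp only [Ser.ofTotal, if_neg hql, wedge_zero_right]
      · simp only [Ser.ofTotal, if_neg hpi, wedge_zero_left]
  rw [Finset.sum_congr rfl key]
  split_ifs
  · rfl
  · exact Finset.sum_const_zero

theorem Ser.one_eq_ofTotal : (Ser.one : Ser n R) = Ser.ofTotal 0 1 := by
  funext j k
  rcases j with _ | j <;> rcases k with _ | k
  · ext v
    simp [Ser.one, Ser.ofTotal, Om.one_apply_zero]
  · simp [Ser.one, Ser.ofTotal]
  · simp [Ser.one, Ser.ofTotal]
  · simp only [Ser.one, Ser.ofTotal]
    rw [Om.one_apply_of_ne (by omega), ite_self]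

theorem Ser.pow_ofTotal {a : Om n R} (ha : Om.par a = a) (m : ℕ) :
    Ser.pow (Ser.ofTotal 0 a) m = Ser.ofTotal 0 (a ^ m) := by
  have hp : ∀ m, Om.par (a ^ m) = a ^ m := fun m => by
    induction m with
    | zero => simp [Om.par_one]
    | succ m ih => rw [pow_succ, Om.par_mul, ih, ha]
  induction m with
  | zero => rw [pow_zero, ← Ser.one_eq_ofTotal]; rfl
  | succ m ih =>
    rw [show Ser.pow (Ser.ofTotal 0 a) (m + 1) = Ser.mul (Ser.pow (Ser.ofTotal 0 a) m)
      (Ser.ofTotal 0 a) from rfl, ih, Ser.mul_ofTotal (by simpa using hp m) (by simpa using ha), pow_succ]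

theorem Ser.exp_ofTotal [CompleteSpace R] {a : Om n R} (ha : Om.par a = a) :
    Ser.exp (Ser.ofTotal 0 a) = Ser.ofTotal 0 (NormedSpace.exp a) := by
  funext j k
  rw [Ser.exp]
  simp only [Ser.pow_ofTotal ha]
  have h := ((hasSum_exp (R := Om n R) a).mapL (Om.proj k)).tsum_eq
  simp only [Ser.ofTotal]
  split_ifs
  · rw [← Om.proj_apply k (NormedSpace.exp a), ← h]
    rfl
  · simp

end Series
end

noncomputable section

namespace Om

section Single

variable {n : ℕ} {F G : Type*} [NormedAddCommGroup F] [NormedSpace ℝ F] [NormedAddCommGroup G]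
  [NormedSpace ℝ G]

theorem map_single (g : F →L[ℝ] G) (k : ℕ) (a : Alt n F k) :
    map g (single k a) = single k (g.compContinuousAlternatingMap a) := by
  ext j : 1
  rw [map_apply]
  by_cases h : j = k
  · subst h
    rw [single_same, single_same]
  · rw [single_of_ne h, single_of_ne h]
    ext v
    simp

theorem comap_single {m : ℕ} (h : Eu m →L[ℝ] Eu n) (k : ℕ) (a : Alt n F k) :
    comap h (single k a) = single k (a.compContinuousLinearMap h) := by
  ext j : 1
  rw [comap_apply]
  by_cases h : j = k
  · subst h
    rw [single_same, single_same]
  · rw [single_of_ne h, single_of_ne h]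
    ext v
    simp

theorem ctr_single_zero (v : Eu n) (a : Alt n F 0) : ctr v (single 0 a) = 0 := by
  ext j : 1
  rw [ctr_apply, single_of_ne (by omega)]
  rfl

theorem ctr_single_succ (v : Eu n) (k : ℕ) (a : Alt n F (k + 1)) :
    ctr v (single (k + 1) a) = single k (a.curryLeft v) := by
  ext j : 1
  rw [ctr_apply]
  by_cases h : j = k
  · subst h
    rw [single_same, single_same]
  · rw [single_of_ne h, single_of_ne (by omega)]
    rfl

theorem d_single {k : ℕ} {f : Eu n → Alt n F k} {x : Eu n} (hf : DifferentiableAt ℝ f x) :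
    d (fun y => single k (f y)) x = single (k + 1) (extDeriv f x) := by
  have hs : DifferentiableAt ℝ (fun y => single k (f y)) x :=
    (single (F := F) k).differentiableAt.comp x hf
  ext j : 1
  rcases j with _ | j
  · rw [d_apply_zero, single_of_ne (by omega)]
  · rw [d_apply_succ hs]
    by_cases h : j = k
    · subst h
      simp only [single_same]
    · rw [single_of_ne (by omega)]
      simp only [single_of_ne h]
      rw [extDeriv, fderiv_fun_const]
      exact map_zero (ContinuousAlternatingMap.alternatizeUncurryFinCLM ℝ (Eu n) F)

variable {R : Type*} [NormedRing R] [NormedAlgebra ℝ R]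

theorem single_mul_apply {p q k : ℕ} (h : p + q = k) (a : Alt n R p) (w : Om n R) :
    (single p a * w) k = wedge h a (w q) := by
  rw [mul_apply, Finset.sum_eq_single (p, q)]
  · rw [wdg_of_eq _ _ h, single_same]
  · rintro ⟨i, j⟩ hij hne
    have := Finset.HasAntidiagonal.mem_antidiagonal.1 hij
    simp only at this
    rw [wdg_of_eq _ _ this, single_of_ne, wedge_zero_left]
    rintro rfl
    exact hne (by simp only [Prod.mk.injEq, true_and]; omega)
  · intro h'
    exact absurd (Finset.HasAntidiagonal.mem_antidiagonal.2 h) h'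

theorem single_mul_apply_of_lt {p k : ℕ} (h : k < p) (a : Alt n R p) (w : Om n R) :
    (single p a * w) k = 0 := by
  rw [mul_apply]
  refine Finset.sum_eq_zero ?_
  rintro ⟨i, j⟩ hij
  have := Finset.HasAntidiagonal.mem_antidiagonal.1 hij
  simp only at this
  rw [wdg_of_eq _ _ this, single_of_ne (by omega), wedge_zero_left]

theorem single_mul_single {p q : ℕ} (a : Alt n R p) (b : Alt n R q) :
    single p a * single q b = single (p + q) (wedge rfl a b) := by
  ext k : 1
  by_cases hk : p ≤ k
  · obtain ⟨j, rfl⟩ := Nat.exists_eq_add_of_le hk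
    rw [single_mul_apply rfl]
    by_cases h : j = q
    · subst h
      rw [single_same, single_same]
    · rw [single_of_ne h, single_of_ne (by omega), wedge_zero_right]
  · rw [single_mul_apply_of_lt (by omega), single_of_ne (by omega)]

/-- The constant function `c`, as a form. -/
def scal (n : ℕ) (c : F) : Om n F :=
  single 0 (ContinuousAlternatingMap.constOfIsEmpty ℝ (Eu n) (Fin 0) c)

theorem par_scal (c : F) : par (scal n c) = scal n c := by
  rw [scal, par_single, pow_zero, one_smul]

theorem map_scal (g : F →L[ℝ] G) (c : F) : map g (scal n c) = scal n (g c) := by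
  rw [scal, map_single]
  rfl

theorem comap_scal {m : ℕ} (h : Eu m →L[ℝ] Eu n) (c : F) : comap h (scal n c) = scal m c := by
  rw [scal, comap_single]
  rfl

theorem ctr_scal (v : Eu n) (c : F) : ctr v (scal n c) = 0 := ctr_single_zero v _

theorem scal_one : scal n (1 : R) = 1 := rfl

theorem map_mul_left (c : R) (w : Om n R) :
    map (ContinuousLinearMap.mul ℝ R c) w = scal n c * w := by
  have h := map_mul_map (n := n) (ContinuousLinearMap.id ℝ R) (ContinuousLinearMap.id ℝ R)
    (ContinuousLinearMap.mul ℝ R c) (ContinuousLinearMap.mul ℝ R c) (ContinuousLinearMap.id ℝ R)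
    (fun x y => by simp [mul_assoc]) 1 w
  rw [map_id, map_id, one_mul, ← scal_one, map_scal] at h
  simpa using h

theorem map_mul_right (c : R) (w : Om n R) :
    map ((ContinuousLinearMap.mul ℝ R).flip c) w = w * scal n c := by
  have h := map_mul_map (n := n) (ContinuousLinearMap.id ℝ R) (ContinuousLinearMap.id ℝ R)
    ((ContinuousLinearMap.mul ℝ R).flip c) (ContinuousLinearMap.id ℝ R)
    ((ContinuousLinearMap.mul ℝ R).flip c) (fun x y => by simp [mul_assoc]) w 1
  rw [map_id, map_id, mul_one, ← scal_one, map_scal] at h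
  simpa using h

theorem scal_mul_scal (a b : R) : scal n a * scal n b = scal n (a * b) := by
  rw [← map_mul_left, map_scal]
  rfl

theorem scal_mul_apply {K : Type*} [NormedField K] [NormedAlgebra ℝ K] (c : K) (w : Om n K) (k : ℕ) : (scal n c * w) k = c • w k := by
  rw [← map_mul_left, map_apply]
  rfl

theorem scal_mul_apply_apply (c : R) (w : Om n R) (k : ℕ) (v : Fin k → Eu n) :
    (scal n c * w) k v = c * w k v := by
  rw [← map_mul_left, map_apply]
  rfl

theorem contDiff_scal {V : Type*} [NormedAddCommGroup V] [NormedSpace ℝ V] {N : WithTop ℕ∞}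
    {f : V → F} (hf : ContDiff ℝ N f) : ContDiff ℝ N fun y => scal n (f y) :=
  (single (F := F) (n := n) 0).contDiff.comp
    ((ContinuousAlternatingMap.constOfIsEmptyLIE ℝ (Eu n) F (Fin 0)).contDiff.comp hf)

theorem d_scal {f : Eu n → F} {x : Eu n} (hf : DifferentiableAt ℝ f x) :
    d (fun y => scal n (f y)) x
      = single 1 (ContinuousAlternatingMap.ofSubsingleton ℝ (Eu n) F 0 (fderiv ℝ f x)) := by
  have h : DifferentiableAt ℝ
      (fun y => ContinuousAlternatingMap.constOfIsEmpty ℝ (Eu n) (Fin 0) (f y)) x :=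
    (ContinuousAlternatingMap.constOfIsEmptyLIE ℝ (Eu n) F
      (Fin 0)).toContinuousLinearEquiv.differentiableAt.comp x hf
  simp only [scal]
  rw [d_single h, extDeriv_constOfIsEmpty]

variable {K : Type*} [NormedField K] [NormedAlgebra ℝ K]

theorem mul_comm_of_even {a : Om n K} (ha : par a = a) (b : Om n K) : a * b = b * a := by
  have := trace_mul_comm_of_even (τ := ContinuousLinearMap.id ℝ K) (fun x y => mul_comm x y) ha b
  rwa [map_id, map_id] at this

theorem expDeriv_of_even [CompleteSpace K] {a : Om n K} (ha : par a = a) (b : Om n K) :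
    expDeriv a b = b * NormedSpace.exp a := by
  have := trace_expDeriv (R := Om n K) (S := a) (ContinuousLinearMap.id ℝ (Om n K))
    (fun b => mul_comm_of_even ha b) b
  simpa using this

end Single

section Factor

variable {n : ℕ} {K : Type*} [NontriviallyNormedField K] [NormedAlgebra ℝ K] [CompleteSpace K]

/-- The form `c⁻¹ e^{-b}`. -/
def chernFactor (c : K) (b : Alt n K 2) : Om n K := scal n c⁻¹ * NormedSpace.exp (single 2 (-b))

theorem par_single_two (b : Alt n K 2) : par (single 2 b) = single 2 b := by
  rw [par_single]
  simp

theorem par_chernFactor (c : K) (b : Alt n K 2) : par (chernFactor c b) = chernFactor c b := by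
  rw [chernFactor, par_mul, par_scal, par_exp (par_single_two _)]

theorem comap_exp {m : ℕ} {R : Type*} [NormedRing R] [NormedAlgebra ℝ R] [CompleteSpace R]
    (h : Eu m →L[ℝ] Eu n) (w : Om n R) :
    comap h (NormedSpace.exp w) = NormedSpace.exp (comap h w) :=
  map_exp_real (R := Om n R) (R' := Om m R) (comap h) (comap_one h) (comap_mul h) w

theorem comap_chernFactor {m : ℕ} (h : Eu m →L[ℝ] Eu n) (c : K) (b : Alt n K 2) :
    comap h (chernFactor c b) = chernFactor c (b.compContinuousLinearMap h) := by
  rw [chernFactor, comap_mul, comap_scal, comap_exp, comap_single]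
  rfl

theorem contDiff_chernFactor {c : Eu n → K} {b : Eu n → Alt n K 2} (hc : ContDiff ℝ ∞ c)
    (h0 : ∀ x, c x ≠ 0) (hb : ContDiff ℝ ∞ b) : ContDiff ℝ ∞ fun x => chernFactor (c x) (b x) :=
  (contDiff_scal (hc.inv h0)).mul ((contDiff_exp_algebra (R := Om n K)).comp
    ((single (F := K) 2).contDiff.comp hb.neg))

theorem d_chernFactor {c : Eu n → K} {b : Eu n → Alt n K 2} (hc : ContDiff ℝ ∞ c)
    (h0 : ∀ x, c x ≠ 0) (hb : ContDiff ℝ ∞ b) (y x : Eu n) {θ : Alt n K 1}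
    (hθ : θ = ContinuousAlternatingMap.ofSubsingleton ℝ (Eu n) K 0 ((c x)⁻¹ • fderiv ℝ c x)
      - (b x).curryLeft y) :
    d (fun z => chernFactor (c z) (b z)) x - ctr y (chernFactor (c x) (b x))
      = -((single 1 θ + single 3 (extDeriv b x)) * chernFactor (c x) (b x)) := by
  have hbx : DifferentiableAt ℝ b x := hb.contDiffAt.differentiableAt (by simp)
  have hcx : DifferentiableAt ℝ c x := hc.contDiffAt.differentiableAt (by simp)
  have hsb : DifferentiableAt ℝ (fun z => single 2 (-b z)) x :=
    (single (F := K) (n := n) 2).differentiableAt.comp x hbx.neg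
  have he := par_single_two (-b x)
  have hex : DifferentiableAt ℝ (fun z => NormedSpace.exp (single 2 (-b z) : Om n K)) x :=
    ((contDiff_exp_algebra (R := Om n K)).comp
    ((single (F := K) 2).contDiff.comp hb.neg)).contDiffAt.differentiableAt (by simp)
  have hci : DifferentiableAt ℝ (fun z => scal n (c z)⁻¹) x :=
    (contDiff_scal (hc.inv h0)).contDiffAt.differentiableAt (by simp)
  have h1 : fderiv ℝ (fun z => (c z)⁻¹) x = -((c x)⁻¹ • ((c x)⁻¹ • fderiv ℝ c x)) := by
    have := (hasDerivAt_inv (h0 x)).hasFDerivAt.restrictScalars ℝ |>.comp x hcx.hasFDerivAt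
    refine this.fderiv.trans ?_
    ext v
    simp
    ring
  have h2 : d (fun z => scal n (c z)⁻¹) x = -(single 1 (ContinuousAlternatingMap.ofSubsingleton ℝ
      (Eu n) K 0 ((c x)⁻¹ • fderiv ℝ c x)) * scal n (c x)⁻¹) := by
    rw [d_scal (f := fun z => (c z)⁻¹) (hcx.inv (h0 x)), h1, ← mul_comm_of_even (par_scal _), ← map_mul_left, map_single,
      ← map_neg]
    congr 1
  have h3 : d (fun z => single 2 (-b z)) x = -single 3 (extDeriv b x) := by
    have : (fun z => (single 2 (-b z) : Om n K)) = fun z => -single 2 (b z) := by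
      funext z
      rw [map_neg]
    rw [this, d_neg, d_single hbx]
  have h4 : ctr y (single 2 (-b x)) = -single 1 ((b x).curryLeft y) := by
    rw [ctr_single_succ, ← map_neg]
    rfl
  have h5 : d (fun z => chernFactor (c z) (b z)) x
      = d (fun z => scal n (c z)⁻¹) x * NormedSpace.exp (single 2 (-b x))
        + scal n (c x)⁻¹ * d (fun z => NormedSpace.exp (single 2 (-b z) : Om n K)) x := by
    have := d_mul hci hex
    rwa [par_scal] at this
  rw [h5, chernFactor, ctr_mul, ctr_scal, par_scal, zero_mul, zero_add, d_exp hsb he, ctr_exp he,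
    expDeriv_of_even he, expDeriv_of_even he, h2, h3, h4, hθ, map_sub]
  have hcomm := mul_comm_of_even (par_scal (n := n) (c x)⁻¹)
  have hA : ∀ A : Om n K, scal n (c x)⁻¹ * (A * NormedSpace.exp (single 2 (-b x)))
      = A * (scal n (c x)⁻¹ * NormedSpace.exp (single 2 (-b x))) := fun A => by
    rw [← mul_assoc, hcomm A, mul_assoc]
  rw [hA, hA]
  simp only [neg_mul, sub_mul, add_mul, mul_assoc]
  abel

/-- The twisted derivative of a form times the factor `c⁻¹ e^{-b}`. -/
theorem twisted_d_chernFactor_mul {c : Eu n → K} {b : Eu n → Alt n K 2} (hc : ContDiff ℝ ∞ c)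
    (h0 : ∀ x, c x ≠ 0) (hb : ContDiff ℝ ∞ b) (y x : Eu n) {θ : Alt n K 1}
    (hθ : θ = ContinuousAlternatingMap.ofSubsingleton ℝ (Eu n) K 0 ((c x)⁻¹ • fderiv ℝ c x)
      - (b x).curryLeft y) {w : Eu n → Om n K} (hw : DifferentiableAt ℝ w x) :
    d (fun z => chernFactor (c z) (b z) * w z) x - ctr y (chernFactor (c x) (b x) * w x)
      + (single 1 θ + single 3 (extDeriv b x)) * (chernFactor (c x) (b x) * w x)
      = chernFactor (c x) (b x) * (d w x - ctr y (w x)) := by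
  have h := d_chernFactor hc h0 hb y x hθ
  rw [d_mul ((contDiff_chernFactor hc h0 hb).contDiffAt.differentiableAt (by simp)) hw, ctr_mul,
    par_chernFactor]
  rw [sub_eq_iff_eq_add] at h
  rw [h]
  generalize single 1 θ + single 3 (extDeriv b x) = T, ctr y (chernFactor (c x) (b x)) = C,
    chernFactor (c x) (b x) = E, ctr y (w x) = q, w x = r, d w x = p
  noncomm_ring

end Factor
end Om
end

noncomputable section

section LocalForms

open Om

variable {Q H : Type u} [NormedAddCommGroup H] [InnerProductSpace ℂ H]
  [CompleteSpace H] {n : ℕ}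

/-- The inclusion of the one-forms with values in the trace class operators. -/
def connIncl (n : ℕ) (H : Type u) [NormedAddCommGroup H] [InnerProductSpace ℂ H]
    [CompleteSpace H] : Alt n (TraceClass H) 1 →L[ℝ] Om n (UnitalTraceClass H) :=
  (map (n := n) (UnitalTraceClass.inr (H := H))).comp (single (F := TraceClass H) (n := n) 1)

/-- The connection form with values in the unital algebra generated by the trace class operators. -/
def connForm (A : FormFamily Q (TraceClass H) 1) (q : Eu n → Q) (x : Eu n) :
    Om n (UnitalTraceClass H) :=
  connIncl n H (A n q x)

theorem connForm_eq (A : FormFamily Q (TraceClass H) 1) (q : Eu n → Q) (x : Eu n) :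
    connForm A q x = map UnitalTraceClass.inr (single 1 (A n q x)) := rfl

theorem par_connForm (A : FormFamily Q (TraceClass H) 1) (q : Eu n → Q) (x : Eu n) :
    par (connForm A q x) = -connForm A q x := by
  rw [connForm_eq, par_map, par_single, pow_one, neg_one_smul, map_neg]

theorem map_fst_map_inr (w : Om n (TraceClass H)) :
    map UnitalTraceClass.fst (map UnitalTraceClass.inr w) = 0 := by
  rw [map_map]
  ext k v
  simp

theorem differentiableAt_connForm {A : FormFamily Q (TraceClass H) 1} {q : Eu n → Q} {x : Eu n}
    (hA : DifferentiableAt ℝ (A n q) x) : DifferentiableAt ℝ (connForm A q) x :=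
  (connIncl n H).differentiableAt.comp x hA

theorem map_fst_connForm (A : FormFamily Q (TraceClass H) 1) (q : Eu n → Q) (x : Eu n) :
    map UnitalTraceClass.fst (connForm A q x) = 0 := map_fst_map_inr _

theorem map_fst_mul (a b : Om n (UnitalTraceClass H)) :
    map UnitalTraceClass.fst (a * b) = map UnitalTraceClass.fst a * map UnitalTraceClass.fst b :=
  map_mul _ UnitalTraceClass.fst_mul a b

theorem map_op_mul (a b : Om n (UnitalTraceClass H)) :
    map UnitalTraceClass.op (a * b) = map UnitalTraceClass.op a * map UnitalTraceClass.op b :=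
  map_mul _ UnitalTraceClass.op_mul a b

theorem map_op_exp (a : Om n (UnitalTraceClass H)) :
    map UnitalTraceClass.op (NormedSpace.exp a) = NormedSpace.exp (map UnitalTraceClass.op a) :=
  map_exp_real (R := Om n (UnitalTraceClass H)) (R' := Om n (H →L[ℂ] H)) _
    (map_one _ UnitalTraceClass.op_one) map_op_mul a

theorem map_fst_exp {a : Om n (UnitalTraceClass H)} (ha : map UnitalTraceClass.fst a = 0) :
    map UnitalTraceClass.fst (NormedSpace.exp a) = 1 := by
  have h := map_exp_real (R := Om n (UnitalTraceClass H)) (R' := Om n ℂ)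
    (map UnitalTraceClass.fst) (map_one _ UnitalTraceClass.fst_one) map_fst_mul a
  rw [ha] at h
  exact h.trans NormedSpace.exp_zero

/-- The trace of a form whose values lie in the trace class. -/
theorem traceAlt_map_op {w : Om n (UnitalTraceClass H)} (hw : map UnitalTraceClass.fst w = 0)
    (k : ℕ) : traceAlt (map UnitalTraceClass.op w k) = map (UnitalTraceClass.trace H) w k := by
  have h0 : ∀ v, UnitalTraceClass.fst (w k v) = 0 := fun v => by
    have := congrArg (fun a : Om n ℂ => a k v) hw
    simpa using this
  have h1 : ∀ v, map (UnitalTraceClass.trace H) w k v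
      = opTrace (map UnitalTraceClass.op w k v) := fun v => by
    rw [map_apply, map_apply]
    show UnitalTraceClass.trace H (w k v) = opTrace (UnitalTraceClass.op (w k v))
    rw [UnitalTraceClass.op_apply, h0, zero_smul, zero_add]
    rfl
  have hex : ∃ τ : Alt n ℂ k, ∀ v, τ v = opTrace (map UnitalTraceClass.op w k v) := ⟨_, h1⟩
  rw [traceAlt, dif_pos hex]
  ext v
  rw [hex.choose_spec, h1]

variable [MulAction (Circle × Circle) Q]

/-- The negative `-(F + μ_K)` of the equivariant curvature. -/
def curvForm (A : FormFamily Q (TraceClass H) 1) (q : Eu n → Q) (x : Eu n) :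
    Om n (UnitalTraceClass H) :=
  map UnitalTraceClass.inr (single 0 (contract flowT A n q x)) - d (connForm A q) x
    - connForm A q x * connForm A q x

theorem par_curvForm {A : FormFamily Q (TraceClass H) 1} {q : Eu n → Q} {x : Eu n}
    (hA : DifferentiableAt ℝ (A n q) x) : par (curvForm A q x) = curvForm A q x := by
  have hc : DifferentiableAt ℝ (connForm A q) x := differentiableAt_connForm hA
  have h1 : (fun y => par (connForm A q y)) = fun y => -connForm A q y :=
    funext fun y => par_connForm A q y
  rw [curvForm, map_sub, map_sub, par_map, par_single, pow_zero, one_smul, par_d hc, par_mul, h1,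
    d_neg, par_connForm, neg_neg, neg_mul_neg]

theorem map_fst_curvForm {A : FormFamily Q (TraceClass H) 1} {q : Eu n → Q} {x : Eu n}
    (hA : DifferentiableAt ℝ (A n q) x) : map UnitalTraceClass.fst (curvForm A q x) = 0 := by
  have hc : DifferentiableAt ℝ (connForm A q) x := differentiableAt_connForm hA
  have h1 : (fun y => map UnitalTraceClass.fst (connForm A q y)) = fun y => 0 :=
    funext fun y => map_fst_connForm A q y
  rw [curvForm, map_sub, map_sub, map_fst_map_inr, map_fst_mul, map_fst_connForm, ← d_map _ hc, h1,
    d_const, zero_sub, neg_zero, zero_sub]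
  exact neg_eq_zero.2 (zero_mul _)

theorem neg_eqCurvature {A : FormFamily Q (TraceClass H) 1} {q : Eu n → Q} {x : Eu n}
    (hA : DifferentiableAt ℝ (A n q) x) :
    -eqCurvature A q x = Ser.ofTotal 0 (map UnitalTraceClass.op (curvForm A q x)) := by
  have hc : DifferentiableAt ℝ (connForm A q) x := differentiableAt_connForm hA
  have hop : DifferentiableAt ℝ (opForm A n q) x :=
    (ContinuousLinearMap.compContinuousAlternatingMapCLM ℝ (Eu n) (TraceClass H) (H →L[ℂ] H)
      (ι := Fin 1) TraceClass.incl).differentiableAt.comp x hA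
  have h1 : ∀ y, map UnitalTraceClass.op (connForm A q y) = single 1 (opForm A n q y) := fun y => by
    rw [connForm_eq, map_map, map_single]
    congr 1
    ext v
    simp [opForm, UnitalTraceClass.op_apply]
    rfl
  have h2 : map UnitalTraceClass.op (map UnitalTraceClass.inr (single 0 (contract flowT A n q x)))
      = single 0 (contract flowT (opForm A) n q x) := by
    rw [map_map, map_single]
    congr 1
    ext v
    simp [opForm, UnitalTraceClass.op_apply, contract]
    rfl
  have h3 : map UnitalTraceClass.op (curvForm A q x) = single 0 (contract flowT (opForm A) n q x)
      + single 2 (-(extD (opForm A) n q x + wedge rfl (opForm A n q x) (opForm A n q x))) := by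
    rw [curvForm, map_sub, map_sub, h2, map_op_mul, h1, ← d_map _ hc]
    simp only [h1]
    rw [d_single hop, single_mul_single, map_neg, map_add]
    show _ - single 2 _ - single 2 _ = _
    rw [neg_add, ← add_assoc, sub_eq_add_neg, sub_eq_add_neg]
    rfl
  funext j k
  rw [h3, Ser.ofTotal, Om.add_apply]
  show -(eqCurvature A q x j k) = _
  by_cases h : j = 0 ∧ k = 0
  · obtain ⟨rfl, rfl⟩ := h
    rw [if_pos rfl, single_same, single_of_ne (by omega), add_zero, eqCurvature, neg_neg]
  by_cases h' : j = 1 ∧ k = 2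
  · obtain ⟨rfl, rfl⟩ := h'
    rw [if_pos rfl, single_same, single_of_ne (by omega), zero_add, eqCurvature]
  have h0 : eqCurvature A q x j k = 0 := by
    unfold eqCurvature
    split
    · simp at h
    · simp at h'
    · rfl
  rw [h0, neg_zero]
  split_ifs with hjk
  · rw [single_of_ne (by omega), single_of_ne (by omega), add_zero]
  · rfl

theorem exp_neg_eqCurvature {A : FormFamily Q (TraceClass H) 1} {q : Eu n → Q} {x : Eu n}
    (hA : DifferentiableAt ℝ (A n q) x) : Ser.exp (-eqCurvature A q x)
      = Ser.ofTotal 0 (map UnitalTraceClass.op (NormedSpace.exp (curvForm A q x))) := by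
  rw [neg_eqCurvature hA, Ser.exp_ofTotal (by rw [par_map, par_curvForm hA]), map_op_exp]

theorem Ser.ofTotal_sub {F : Type*} [NormedAddCommGroup F] [NormedSpace ℝ F] (δ : ℕ)
    (a b : Om n F) (j k : ℕ) :
    Ser.ofTotal δ a j k - Ser.ofTotal δ b j k = Ser.ofTotal δ (a - b) j k := by
  simp only [Ser.ofTotal]
  split_ifs
  · rfl
  · exact sub_zero 0

theorem traceAlt_ofTotal (δ : ℕ) {w : Om n (UnitalTraceClass H)}
    (hw : map UnitalTraceClass.fst w = 0) (j k : ℕ) :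
    traceAlt (Ser.ofTotal δ (map UnitalTraceClass.op w) j k)
      = Ser.ofTotal δ (map (UnitalTraceClass.trace H) w) j k := by
  simp only [Ser.ofTotal]
  split_ifs
  · exact traceAlt_map_op hw k
  · have h := traceAlt_map_op (n := n) (H := H) (w := 0)
      (ContinuousLinearMap.map_zero (map (n := n) (UnitalTraceClass.fst (H := H)))) k
    rw [ContinuousLinearMap.map_zero (map (n := n) (UnitalTraceClass.trace H)),
      ContinuousLinearMap.map_zero (map (n := n) (UnitalTraceClass.op (H := H)))] at h
    exact h

/-- The trace of the exponential of the curvature, minus the rank. -/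
def chernTrace (A : FormFamily Q (TraceClass H) 1) (q : Eu n → Q) (x : Eu n) : Om n ℂ :=
  map (UnitalTraceClass.trace H) (NormedSpace.exp (curvForm A q x))

theorem traceAlt_exp_sub_exp {Q' : Type u} [MulAction (Circle × Circle) Q']
    {A : FormFamily Q (TraceClass H) 1} {A' : FormFamily Q' (TraceClass H) 1} {q : Eu n → Q}
    {q' : Eu n → Q'} {x : Eu n} (hA : DifferentiableAt ℝ (A n q) x)
    (hA' : DifferentiableAt ℝ (A' n q') x) (j k : ℕ) :
    traceAlt (Ser.exp (-eqCurvature A q x) j k - Ser.exp (-eqCurvature A' q' x) j k)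
      = Ser.ofTotal 0 (chernTrace A q x - chernTrace A' q' x) j k := by
  rw [exp_neg_eqCurvature hA, exp_neg_eqCurvature hA', Ser.ofTotal_sub, ← map_sub,
    traceAlt_ofTotal, map_sub]
  · rfl
  · rw [map_sub, map_fst_exp (map_fst_curvForm hA), map_fst_exp (map_fst_curvForm hA'), sub_self]

/-- The integrand of the Chern–Simons form. -/
def transForm (A₀ A₁ : FormFamily Q (TraceClass H) 1) (t : ℝ) (q : Eu n → Q) (x : Eu n) :
    Om n (UnitalTraceClass H) :=
  -(connForm A₁ q x - connForm A₀ q x) * NormedSpace.exp (curvForm (interpolate A₀ A₁ t) q x)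

theorem map_fst_transForm (A₀ A₁ : FormFamily Q (TraceClass H) 1) (t : ℝ) (q : Eu n → Q)
    (x : Eu n) : map UnitalTraceClass.fst (transForm A₀ A₁ t q x) = 0 := by
  rw [transForm, map_fst_mul, map_neg, map_sub, map_fst_connForm, map_fst_connForm, sub_zero,
    neg_zero]
  exact zero_mul _

theorem differentiableAt_interpolate {A₀ A₁ : FormFamily Q (TraceClass H) 1} {q : Eu n → Q}
    {x : Eu n} (h₀ : DifferentiableAt ℝ (A₀ n q) x) (h₁ : DifferentiableAt ℝ (A₁ n q) x) (t : ℝ) :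
    DifferentiableAt ℝ (interpolate A₀ A₁ t n q) x :=
  (h₀.const_smul (1 - t)).add (h₁.const_smul t)

theorem transgression_eq {A₀ A₁ : FormFamily Q (TraceClass H) 1} {q : Eu n → Q}
    {x : Eu n} (h₀ : DifferentiableAt ℝ (A₀ n q) x) (h₁ : DifferentiableAt ℝ (A₁ n q) x) (t : ℝ) :
    transgression A₀ A₁ t q x = Ser.ofTotal 1 (map UnitalTraceClass.op (transForm A₀ A₁ t q x)) := by
  have hd : (fun j k => match j, k with
      | 1, 1 => -opForm (A₁ - A₀) n q x
      | _, _ => 0 : Ser n (H →L[ℂ] H))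
      = Ser.ofTotal 1 (map UnitalTraceClass.op (-(connForm A₁ q x - connForm A₀ q x))) := by
    have h1 : map UnitalTraceClass.op (-(connForm A₁ q x - connForm A₀ q x))
        = single 1 (-opForm (A₁ - A₀) n q x) := by
      rw [connForm_eq, connForm_eq, ← map_sub, ← map_neg, ← map_sub, ← map_neg, map_map, map_single]
      congr 1
      ext v
      simp [opForm, UnitalTraceClass.op_apply]
      rfl
    funext j k
    rw [h1, Ser.ofTotal]
    split
    · rw [if_pos rfl, single_same]
    · rename_i h
      split_ifs with hjk
      · rw [single_of_ne]
        rintro rfl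
        exact h (by omega) rfl
      · rfl
  have hp : par (connForm A₁ q x - connForm A₀ q x) = -(connForm A₁ q x - connForm A₀ q x) := by
    rw [map_sub, par_connForm, par_connForm, neg_sub_neg, neg_sub]
  have hA := differentiableAt_interpolate h₀ h₁ t
  have h2 : transgression A₀ A₁ t q x = Ser.mul (fun j k => match j, k with
      | 1, 1 => -opForm (A₁ - A₀) n q x
      | _, _ => 0) (Ser.exp (-eqCurvature (interpolate A₀ A₁ t) q x)) := rfl
  rw [h2, hd, exp_neg_eqCurvature hA, Ser.mul_ofTotal, transForm, map_op_mul]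
  · rw [par_map, map_neg par, hp, pow_one, neg_one_smul, ← map_neg]
  · rw [par_map, par_exp (par_curvForm hA), pow_zero, one_smul]

end LocalForms

section GerbeForms

open Om

variable {M : Type u} [DiffeologicalSpace M] [MulAction Circle M] {ι : Type u}
  {𝒰 : GoodCover M ι} {L : HermitianLineBundle 𝒰} {𝒢 : WeakInvariantGerbe 𝒰} {H : Type u}
  [NormedAddCommGroup H] [InnerProductSpace ℂ H] [CompleteSpace H] {n : ℕ}

/-- The form `e^{-π^*B_α - 2πiθ_α}`. -/
def expFactor (𝒢 : WeakInvariantGerbe 𝒰) (α : ι) (p : Eu n → CircleBundle L) (x : Eu n) :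
    Om n ℂ := chernFactor ((p x).coordAt α : ℂ) (𝒢.B α n (proj p) x)

theorem scalarFactor_eq (α : ι) (p : Eu n → CircleBundle L) (x : Eu n) :
    scalarFactor 𝒢 α p x = Ser.ofTotal 0 (expFactor 𝒢 α p x) := by
  have h1 : (fun j k => match j, k with
      | 1, 2 => -𝒢.B α n (proj p) x
      | _, _ => 0 : Ser n ℂ) = Ser.ofTotal 0 (single 2 (-𝒢.B α n (proj p) x)) := by
    funext j k
    rw [Ser.ofTotal]
    split
    · rw [if_pos rfl, single_same]
    · rename_i h
      split_ifs with hjk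
      · rw [single_of_ne]
        rintro rfl
        exact h (by omega) rfl
      · rfl
  have h2 : scalarFactor 𝒢 α p x = ((p x).coordAt α : ℂ)⁻¹ • Ser.exp (fun j k => match j, k with
      | 1, 2 => -𝒢.B α n (proj p) x
      | _, _ => 0 : Ser n ℂ) := rfl
  rw [h2, h1, Ser.exp_ofTotal (par_single_two _)]
  funext j k
  show ((p x).coordAt α : ℂ)⁻¹ • Ser.ofTotal 0 _ j k = _
  simp only [Ser.ofTotal]
  split_ifs
  · exact (scal_mul_apply _ _ k).symm
  · exact smul_zero _

theorem par_expFactor (α : ι) (p : Eu n → CircleBundle L) (x : Eu n) :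
    par (expFactor 𝒢 α p x) = expFactor 𝒢 α p x := par_chernFactor _ _

theorem par_chernTrace {Q : Type u} [MulAction (Circle × Circle) Q]
    {A : FormFamily Q (TraceClass H) 1} {q : Eu n → Q} {x : Eu n}
    (hA : DifferentiableAt ℝ (A n q) x) : par (chernTrace A q x) = chernTrace A q x := by
  rw [chernTrace, par_map, par_exp (par_curvForm hA)]

theorem chLocal_eq {E E' : GerbeModule L 𝒢 H} (a : HorizontalConnection E)
    (a' : HorizontalConnection E') (α : ι) {q : Eu n → (E.E α).Q} {q' : Eu n → (E'.E α).Q}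
    {x : Eu n} (hA : DifferentiableAt ℝ (a.A α n q) x) (hA' : DifferentiableAt ℝ (a'.A α n q') x) :
    chLocal a a' α q q' x = Ser.ofTotal 0 (expFactor 𝒢 α (fun y => (E.E α).pr (q y)) x
      * (chernTrace (a.A α) q x - chernTrace (a'.A α) q' x)) := by
  have h : (fun j k => traceAlt (Ser.exp (-eqCurvature (a.A α) q x) j k
      - Ser.exp (-eqCurvature (a'.A α) q' x) j k))
      = Ser.ofTotal 0 (chernTrace (a.A α) q x - chernTrace (a'.A α) q' x) := by
    funext j k
    exact traceAlt_exp_sub_exp hA hA' j k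
  rw [chLocal, h, scalarFactor_eq, Ser.mul_ofTotal]
  · rw [pow_zero, one_smul]
    exact par_expFactor α _ x
  · rw [map_sub, par_chernTrace hA, par_chernTrace hA', pow_zero, one_smul]

theorem neg_sub_neg_eq_neg_sub {R : Type*} [AddCommGroup R] (a b : R) :
    -a - -b = -(a - b) := by abel

theorem par_integral {F : Type*} [NormedAddCommGroup F] [NormedSpace ℝ F] [CompleteSpace F]
    {f : ℝ → Om n F} (hc : Continuous f) (hf : ∀ t, par (f t) = -f t) :
    par (∫ t in (0 : ℝ)..1, f t) = -∫ t in (0 : ℝ)..1, f t := by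
  rw [← (par : Om n F →L[ℝ] Om n F).intervalIntegral_comp_comm (hc.intervalIntegrable 0 1)]
  simp only [hf, intervalIntegral.integral_neg]

/-- The integral of the trace of the transgression form. -/
def csTrace {Q : Type u} [MulAction (Circle × Circle) Q]
    (A₀ A₁ : FormFamily Q (TraceClass H) 1) (q : Eu n → Q) (x : Eu n) : Om n ℂ :=
  ∫ t in (0 : ℝ)..1, map (UnitalTraceClass.trace H) (transForm A₀ A₁ t q x)

theorem neg_neg_sub_neg_mul {R : Type*} [Ring R] (a b e : R) :
    -(-a - -b) * e = -(-(a - b) * e) := by noncomm_ring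

theorem par_csTrace {Q : Type u} [MulAction (Circle × Circle) Q]
    {A₀ A₁ : FormFamily Q (TraceClass H) 1} {q : Eu n → Q}
    {x : Eu n} (h₀ : DifferentiableAt ℝ (A₀ n q) x) (h₁ : DifferentiableAt ℝ (A₁ n q) x)
    (hc : Continuous fun t => transForm A₀ A₁ t q x) :
    par (csTrace A₀ A₁ q x) = -csTrace A₀ A₁ q x := by
  refine par_integral ((map _).continuous.comp hc) fun t => ?_
  rw [par_map, ← map_neg, transForm, par_mul,
    par_exp (par_curvForm (differentiableAt_interpolate h₀ h₁ t)), map_neg par, map_sub,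
    par_connForm, par_connForm]
  exact congrArg _ (neg_neg_sub_neg_mul _ _ _)

theorem Ser.integral_ofTotal_sub {F : Type*} [NormedAddCommGroup F] [NormedSpace ℝ F]
    [CompleteSpace F] {f g : ℝ → Om n F} (hf : Continuous f) (hg : Continuous g) (δ j k : ℕ) :
    ∫ t in (0 : ℝ)..1, Ser.ofTotal δ (f t - g t) j k
      = Ser.ofTotal δ ((∫ t in (0 : ℝ)..1, f t) - ∫ t in (0 : ℝ)..1, g t) j k := by
  have hfi : IntervalIntegrable f MeasureTheory.volume 0 1 := hf.intervalIntegrable 0 1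
  have hgi : IntervalIntegrable g MeasureTheory.volume 0 1 := hg.intervalIntegrable 0 1
  have h : (∫ t in (0 : ℝ)..1, f t) - ∫ t in (0 : ℝ)..1, g t = ∫ t in (0 : ℝ)..1, (f t - g t) :=
    (intervalIntegral.integral_sub hfi hgi).symm
  rw [h]
  simp only [Ser.ofTotal]
  split_ifs
  · exact (Om.proj k).intervalIntegral_comp_comm (hfi.sub hgi)
  · exact intervalIntegral.integral_zero

theorem csLocal_eq {E E' : GerbeModule L 𝒢 H} (a₀ a₁ : HorizontalConnection E)
    (a₀' a₁' : HorizontalConnection E') (α : ι) {q : Eu n → (E.E α).Q} {q' : Eu n → (E'.E α).Q}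
    {x : Eu n} (h₀ : DifferentiableAt ℝ (a₀.A α n q) x) (h₁ : DifferentiableAt ℝ (a₁.A α n q) x)
    (h₀' : DifferentiableAt ℝ (a₀'.A α n q') x) (h₁' : DifferentiableAt ℝ (a₁'.A α n q') x)
    (hc : Continuous fun t => transForm (a₀.A α) (a₁.A α) t q x)
    (hc' : Continuous fun t => transForm (a₀'.A α) (a₁'.A α) t q' x) :
    csLocal a₀ a₁ a₀' a₁' α q q' x = Ser.ofTotal 1 (expFactor 𝒢 α (fun y => (E.E α).pr (q y)) x
      * (csTrace (a₀.A α) (a₁.A α) q x - csTrace (a₀'.A α) (a₁'.A α) q' x)) := by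
  have h : (fun j k => ∫ t in (0 : ℝ)..1, traceAlt (transgression (a₀.A α) (a₁.A α) t q x j k
      - transgression (a₀'.A α) (a₁'.A α) t q' x j k))
      = Ser.ofTotal 1 (csTrace (a₀.A α) (a₁.A α) q x - csTrace (a₀'.A α) (a₁'.A α) q' x) := by
    funext j k
    have h1 : ∀ t, traceAlt (transgression (a₀.A α) (a₁.A α) t q x j k
        - transgression (a₀'.A α) (a₁'.A α) t q' x j k)
        = Ser.ofTotal 1 (map (UnitalTraceClass.trace H) (transForm (a₀.A α) (a₁.A α) t q x)
          - map (UnitalTraceClass.trace H) (transForm (a₀'.A α) (a₁'.A α) t q' x)) j k := fun t => by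
      rw [transgression_eq h₀ h₁, transgression_eq h₀' h₁', Ser.ofTotal_sub, ← map_sub,
        traceAlt_ofTotal, map_sub]
      rw [map_sub, map_fst_transForm, map_fst_transForm, sub_zero]
    simp only [h1]
    have c1 : Continuous fun t => map (UnitalTraceClass.trace H)
      (transForm (a₀.A α) (a₁.A α) t q x) := (map _).continuous.comp hc
    have c2 : Continuous fun t => map (UnitalTraceClass.trace H)
      (transForm (a₀'.A α) (a₁'.A α) t q' x) := (map _).continuous.comp hc'
    exact Ser.integral_ofTotal_sub c1 c2 1 j k
  rw [csLocal, h, scalarFactor_eq, Ser.mul_ofTotal, zero_add]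
  · rw [pow_zero, one_smul]
    exact par_expFactor α _ x
  · rw [map_sub, par_csTrace h₀ h₁ hc, par_csTrace h₀' h₁' hc', pow_one, neg_one_smul]
    exact neg_sub_neg_eq_neg_sub _ _

end GerbeForms
end

noncomputable section

section Flows

variable {X F : Type*} [NormedAddCommGroup F] [NormedSpace ℝ F] {n m k : ℕ}

/-- A smooth map `ℝⁿ → ℝⁿ` with values in a given neighbourhood of `x`, equal to the identity
near `x`. -/
theorem exists_cutoff (x : Eu n) {U : Set (Eu n)} (hU : U ∈ 𝓝 x) :
    ∃ h : Eu n → Eu n, ContDiff ℝ ∞ h ∧ (∀ᶠ y in 𝓝 x, h y = y) ∧ ∀ y, h y ∈ U := by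
  obtain ⟨ε, hε, hεU⟩ := Metric.mem_nhds_iff.1 hU
  let ρ : ContDiffBump x := ⟨ε / 4, ε / 2, by positivity, by linarith⟩
  refine ⟨fun y => x + ρ y • (y - x), ?_, ?_, fun y => hεU ?_⟩
  · exact contDiff_const.add (ρ.contDiff.smul (contDiff_id.sub contDiff_const))
  · filter_upwards [ρ.eventuallyEq_one] with y hy
    rw [hy]
    simp
  · rw [mem_ball_iff_norm, add_sub_cancel_left, norm_smul, Real.norm_of_nonneg ρ.nonneg]
    by_cases hy : dist y x < ε / 2
    · rw [dist_eq_norm] at hy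
      calc ρ y * ‖y - x‖ ≤ 1 * ‖y - x‖ := mul_le_mul_of_nonneg_right ρ.le_one (norm_nonneg _)
        _ < ε := by linarith
    · rw [ρ.zero_of_le_dist (not_lt.1 hy), zero_mul]
      exact hε

variable [DiffeologicalSpace X] {W : Set X} {w : FormFamily X F k}

/-- The value of a form depends only on the germ of the plot. -/
theorem IsFormOn.congr_germ (hw : IsFormOn W w) {p p' : Eu n → X} (hp : IsPlot p)
    (hp' : IsPlot p') {x : Eu n} (hx : p x ∈ W) (h : ∀ᶠ y in 𝓝 x, p y = p' y) :
    w n p x = w n p' x := by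
  obtain ⟨c, hc, hcx, hcU⟩ := exists_cutoff x h
  have hx0 : c x = x := hcx.self_of_nhds
  have h1 : fderiv ℝ c x = ContinuousLinearMap.id ℝ (Eu n) := by
    have : c =ᶠ[𝓝 x] id := hcx
    rw [this.fderiv_eq, fderiv_id]
  have h2 : p ∘ c = p' ∘ c := funext fun y => hcU y
  have e1 := hw.2 n n p c hp hc x (by rwa [hx0])
  have e2 := hw.2 n n p' c hp' hc x (by rw [hx0, ← h.self_of_nhds]; exact hx)
  rw [h1, hx0] at e1 e2
  rw [h2, e2] at e1
  ext v
  exact (congrArg (fun a : Alt n F k => a v) e1).symm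

/-- The projection `(t, x) ↦ x` of `ℝ × ℝⁿ = ℝⁿ⁺¹` onto `ℝⁿ`. -/
def tailL (n : ℕ) : Eu (n + 1) →L[ℝ] Eu n :=
  LinearMap.toContinuousLinearMap
    { toFun := fun z => WithLp.toLp 2 fun i => z i.succ
      map_add' := fun _ _ => rfl
      map_smul' := fun _ _ => rfl }

/-- The generator `∂/∂t` of `ℝ × ℝⁿ = ℝⁿ⁺¹`. -/
def timeVec (n : ℕ) : Eu (n + 1) := EuclideanSpace.single 0 1

@[simp] theorem tailL_apply (z : Eu (n + 1)) (i : Fin n) : tailL n z i = z i.succ := rfl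

@[simp] theorem zeroSlice_zero (x : Eu n) : zeroSlice n x 0 = 0 := rfl

@[simp] theorem zeroSlice_succ (x : Eu n) (i : Fin n) : zeroSlice n x i.succ = x i := rfl

@[simp] theorem tailL_zeroSlice (x : Eu n) : tailL n (zeroSlice n x) = x := rfl

@[simp] theorem timeVec_zero : timeVec n 0 = 1 := by simp [timeVec]

@[simp] theorem timeVec_succ (i : Fin n) : timeVec n i.succ = 0 := by simp [timeVec]

@[simp] theorem tailL_timeVec : tailL n (timeVec n) = 0 := by
  ext i
  simp

/-- The function `z ↦ z₀`, as a linear functional. -/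
def timeL (n : ℕ) : Eu (n + 1) →L[ℝ] ℝ := EuclideanSpace.proj 0

@[simp] theorem timeL_apply (z : Eu (n + 1)) : timeL n z = z 0 := rfl

theorem flowOut_apply (fl : ℝ → X → X) (p : Eu n → X) (z : Eu (n + 1)) :
    flowOut fl p z = fl (z 0) (p (tailL n z)) := rfl

/-- Smooth flows. -/
structure SmoothFlow (fl : ℝ → X → X) : Prop where
  plot : ∀ {n : ℕ} {p : Eu n → X}, IsPlot p → IsPlot (flowOut fl p)
  zero : ∀ x, fl 0 x = x
  add : ∀ s t x, fl (s + t) x = fl s (fl t x)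

theorem contract_eq (fl : ℝ → X → X) (w : FormFamily X F (k + 1)) (p : Eu n → X) (x : Eu n) :
    contract fl w n p x = ((w (n + 1) (flowOut fl p) (zeroSlice n x)).curryLeft
      (timeVec n)).compContinuousLinearMap (zeroSlice n) := rfl

theorem curryLeft_comp {h : Eu m →L[ℝ] Eu n} (a : Alt n F (k + 1)) (v : Eu m) :
    (a.compContinuousLinearMap h).curryLeft v = (a.curryLeft (h v)).compContinuousLinearMap h := by
  ext u
  show a _ = a _
  congr 1
  funext i
  refine Fin.cases rfl (fun i => rfl) i

namespace SmoothFlow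

variable {fl : ℝ → X → X}

theorem flowOut_zeroSlice (hfl : SmoothFlow fl) (p : Eu n → X) (x : Eu n) : flowOut fl p (zeroSlice n x) = p x := by
  rw [flowOut_apply, zeroSlice_zero, hfl.zero, tailL_zeroSlice]

theorem flowOut_add (hfl : SmoothFlow fl) (p : Eu n → X) (s : ℝ) (z : Eu (n + 1)) :
    flowOut fl p (z + s • timeVec n) = fl s (flowOut fl p z) := by
  rw [flowOut_apply, flowOut_apply, ← hfl.add, map_add, map_smul, tailL_timeVec, smul_zero,
    add_zero, add_comm s]
  simp

theorem form_zeroSlice (hfl : SmoothFlow fl) (hw : IsFormOn W w) {p : Eu n → X} (hp : IsPlot p) {x : Eu n}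
    (hx : p x ∈ W) : w n p x = (w (n + 1) (flowOut fl p) (zeroSlice n x)).compContinuousLinearMap
      (zeroSlice n) := by
  have h := hw.2 (n + 1) n (flowOut fl p) (zeroSlice n) (hfl.plot hp) (zeroSlice n).contDiff x
    (by rwa [hfl.flowOut_zeroSlice])
  rw [(zeroSlice n).fderiv] at h
  rw [← h]
  congr 1
  funext y
  exact (hfl.flowOut_zeroSlice p y).symm


theorem contract_comp (hfl : SmoothFlow fl) {w : FormFamily X F (k + 1)} (hw : IsFormOn W w) {p : Eu n → X}
    (hp : IsPlot p) {h : Eu m → Eu n} (hh : ContDiff ℝ ∞ h) {y : Eu m} (hy : p (h y) ∈ W) :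
    contract fl w m (p ∘ h) y
      = (contract fl w n p (h y)).compContinuousLinearMap (fderiv ℝ h y) := by
  let H : Eu (m + 1) → Eu (n + 1) := fun z => timeL m z • timeVec n + zeroSlice n (h (tailL m z))
  have hH : ContDiff ℝ ∞ H := ((timeL m).contDiff.smul contDiff_const).add
    ((zeroSlice n).contDiff.comp (hh.comp (tailL m).contDiff))
  have h1 : flowOut fl (p ∘ h) = flowOut fl p ∘ H := by
    funext z
    rw [Function.comp_apply, flowOut_apply, flowOut_apply]
    have e1 : H z 0 = z 0 := by simp [H]
    have e2 : tailL n (H z) = h (tailL m z) := by simp [H]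
    rw [e1, e2]
    rfl
  have h2 : H (zeroSlice m y) = zeroSlice n (h y) := by simp [H]
  have h3 : fderiv ℝ H (zeroSlice m y) = (timeL m).smulRight (timeVec n)
      + (zeroSlice n).comp ((fderiv ℝ h y).comp (tailL m)) := by
    refine HasFDerivAt.fderiv ?_
    refine ((timeL m).smulRight (timeVec n)).hasFDerivAt.add ?_
    refine (zeroSlice n).hasFDerivAt.comp (zeroSlice m y) ?_
    exact HasFDerivAt.comp (zeroSlice m y)
      (hh.contDiffAt.differentiableAt (by simp)).hasFDerivAt (tailL m).hasFDerivAt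
  have h4 : fderiv ℝ H (zeroSlice m y) (timeVec m) = timeVec n := by rw [h3]; simp
  have h5 : (fderiv ℝ H (zeroSlice m y)).comp (zeroSlice m)
      = (zeroSlice n).comp (fderiv ℝ h y) := by
    rw [h3]
    ext v
    simp
  have h6 := hw.2 (n + 1) (m + 1) (flowOut fl p) H (hfl.plot hp) hH (zeroSlice m y)
    (by rw [h2, hfl.flowOut_zeroSlice]; exact hy)
  rw [contract_eq, h1, h6, curryLeft_comp, h4, h2, contract_eq]
  generalize (w (n + 1) (flowOut fl p) (zeroSlice n (h y))).curryLeft (timeVec n) = a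
  ext v
  exact congrArg a (funext fun i => DFunLike.congr_fun h5 (v i))

theorem contDiffAt_contract (hfl : SmoothFlow fl) {w : FormFamily X F (k + 1)} (hw : IsFormOn W w) {p : Eu n → X}
    (hp : IsPlot p) {x : Eu n} (hx : p x ∈ W) : ContDiffAt ℝ ∞ (contract fl w n p) x := by
  have h := hw.1 (n + 1) (flowOut fl p) (hfl.plot hp) (zeroSlice n x)
    (by rwa [hfl.flowOut_zeroSlice])
  have h1 : ContDiffAt ℝ ∞ (fun y => w (n + 1) (flowOut fl p) (zeroSlice n y)) x :=
    h.comp x (zeroSlice n).contDiff.contDiffAt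
  have h2 : contract fl w n p = fun y => Om.proj k (Om.comap (zeroSlice n)
      (Om.ctr (timeVec n) (Om.single (k + 1) (w (n + 1) (flowOut fl p) (zeroSlice n y))))) := by
    funext y
    rw [Om.proj_apply, Om.comap_apply, Om.ctr_apply, Om.single_same]
    rfl
  rw [h2]
  exact ((Om.proj k).comp ((Om.comap (zeroSlice n)).comp ((Om.ctr (timeVec n)).comp
    (Om.single (F := F) (n := n + 1) (k + 1))))).contDiff.contDiffAt.comp x h1

theorem isFormOn_contract (hfl : SmoothFlow fl) {w : FormFamily X F (k + 1)} (hw : IsFormOn W w) :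
    IsFormOn W (contract fl w) :=
  ⟨fun _ _ hp _ hx => hfl.contDiffAt_contract hw hp hx,
    fun _ _ _ _ hp hh _ hy => hfl.contract_comp hw hp hh hy⟩

theorem flowOut_mem (hW : ∀ t x, x ∈ W → fl t x ∈ W) {p : Eu n → X} (hp : ∀ y, p y ∈ W) (z : Eu (n + 1)) : flowOut fl p z ∈ W :=
  hW _ _ (hp _)

theorem contract_flowOut (hfl : SmoothFlow fl) (hW : ∀ t x, x ∈ W → fl t x ∈ W)
    {w : FormFamily X F (k + 1)} (hw : IsFormOn W w) {p : Eu n → X}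
    (hp : IsPlot p) (hpW : ∀ y, p y ∈ W) (z : Eu (n + 1)) :
    contract fl w (n + 1) (flowOut fl p) z
      = (w (n + 1) (flowOut fl p) z).curryLeft (timeVec n) := by
  let a : Eu (n + 1 + 1) →L[ℝ] Eu (n + 1) := (timeL (n + 1)).smulRight (timeVec n) + tailL (n + 1)
  have h1 : flowOut fl (flowOut fl p) = flowOut fl p ∘ a := by
    funext z
    have : a z = tailL (n + 1) z + z 0 • timeVec n := by simp [a, add_comm]
    rw [Function.comp_apply, this, hfl.flowOut_add, flowOut_apply fl (flowOut fl p)]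
  have h2 := hw.2 (n + 1) (n + 1 + 1) (flowOut fl p) a (hfl.plot hp) a.contDiff
    (zeroSlice (n + 1) z) (flowOut_mem hW hpW _)
  have h3 : a (zeroSlice (n + 1) z) = z := by simp [a]
  have h4 : a (timeVec (n + 1)) = timeVec n := by simp [a]
  rw [contract_eq, h1, h2, a.fderiv, curryLeft_comp, h3, h4]
  generalize (w (n + 1) (flowOut fl p) z).curryLeft (timeVec n) = b
  ext v
  refine congrArg b (funext fun i => ?_)
  show a (zeroSlice (n + 1) (v i)) = v i
  simp [a]

theorem form_flowOut_add (hfl : SmoothFlow fl) (hW : ∀ t x, x ∈ W → fl t x ∈ W)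
    (hw : IsFormOn W w)
    (hinv : ∀ (t : ℝ) (n : ℕ) (p : Eu n → X), IsPlot p → ∀ x, p x ∈ W →
      w n (fun y => fl t (p y)) x = w n p x) {p : Eu n → X}
    (hp : IsPlot p) (hpW : ∀ y, p y ∈ W) (s : ℝ) (z : Eu (n + 1)) :
    w (n + 1) (flowOut fl p) (z + s • timeVec n) = w (n + 1) (flowOut fl p) z := by
  have hs : ContDiff ℝ ∞ fun z : Eu (n + 1) => z + s • timeVec n := contDiff_id.add contDiff_const
  have h1 := hw.2 (n + 1) (n + 1) (flowOut fl p) (fun z => z + s • timeVec n) (hfl.plot hp) hs z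
    (flowOut_mem hW hpW _)
  have h2 : flowOut fl p ∘ (fun z => z + s • timeVec n) = fun z => fl s (flowOut fl p z) :=
    funext fun z => hfl.flowOut_add p s z
  have h3 : fderiv ℝ (fun z : Eu (n + 1) => z + s • timeVec n) z
      = ContinuousLinearMap.id ℝ (Eu (n + 1)) := by
    rw [fderiv_add_const, fderiv_fun_id]
  rw [h2, h3, hinv s (n + 1) _ (hfl.plot hp) z (flowOut_mem hW hpW _)] at h1
  rw [h1]
  rfl

theorem fderiv_form_flowOut (hfl : SmoothFlow fl) (hW : ∀ t x, x ∈ W → fl t x ∈ W)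
    (hw : IsFormOn W w)
    (hinv : ∀ (t : ℝ) (n : ℕ) (p : Eu n → X), IsPlot p → ∀ x, p x ∈ W →
      w n (fun y => fl t (p y)) x = w n p x) {p : Eu n → X}
    (hp : IsPlot p) (hpW : ∀ y, p y ∈ W) (z : Eu (n + 1)) :
    fderiv ℝ (w (n + 1) (flowOut fl p)) z (timeVec n) = 0 := by
  have h1 : DifferentiableAt ℝ (w (n + 1) (flowOut fl p)) z :=
    (hw.1 (n + 1) _ (hfl.plot hp) z (flowOut_mem hW hpW _)).differentiableAt (by simp)
  rw [← h1.lineDeriv_eq_fderiv, lineDeriv]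
  simp only [hfl.form_flowOut_add hW hw hinv hp hpW, deriv_const]

end SmoothFlow

theorem smoothCircleMap_exp {f : Eu n → ℝ} (hf : ContDiff ℝ ∞ f) :
    SmoothCircleMap fun y => Circle.exp (f y) := by
  show ContDiff ℝ ∞ fun y => (Circle.exp (f y) : ℂ)
  simp only [Circle.coe_exp]
  exact Complex.contDiff_exp.comp ((Complex.ofRealCLM.contDiff.comp hf).mul contDiff_const)

theorem smoothCircleMap_one : SmoothCircleMap fun _ : Eu n => (1 : Circle) := contDiff_const

theorem smoothFlow_flowK {M : Type*} [DiffeologicalSpace M] [MulAction Circle M]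
    (hM : IsSmoothCircleAction M) : SmoothFlow (flowK : ℝ → M → M) where
  plot {n p} hp := hM (n + 1) (fun z => Circle.exp (2 * Real.pi * z 0)) (fun z => p (tailL n z))
    (smoothCircleMap_exp (contDiff_const.mul (timeL n).contDiff))
    (isPlot_reparam hp (tailL n).contDiff)
  zero x := by simp [flowK]
  add s t x := by rw [flowK, mul_add, Circle.exp_add, mul_smul]; rfl

theorem smoothFlow_flowT {Q : Type*} [DiffeologicalSpace Q] [MulAction (Circle × Circle) Q]
    (hQ : IsSmoothTorusAction Q) : SmoothFlow (flowT : ℝ → Q → Q) where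
  plot {n p} hp := hQ (n + 1) (fun z => Circle.exp (2 * Real.pi * z 0)) (fun _ => 1)
    (fun z => p (tailL n z)) (smoothCircleMap_exp (contDiff_const.mul (timeL n).contDiff))
    smoothCircleMap_one (isPlot_reparam hp (tailL n).contDiff)
  zero x := by
    have : ((1, 1) : Circle × Circle) = 1 := rfl
    simp [flowT, this]
  add s t x := by
    rw [flowT, flowT, flowT, mul_add, Circle.exp_add, ← mul_smul, Prod.mk_mul_mk, one_mul]

theorem smoothFlow_flowU {Q : Type*} [DiffeologicalSpace Q] [MulAction (Circle × Circle) Q]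
    (hQ : IsSmoothTorusAction Q) : SmoothFlow (flowU : ℝ → Q → Q) where
  plot {n p} hp := hQ (n + 1) (fun _ => 1) (fun z => Circle.exp (z 0))
    (fun z => p (tailL n z)) smoothCircleMap_one (smoothCircleMap_exp (timeL n).contDiff)
    (isPlot_reparam hp (tailL n).contDiff)
  zero x := by
    have : ((1, 1) : Circle × Circle) = 1 := rfl
    simp [flowU, this]
  add s t x := by
    rw [flowU, flowU, flowU, Circle.exp_add, ← mul_smul, Prod.mk_mul_mk, one_mul]

end Flows
end

noncomputable section

section TotalForms

open Om

/-- Candidates for forms of mixed degree on `X`. -/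
abbrev TotalFamily (X F : Type*) [NormedAddCommGroup F] [NormedSpace ℝ F] : Type _ :=
  ∀ n : ℕ, (Eu n → X) → Eu n → Om n F

/-- `w` is a smooth form of mixed degree on `X`. -/
structure IsTotalForm {X F : Type*} [DiffeologicalSpace X] [NormedAddCommGroup F] [NormedSpace ℝ F]
    (w : TotalFamily X F) : Prop where
  contDiff : ∀ {n : ℕ} {p : Eu n → X}, IsPlot p → ContDiff ℝ ∞ (w n p)
  comp : ∀ {n m : ℕ} {p : Eu n → X} {h : Eu m → Eu n}, IsPlot p → ContDiff ℝ ∞ h →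
    ∀ y, w m (p ∘ h) y = comap (fderiv ℝ h y) (w n p (h y))

variable {X Y F G : Type*} [DiffeologicalSpace X] [DiffeologicalSpace Y]
  [NormedAddCommGroup F] [NormedSpace ℝ F] [NormedAddCommGroup G] [NormedSpace ℝ G] {n m : ℕ}

theorem Om.d_comap {f : Eu n → Om n F} {h : Eu m → Eu n} {y : Eu m} (hf : ContDiff ℝ ∞ f)
    (hh : ContDiff ℝ ∞ h) :
    d (fun z => comap (fderiv ℝ h z) (f (h z))) y = comap (fderiv ℝ h y) (d f (h y)) := by
  have hk : ∀ k, ContDiff ℝ ∞ fun x => f x k := fun k => (Om.proj (F := F) (n := n) k).contDiff.comp hf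
  have hs : DifferentiableAt ℝ (fun z => comap (fderiv ℝ h z) (f (h z))) y := by
    have h1 : (fun z => comap (fderiv ℝ h z) (f (h z))) = fun z => ∑ k ∈ Finset.range (m + 1),
        single k ((f (h z) k).compContinuousLinearMap (fderiv ℝ h z)) := by
      funext z
      rw [← sum_single (comap (fderiv ℝ h z) (f (h z)))]
      simp only [comap_apply]
    rw [h1]
    refine DifferentiableAt.fun_sum fun k _ => ?_
    refine (single (F := F) (n := m) k).differentiableAt.comp y ?_
    have h2 : DifferentiableAt ℝ (fun z => f (h z) k) y :=
      ((hk k).comp hh).contDiffAt.differentiableAt (by simp)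
    have h3 : DifferentiableAt ℝ (fderiv ℝ h) y :=
      (contDiff_infty_iff_fderiv.1 hh).2.contDiffAt.differentiableAt (by simp)
    exact h2.continuousAlternatingMapCompContinuousLinearMap h3
  ext k
  rcases k with _ | k
  · rw [d_apply_zero, comap_apply, d_apply_zero]
    rfl
  · rw [d_apply_succ hs, comap_apply, d_apply_succ (hf.contDiffAt.differentiableAt (by simp))]
    simp only [comap_apply]
    have hr : minSmoothness ℝ 2 ≤ ∞ := by
      rw [minSmoothness_of_isRCLikeNormedField]
      exact WithTop.coe_le_coe.2 le_top
    exact DFunLike.congr_fun (extDeriv_pullback ((hk k).contDiffAt.differentiableAt (by simp))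
      hh.contDiffAt hr) _

namespace IsTotalForm

variable {w : TotalFamily X F}

theorem isFormOn (hw : IsTotalForm w) (W : Set X) (k : ℕ) :
    IsFormOn W fun n p x => w n p x k :=
  ⟨fun _ _ hp _ _ => contDiffAt_iff.1 (hw.contDiff hp).contDiffAt k,
    fun n m p h hp hh y _ => by
      show w m (p ∘ h) y k = _
      rw [hw.comp hp hh, comap_apply]⟩

theorem congr_germ (hw : IsTotalForm w) {p p' : Eu n → X} (hp : IsPlot p) (hp' : IsPlot p')
    {x : Eu n} (h : ∀ᶠ y in 𝓝 x, p y = p' y) : w n p x = w n p' x :=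
  Om.ext fun k => (hw.isFormOn Set.univ k).congr_germ hp hp' (Set.mem_univ _) h

theorem add {w' : TotalFamily X F} (hw : IsTotalForm w) (hw' : IsTotalForm w') :
    IsTotalForm fun n p x => w n p x + w' n p x :=
  ⟨fun hp => (hw.contDiff hp).add (hw'.contDiff hp),
    fun hp hh y => by rw [hw.comp hp hh, hw'.comp hp hh, map_add]⟩

theorem sub {w' : TotalFamily X F} (hw : IsTotalForm w) (hw' : IsTotalForm w') :
    IsTotalForm fun n p x => w n p x - w' n p x :=
  ⟨fun hp => (hw.contDiff hp).sub (hw'.contDiff hp),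
    fun hp hh y => by rw [hw.comp hp hh, hw'.comp hp hh, map_sub]⟩

theorem neg (hw : IsTotalForm w) : IsTotalForm fun n p x => -w n p x :=
  ⟨fun hp => (hw.contDiff hp).neg, fun hp hh y => by rw [hw.comp hp hh, map_neg]⟩

theorem mul {R : Type*} [NormedRing R] [NormedAlgebra ℝ R] {w w' : TotalFamily X R}
    (hw : IsTotalForm w) (hw' : IsTotalForm w') : IsTotalForm fun n p x => w n p x * w' n p x :=
  ⟨fun hp => (hw.contDiff hp).mul (hw'.contDiff hp),
    fun hp hh y => by rw [hw.comp hp hh, hw'.comp hp hh, comap_mul]⟩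

theorem exp {R : Type*} [NormedRing R] [NormedAlgebra ℝ R] [CompleteSpace R]
    {w : TotalFamily X R} (hw : IsTotalForm w) : IsTotalForm fun n p x => NormedSpace.exp (w n p x) :=
  ⟨fun {n _} hp => (contDiff_exp_algebra (R := Om n R)).comp (hw.contDiff hp),
    fun hp hh y => by rw [hw.comp hp hh, comap_exp]⟩

theorem map (g : F →L[ℝ] G) (hw : IsTotalForm w) : IsTotalForm fun n p x => Om.map g (w n p x) :=
  ⟨fun hp => (Om.map g).contDiff.comp (hw.contDiff hp),
    fun hp hh y => by rw [hw.comp hp hh, map_comap]⟩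

theorem d (hw : IsTotalForm w) : IsTotalForm fun n p x => Om.d (w n p) x where
  contDiff hp := contDiff_iff_contDiffAt.2 fun x => (hw.contDiff hp).contDiffAt.om_d
  comp hp hh y := by
    rw [← d_comap (hw.contDiff hp) hh]
    congr 1
    exact funext fun z => hw.comp hp hh z

end IsTotalForm

theorem IsFormOn.isTotalForm {k : ℕ} {w : FormFamily X F k} (hw : IsFormOn Set.univ w) :
    IsTotalForm fun n p x => single k (w n p x) where
  contDiff {n p} hp := (single (F := F) (n := n) k).contDiff.comp
    (contDiff_iff_contDiffAt.2 fun x => hw.1 n p hp x trivial)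
  comp hp hh y := by rw [hw.2 _ _ _ _ hp hh y trivial, comap_single]

theorem IsFormOn.contDiff {k : ℕ} {w : FormFamily X F k} {W : Set X} (hw : IsFormOn W w)
    {p : Eu n → X} (hp : IsPlot p) (hpW : ∀ y, p y ∈ W) : ContDiff ℝ ∞ (w n p) :=
  contDiff_iff_contDiffAt.2 fun x => hw.1 n p hp x (hpW x)

theorem IsFormOn.add_smul {k : ℕ} {w w' : FormFamily X F k} {W : Set X} (hw : IsFormOn W w)
    (hw' : IsFormOn W w') (a b : ℝ) : IsFormOn W (a • w + b • w') := by
  refine ⟨fun n p hp x hx => ?_, fun n m p h hp hh y hy => ?_⟩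
  · exact ((hw.1 n p hp x hx).const_smul a).add ((hw'.1 n p hp x hx).const_smul b)
  · show a • w m (p ∘ h) y + b • w' m (p ∘ h) y = _
    rw [hw.2 n m p h hp hh y hy, hw'.2 n m p h hp hh y hy]
    rfl

theorem contract_add_smul {fl : ℝ → X → X} {k : ℕ} (w w' : FormFamily X F (k + 1)) (a b : ℝ)
    (p : Eu n → X) (x : Eu n) : contract fl (a • w + b • w') n p x
      = a • contract fl w n p x + b • contract fl w' n p x := rfl

end TotalForms

section InvariantConnections

open Om

variable {Q H : Type u} [NormedAddCommGroup H] [InnerProductSpace ℂ H] [CompleteSpace H]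
  [DiffeologicalSpace Q] [MulAction (Circle × Circle) Q] {n m : ℕ}

/-- The connection forms of horizontal invariant connections. -/
structure InvariantConnection (A : FormFamily Q (TraceClass H) 1) : Prop where
  isForm : IsFormOn Set.univ A
  invariant : ∀ t : Circle × Circle, InvariantOn t Set.univ A
  horizontal : ∀ (n : ℕ) (q : Eu n → Q), IsPlot q → ∀ x, contract flowU A n q x = 0

theorem IsSmoothTorusAction.const_smul (hQ : IsSmoothTorusAction Q) (t : Circle × Circle)
    {q : Eu n → Q} (hq : IsPlot q) : IsPlot fun y => t • q y :=
  hQ n (fun _ => t.1) (fun _ => t.2) q contDiff_const contDiff_const hq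

/-- Near a point, a smooth map to the circle is a constant times the exponential of a
globally defined smooth function. -/
theorem exists_log_circle {c : Eu n → Circle} (hc : SmoothCircleMap c) (x : Eu n) :
    ∃ s : Eu n → ℝ, ContDiff ℝ ∞ s ∧ ∀ᶠ y in 𝓝 x, c y = Circle.exp (s y) := by
  have hs : ContDiff ℝ ∞ fun y => ((c y / c x : Circle) : ℂ) := by
    simp only [Circle.coe_div]
    exact hc.div_const _
  have hU : ∀ᶠ y in 𝓝 x, ((c y / c x : Circle) : ℂ) ∈ Complex.slitPlane := by
    refine hs.continuous.continuousAt.eventually (Complex.isOpen_slitPlane.mem_nhds ?_)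
    show ((c x / c x : Circle) : ℂ) ∈ Complex.slitPlane
    rw [div_self']
    exact Complex.one_mem_slitPlane
  obtain ⟨h, hh, hhx, hhU⟩ := exists_cutoff x hU
  refine ⟨fun y => Complex.arg (c x) + (Complex.log ((c (h y) / c x : Circle) : ℂ)).im, ?_, ?_⟩
  · have hl : ContDiff ℝ ∞ fun y => Complex.log ((c (h y) / c x : Circle) : ℂ) :=
      contDiff_iff_contDiffAt.2 fun y => ContDiffAt.comp (g := Complex.log)
        (f := fun y => ((c (h y) / c x : Circle) : ℂ)) y
        ((Complex.contDiffAt_log (hhU y)).restrict_scalars ℝ) (hs.comp hh).contDiffAt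
    exact contDiff_const.add (Complex.imCLM.contDiff.comp hl)
  · filter_upwards [hhx] with y hy
    rw [hy, Circle.exp_add, Circle.exp_arg, Complex.log_im, Circle.exp_arg, mul_div_cancel]

variable {A : FormFamily Q (TraceClass H) 1}

theorem InvariantConnection.flow (hA : InvariantConnection A) {fl : ℝ → Q → Q}
    (hfl : ∀ t, ∃ c : Circle × Circle, ∀ q, fl t q = c • q) (t : ℝ) (n : ℕ) (q : Eu n → Q)
    (hq : IsPlot q) (x : Eu n) (_ : q x ∈ Set.univ) : A n (fun y => fl t (q y)) x = A n q x := by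
  obtain ⟨c, hc⟩ := hfl t
  simp only [hc]
  exact hA.invariant c n q hq x trivial

theorem exists_flowT_eq (t : ℝ) : ∃ c : Circle × Circle, ∀ q : Q, flowT t q = c • q := ⟨_, fun _ => rfl⟩

theorem exists_flowU_eq (t : ℝ) : ∃ c : Circle × Circle, ∀ q : Q, flowU t q = c • q := ⟨_, fun _ => rfl⟩

/-- The connection form does not change when a frame is moved along the circle `U(1)`. -/
theorem InvariantConnection.smul_snd (hQ : IsSmoothTorusAction Q) (hA : InvariantConnection A)
    {c : Eu n → Circle} (hc : SmoothCircleMap c) {q : Eu n → Q} (hq : IsPlot q) (x : Eu n) :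
    A n (fun y => ((1 : Circle), c y) • q y) x = A n q x := by
  have hfl := smoothFlow_flowU hQ
  obtain ⟨s, hs, hcs⟩ := exists_log_circle hc x
  let k : Eu n → Eu (n + 1) := fun y => s y • timeVec n + zeroSlice n y
  have hk : ContDiff ℝ ∞ k := (hs.smul contDiff_const).add (zeroSlice n).contDiff
  have h1 : A n (fun y => ((1 : Circle), c y) • q y) x = A n (flowOut flowU q ∘ k) x := by
    refine hA.isForm.congr_germ (hQ n _ c q smoothCircleMap_one hc hq)
      (isPlot_reparam (hfl.plot hq) hk) trivial ?_
    filter_upwards [hcs] with y hy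
    have e1 : k y 0 = s y := by simp [k]
    have e2 : tailL n (k y) = y := by simp [k]
    rw [Function.comp_apply, flowOut_apply, e1, e2, hy]
    rfl
  have h2 := hA.isForm.2 (n + 1) n (flowOut flowU q) k (hfl.plot hq) hk x trivial
  have h3 : fderiv ℝ k x = (fderiv ℝ s x).smulRight (timeVec n) + zeroSlice n := by
    refine HasFDerivAt.fderiv ?_
    exact ((hs.contDiffAt.differentiableAt (by simp)).hasFDerivAt.smul_const _).add
      (zeroSlice n).hasFDerivAt
  have h4 : k x = zeroSlice n x + s x • timeVec n := add_comm _ _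
  have h5 := hfl.form_flowOut_add (W := Set.univ) (fun _ _ _ => trivial) hA.isForm
    (hA.flow exists_flowU_eq) hq (fun _ => trivial) (s x) (zeroSlice n x)
  have h6 := hfl.form_zeroSlice hA.isForm hq (x := x) trivial
  have h7 := hA.horizontal n q hq x
  rw [contract_eq] at h7
  rw [h1, h2, h4, h5, h6, h3]
  generalize A (n + 1) (flowOut flowU q) (zeroSlice n x) = a at *
  ext v
  have h8 : ∀ r : ℝ, a (fun _ => r • timeVec n) = 0 := fun r => by
    have h9 : a (fun _ => timeVec n) = 0 := by
      have h10 := DFunLike.congr_fun h7 (fun i => i.elim0)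
      refine Eq.trans ?_ h10
      show _ = a _
      congr 1
      funext i
      rw [Subsingleton.elim i 0]
      rfl
    have := a.map_update_smul (fun _ => timeVec n) 0 r (timeVec n)
    rw [Function.update_eq_self, h9, smul_zero] at this
    rw [← this]
    congr 1
    funext i
    rw [Subsingleton.elim i 0, Function.update_self]
  have h10 := a.map_update_add (fun _ => 0) 0 (fderiv ℝ s x (v 0) • timeVec n) (zeroSlice n (v 0))
  have e : ∀ z : Eu (n + 1), Function.update (fun _ : Fin 1 => (0 : Eu (n + 1))) 0 z = fun _ => z :=
    fun z => funext fun i => by rw [Subsingleton.elim i 0, Function.update_self]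
  rw [e, e, e, h8, zero_add] at h10
  have f1 : ∀ L : Eu n →L[ℝ] Eu (n + 1),
      a.compContinuousLinearMap L v = a fun _ => L (v 0) := fun L => by
    show a _ = a _
    congr 1
    funext i
    rw [Subsingleton.elim i 0]
    rfl
  rw [f1, f1]
  exact congrArg (fun T : TraceClass H => T.op _) h10

/-- The connection form does not change when a frame is moved by a constant element of `𝕋` and
along the circle `U(1)`. -/
theorem InvariantConnection.twist (hQ : IsSmoothTorusAction Q) (hA : InvariantConnection A)
    (t : Circle) {c : Eu n → Circle} (hc : SmoothCircleMap c) {q : Eu n → Q} (hq : IsPlot q) :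
    A n (fun y => (t, c y) • q y) = A n q := by
  funext x
  have h1 : (fun y => (t, c y) • q y) = fun y => ((1 : Circle), c y) • (t, (1 : Circle)) • q y := by
    funext y
    rw [← mul_smul, Prod.mk_mul_mk, one_mul, mul_one]
  rw [h1, hA.smul_snd hQ hc (hQ.const_smul _ hq)]
  exact hA.invariant (t, 1) n q hq x trivial

theorem isPlot_twist (hQ : IsSmoothTorusAction Q) (t : Circle) {c : Eu n → Circle}
    (hc : SmoothCircleMap c) {q : Eu n → Q} (hq : IsPlot q) : IsPlot fun y => (t, c y) • q y :=
  hQ n (fun _ => t) c q contDiff_const hc hq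

theorem flowOut_twist (t : Circle) (c : Eu n → Circle) (q : Eu n → Q) :
    flowOut flowT (fun y => (t, c y) • q y)
      = fun z => (t, c (tailL n z)) • flowOut flowT q z := by
  funext z
  rw [flowOut_apply, flowOut_apply, flowT, flowT, ← mul_smul, ← mul_smul, mul_comm]

theorem InvariantConnection.curvForm_twist (hQ : IsSmoothTorusAction Q)
    (hA : InvariantConnection A) (t : Circle) {c : Eu n → Circle} (hc : SmoothCircleMap c)
    {q : Eu n → Q} (hq : IsPlot q) (x : Eu n) :
    curvForm A (fun y => (t, c y) • q y) x = curvForm A q x := by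
  have h1 : connForm A (fun y => (t, c y) • q y) = connForm A q :=
    funext fun y => by rw [connForm, connForm, hA.twist hQ t hc hq]
  have h2 : contract flowT A n (fun y => (t, c y) • q y) x = contract flowT A n q x := by
    rw [contract_eq, contract_eq, flowOut_twist, hA.twist hQ t (c := fun z => c (tailL n z))
      (hc.comp (tailL n).contDiff) ((smoothFlow_flowT hQ).plot hq)]
  rw [curvForm, curvForm, h1, h2]

theorem InvariantConnection.isTotalForm_connForm (hA : InvariantConnection A) :
    IsTotalForm fun n q x => connForm (n := n) A q x := hA.isForm.isTotalForm.map _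

theorem InvariantConnection.isTotalForm_curvForm (hQ : IsSmoothTorusAction Q)
    (hA : InvariantConnection A) : IsTotalForm fun n q x => curvForm (n := n) A q x :=
  ((((smoothFlow_flowT hQ).isFormOn_contract hA.isForm).isTotalForm.map _).sub
    hA.isTotalForm_connForm.d).sub (hA.isTotalForm_connForm.mul hA.isTotalForm_connForm)

theorem InvariantConnection.isTotalForm_chernTrace (hQ : IsSmoothTorusAction Q)
    (hA : InvariantConnection A) : IsTotalForm fun n q x => chernTrace (n := n) A q x :=
  (hA.isTotalForm_curvForm hQ).exp.map _

theorem InvariantConnection.chernTrace_twist (hQ : IsSmoothTorusAction Q)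
    (hA : InvariantConnection A) (t : Circle) {c : Eu n → Circle} (hc : SmoothCircleMap c)
    {q : Eu n → Q} (hq : IsPlot q) (x : Eu n) :
    chernTrace A (fun y => (t, c y) • q y) x = chernTrace A q x := by
  rw [chernTrace, hA.curvForm_twist hQ t hc hq, chernTrace]

theorem InvariantConnection.fderiv_connForm_flowOut (hQ : IsSmoothTorusAction Q)
    (hA : InvariantConnection A) {q : Eu n → Q} (hq : IsPlot q) (z : Eu (n + 1)) :
    fderiv ℝ (connForm A (flowOut flowT q)) z (timeVec n) = 0 := by
  have hfl := smoothFlow_flowT hQ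
  have h1 := hfl.fderiv_form_flowOut (W := Set.univ) (fun _ _ _ => trivial) hA.isForm
    (hA.flow exists_flowT_eq) hq (fun _ => trivial) z
  have h2 : HasFDerivAt (A (n + 1) (flowOut flowT q)) _ z :=
    ((hA.isForm.1 (n + 1) _ (hfl.plot hq) z trivial).differentiableAt (by simp)).hasFDerivAt
  have h3 : HasFDerivAt (connForm A (flowOut flowT q)) _ z :=
    (connIncl (n + 1) H).hasFDerivAt.comp z h2
  rw [h3.fderiv, ContinuousLinearMap.comp_apply, h1, ContinuousLinearMap.map_zero]

/-- On flowed out frames the equivariant curvature is that of a connection on `ℝⁿ⁺¹` which is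
invariant under translations in the time direction. -/
theorem InvariantConnection.curvForm_flowOut (hQ : IsSmoothTorusAction Q)
    (hA : InvariantConnection A) {q : Eu n → Q} (hq : IsPlot q) :
    curvForm A (flowOut flowT q) = curv (timeVec n) (connForm A (flowOut flowT q)) := by
  funext z
  rw [curvForm, curv, (smoothFlow_flowT hQ).contract_flowOut (W := Set.univ)
    (fun _ _ _ => trivial) hA.isForm hq (fun _ => trivial), connForm_eq, ctr_map, ctr_single_succ]

theorem InvariantConnection.d_chernTrace (hQ : IsSmoothTorusAction Q)
    (hA : InvariantConnection A) {q : Eu n → Q} (hq : IsPlot q) (z : Eu (n + 1)) :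
    Om.d (chernTrace A (flowOut flowT q)) z
      - ctr (timeVec n) (chernTrace A (flowOut flowT q) z) = 0 := by
  have h := d_trace_exp_curv (τ := UnitalTraceClass.trace H) UnitalTraceClass.trace_mul_comm
    (y := timeVec n) (hA.isTotalForm_connForm.contDiff ((smoothFlow_flowT hQ).plot hq))
    (par_connForm A _) (hA.fderiv_connForm_flowOut hQ hq) z
  rw [← hA.curvForm_flowOut hQ hq] at h
  exact h

variable {A₀ A₁ : FormFamily Q (TraceClass H) 1}

theorem InvariantConnection.interpolate (h₀ : InvariantConnection A₀)
    (h₁ : InvariantConnection A₁) (t : ℝ) : InvariantConnection (interpolate A₀ A₁ t) where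
  isForm := h₀.isForm.add_smul h₁.isForm (1 - t) t
  invariant c n p hp x hx := congrArg₂ (fun a b => (1 - t) • a + t • b)
    (h₀.invariant c n p hp x hx) (h₁.invariant c n p hp x hx)
  horizontal n q hq x := by
    refine (contract_add_smul A₀ A₁ (1 - t) t q x).trans ?_
    rw [h₀.horizontal n q hq, h₁.horizontal n q hq, smul_zero, smul_zero, add_zero]

theorem connForm_interpolate (t : ℝ) (q : Eu n → Q) :
    connForm (interpolate A₀ A₁ t) q = path (connForm A₀ q) (connForm A₁ q) t := by
  funext x
  show connIncl n H ((1 - t) • A₀ n q x + t • A₁ n q x) = _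
  rw [map_add, map_smul, map_smul]
  rfl

theorem transForm_flowOut (hQ : IsSmoothTorusAction Q) (h₀ : InvariantConnection A₀)
    (h₁ : InvariantConnection A₁) {q : Eu n → Q} (hq : IsPlot q) (t : ℝ) (z : Eu (n + 1)) :
    transForm A₀ A₁ t (flowOut flowT q) z = Om.trans (timeVec n) (connForm A₀ (flowOut flowT q))
      (connForm A₁ (flowOut flowT q)) t z := by
  rw [transForm, Om.trans, (h₀.interpolate h₁ t).curvForm_flowOut hQ hq, connForm_interpolate]

theorem isTotalForm_transForm (hQ : IsSmoothTorusAction Q) (h₀ : InvariantConnection A₀)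
    (h₁ : InvariantConnection A₁) (t : ℝ) :
    IsTotalForm fun n q x => transForm (n := n) A₀ A₁ t q x :=
  (h₁.isTotalForm_connForm.sub h₀.isTotalForm_connForm).neg.mul
    ((h₀.interpolate h₁ t).isTotalForm_curvForm hQ).exp

theorem IsTotalForm.zeroSlice {X F : Type*} [DiffeologicalSpace X] [NormedAddCommGroup F]
    [NormedSpace ℝ F] {w : TotalFamily X F} (hw : IsTotalForm w) {fl : ℝ → X → X}
    (hfl : SmoothFlow fl) {p : Eu n → X} (hp : IsPlot p) (x : Eu n) :
    w n p x = comap (zeroSlice n) (w (n + 1) (flowOut fl p) (zeroSlice n x)) := by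
  have h := hw.comp (hfl.plot hp) (_root_.zeroSlice n).contDiff x
  rw [(_root_.zeroSlice n).fderiv] at h
  rw [← h]
  congr 1
  funext y
  exact (hfl.flowOut_zeroSlice p y).symm

theorem contDiff_transForm_flowOut (hQ : IsSmoothTorusAction Q) (h₀ : InvariantConnection A₀)
    (h₁ : InvariantConnection A₁) {q : Eu n → Q} (hq : IsPlot q) :
    ContDiff ℝ ∞ fun z : ℝ × Eu (n + 1) => transForm A₀ A₁ z.1 (flowOut flowT q) z.2 := by
  have hfl := smoothFlow_flowT hQ
  have e : (fun z : ℝ × Eu (n + 1) => transForm A₀ A₁ z.1 (flowOut flowT q) z.2) = fun z =>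
      Om.trans (timeVec n) (connForm A₀ (flowOut flowT q)) (connForm A₁ (flowOut flowT q)) z.1 z.2 :=
    funext fun z => transForm_flowOut hQ h₀ h₁ hq z.1 z.2
  rw [e]
  exact contDiff_trans (timeVec n) (h₀.isTotalForm_connForm.contDiff (hfl.plot hq))
    (h₁.isTotalForm_connForm.contDiff (hfl.plot hq))

theorem contDiff_transForm (hQ : IsSmoothTorusAction Q) (h₀ : InvariantConnection A₀)
    (h₁ : InvariantConnection A₁) {q : Eu n → Q} (hq : IsPlot q) :
    ContDiff ℝ ∞ fun z : ℝ × Eu n => transForm A₀ A₁ z.1 q z.2 := by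
  have hfl := smoothFlow_flowT hQ
  have h := contDiff_transForm_flowOut hQ h₀ h₁ hq
  have h1 : ContDiff ℝ ∞ fun z : ℝ × Eu n => (z.1, zeroSlice n z.2) :=
    contDiff_fst.prodMk ((zeroSlice n).contDiff.comp contDiff_snd)
  have h2 : (fun z : ℝ × Eu n => transForm A₀ A₁ z.1 q z.2) = fun z =>
      comap (zeroSlice n) (transForm A₀ A₁ z.1 (flowOut flowT q) (zeroSlice n z.2)) :=
    funext fun z => (isTotalForm_transForm hQ h₀ h₁ z.1).zeroSlice hfl hq z.2
  rw [h2]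
  have h3 := h.comp h1
  exact (comap (F := UnitalTraceClass H) (zeroSlice n)).contDiff.comp h3

theorem continuous_transForm (hQ : IsSmoothTorusAction Q) (h₀ : InvariantConnection A₀)
    (h₁ : InvariantConnection A₁) {q : Eu n → Q} (hq : IsPlot q) (x : Eu n) :
    Continuous fun t => transForm A₀ A₁ t q x :=
  (contDiff_transForm hQ h₀ h₁ hq).continuous.comp (f := fun t => (t, x)) (by fun_prop)

theorem isTotalForm_csTrace (hQ : IsSmoothTorusAction Q) (h₀ : InvariantConnection A₀)
    (h₁ : InvariantConnection A₁) : IsTotalForm fun n q x => csTrace (n := n) A₀ A₁ q x where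
  contDiff {n q} hq := contDiff_integral_unitInterval
    ((map (UnitalTraceClass.trace H)).contDiff.comp (contDiff_transForm hQ h₀ h₁ hq))
  comp {n m q h} hq hh y := by
    have hc : Continuous fun t => map (UnitalTraceClass.trace H) (transForm A₀ A₁ t q (h y)) :=
      (map _).continuous.comp (continuous_transForm hQ h₀ h₁ hq _)
    rw [csTrace, csTrace, ← (comap (fderiv ℝ h y)).intervalIntegral_comp_comm
      (hc.intervalIntegrable 0 1)]
    refine intervalIntegral.integral_congr fun t _ => ?_
    exact ((isTotalForm_transForm hQ h₀ h₁ t).map (UnitalTraceClass.trace H)).comp hq hh y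

theorem csTrace_twist (hQ : IsSmoothTorusAction Q) (h₀ : InvariantConnection A₀)
    (h₁ : InvariantConnection A₁) (t : Circle) {c : Eu n → Circle} (hc : SmoothCircleMap c)
    {q : Eu n → Q} (hq : IsPlot q) (x : Eu n) :
    csTrace A₀ A₁ (fun y => (t, c y) • q y) x = csTrace A₀ A₁ q x := by
  rw [csTrace, csTrace]
  refine intervalIntegral.integral_congr fun s _ => ?_
  simp only [transForm, (h₀.interpolate h₁ s).curvForm_twist hQ t hc hq, connForm,
    h₀.twist hQ t hc hq, h₁.twist hQ t hc hq]

theorem d_csTrace (hQ : IsSmoothTorusAction Q) (h₀ : InvariantConnection A₀)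
    (h₁ : InvariantConnection A₁) {q : Eu n → Q} (hq : IsPlot q) (z : Eu (n + 1)) :
    Om.d (csTrace A₀ A₁ (flowOut flowT q)) z
      - ctr (timeVec n) (csTrace A₀ A₁ (flowOut flowT q) z)
      = chernTrace A₁ (flowOut flowT q) z - chernTrace A₀ (flowOut flowT q) z := by
  have hfl := smoothFlow_flowT hQ
  have h := trace_exp_curv_sub (τ := UnitalTraceClass.trace H) UnitalTraceClass.trace_mul_comm
    (timeVec n) (h₀.isTotalForm_connForm.contDiff (hfl.plot hq))
    (h₁.isTotalForm_connForm.contDiff (hfl.plot hq)) (par_connForm A₀ _) (par_connForm A₁ _)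
    (h₀.fderiv_connForm_flowOut hQ hq) (h₁.fderiv_connForm_flowOut hQ hq) z
  simp only [← transForm_flowOut hQ h₀ h₁ hq] at h
  rw [← h₀.curvForm_flowOut hQ hq, ← h₁.curvForm_flowOut hQ hq] at h
  exact h.symm

end InvariantConnections
end

noncomputable section

section Intertwine

variable {R : Type*} [NormedRing R] [NormedAlgebra ℝ R] [CompleteSpace R]

theorem exp_mul_eq_mul_exp {x y g : R} (h : x * g = g * y) :
    NormedSpace.exp x * g = g * NormedSpace.exp y := by
  have hp : ∀ m : ℕ, x ^ m * g = g * y ^ m := fun m => by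
    induction m with
    | zero => simp
    | succ m ih => rw [pow_succ', mul_assoc, ih, ← mul_assoc, h, mul_assoc, ← pow_succ']
  have h1 := (hasSum_exp x).mul_right g
  have h2 := (hasSum_exp y).mul_left g
  simp only [smul_mul_assoc, hp] at h1
  simp only [mul_smul_comm] at h2
  exact h1.unique h2

theorem exp_mul_eq_mul_exp_mul_exp {x y g s : R} (hs : ∀ z, s * z = z * s)
    (h : x * g = g * y + s * g) :
    NormedSpace.exp x * g = g * NormedSpace.exp y * NormedSpace.exp s := by
  have h1 : x * g = g * (y + s) := by rw [h, hs, mul_add]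
  rw [exp_mul_eq_mul_exp h1, exp_add_of_commute_real (hs y).symm, mul_assoc]

theorem const_mul_integral (a : R) {f : ℝ → R} (hf : Continuous f) :
    a * ∫ t in (0 : ℝ)..1, f t = ∫ t in (0 : ℝ)..1, a * f t :=
  ((ContinuousLinearMap.mul ℝ R a).intervalIntegral_comp_comm
    (hf.intervalIntegrable (μ := MeasureTheory.volume) 0 1)).symm

end Intertwine

namespace Om
section Gauge

variable {n : ℕ} {R R' : Type*} [NormedRing R] [NormedAlgebra ℝ R] [NormedRing R']
  [NormedAlgebra ℝ R']

theorem map_curv (g : R →L[ℝ] R') (hg : ∀ x y, g (x * y) = g x * g y) (y : Eu n)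
    {a : Eu n → Om n R} (ha : ContDiff ℝ ∞ a) (x : Eu n) :
    map g (curv y a x) = curv y (fun z => map g (a z)) x := by
  rw [curv, curv, map_sub, map_sub, map_mul g hg, ← ctr_map,
    d_map g (ha.contDiffAt.differentiableAt (by simp))]

/-- The gauge transformation formula for the equivariant curvature. -/
theorem curv_mul_gauge {y : Eu n} {a b c g : Eu n → Om n R} (ha : ContDiff ℝ ∞ a)
    (hb : ContDiff ℝ ∞ b) (hc : ContDiff ℝ ∞ c) (hg : ContDiff ℝ ∞ g)
    (oa : ∀ x, par (a x) = -a x) (oc : ∀ x, par (c x) = -c x) (eg : ∀ x, par (g x) = g x)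
    (hd : ∀ x, d g x = g x * b x - a x * g x - c x * g x) {x : Eu n}
    (hgy : ctr y (g x) = 0) (hdy : ctr y (d g x) = 0) (hcc : ∀ z, c x * z = par z * c x) :
    curv y a x * g x = g x * curv y b x + (d c x - ctr y (c x)) * g x := by
  have da := ha.contDiffAt.differentiableAt (x := x) (by simp)
  have db := hb.contDiffAt.differentiableAt (x := x) (by simp)
  have dc := hc.contDiffAt.differentiableAt (x := x) (by simp)
  have dg := hg.contDiffAt.differentiableAt (x := x) (by simp)
  have h1 : d g x * b x + g x * d b x - (d a x * g x - a x * d g x)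
      - (d c x * g x - c x * d g x) = 0 := by
    have h := d_d (hg.contDiffAt (x := x))
    have e : d g = fun z => g z * b z - a z * g z - c z * g z := funext hd
    have e2 : d (d g) x = d (fun z => g z * b z - a z * g z - c z * g z) x := by rw [e]
    rw [e2, d_sub ((dg.fun_mul db).fun_sub (da.fun_mul dg)) (dc.fun_mul dg),
      d_sub (dg.fun_mul db) (da.fun_mul dg), d_mul dg db, d_mul da dg, d_mul dc dg, eg, oa, oc,
      neg_mul, neg_mul, ← sub_eq_add_neg, ← sub_eq_add_neg] at h
    exact h
  have h2 : g x * ctr y (b x) - ctr y (a x) * g x - ctr y (c x) * g x = 0 := by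
    rw [hd x, map_sub, map_sub, ctr_mul, ctr_mul, ctr_mul, hgy, eg, mul_zero, mul_zero, zero_mul,
      zero_add, add_zero, add_zero] at hdy
    exact hdy
  have h3 : c x * c x = 0 := by
    have h := hcc (c x)
    rw [oc, neg_mul] at h
    have h' : (2 : ℝ) • (c x * c x) = 0 := by
      rw [two_smul]
      nth_rewrite 1 [h]
      exact neg_add_cancel _
    exact (smul_eq_zero.1 h').resolve_left two_ne_zero
  have h4 : c x * a x = -(a x * c x) := by rw [hcc, oa, neg_mul]
  rw [hd x] at h1
  rw [curv, curv]
  generalize d a x = a', d b x = b', d c x = c', a x = a, b x = b, c x = c, g x = g at *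
  generalize ctr y a = ya, ctr y b = yb, ctr y c = yc at *
  have e1 : ya * g = g * yb - yc * g := by
    rw [← sub_eq_zero, ← neg_eq_zero]
    refine Eq.trans ?_ h2
    abel
  have e2 : a' * g = g * b * b + g * b' - a * a * g - c' * g := by
    rw [← sub_eq_zero, ← neg_eq_zero]
    refine Eq.trans ?_ h1
    have f1 : c * (a * g) = -(a * (c * g)) := by rw [← mul_assoc, h4, neg_mul, mul_assoc]
    have f2 : c * (c * g) = 0 := by rw [← mul_assoc, h3, zero_mul]
    simp only [mul_sub, sub_mul, mul_assoc, f1, f2]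
    abel
  rw [sub_mul, sub_mul, e1, e2]
  noncomm_ring

end Gauge
end Om

namespace UnitalTraceClass

variable {H : Type u} [NormedAddCommGroup H] [InnerProductSpace ℂ H] [CompleteSpace H]

variable (H) in
/-- The inclusion of the scalars. -/
def inl : ℂ →L[ℝ] UnitalTraceClass H :=
  (ContinuousLinearMap.toSpanSingleton ℂ (1 : UnitalTraceClass H)).restrictScalars ℝ

theorem inl_apply (c : ℂ) : inl H c = c • (1 : UnitalTraceClass H) := rfl

theorem fst_inl_mul (c : ℂ) (x : UnitalTraceClass H) : fst (inl H c * x) = c * fst x := by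
  rw [inl_apply, smul_mul_assoc, one_mul]
  rfl

theorem op_inl_mul (c : ℂ) (x : UnitalTraceClass H) : op (inl H c * x) = scalarOp H c * op x := by
  rw [inl_apply, smul_mul_assoc, one_mul, scalarOp_apply, smul_mul_assoc, one_mul, op_apply,
    op_apply, smul_add, smul_smul]
  rfl

theorem trace_inl_mul (c : ℂ) (x : UnitalTraceClass H) :
    trace H (inl H c * x) = c * trace H x := by
  rw [inl_apply, smul_mul_assoc, one_mul, trace_apply, trace_apply]
  exact TraceClass.tr.map_smul c (snd x)

theorem ext_fst_op {x y : UnitalTraceClass H} (h1 : fst x = fst y) (h2 : op x = op y) : x = y := by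
  rw [op_apply, op_apply, h1, add_right_inj] at h2
  have h3 : snd x = snd y := TraceClass.ext h2
  exact WithLp.ofLp_injective 1 (Unitization.ext h1 h3)

theorem snd_inl (c : ℂ) : snd (inl H c) = 0 :=
  (show snd (inl H c) = c • (0 : TraceClass H) from rfl).trans (smul_zero c)

/-- Conjugation with a unitary operator. -/
def conj (U : unitary (H →L[ℂ] H)) : UnitalTraceClass H →L[ℝ] UnitalTraceClass H :=
  (inl H).comp (fst (H := H)) + (inr (H := H)).comp (((TraceClass.sandwich (U : H →L[ℂ] H)
    (star (U : H →L[ℂ] H))).restrictScalars ℝ).comp (snd (H := H)))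

theorem conj_apply (U : unitary (H →L[ℂ] H)) (x : UnitalTraceClass H) :
    conj U x = inl H (fst x) + inr (TraceClass.sandwich (U : H →L[ℂ] H)
      (star (U : H →L[ℂ] H)) (snd x)) := rfl

theorem op_inl (c : ℂ) : op (inl H c) = c • (1 : H →L[ℂ] H) := by
  have := op_inl_mul c (1 : UnitalTraceClass H)
  rwa [mul_one, op_one, mul_one, scalarOp_apply] at this

theorem fst_conj (U : unitary (H →L[ℂ] H)) (x : UnitalTraceClass H) : fst (conj U x) = fst x := by
  rw [conj_apply, map_add, fst_inr, add_zero, inl_apply]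
  exact mul_one _

theorem op_conj_mul (U : unitary (H →L[ℂ] H)) (x : UnitalTraceClass H) :
    op (conj U x) * U = U * op x := by
  have hU : star (U : H →L[ℂ] H) * U = 1 := Unitary.coe_star_mul_self U
  rw [conj_apply, map_add, op_inr, op_inl, op_apply, add_mul, mul_add, smul_mul_assoc, one_mul,
    mul_smul_comm, mul_one, TraceClass.op_sandwich]
  congr 1
  show (U : H →L[ℂ] H) * ((snd x).op * star (U : H →L[ℂ] H)) * U = _
  rw [mul_assoc, mul_assoc, hU, mul_one]

theorem trace_conj (U : unitary (H →L[ℂ] H)) (x : UnitalTraceClass H) :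
    trace H (conj U x) = trace H x := by
  have hU : (star (U : H →L[ℂ] H)).comp (U : H →L[ℂ] H) = .id ℂ H := Unitary.coe_star_mul_self U
  rw [trace_apply, trace_apply, conj_apply, map_add, snd_inr, snd_inl, zero_add, TraceClass.tr_sandwich, hU]
  rfl

end UnitalTraceClass

namespace Om

variable {n : ℕ} {H : Type u} [NormedAddCommGroup H] [InnerProductSpace ℂ H] [CompleteSpace H]

open UnitalTraceClass

theorem map_inl_mul {G : Type*} [NormedRing G] [NormedAlgebra ℝ G]
    (g : UnitalTraceClass H →L[ℝ] G) (s : ℂ →L[ℝ] G) (h : ∀ c x, g (inl H c * x) = s c * g x)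
    (e : Om n ℂ) (w : Om n (UnitalTraceClass H)) :
    map g (map (inl H) e * w) = map s e * map g w := by
  have := map_mul_map (n := n) (inl H) (.id ℝ _) g s g h e w
  rwa [map_id] at this

theorem map_op_conj_mul (U : unitary (H →L[ℂ] H)) (w : Om n (UnitalTraceClass H)) :
    map op (map (conj U) w) * scal n (U : H →L[ℂ] H) = scal n (U : H →L[ℂ] H) * map op w := by
  have h : ((ContinuousLinearMap.mul ℝ (H →L[ℂ] H)).flip (U : H →L[ℂ] H)).comp (op.comp (conj U))
      = (ContinuousLinearMap.mul ℝ (H →L[ℂ] H) (U : H →L[ℂ] H)).comp op :=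
    ContinuousLinearMap.ext fun x => op_conj_mul U x
  rw [← map_mul_left, ← map_mul_right, map_map, map_map, map_map, ContinuousLinearMap.comp_assoc, h]

theorem mul_scal_unitary_cancel {U : unitary (H →L[ℂ] H)} {a b : Om n (H →L[ℂ] H)}
    (h : a * scal n (U : H →L[ℂ] H) = b * scal n (U : H →L[ℂ] H)) : a = b := by
  have h1 : scal n (U : H →L[ℂ] H) * scal n (star (U : H →L[ℂ] H)) = 1 := by
    rw [scal_mul_scal, show (U : H →L[ℂ] H) * star (U : H →L[ℂ] H) = 1 from
      Unitary.coe_mul_star_self U, scal_one]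
  have := congrArg (· * scal n (star (U : H →L[ℂ] H))) h
  simpa only [mul_assoc, h1, mul_one] using this

theorem map_scalarOp_comm {s : Om n ℂ} (hs : par s = s) (z : Om n (H →L[ℂ] H)) :
    map (scalarOp H) s * z = z * map (scalarOp H) s := by
  have := map_mul_comm_of_even (scalarOp H) (.id ℝ _) (.id ℝ (H →L[ℂ] H)) (fun c x => by simp) hs z
  rwa [map_id, map_id, map_id] at this

theorem map_scalarOp_anticomm {s : Om n ℂ} (hs : par s = -s) (z : Om n (H →L[ℂ] H)) :
    map (scalarOp H) s * z = par z * map (scalarOp H) s := by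
  have := map_mul_comm_of_odd (scalarOp H) (.id ℝ _) (.id ℝ (H →L[ℂ] H)) (fun c x => by simp) hs z
  rwa [map_id, map_id, map_id, map_id] at this

theorem map_scalarOp_exp (s : Om n ℂ) :
    map (scalarOp H) (NormedSpace.exp s) = NormedSpace.exp (map (scalarOp H) s) :=
  map_exp_real (R := Om n ℂ) (R' := Om n (H →L[ℂ] H)) _
    (map_one _ (by simp)) (map_mul _ fun c c' => by simp [smul_smul, mul_comm]) s

/-- Conjugate even forms, up to a scalar form, have conjugate exponentials. -/
theorem map_op_mul_exp_gauge {U : unitary (H →L[ℂ] H)} {s : Om n ℂ} (hs : par s = s)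
    {a b S T : Om n (UnitalTraceClass H)}
    (hab : map op a * scal n (U : H →L[ℂ] H) = scal n (U : H →L[ℂ] H) * map op b)
    (h : map op S * scal n (U : H →L[ℂ] H) = scal n (U : H →L[ℂ] H) * map op T
      + map (scalarOp H) s * scal n (U : H →L[ℂ] H)) :
    map op (a * NormedSpace.exp S)
      = map op (map (inl H) (NormedSpace.exp s) * map (conj U) (b * NormedSpace.exp T)) := by
  refine mul_scal_unitary_cancel (U := U) ?_
  have h1 := exp_mul_eq_mul_exp_mul_exp (R := Om n (H →L[ℂ] H)) (map_scalarOp_comm hs) h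
  rw [map_inl_mul op (scalarOp H) op_inl_mul, mul_assoc, map_op_conj_mul, map_op_mul, map_op_exp,
    mul_assoc, h1, map_op_mul, map_op_exp, map_scalarOp_exp, ← map_scalarOp_exp]
  have hs' : par (NormedSpace.exp s) = NormedSpace.exp s := par_exp hs
  rw [map_scalarOp_comm hs', ← mul_assoc, ← mul_assoc, hab]
  simp only [mul_assoc]

theorem ext_map_fst_op {a b : Om n (UnitalTraceClass H)} (h1 : map fst a = map fst b)
    (h2 : map op a = map op b) : a = b := by
  ext k v : 2
  refine ext_fst_op ?_ ?_
  · simpa using congrArg (fun w : Om n ℂ => w k v) h1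
  · simpa using congrArg (fun w : Om n (H →L[ℂ] H) => w k v) h2

theorem map_fst_map_conj (U : unitary (H →L[ℂ] H)) (w : Om n (UnitalTraceClass H)) :
    map fst (map (conj U) w) = map fst w := by
  rw [map_map, show fst.comp (conj U) = fst from ContinuousLinearMap.ext (fst_conj U)]

theorem map_trace_map_conj (U : unitary (H →L[ℂ] H)) (w : Om n (UnitalTraceClass H)) :
    map (trace H) (map (conj U) w) = map (trace H) w := by
  rw [map_map, show (trace H).comp (conj U) = trace H from ContinuousLinearMap.ext (trace_conj U)]

theorem map_trace_inl_mul (e : Om n ℂ) (w : Om n (UnitalTraceClass H)) :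
    map (trace H) (map (inl H) e * w) = e * map (trace H) w := by
  have := map_inl_mul (trace H) (.id ℝ ℂ) trace_inl_mul e w
  rwa [map_id] at this

theorem map_fst_inl_mul (e : Om n ℂ) (w : Om n (UnitalTraceClass H)) :
    map fst (map (inl H) e * w) = e * map fst w := by
  have := map_inl_mul fst (.id ℝ ℂ) fst_inl_mul e w
  rwa [map_id] at this

end Om
end

noncomputable section

section GaugeRelations

open Om

variable {Q Q' V : Type u} [NormedAddCommGroup V] [InnerProductSpace ℂ V] [CompleteSpace V]
  [DiffeologicalSpace Q] [MulAction (Circle × Circle) Q]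
  [DiffeologicalSpace Q'] [MulAction (Circle × Circle) Q'] {n m : ℕ}

/-- The scalar form `dc - ι_K c`. -/
def gaugeScalar (c : FormFamily Q ℂ 1) (q : Eu n → Q) (x : Eu n) : Om n ℂ :=
  d (fun y => single 1 (c n q y)) x - single 0 (contract flowT c n q x)

theorem isTotalForm_gaugeScalar (hQ : IsSmoothTorusAction Q) {c : FormFamily Q ℂ 1}
    (hc : IsFormOn Set.univ c) : IsTotalForm fun n q x => gaugeScalar (n := n) c q x :=
  hc.isTotalForm.d.sub ((smoothFlow_flowT hQ).isFormOn_contract hc).isTotalForm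

theorem par_d_of_odd {R : Type*} [NormedRing R] [NormedAlgebra ℝ R] {f : Eu n → Om n R} {x : Eu n}
    (hf : DifferentiableAt ℝ f x) (ho : ∀ y, par (f y) = -f y) : par (d f x) = d f x := by
  rw [par_d hf, funext ho, d_neg, neg_neg]

theorem par_single_one {F : Type*} [NormedAddCommGroup F] [NormedSpace ℝ F] (a : Alt n F 1) :
    par (single 1 a) = -single 1 a := by
  rw [par_single, pow_one, neg_one_smul]

theorem par_single_zero {F : Type*} [NormedAddCommGroup F] [NormedSpace ℝ F] (a : Alt n F 0) :
    par (single 0 a) = single 0 a := by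
  rw [par_single, pow_zero, one_smul]

theorem par_gaugeScalar {c : FormFamily Q ℂ 1} (hc : IsFormOn Set.univ c) {q : Eu n → Q}
    (hq : IsPlot q) (x : Eu n) : par (gaugeScalar c q x) = gaugeScalar c q x := by
  have h := (hc.isTotalForm.contDiff hq).contDiffAt.differentiableAt (x := x) (by simp)
  rw [gaugeScalar, map_sub, par_single_zero, par_d_of_odd h fun y => par_single_one _]

/-- A relation between frames along which the connections `A'` and `A + c` are identified by the
unitary operators `φ`. -/
structure GaugeRel (A : FormFamily Q (TraceClass V) 1) (A' : FormFamily Q' (TraceClass V) 1)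
    (rel : Q → Q' → Prop) (φ : Q → Q' → unitary (V →L[ℂ] V)) (c : FormFamily Q ℂ 1) : Prop where
  rel_smul : ∀ {q r}, rel q r → ∀ t : Circle × Circle, rel (t • q) (t • r)
  φ_smul : ∀ {q r}, rel q r → ∀ t : Circle × Circle, φ (t • q) (t • r) = φ q r
  contDiff : ∀ {n : ℕ} {q : Eu n → Q} {r : Eu n → Q'}, IsPlot q → IsPlot r →
    (∀ y, rel (q y) (r y)) → ContDiff ℝ ∞ fun y => (φ (q y) (r y) : V →L[ℂ] V)
  isForm : IsFormOn Set.univ c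
  parallel : ∀ {n : ℕ} {q : Eu n → Q} {r : Eu n → Q'}, IsPlot q → IsPlot r →
    (∀ y, rel (q y) (r y)) → ∀ x (v : Fin 1 → Eu n),
      fderiv ℝ (fun y => (φ (q y) (r y) : V →L[ℂ] V)) x (v 0)
        = (φ (q x) (r x) : V →L[ℂ] V) * opForm A' n r x v
          - opForm A n q x v * (φ (q x) (r x) : V →L[ℂ] V)
          - c n q x v • (φ (q x) (r x) : V →L[ℂ] V)

variable {A : FormFamily Q (TraceClass V) 1} {A' : FormFamily Q' (TraceClass V) 1}
  {rel : Q → Q' → Prop} {φ : Q → Q' → unitary (V →L[ℂ] V)} {c : FormFamily Q ℂ 1}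

theorem map_op_connForm_apply (A : FormFamily Q (TraceClass V) 1) (q : Eu n → Q) (x : Eu n) :
    map UnitalTraceClass.op (connForm A q x) = single 1 (opForm A n q x) := by
  rw [connForm_eq, map_map, map_single]
  congr 1
  ext v : 1
  exact UnitalTraceClass.op_inr _

theorem d_scal_gauge (h : GaugeRel A A' rel φ c) {q : Eu n → Q} {r : Eu n → Q'} (hq : IsPlot q)
    (hr : IsPlot r) (hqr : ∀ y, rel (q y) (r y)) (x : Eu n) :
    d (fun y => scal n (φ (q y) (r y) : V →L[ℂ] V)) x
      = scal n (φ (q x) (r x) : V →L[ℂ] V) * map UnitalTraceClass.op (connForm A' r x)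
        - map UnitalTraceClass.op (connForm A q x) * scal n (φ (q x) (r x) : V →L[ℂ] V)
        - map (UnitalTraceClass.scalarOp V) (single 1 (c n q x))
          * scal n (φ (q x) (r x) : V →L[ℂ] V) := by
  rw [d_scal ((h.contDiff hq hr hqr).contDiffAt.differentiableAt (by simp)),
    map_op_connForm_apply, map_op_connForm_apply, ← Om.map_mul_left, ← Om.map_mul_right,
    ← Om.map_mul_right, map_single, map_single, map_map, map_single]
  rw [← map_sub (single (n := n) (F := V →L[ℂ] V) 1), ← map_sub (single (n := n) (F := V →L[ℂ] V) 1)]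
  congr 1
  ext v : 1
  refine (h.parallel hq hr hqr x v).trans ?_
  show _ = _ - _ - (c n q x v • (1 : V →L[ℂ] V)) * (φ (q x) (r x) : V →L[ℂ] V)
  rw [smul_mul_assoc, one_mul]
  rfl

/-- The equivariant curvatures of gauge equivalent connections are conjugate up to a scalar. -/
theorem map_op_curvForm_gauge (hQ : IsSmoothTorusAction Q) (hQ' : IsSmoothTorusAction Q')
    (hA : InvariantConnection A) (hA' : InvariantConnection A') (h : GaugeRel A A' rel φ c)
    {q : Eu n → Q} {r : Eu n → Q'} (hq : IsPlot q) (hr : IsPlot r) (hqr : ∀ y, rel (q y) (r y))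
    (x : Eu n) :
    map UnitalTraceClass.op (curvForm A q x) * scal n (φ (q x) (r x) : V →L[ℂ] V)
      = scal n (φ (q x) (r x) : V →L[ℂ] V) * map UnitalTraceClass.op (curvForm A' r x)
        + map (UnitalTraceClass.scalarOp V) (gaugeScalar c q x)
          * scal n (φ (q x) (r x) : V →L[ℂ] V) := by
  have hfl := smoothFlow_flowT hQ
  have hfl' := smoothFlow_flowT hQ'
  have hF := hfl.plot hq
  have hF' := hfl'.plot hr
  have hrel : ∀ z, rel (flowOut flowT q z) (flowOut flowT r z) := fun z => h.rel_smul (hqr _) _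
  have hφ : ∀ z, φ (flowOut flowT q z) (flowOut flowT r z)
      = φ (q (tailL n z)) (r (tailL n z)) := fun z => h.φ_smul (hqr _) _
  have ca := (hA.isTotalForm_connForm.map UnitalTraceClass.op).contDiff hF
  have cb := (hA'.isTotalForm_connForm.map UnitalTraceClass.op).contDiff hF'
  have cc := (h.isForm.isTotalForm.map (UnitalTraceClass.scalarOp V)).contDiff hF
  have cg := contDiff_scal (n := n + 1) (h.contDiff hF hF' hrel)
  have oc : ∀ z, par (map (UnitalTraceClass.scalarOp V) (single 1 (c (n + 1) (flowOut flowT q) z)))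
      = -map (UnitalTraceClass.scalarOp V) (single 1 (c (n + 1) (flowOut flowT q) z)) := fun z => by
    rw [par_map, par_single_one, map_neg]
  have oa : ∀ z, par (map UnitalTraceClass.op (connForm A (flowOut flowT q) z))
      = -map UnitalTraceClass.op (connForm A (flowOut flowT q) z) := fun z => by
    rw [par_map, par_connForm, map_neg]
  have hdy : ctr (timeVec n) (d (fun z => scal (n + 1) (φ (flowOut flowT q z) (flowOut flowT r z) :
      V →L[ℂ] V)) (zeroSlice n x)) = 0 := by
    have h0 : fderiv ℝ (fun z => (φ (flowOut flowT q z) (flowOut flowT r z) : V →L[ℂ] V))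
        (zeroSlice n x) (timeVec n) = 0 := by
      have hd : DifferentiableAt ℝ
          (fun z => (φ (flowOut flowT q z) (flowOut flowT r z) : V →L[ℂ] V)) (zeroSlice n x) :=
        (h.contDiff hF hF' hrel).contDiffAt.differentiableAt (by simp)
      rw [← hd.lineDeriv_eq_fderiv, lineDeriv]
      simp only [hφ, map_add, map_smul, tailL_timeVec, smul_zero, add_zero, deriv_const]
    rw [d_scal ((h.contDiff hF hF' hrel).contDiffAt.differentiableAt (by simp)), ctr_single_succ]
    refine (congrArg (single 0) ?_).trans (single 0).map_zero
    ext v : 1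
    exact h0
  have key := curv_mul_gauge (y := timeVec n) ca cb cc cg oa oc (fun z => par_scal _)
    (d_scal_gauge h hF hF' hrel) (x := zeroSlice n x) (ctr_scal _ _) hdy
    (map_scalarOp_anticomm (par_single_one _))
  rw [← map_curv _ UnitalTraceClass.op_mul _ (hA.isTotalForm_connForm.contDiff hF),
    ← map_curv _ UnitalTraceClass.op_mul _ (hA'.isTotalForm_connForm.contDiff hF'),
    ← hA.curvForm_flowOut hQ hq, ← hA'.curvForm_flowOut hQ' hr] at key
  have hs : d (fun z => map (UnitalTraceClass.scalarOp V)
        (single 1 (c (n + 1) (flowOut flowT q) z))) (zeroSlice n x)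
      - ctr (timeVec n) (map (UnitalTraceClass.scalarOp V)
        (single 1 (c (n + 1) (flowOut flowT q) (zeroSlice n x))))
      = map (UnitalTraceClass.scalarOp V) (gaugeScalar c (flowOut flowT q) (zeroSlice n x)) := by
    rw [gaugeScalar, hfl.contract_flowOut (W := Set.univ) (fun _ _ _ => trivial) h.isForm hq
      (fun _ => trivial), map_sub, ctr_map, ctr_single_succ, d_map]
    exact (h.isForm.isTotalForm.contDiff hF).contDiffAt.differentiableAt (by simp)
  rw [hs, hφ, tailL_zeroSlice] at key
  have key2 := congrArg (comap (zeroSlice n)) key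
  rw [map_add, comap_mul, comap_mul, comap_mul, comap_scal, ← map_comap, ← map_comap, ← map_comap,
    ← (hA.isTotalForm_curvForm hQ).zeroSlice hfl hq, ← (hA'.isTotalForm_curvForm hQ').zeroSlice hfl' hr,
    ← (isTotalForm_gaugeScalar hQ h.isForm).zeroSlice hfl hq] at key2
  exact key2

theorem InvariantConnection.differentiableAt (hA : InvariantConnection A) {q : Eu n → Q}
    (hq : IsPlot q) (x : Eu n) : DifferentiableAt ℝ (A n q) x :=
  (hA.isForm.1 n q hq x trivial).differentiableAt (by simp)

theorem exp_curvForm_gauge (hQ : IsSmoothTorusAction Q) (hQ' : IsSmoothTorusAction Q')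
    (hA : InvariantConnection A) (hA' : InvariantConnection A') (h : GaugeRel A A' rel φ c)
    {q : Eu n → Q} {r : Eu n → Q'} (hq : IsPlot q) (hr : IsPlot r) (hqr : ∀ y, rel (q y) (r y))
    (x : Eu n) :
    map UnitalTraceClass.op (NormedSpace.exp (curvForm A q x))
      = map UnitalTraceClass.op (map (UnitalTraceClass.inl V) (NormedSpace.exp (gaugeScalar c q x))
        * map (UnitalTraceClass.conj (φ (q x) (r x))) (NormedSpace.exp (curvForm A' r x))) := by
  have h1 := map_op_mul_exp_gauge (par_gaugeScalar h.isForm hq x) (a := 1) (b := 1)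
    (U := φ (q x) (r x)) (by rw [map_one _ UnitalTraceClass.op_one, one_mul, mul_one])
    (map_op_curvForm_gauge hQ hQ' hA hA' h hq hr hqr x)
  rwa [one_mul, one_mul] at h1

/-- The difference of the Chern characters of two modules depends on the frames only through a
scalar factor. -/
theorem chernTrace_sub_gauge {P P' : Type u} [DiffeologicalSpace P]
    [MulAction (Circle × Circle) P] [DiffeologicalSpace P'] [MulAction (Circle × Circle) P']
    {B : FormFamily P (TraceClass V) 1} {B' : FormFamily P' (TraceClass V) 1}
    {rel' : P → P' → Prop} {ψ : P → P' → unitary (V →L[ℂ] V)} {c' : FormFamily P ℂ 1}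
    (hQ : IsSmoothTorusAction Q) (hQ' : IsSmoothTorusAction Q')
    (hP : IsSmoothTorusAction P) (hP' : IsSmoothTorusAction P')
    (hA : InvariantConnection A) (hA' : InvariantConnection A') (h : GaugeRel A A' rel φ c)
    (hB : InvariantConnection B) (hB' : InvariantConnection B') (h' : GaugeRel B B' rel' ψ c')
    {q : Eu n → Q} {r : Eu n → Q'} (hq : IsPlot q) (hr : IsPlot r) (hqr : ∀ y, rel (q y) (r y))
    {s : Eu n → P} {t : Eu n → P'} (hs : IsPlot s) (ht : IsPlot t) (hst : ∀ y, rel' (s y) (t y))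
    (x : Eu n) (hc : gaugeScalar c q x = gaugeScalar c' s x) :
    chernTrace A q x - chernTrace B s x
      = NormedSpace.exp (gaugeScalar c q x) * (chernTrace A' r x - chernTrace B' t x) := by
  have h1 := exp_curvForm_gauge hQ hQ' hA hA' h hq hr hqr x
  have h2 := exp_curvForm_gauge hP hP' hB hB' h' hs ht hst x
  rw [← hc] at h2
  have f1 := map_fst_exp (map_fst_curvForm (hA.differentiableAt hq x))
  have f2 := map_fst_exp (map_fst_curvForm (hB.differentiableAt hs x))
  have f3 := map_fst_exp (map_fst_curvForm (hA'.differentiableAt hr x))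
  have f4 := map_fst_exp (map_fst_curvForm (hB'.differentiableAt ht x))
  have key : NormedSpace.exp (curvForm A q x) - NormedSpace.exp (curvForm B s x)
      = map (UnitalTraceClass.inl V) (NormedSpace.exp (gaugeScalar c q x))
        * (map (UnitalTraceClass.conj (φ (q x) (r x))) (NormedSpace.exp (curvForm A' r x))
          - map (UnitalTraceClass.conj (ψ (s x) (t x))) (NormedSpace.exp (curvForm B' t x))) := by
    refine ext_map_fst_op ?_ ?_
    · rw [map_sub, f1, f2, map_fst_inl_mul, map_sub, map_fst_map_conj, map_fst_map_conj, f3, f4]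
      exact (sub_self _).trans ((mul_zero _).symm.trans (congrArg _ (sub_self _).symm))
    · rw [map_sub, h1, h2, mul_sub, map_sub]
  have k2 := congrArg (map (UnitalTraceClass.trace V)) key
  rw [map_sub, map_trace_inl_mul, map_sub, map_trace_map_conj, map_trace_map_conj] at k2
  exact k2

theorem chernTrace_gauge (hQ : IsSmoothTorusAction Q) (hQ' : IsSmoothTorusAction Q')
    (hA : InvariantConnection A) (hA' : InvariantConnection A') (h : GaugeRel A A' rel φ c)
    {q : Eu n → Q} {r : Eu n → Q'} (hq : IsPlot q) (hr : IsPlot r) (hqr : ∀ y, rel (q y) (r y))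
    (x : Eu n) (hc : gaugeScalar c q x = 0) : chernTrace A q x = chernTrace A' r x := by
  have h1 := exp_curvForm_gauge hQ hQ' hA hA' h hq hr hqr x
  have he : NormedSpace.exp (gaugeScalar c q x) = 1 := by rw [hc]; exact NormedSpace.exp_zero
  have hi : map (UnitalTraceClass.inl V) (1 : Om n ℂ) = 1 :=
    map_one _ (by rw [UnitalTraceClass.inl_apply, one_smul])
  rw [he, hi, one_mul] at h1
  have key : NormedSpace.exp (curvForm A q x)
      = map (UnitalTraceClass.conj (φ (q x) (r x))) (NormedSpace.exp (curvForm A' r x)) := by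
    refine ext_map_fst_op ?_ h1
    rw [map_fst_map_conj, map_fst_exp (map_fst_curvForm (hA.differentiableAt hq x)),
      map_fst_exp (map_fst_curvForm (hA'.differentiableAt hr x))]
  rw [chernTrace, chernTrace, key, map_trace_map_conj]

theorem GaugeRel.interpolate {A₀ A₁ : FormFamily Q (TraceClass V) 1}
    {A₀' A₁' : FormFamily Q' (TraceClass V) 1} (h₀ : GaugeRel A₀ A₀' rel φ c)
    (h₁ : GaugeRel A₁ A₁' rel φ c) (t : ℝ) :
    GaugeRel (interpolate A₀ A₁ t) (interpolate A₀' A₁' t) rel φ c where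
  rel_smul := h₀.rel_smul
  φ_smul := h₀.φ_smul
  contDiff := h₀.contDiff
  isForm := h₀.isForm
  parallel {n q r} hq hr hqr x v := by
    have e : ∀ {P : Type u} (B₀ B₁ : FormFamily P (TraceClass V) 1) (p : Eu n → P),
        opForm (_root_.interpolate B₀ B₁ t) n p x v
          = (1 - t) • opForm B₀ n p x v + t • opForm B₁ n p x v := fun _ _ _ => rfl
    have e₀ := h₀.parallel hq hr hqr x v
    have e₁ := h₁.parallel hq hr hqr x v
    rw [e, e]
    generalize fderiv ℝ (fun y => (φ (q y) (r y) : V →L[ℂ] V)) x (v 0) = f at *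
    generalize (φ (q x) (r x) : V →L[ℂ] V) = g, opForm A₀ n q x v = a₀, opForm A₁ n q x v = a₁,
      opForm A₀' n r x v = b₀, opForm A₁' n r x v = b₁ at *
    have hf : f = (1 - t) • f + t • f := by rw [← add_smul, sub_add_cancel, one_smul]
    generalize c n q x v • g = cg at *
    rw [hf]
    nth_rewrite 1 [e₀]
    rw [e₁]
    simp only [mul_add, add_mul, smul_mul_assoc, mul_smul_comm, smul_sub]
    have hcg : (1 - t) • cg + t • cg = cg := by rw [← add_smul, sub_add_cancel, one_smul]
    conv_rhs => rw [← hcg]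
    abel

theorem neg_sub_mul_eq_of_sub_eq {R : Type*} [Ring R] {a₀ a₁ b₀ b₁ g : R}
    (h : g * b₀ - a₀ * g = g * b₁ - a₁ * g) : -(a₁ - a₀) * g = g * -(b₁ - b₀) := by
  have e1 : -(a₁ - a₀) * g = a₀ * g - a₁ * g := by noncomm_ring
  have e2 : g * -(b₁ - b₀) = g * b₀ - g * b₁ := by noncomm_ring
  rw [e1, e2]
  rw [sub_eq_sub_iff_add_eq_add] at h ⊢
  rw [add_comm, ← h, add_comm]

theorem csTrace_gauge {A₀ A₁ : FormFamily Q (TraceClass V) 1}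
    {A₀' A₁' : FormFamily Q' (TraceClass V) 1} (hQ : IsSmoothTorusAction Q)
    (hQ' : IsSmoothTorusAction Q') (hA₀ : InvariantConnection A₀) (hA₁ : InvariantConnection A₁)
    (hA₀' : InvariantConnection A₀') (hA₁' : InvariantConnection A₁')
    (h₀ : GaugeRel A₀ A₀' rel φ c) (h₁ : GaugeRel A₁ A₁' rel φ c)
    {q : Eu n → Q} {r : Eu n → Q'} (hq : IsPlot q) (hr : IsPlot r) (hqr : ∀ y, rel (q y) (r y))
    (x : Eu n) :
    csTrace A₀ A₁ q x = NormedSpace.exp (gaugeScalar c q x) * csTrace A₀' A₁' r x := by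
  have key : ∀ t, transForm A₀ A₁ t q x = map (UnitalTraceClass.inl V)
      (NormedSpace.exp (gaugeScalar c q x)) * map (UnitalTraceClass.conj (φ (q x) (r x)))
        (transForm A₀' A₁' t r x) := fun t => by
    refine ext_map_fst_op ?_ ?_
    · rw [map_fst_transForm, map_fst_inl_mul, map_fst_map_conj, map_fst_transForm]
      exact (mul_zero _).symm
    · refine map_op_mul_exp_gauge (par_gaugeScalar h₀.isForm hq x) ?_
        (map_op_curvForm_gauge hQ hQ' (hA₀.interpolate hA₁ t) (hA₀'.interpolate hA₁' t)
          (h₀.interpolate h₁ t) hq hr hqr x)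
      have e₀ := d_scal_gauge h₀ hq hr hqr x
      have e₁ := d_scal_gauge h₁ hq hr hqr x
      rw [e₀, sub_left_inj] at e₁
      rw [map_neg, map_neg, map_sub, map_sub]
      exact neg_sub_mul_eq_of_sub_eq e₁
  have hc := continuous_transForm hQ' hA₀' hA₁' hr x
  have h := const_mul_integral (R := Om n ℂ) (NormedSpace.exp (gaugeScalar c q x))
    (f := fun t => map (UnitalTraceClass.trace V) (transForm A₀' A₁' t r x))
    ((map (UnitalTraceClass.trace V)).continuous.comp hc)
  refine Eq.trans ?_ h.symm
  refine intervalIntegral.integral_congr fun t _ => ?_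
  show map (UnitalTraceClass.trace V) _ = _ * map (UnitalTraceClass.trace V) _
  rw [key, map_trace_inl_mul, map_trace_map_conj]

end GaugeRelations
end

noncomputable section

namespace Om
section ScalarGauge

variable {n : ℕ} {K : Type*} [NontriviallyNormedField K] [NormedAlgebra ℝ K] [CompleteSpace K]

theorem exp_scal (z : K) : NormedSpace.exp (scal n z) = scal n (NormedSpace.exp z) := by
  let f : K →L[ℝ] Om n K := (single (F := K) (n := n) 0).comp
    (ContinuousAlternatingMap.constOfIsEmptyLIE ℝ (Eu n) K
      (Fin 0)).toContinuousLinearEquiv.toContinuousLinearMap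
  exact (map_exp_real (R := K) (R' := Om n K) f scal_one
    (fun x y => (scal_mul_scal x y).symm) z).symm

theorem chernFactor_gauge {c c' z : K} {b b' : Alt n K 2} (h : c⁻¹ = NormedSpace.exp z * c'⁻¹) :
    NormedSpace.exp (scal n z + single 2 (-(b - b'))) * chernFactor c' b' = chernFactor c b := by
  have e1 : ∀ w : Om n K, single 2 (-(b - b')) * w = w * single 2 (-(b - b')) :=
    mul_comm_of_even (par_single_two _)
  have e2 : ∀ w : Om n K, scal n (c'⁻¹) * w = w * scal n (c'⁻¹) := mul_comm_of_even (par_scal _)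
  have e3 : (single 2 (-b) : Om n K) = single 2 (-(b - b')) + single 2 (-b') := by
    rw [← map_add]
    congr 1
    abel
  rw [chernFactor, chernFactor, h, e3, exp_add_of_commute_real (R := Om n K) (e1 _),
    exp_add_of_commute_real (R := Om n K) (e1 _).symm, exp_scal, ← scal_mul_scal]
  simp only [mul_assoc]
  congr 1
  rw [← mul_assoc, ← mul_assoc, e2]

theorem glue_of_gauge {s a b t t' : Om n K} (hs : par s = s) (h : NormedSpace.exp (-s) * b = a)
    (ht : t = NormedSpace.exp s * t') : a * t = b * t' := by
  have e1 : NormedSpace.exp (-s) * b = b * NormedSpace.exp (-s) :=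
    mul_comm_of_even (par_exp (by rw [map_neg, hs])) b
  have e2 : NormedSpace.exp (-s) * NormedSpace.exp s = (1 : Om n K) := by
    rw [← exp_add_of_commute_real (R := Om n K) (Commute.neg_left (Commute.refl s)),
      neg_add_cancel]
    exact NormedSpace.exp_zero
  rw [ht, ← h, e1, mul_assoc, ← mul_assoc (NormedSpace.exp (-s)), e2, one_mul]

theorem chernFactor_mul_left (t c : K) (b : Alt n K 2) :
    chernFactor (t * c) b = scal n t⁻¹ * chernFactor c b := by
  rw [chernFactor, chernFactor, mul_inv, ← scal_mul_scal, mul_assoc]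

theorem neg_sub_eq_add_neg {R : Type*} [AddCommGroup R] (a b : R) : -(a - b) = b + -a := by abel

theorem mul_mul_of_eq {R : Type*} [Ring R] {e e' s t : R} (h : e' = s * e) :
    e' * t = s * (e * t) := by rw [h, mul_assoc]

end ScalarGauge
end Om

section Gluing

open Om

variable {X F : Type*} [DiffeologicalSpace X] [NormedAddCommGroup F] [NormedSpace ℝ F]

/-- Compatible local forms glue. -/
theorem exists_isTotalForm_glue {ι : Type*} {Q : ι → Type*} [∀ α, DiffeologicalSpace (Q α)]
    (pr : ∀ α, Q α → X) (hpr : ∀ α, DSmooth (pr α))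
    (hlift : ∀ (n : ℕ) (p : Eu n → X), IsPlot p → ∀ x, ∃ α, ∃ q : Eu n → Q α, IsPlot q ∧
      ∀ᶠ y in 𝓝 x, pr α (q y) = p y)
    (w : ∀ α, TotalFamily (Q α) F) (hw : ∀ α, IsTotalForm (w α))
    (hglue : ∀ α β (n : ℕ) (q : Eu n → Q α) (r : Eu n → Q β), IsPlot q → IsPlot r →
      (∀ y, pr α (q y) = pr β (r y)) → ∀ x, w α n q x = w β n r x) :
    ∃ W : TotalFamily X F, IsTotalForm W ∧ ∀ α (n : ℕ) (q : Eu n → Q α), IsPlot q → ∀ x,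
      W n (fun y => pr α (q y)) x = w α n q x := by
  classical
  have hgerm : ∀ α β (n : ℕ) (q : Eu n → Q α) (r : Eu n → Q β), IsPlot q → IsPlot r → ∀ x,
      (∀ᶠ y in 𝓝 x, pr α (q y) = pr β (r y)) → w α n q x = w β n r x := by
    intro α β n q r hq hr x h
    obtain ⟨c, hc, hcx, hcU⟩ := exists_cutoff x h
    have e1 := (hw α).congr_germ hq (isPlot_reparam hq hc)
      (hcx.mono fun y hy => congrArg q hy.symm)
    have e2 := (hw β).congr_germ hr (isPlot_reparam hr hc)
      (hcx.mono fun y hy => congrArg r hy.symm)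
    rw [e1, e2]
    exact hglue α β n _ _ (isPlot_reparam hq hc) (isPlot_reparam hr hc) (fun y => hcU y) x
  let W : TotalFamily X F := fun n p x =>
    if h : IsPlot p then w _ n (hlift n p h x).choose_spec.choose x else 0
  have hW : ∀ (n : ℕ) (p : Eu n → X), IsPlot p → ∀ x α (q : Eu n → Q α), IsPlot q →
      (∀ᶠ y in 𝓝 x, pr α (q y) = p y) → W n p x = w α n q x := by
    intro n p hp x α q hq h
    have hs := (hlift n p hp x).choose_spec.choose_spec
    simp only [W, dif_pos hp]
    refine hgerm _ _ n _ _ hs.1 hq x ?_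
    filter_upwards [hs.2, h] with y h1 h2
    rw [h1, h2]
  refine ⟨W, ⟨fun {n p} hp => ?_, fun {n m p h} hp hh y => ?_⟩, fun α n q hq x => ?_⟩
  · refine contDiff_iff_contDiffAt.2 fun x => ?_
    obtain ⟨α, q, hq, h⟩ := hlift n p hp x
    refine ((hw α).contDiff hq).contDiffAt.congr_of_eventuallyEq ?_
    filter_upwards [h.eventually_nhds] with y hy
    exact hW n p hp y α q hq hy
  · obtain ⟨α, q, hq, hqp⟩ := hlift n p hp (h y)
    rw [hW n p hp (h y) α q hq hqp, hW m (p ∘ h) (isPlot_reparam hp hh) y α (q ∘ h)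
      (isPlot_reparam hq hh) (hh.continuous.continuousAt.eventually hqp), (hw α).comp hq hh]
  · exact hW n _ (hpr α n q hq) x α q hq (Filter.Eventually.of_forall fun _ => rfl)

end Gluing

section CircleBundleForms

open Om

variable {M : Type u} [DiffeologicalSpace M] [MulAction Circle M] {ι : Type u}
  {𝒰 : GoodCover M ι} {L : HermitianLineBundle 𝒰} {𝒢 : WeakInvariantGerbe 𝒰} {n m : ℕ}

theorem coordAt_of_mem {α : ι} {s : CircleBundle L} (h : s.base ∈ 𝒰.U α) :
    s.coordAt α = s.coord α h := dif_pos h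

theorem coordAt_smul {α : ι} {s : CircleBundle L} (h : s.base ∈ 𝒰.U α) (t c : Circle) :
    ((t, c) • s).coordAt α = c * s.coordAt α := by
  have h' : ((t, c) • s).base ∈ 𝒰.U α := (𝒰.smul_mem_iff α t s.base).2 h
  rw [coordAt_of_mem h, coordAt_of_mem h']
  rfl

theorem coordAt_eq {α β : ι} {s : CircleBundle L} (hα : s.base ∈ 𝒰.U α) (hβ : s.base ∈ 𝒰.U β) :
    s.coordAt α = L.g α β s.base * s.coordAt β := by
  rw [coordAt_of_mem hα, coordAt_of_mem hβ]
  exact s.compat α β hα hβ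

theorem isPlot_proj {p : Eu n → CircleBundle L} (hp : IsPlot p) : IsPlot (proj p) := hp.1

theorem contDiff_coordAt {α : ι} {p : Eu n → CircleBundle L} (hp : IsPlot p)
    (hpα : ∀ y, p y ∈ CircleBundle.over L α) : ContDiff ℝ ∞ fun y => ((p y).coordAt α : ℂ) :=
  contDiff_iff_contDiffAt.2 fun x => hp.2 α x (hpα x)

theorem eventually_mem {α : ι} {p : Eu n → M} (hp : IsPlot p) {x : Eu n} (hx : p x ∈ 𝒰.U α) :
    ∀ᶠ y in 𝓝 x, p y ∈ 𝒰.U α :=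
  (isOpen_iff_preimages_plots.1 (𝒰.isOpen α) n p hp).mem_nhds hx

theorem isSmoothTorusAction_circleBundle (hM : IsSmoothCircleAction M) :
    IsSmoothTorusAction (CircleBundle L) := by
  intro n c d p hc hd hp
  refine ⟨hM n c _ hc hp.1, fun α x hx => ?_⟩
  have hx' : (p x).base ∈ 𝒰.U α := (𝒰.smul_mem_iff α (c x) _).1 hx
  have hU : ∀ᶠ y in 𝓝 x, (p y).base ∈ 𝒰.U α := eventually_mem hp.1 hx'
  refine (hd.contDiffAt.mul (hp.2 α x hx')).congr_of_eventuallyEq ?_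
  filter_upwards [hU] with y hy
  rw [coordAt_smul hy, Circle.coe_mul]

theorem flowK_mem (α : ι) (t : ℝ) (x : M) (hx : x ∈ 𝒰.U α) : flowK t x ∈ 𝒰.U α :=
  (𝒰.smul_mem_iff α _ x).2 hx

theorem proj_flowOut (p : Eu n → CircleBundle L) :
    proj (flowOut flowT p) = flowOut flowK (proj p) := rfl

/-- The local factor is a form on each space over `π⁻¹(U_α)`. -/
theorem isTotalForm_expFactor {Q : Type*} [DiffeologicalSpace Q] {pr : Q → CircleBundle L}
    (hpr : DSmooth pr) {α : ι} (hα : ∀ q, pr q ∈ CircleBundle.over L α) :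
    IsTotalForm fun n q x => expFactor (n := n) 𝒢 α (fun y => pr (q y)) x where
  contDiff {n q} hq := contDiff_chernFactor (contDiff_coordAt (hpr n q hq) fun y => hα _)
    (fun x => Circle.coe_ne_zero _)
    ((𝒢.isForm_B α).contDiff (isPlot_proj (hpr n q hq)) fun y => hα _)
  comp {n m q h} hq hh y := by
    rw [expFactor, expFactor, comap_chernFactor]
    congr 1
    exact (𝒢.isForm_B α).2 n m _ h (isPlot_proj (hpr n q hq)) hh y (hα _)

theorem expFactor_twist {α : ι} {p : Eu n → CircleBundle L} (hp : IsPlot p)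
    (hα : ∀ y, p y ∈ CircleBundle.over L α) (t : Circle) (c : Eu n → Circle) (x : Eu n) :
    expFactor 𝒢 α (fun y => (t, c y) • p y) x
      = scal n ((c x : ℂ)⁻¹) * expFactor 𝒢 α p x := by
  have h1 := 𝒢.invariant_B α t n (proj p) (isPlot_proj hp) x (hα x)
  have h2 : expFactor 𝒢 α (fun y => (t, c y) • p y) x
      = chernFactor ((c x : ℂ) * ((p x).coordAt α : ℂ)) (𝒢.B α n (proj p) x) := by
    rw [expFactor, coordAt_smul (hα x), Circle.coe_mul, ← h1]
    rfl
  rw [h2]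
  exact chernFactor_mul_left _ _ _

/-- The form `A_{αβ}` on a space over `Sξ`. -/
def pullA {Q : Type*} (𝒢 : WeakInvariantGerbe 𝒰) (pr : Q → CircleBundle L) (α β : ι) :
    FormFamily Q ℂ 1 := fun n q x => 𝒢.A α β n (proj fun y => pr (q y)) x

theorem isFormOn_pullA {Q : Type*} [DiffeologicalSpace Q] {pr : Q → CircleBundle L}
    (hpr : DSmooth pr) {α β : ι} (hα : ∀ q, pr q ∈ CircleBundle.over L α)
    (hβ : ∀ q, pr q ∈ CircleBundle.over L β) : IsFormOn Set.univ (pullA 𝒢 pr α β) :=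
  ⟨fun n q hq x _ => (𝒢.isForm_A α β).1 n _ (isPlot_proj (hpr n q hq)) x ⟨hα _, hβ _⟩,
    fun n m q h hq hh y _ => (𝒢.isForm_A α β).2 n m _ h (isPlot_proj (hpr n q hq)) hh y
      ⟨hα _, hβ _⟩⟩

theorem exp_neg_gaugeScalar_mul_expFactor (hc : IsCoupled L 𝒢) {Q : Type*} [DiffeologicalSpace Q]
    [MulAction (Circle × Circle) Q] {pr : Q → CircleBundle L}
    (hpr : DSmooth pr) (heq : ∀ (t : Circle × Circle) q, pr (t • q) = t • pr q) {α β : ι}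
    (hα : ∀ q, pr q ∈ CircleBundle.over L α)
    (hβ : ∀ q, pr q ∈ CircleBundle.over L β) {q : Eu n → Q} (hq : IsPlot q) (x : Eu n) :
    NormedSpace.exp (-gaugeScalar (pullA 𝒢 pr α β) q x) * expFactor 𝒢 β (fun y => pr (q y)) x
      = expFactor 𝒢 α (fun y => pr (q y)) x := by
  have hp := hpr n q hq
  have hA := isFormOn_pullA (𝒢 := 𝒢) hpr hα hβ
  have h1 : d (fun y => single 1 (pullA 𝒢 pr α β n q y)) x
      = single 2 (𝒢.B α n (proj fun y => pr (q y)) x - 𝒢.B β n (proj fun y => pr (q y)) x) := by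
    rw [d_single ((hA.1 n q hq x trivial).differentiableAt (by simp))]
    exact congrArg (single 2) (𝒢.B_sub α β n _ (isPlot_proj hp) x ⟨hα _, hβ _⟩).symm
  have h2 : contract flowT (pullA 𝒢 pr α β) n q x
      = contract flowK (𝒢.A α β) n (proj fun y => pr (q y)) x := by
    rw [contract_eq, contract_eq, pullA]
    have : (proj fun y => pr (flowOut flowT q y)) = flowOut flowK (proj fun y => pr (q y)) := by
      funext z
      show (pr (flowT _ _)).base = _
      rw [flowT, heq]
      rfl
    rw [this]
  have h3 : single 0 (contract flowK (𝒢.A α β) n (proj fun y => pr (q y)) x)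
      = scal n (contract flowK (𝒢.A α β) n (proj fun y => pr (q y)) x ![]) := by
    rw [scal]
    congr 1
    ext v
    rw [Subsingleton.elim v ![]]
    rfl
  have h4 : -gaugeScalar (pullA 𝒢 pr α β) q x
      = scal n (contract flowK (𝒢.A α β) n (proj fun y => pr (q y)) x ![])
        + single 2 (-(𝒢.B α n (proj fun y => pr (q y)) x
          - 𝒢.B β n (proj fun y => pr (q y)) x)) := by
    rw [gaugeScalar, h1, h2, h3, map_neg]
    exact neg_sub_eq_add_neg _ _
  rw [h4]
  refine chernFactor_gauge ?_
  have h5 := hc.2 α β n _ (isPlot_proj hp) x ⟨hα _, hβ _⟩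
  rw [coordAt_eq (hα (q x)) (hβ (q x)), Circle.coe_mul, mul_inv]
  congr 1
  have h6 : (L.g α β (pr (q x)).base : ℂ) = Complex.exp
    (-(contract flowK (𝒢.A α β) n (proj fun y => pr (q y)) x ![])) := h5
  rw [h6, ← Complex.exp_neg, neg_neg, Complex.exp_eq_exp_ℂ]

end CircleBundleForms
end

noncomputable section

section TwistedForms

open Om

variable {M : Type u} [DiffeologicalSpace M] [MulAction Circle M] {ι : Type u}
  {𝒰 : GoodCover M ι} {L : HermitianLineBundle 𝒰} {𝒢 : WeakInvariantGerbe 𝒰} {n m : ℕ}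

/-- The `𝕋`-invariant forms on `Sξ` that are horizontal and of weight `-1` for `U(1)`. -/
structure IsTwisted (W : TotalFamily (CircleBundle L) ℂ) : Prop where
  isTotalForm : IsTotalForm W
  smul : ∀ {n : ℕ} {p : Eu n → CircleBundle L} {c : Eu n → Circle}, IsPlot p →
    SmoothCircleMap c → ∀ (t : Circle) x,
      W n (fun y => (t, c y) • p y) x = scal n (c x : ℂ)⁻¹ * W n p x

/-- Families of spaces over the `π⁻¹(U_α)` with local sections. -/
structure IsLocalFrames (L : HermitianLineBundle 𝒰) (Q : ι → Type u)
    [∀ α, DiffeologicalSpace (Q α)] [∀ α, MulAction (Circle × Circle) (Q α)]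
    (pr : ∀ α, Q α → CircleBundle L) : Prop where
  smooth_action : ∀ α, IsSmoothTorusAction (Q α)
  smooth_pr : ∀ α, DSmooth (pr α)
  pr_mem : ∀ α q, pr α q ∈ CircleBundle.over L α
  pr_smul : ∀ α (t : Circle × Circle) q, pr α (t • q) = t • pr α q
  exists_lift : ∀ α (n : ℕ) (p : Eu n → CircleBundle L), IsPlot p → ∀ x,
    p x ∈ CircleBundle.over L α → ∃ q : Eu n → Q α, IsPlot q ∧ ∀ᶠ y in 𝓝 x, pr α (q y) = p y

/-- Forms on the spaces `Q α` that give a form on `Sξ` after multiplication with the factors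
`exp(-u⁻¹ π^* B_α - 2πiθ_α)`. -/
structure IsGluing (𝒢 : WeakInvariantGerbe 𝒰) {Q : ι → Type u}
    [∀ α, DiffeologicalSpace (Q α)] [∀ α, MulAction (Circle × Circle) (Q α)]
    (pr : ∀ α, Q α → CircleBundle L) (T : ∀ α, TotalFamily (Q α) ℂ) : Prop where
  isTotalForm : ∀ α, IsTotalForm (T α)
  twist : ∀ α {n : ℕ} {q : Eu n → Q α} {c : Eu n → Circle}, IsPlot q → SmoothCircleMap c →
    ∀ (t : Circle) x, T α n (fun y => (t, c y) • q y) x = T α n q x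
  glue : ∀ α β {n : ℕ} {q : Eu n → Q α} {r : Eu n → Q β}, IsPlot q → IsPlot r →
    (∀ y, pr α (q y) = pr β (r y)) → ∀ x,
      expFactor 𝒢 α (fun y => pr α (q y)) x * T α n q x
        = expFactor 𝒢 β (fun y => pr β (r y)) x * T β n r x

variable {Q : ι → Type u} [∀ α, DiffeologicalSpace (Q α)] [∀ α, MulAction (Circle × Circle) (Q α)]
  {pr : ∀ α, Q α → CircleBundle L} {T : ∀ α, TotalFamily (Q α) ℂ}

theorem IsLocalFrames.plot (hQ : IsLocalFrames L Q pr) {α : ι} {q : Eu n → Q α} (hq : IsPlot q) :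
    IsPlot fun y => pr α (q y) := hQ.smooth_pr α n q hq

theorem IsGluing.exists_isTwisted (hM : IsSmoothCircleAction M) (hQ : IsLocalFrames L Q pr)
    (hT : IsGluing 𝒢 pr T) :
    ∃ W : TotalFamily (CircleBundle L) ℂ, IsTwisted W ∧ ∀ α (n : ℕ) (q : Eu n → Q α), IsPlot q →
      ∀ x, W n (fun y => pr α (q y)) x = expFactor 𝒢 α (fun y => pr α (q y)) x * T α n q x := by
  have hlift : ∀ (n : ℕ) (p : Eu n → CircleBundle L), IsPlot p → ∀ x, ∃ α, ∃ q : Eu n → Q α,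
      IsPlot q ∧ ∀ᶠ y in 𝓝 x, pr α (q y) = p y := fun n p hp x => by
    obtain ⟨α, hα⟩ := 𝒰.exists_mem (p x).base
    exact ⟨α, hQ.exists_lift α n p hp x hα⟩
  obtain ⟨W, hW, hWq⟩ := exists_isTotalForm_glue pr hQ.smooth_pr hlift
    (fun α n q x => expFactor 𝒢 α (fun y => pr α (q y)) x * T α n q x)
    (fun α => (isTotalForm_expFactor (hQ.smooth_pr α) (hQ.pr_mem α)).mul (hT.isTotalForm α))
    fun α β n q r hq hr h x => hT.glue α β hq hr h x
  refine ⟨W, ⟨hW, fun {n p c} hp hc t x => ?_⟩, hWq⟩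
  obtain ⟨α, q, hq, h⟩ := hlift n p hp x
  have hp' := isPlot_twist (isSmoothTorusAction_circleBundle (L := L) hM) t hc hp
  have hq' := isPlot_twist (hQ.smooth_action α) t hc hq
  have h1 := hW.congr_germ hp' (hQ.plot hq') (x := x) (by
    filter_upwards [h] with y hy
    rw [hQ.pr_smul, hy])
  have h2 := hW.congr_germ hp (hQ.plot hq) (x := x) (h.mono fun y hy => hy.symm)
  have h3 : expFactor 𝒢 α (fun y => pr α ((t, c y) • q y)) x
      = scal n ((c x : ℂ)⁻¹) * expFactor 𝒢 α (fun y => pr α (q y)) x := by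
    refine Eq.trans ?_ (expFactor_twist (hQ.plot hq) (fun y => hQ.pr_mem α _) t c x)
    congr 1
    exact funext fun y => hQ.pr_smul α _ _
  rw [h1, h2, hWq α n q hq x]
  refine (hWq α n _ hq' x).trans ?_
  rw [hT.twist α hq hc]
  exact mul_mul_of_eq h3

theorem dlog_mul {c d : Eu n → Circle} {x : Eu n} (hc : DifferentiableAt ℝ (fun y => (c y : ℂ)) x)
    (hd : DifferentiableAt ℝ (fun y => (d y : ℂ)) x) :
    dlog (fun y => c y * d y) x = dlog c x + dlog d x := by
  have h : fderiv ℝ (fun y => ((c y * d y : Circle) : ℂ)) x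
      = (c x : ℂ) • fderiv ℝ (fun y => (d y : ℂ)) x
        + (d x : ℂ) • fderiv ℝ (fun y => (c y : ℂ)) x := by
    simp only [Circle.coe_mul]
    exact fderiv_fun_mul hc hd
  ext v
  show ((c x * d x : Circle) : ℂ)⁻¹ * fderiv ℝ (fun y => ((c y * d y : Circle) : ℂ)) x (v 0)
    = (c x : ℂ)⁻¹ * fderiv ℝ (fun y => (c y : ℂ)) x (v 0)
      + (d x : ℂ)⁻¹ * fderiv ℝ (fun y => (d y : ℂ)) x (v 0)
  rw [h, Circle.coe_mul]
  show _ * ((c x : ℂ) * fderiv ℝ (fun y => (d y : ℂ)) x (v 0)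
    + (d x : ℂ) * fderiv ℝ (fun y => (c y : ℂ)) x (v 0)) = _
  have h1 := Circle.coe_ne_zero (c x)
  have h2 := Circle.coe_ne_zero (d x)
  field_simp
  ring

theorem dlog_congr {c d : Eu n → Circle} {x : Eu n} (h : c =ᶠ[𝓝 x] d) : dlog c x = dlog d x := by
  have h' : (fun y => (c y : ℂ)) =ᶠ[𝓝 x] fun y => (d y : ℂ) := h.mono fun y hy => by
    show (c y : ℂ) = d y
    rw [hy]
  rw [dlog, dlog, h'.fderiv_eq, h.self_of_nhds]

theorem Theta_eq {p : Eu n → CircleBundle L} (hp : IsPlot p) {x : Eu n} {α : ι}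
    (hα : (p x).base ∈ 𝒰.U α) :
    Theta L n p x = dlog (fun y => (p y).coordAt α) x + L.η α n (proj p) x := by
  have hβ := (𝒰.exists_mem (p x).base).choose_spec
  rw [Theta]
  generalize (𝒰.exists_mem (p x).base).choose = β at hβ
  have h1 : dlog (fun y => (p y).coordAt α) x
      = dlog (fun y => L.g α β (proj p y)) x + dlog (fun y => (p y).coordAt β) x := by
    rw [← dlog_mul ((L.smooth_g α β n _ (isPlot_proj hp) x ⟨hα, hβ⟩).differentiableAt (by simp))
      ((hp.2 β x hβ).differentiableAt (by simp))]
    refine dlog_congr ?_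
    filter_upwards [eventually_mem (isPlot_proj hp) hα, eventually_mem (isPlot_proj hp) hβ]
      with y h1 h2
    exact coordAt_eq h1 h2
  have h2 := L.η_eq α β n _ (isPlot_proj hp) x ⟨hα, hβ⟩
  show dlog (fun y => (p y).coordAt β) x + L.η β n (proj p) x = _
  rw [h1, h2]
  abel

/-- The operator `d - ι_K + Θ + π^* H`. -/
def twistD (𝒢 : WeakInvariantGerbe 𝒰) (W : TotalFamily (CircleBundle L) ℂ) :
    TotalFamily (CircleBundle L) ℂ := fun n p x =>
  d (W n p) x - comap (zeroSlice n) (ctr (timeVec n) (W (n + 1) (flowOut flowT p) (zeroSlice n x)))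
    + (single 1 (Theta L n p x) + single 3 (𝒢.H n (proj p) x)) * W n p x

theorem comap_d_zeroSlice {X F : Type*} [DiffeologicalSpace X] [NormedAddCommGroup F]
    [NormedSpace ℝ F] {w : TotalFamily X F} (hw : IsTotalForm w) {fl : ℝ → X → X}
    (hfl : SmoothFlow fl) {p : Eu n → X} (hp : IsPlot p) (x : Eu n) :
    d (w n p) x = comap (zeroSlice n) (d (w (n + 1) (flowOut fl p)) (zeroSlice n x)) :=
  hw.d.zeroSlice hfl hp x

theorem comap_twisted {m : ℕ} (h : Eu m →L[ℝ] Eu n) (a b s t w e f g : Om n ℂ)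
    (H : a - b + (s + t) * w = e * (f - g)) :
    comap h a - comap h b + (comap h s + comap h t) * comap h w
      = comap h e * (comap h f - comap h g) := by
  have := congrArg (comap h) H
  rwa [comap_mul, map_add, comap_mul, map_sub, map_add, map_sub] at this

theorem IsGluing.twistD_eq (hM : IsSmoothCircleAction M) (hc : IsCoupled L 𝒢)
    (hQ : IsLocalFrames L Q pr) (hT : IsGluing 𝒢 pr T) {W : TotalFamily (CircleBundle L) ℂ}
    (hW : IsTwisted W) {α : ι} (hWq : ∀ (n : ℕ) (q : Eu n → Q α), IsPlot q →
      ∀ x, W n (fun y => pr α (q y)) x = expFactor 𝒢 α (fun y => pr α (q y)) x * T α n q x)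
    {q : Eu n → Q α} (hq : IsPlot q) {s : Eu (n + 1) → Om (n + 1) ℂ}
    (hs : ∀ z, d (T α (n + 1) (flowOut flowT q)) z
      - ctr (timeVec n) (T α (n + 1) (flowOut flowT q) z) = s z) (x : Eu n) :
    twistD 𝒢 W n (fun y => pr α (q y)) x
      = expFactor 𝒢 α (fun y => pr α (q y)) x * comap (zeroSlice n) (s (zeroSlice n x)) := by
  have hflQ := smoothFlow_flowT (hQ.smooth_action α)
  have hflS := smoothFlow_flowT (isSmoothTorusAction_circleBundle (L := L) hM)
  have hflM := smoothFlow_flowK hM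
  have hp := hQ.plot hq
  have hF := hflQ.plot hq
  have hpF := hQ.plot hF
  have hpm : ∀ y, (pr α (q y)).base ∈ 𝒰.U α := fun y => hQ.pr_mem α _
  have hFm : ∀ y, (pr α (flowOut flowT q y)).base ∈ 𝒰.U α := fun y => hQ.pr_mem α _
  have hpre : flowOut flowT (fun y => pr α (q y)) = fun z => pr α (flowOut flowT q z) :=
    funext fun z => (hQ.pr_smul α _ _).symm
  let c : Eu (n + 1) → ℂ := fun z => ((pr α (flowOut flowT q z)).coordAt α : ℂ)
  let b : Eu (n + 1) → Alt (n + 1) ℂ 2 := 𝒢.B α (n + 1) (proj fun z => pr α (flowOut flowT q z))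
  have hcs : ContDiff ℝ ∞ c := contDiff_coordAt hpF hFm
  have hbs : ContDiff ℝ ∞ b := (𝒢.isForm_B α).contDiff (isPlot_proj hpF) hFm
  have hTF := (hT.isTotalForm α).contDiff hF
  have key := twisted_d_chernFactor_mul hcs (fun z => Circle.coe_ne_zero _) hbs (timeVec n)
    (zeroSlice n x) rfl (hTF.contDiffAt.differentiableAt (by simp))
  have hcz : (fun y => ((pr α (q y)).coordAt α : ℂ)) = c ∘ zeroSlice n := by
    funext y
    show _ = ((pr α (flowOut flowT q (zeroSlice n y))).coordAt α : ℂ)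
    rw [hflQ.flowOut_zeroSlice]
  have hθ : comap (zeroSlice n) (single 1 (ContinuousAlternatingMap.ofSubsingleton ℝ (Eu (n + 1)) ℂ 0
      ((c (zeroSlice n x))⁻¹ • fderiv ℝ c (zeroSlice n x))
        - (b (zeroSlice n x)).curryLeft (timeVec n)))
      = single 1 (Theta L n (fun y => pr α (q y)) x) := by
    rw [comap_single, Theta_eq hp (hpm x), hc.1 α n _ (isPlot_proj hp) x (hpm x), contract_eq,
      ← proj_flowOut, hpre, dlog, hcz]
    congr 1
    have h1 : fderiv ℝ (c ∘ zeroSlice n) x = (fderiv ℝ c (zeroSlice n x)).comp (zeroSlice n) := by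
      rw [fderiv_comp x (hcs.contDiffAt.differentiableAt (by simp))
        (zeroSlice n).differentiableAt, (zeroSlice n).fderiv]
    have h2 : ((pr α (q x)).coordAt α : ℂ) = c (zeroSlice n x) := congrFun hcz x
    rw [h1, h2]
    ext v
    exact sub_eq_add_neg _ _
  have hH : comap (zeroSlice n) (single 3 (extDeriv b (zeroSlice n x)))
      = single 3 (𝒢.H n (proj fun y => pr α (q y)) x) := by
    rw [comap_single, hflM.form_zeroSlice 𝒢.isForm_H (isPlot_proj hp) trivial, ← proj_flowOut, hpre,
      𝒢.H_eq α _ _ (isPlot_proj hpF) _ (hFm _)]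
    rfl
  have hWF : W (n + 1) (flowOut flowT fun y => pr α (q y)) = fun z => chernFactor (c z) (b z)
      * T α (n + 1) (flowOut flowT q) z := by
    rw [hpre]
    exact funext fun z => hWq (n + 1) _ hF z
  have hd := comap_d_zeroSlice hW.isTotalForm hflS hp x
  have hw := hW.isTotalForm.zeroSlice hflS hp x
  have he := (isTotalForm_expFactor (𝒢 := 𝒢) (hQ.smooth_pr α) (hQ.pr_mem α)).zeroSlice hflQ hq x
  rw [hWF] at hd hw
  rw [twistD, hWF, hd, hw, he, ← hθ, ← hH]
  have h3 := comap_twisted (zeroSlice n) _ _ _ _ _ _ _ _ key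
  refine h3.trans ?_
  rw [← map_sub, hs]
  rfl

end TwistedForms
end

noncomputable section

section LaurentForms

open Om

/-- The Laurent series with total form `W`, whose degrees satisfy `k + δ = -2j` in front of `uʲ`. -/
def laurentOf {X : Type*} (δ : ℤ) (W : TotalFamily X ℂ) : Laurent X :=
  fun j k n p x => if (k : ℤ) + δ = -2 * j then W n p x k else 0

theorem isLaurentOn_laurentOf {X : Type*} [DiffeologicalSpace X] {W : TotalFamily X ℂ}
    (hW : IsTotalForm W) (δ : ℤ) (S : Set X) : IsLaurentOn S (laurentOf δ W) := by
  refine ⟨fun j k => ?_, fun j => ⟨(-2 * j - δ).toNat + 1, fun k hk n p _ x _ => if_neg (by omega)⟩⟩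
  by_cases h : (k : ℤ) + δ = -2 * j
  · have e : laurentOf δ W j k = fun n p x => W n p x k := by
      funext n p x
      exact if_pos h
    rw [e]
    exact hW.isFormOn S k
  · have e : laurentOf δ W j k = fun n p x => 0 := by
      funext n p x
      exact if_neg h
    rw [e]
    exact ⟨fun _ _ _ _ _ => contDiffAt_const, fun _ _ _ _ _ _ _ _ => rfl⟩

theorem laurentOf_sub {X : Type*} (δ : ℤ) (W W' : TotalFamily X ℂ) (j : ℤ) (k n : ℕ)
    (p : Eu n → X) (x : Eu n) : laurentOf δ W j k n p x - laurentOf δ W' j k n p x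
      = laurentOf δ (fun n p x => W n p x - W' n p x) j k n p x := by
  rw [laurentOf, laurentOf, laurentOf]
  split_ifs
  · rfl
  · exact sub_zero _

theorem laurentOf_natCast (δ : ℕ) {n : ℕ} (w : Om n ℂ) (j : ℤ) (k : ℕ) :
    (if (k : ℤ) + δ = -2 * j then w k else 0)
      = if j ≤ 0 then Ser.ofTotal δ w (-j).toNat k else 0 := by
  rw [Ser.ofTotal]
  split_ifs <;> first | rfl | omega

variable {M : Type u} [DiffeologicalSpace M] [MulAction Circle M] {ι : Type u}
  {𝒰 : GoodCover M ι} {L : HermitianLineBundle 𝒰} {𝒢 : WeakInvariantGerbe 𝒰} {n m : ℕ}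
  {W : TotalFamily (CircleBundle L) ℂ}

theorem extD_laurentOf {X : Type*} [DiffeologicalSpace X] {W : TotalFamily X ℂ}
    (hW : IsTotalForm W) (δ : ℤ) (j : ℤ) (k : ℕ) {p : Eu n → X} (hp : IsPlot p) (x : Eu n) :
    extD (laurentOf δ W j k) n p x
      = if (k : ℤ) + δ = -2 * j then d (W n p) x (k + 1) else 0 := by
  rw [extD]
  by_cases h : (k : ℤ) + δ = -2 * j
  · have e : laurentOf δ W j k n p = fun y => W n p y k := funext fun y => if_pos h
    rw [e, if_pos h, d_apply_succ ((hW.contDiff hp).contDiffAt.differentiableAt (by simp))]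
  · have e : laurentOf δ W j k n p = fun y => 0 := funext fun y => if_neg h
    rw [e, if_neg h]
    have h0 := extDeriv_fun_smul (x := x) (0 : ℝ) fun _ : Eu n => (0 : Alt n ℂ k)
    simp only [zero_smul] at h0
    exact h0

theorem contract_laurentOf {X : Type*} [DiffeologicalSpace X] {W : TotalFamily X ℂ} (fl : ℝ → X → X) (δ : ℤ) (j : ℤ)
    (k : ℕ) (p : Eu n → X) (x : Eu n) :
    contract fl (laurentOf δ W j (k + 1)) n p x = if ((k + 1 : ℕ) : ℤ) + δ = -2 * j then
      comap (zeroSlice n) (ctr (timeVec n) (W (n + 1) (flowOut fl p) (zeroSlice n x))) k else 0 := by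
  rw [contract_eq, laurentOf]
  split_ifs
  · rw [comap_apply, ctr_apply]
  · rfl

theorem wedge_laurentOf {X : Type*} {W : TotalFamily X ℂ} (δ : ℤ) (j : ℤ) {r k l : ℕ}
    (h : r + k = l) (a : Alt n ℂ r) (p : Eu n → X) (x : Eu n) :
    wedge h a (laurentOf δ W j k n p x)
      = if (k : ℤ) + δ = -2 * j then (single r a * W n p x) l else 0 := by
  rw [laurentOf]
  split_ifs
  · rw [single_mul_apply h]
  · exact wedge_zero_right h a

theorem zero_mul_add_mul_zero {R : Type*} [Ring R] (a b : R) : 0 * a + b * 0 = 0 := by simp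

theorem IsTwisted.ctr_flowOut (hW : IsTwisted W)
    {p : Eu n → CircleBundle L} (hp : IsPlot p) (z : Eu (n + 1)) :
    ctr (timeVec n) (W (n + 1) (flowOut flowU p) z) = 0 := by
  have hc : SmoothCircleMap fun z : Eu (n + 1) => Circle.exp (timeL n z) :=
    smoothCircleMap_exp (timeL n).contDiff
  have h1 := hW.smul (isPlot_reparam hp (tailL n).contDiff) hc 1 z
  have h2 := hW.isTotalForm.comp hp (tailL n).contDiff z
  have h3 : W (n + 1) (flowOut flowU p) z = scal (n + 1) (Circle.exp (timeL n z) : ℂ)⁻¹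
      * comap (tailL n) (W n p (tailL n z)) := by
    rw [(tailL n).fderiv] at h2
    rw [← h2]
    exact h1
  rw [h3, ctr_mul, ctr_scal, ctr_comap, tailL_timeVec]
  have h4 : ctr (0 : Eu n) (W n p (tailL n z)) = 0 := by
    ext k : 1
    rw [ctr_apply]
    ext v
    exact (W n p (tailL n z) (k + 1)).map_coord_zero 0 rfl
  rw [h4, ContinuousLinearMap.map_zero (comap (tailL n))]
  exact zero_mul_add_mul_zero _ _

theorem IsTwisted.contractV_laurentOf (hW : IsTwisted W) (δ j : ℤ)
    (k : ℕ) {p : Eu n → CircleBundle L} (hp : IsPlot p) (x : Eu n) :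
    contractV (laurentOf δ W j (k + 1)) n p x = 0 := by
  show (-Complex.I) • contract flowU (laurentOf δ W j (k + 1)) n p x = 0
  rw [contract_laurentOf, hW.ctr_flowOut hp,
    ContinuousLinearMap.map_zero (comap (zeroSlice n))]
  split_ifs
  · exact smul_zero _
  · exact smul_zero _

theorem IsTwisted.lieV_laurentOf (hW : IsTwisted W) (δ j : ℤ)
    (k : ℕ) {p : Eu n → CircleBundle L} (hp : IsPlot p) (x : Eu n) :
    lieV (laurentOf δ W j k) n p x = -laurentOf δ W j k n p x := by
  show (-Complex.I) • deriv (fun t => laurentOf δ W j k n (fun y => flowU t (p y)) x) 0 = _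
  have h1 : (fun t => laurentOf δ W j k n (fun y => flowU t (p y)) x)
      = fun t : ℝ => (Complex.exp (t * Complex.I))⁻¹ • laurentOf δ W j k n p x := by
    funext t
    have h2 := hW.smul hp (c := fun _ => Circle.exp t) contDiff_const 1 x
    have h3 : W n (fun y => flowU t (p y)) x k = (Complex.exp (t * Complex.I))⁻¹ • W n p x k := by
      refine (congrArg (fun w : Om n ℂ => w k) h2).trans ?_
      rw [scal_mul_apply, Circle.coe_exp]
    rw [laurentOf, laurentOf, h3]
    split_ifs
    · rfl
    · exact (smul_zero _).symm
  have h4 : HasDerivAt (fun t : ℝ => (Complex.exp (t * Complex.I))⁻¹) (-Complex.I) 0 := by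
    have h5 : HasDerivAt (fun t : ℝ => Complex.exp (-((t : ℂ) * Complex.I)))
        (Complex.exp (-(((0 : ℝ) : ℂ) * Complex.I)) * -(1 * Complex.I)) 0 :=
      ((Complex.ofRealCLM.hasDerivAt.mul_const Complex.I).neg).cexp
    simp only [Complex.exp_neg] at h5
    convert h5 using 1
    simp
  have h6 : HasDerivAt (fun t : ℝ => (Complex.exp (t * Complex.I))⁻¹ • laurentOf δ W j k n p x)
      ((-Complex.I) • laurentOf δ W j k n p x) 0 := by
    let g : ℂ →ₗ[ℝ] Alt n ℂ k :=
      { toFun := fun c => c • laurentOf δ W j k n p x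
        map_add' := fun a b => add_smul a b _
        map_smul' := fun r c => smul_assoc r c _ }
    exact (LinearMap.toContinuousLinearMap g).hasFDerivAt.comp_hasDerivAt (0 : ℝ) h4
  rw [h1, h6.deriv, smul_smul, neg_mul_neg, Complex.I_mul_I, neg_one_smul]

theorem IsTwisted.inOmegaTilde (hW : IsTwisted W) (δ : ℤ) :
    InOmegaTilde (laurentOf δ W) :=
  ⟨isLaurentOn_laurentOf hW.isTotalForm δ _, fun j k _ _ hp x =>
    ⟨hW.contractV_laurentOf δ j k hp x, hW.lieV_laurentOf δ j k hp x⟩⟩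

theorem IsTwisted.smul_const (hW : IsTwisted W) (t : Circle) {p : Eu n → CircleBundle L}
    (hp : IsPlot p) (x : Eu n) : W n (fun y => (t, (1 : Circle)) • p y) x = W n p x := by
  refine (hW.smul hp (c := fun _ => 1) smoothCircleMap_one t x).trans ?_
  have h : scal n ((1 : Circle) : ℂ)⁻¹ = 1 := by
    rw [Circle.coe_one, inv_one, scal_one]
  exact (congrArg (· * W n p x) h).trans (one_mul _)

theorem IsTwisted.isTInvariant (hW : IsTwisted W) (δ : ℤ) : IsTInvariant (laurentOf δ W) := by
  intro t j k n p hp x _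
  rw [laurentOf, laurentOf, hW.smul_const t hp]

theorem twistD_apply (p : Eu n → CircleBundle L) (x : Eu n) (k : ℕ) :
    twistD 𝒢 W n p x k = d (W n p) x k
      - comap (zeroSlice n) (ctr (timeVec n) (W (n + 1) (flowOut flowT p) (zeroSlice n x))) k
      + (single 1 (Theta L n p x) * W n p x) k + (single 3 (𝒢.H n (proj p) x) * W n p x) k := by
  have h : twistD 𝒢 W n p x = d (W n p) x
      - comap (zeroSlice n) (ctr (timeVec n) (W (n + 1) (flowOut flowT p) (zeroSlice n x)))
      + (single 1 (Theta L n p x) * W n p x + single 3 (𝒢.H n (proj p) x) * W n p x) :=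
    congrArg (_ + ·) (add_mul' _ _ _)
  rw [h, add_assoc]
  rfl

theorem ite_combine {V : Type*} [AddCommGroup V] {P P₁ P₂ P₃ P₄ : Prop} [Decidable P]
    [Decidable P₁] [Decidable P₂] [Decidable P₃] [Decidable P₄] (h₁ : P₁ ↔ P) (h₂ : P₂ ↔ P)
    (h₃ : P₃ ↔ P) (h₄ : P₄ ↔ P) (a b c e : V) :
    (if P₁ then a else 0) - 0 - (if P₂ then b else 0) + (if P₃ then c else 0)
      + (if P₄ then e else 0) = if P then a - b + c + e else 0 := by
  by_cases h : P
  · rw [if_pos h, if_pos (h₁.2 h), if_pos (h₂.2 h), if_pos (h₃.2 h), if_pos (h₄.2 h), sub_zero]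
  · rw [if_neg h, if_neg (mt h₁.1 h), if_neg (mt h₂.1 h), if_neg (mt h₃.1 h), if_neg (mt h₄.1 h),
      sub_zero, sub_zero, add_zero, add_zero]

theorem IsTwisted.circleD_laurentOf (hW : IsTwisted W) (δ j : ℤ)
    (k : ℕ) {p : Eu n → CircleBundle L} (hp : IsPlot p) (x : Eu n) :
    circleD L 𝒢 (laurentOf δ W) j k n p x
      = if (k : ℤ) + δ = -2 * j + 1 then twistD 𝒢 W n p x k else 0 := by
  rw [twistD_apply]
  have z1 : (single 1 (Theta L n p x) * W n p x) 0 = 0 := single_mul_apply_of_lt (by norm_num) _ _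
  have z3 : ∀ k < 3, (single 3 (𝒢.H n (proj p) x) * W n p x) k = 0 :=
    fun k hk => single_mul_apply_of_lt hk _ _
  have hc : ∀ k : ℕ, ((k + 1 : ℕ) : ℤ) + δ = -2 * (j - 1) ↔ (k : ℤ) + δ = -2 * j + 1 :=
    fun k => by push_cast; constructor <;> intro h <;> linarith
  have hd : ∀ k : ℕ, (k : ℤ) + δ = -2 * j ↔ ((k + 1 : ℕ) : ℤ) + δ = -2 * j + 1 :=
    fun k => by push_cast; constructor <;> intro h <;> linarith
  have hh : ∀ k : ℕ, (k : ℤ) + δ = -2 * (j + 1) ↔ ((k + 3 : ℕ) : ℤ) + δ = -2 * j + 1 :=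
    fun k => by push_cast; constructor <;> intro h <;> linarith
  rcases k with _ | _ | _ | k
  · have h := ite_combine (P := ((0 : ℕ) : ℤ) + δ = -2 * j + 1) Iff.rfl (hc 0) Iff.rfl Iff.rfl
      (d (W n p) x 0) (comap (zeroSlice n) (ctr (timeVec n)
        (W (n + 1) (flowOut flowT p) (zeroSlice n x))) 0)
      ((single 1 (Theta L n p x) * W n p x) 0) ((single 3 (𝒢.H n (proj p) x) * W n p x) 0)
    refine Eq.trans ?_ h
    show 0 - contractV (laurentOf δ W j (0 + 1)) n p x
      - contract flowT (laurentOf δ W (j - 1) (0 + 1)) n p x + 0 + 0 = _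
    rw [hW.contractV_laurentOf δ j 0 hp, contract_laurentOf, z1, z3 0 (by norm_num),
      d_apply_zero, ite_self]
  · have h := ite_combine (P := ((1 : ℕ) : ℤ) + δ = -2 * j + 1) (hd 0) (hc 1) (hd 0) Iff.rfl
      (d (W n p) x 1) (comap (zeroSlice n) (ctr (timeVec n)
        (W (n + 1) (flowOut flowT p) (zeroSlice n x))) 1)
      ((single 1 (Theta L n p x) * W n p x) 1) ((single 3 (𝒢.H n (proj p) x) * W n p x) 1)
    refine Eq.trans ?_ h
    show extD (laurentOf δ W j 0) n p x - contractV (laurentOf δ W j (1 + 1)) n p x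
      - contract flowT (laurentOf δ W (j - 1) (1 + 1)) n p x
      + wedge (Nat.add_comm 1 0) (Theta L n p x) (laurentOf δ W j 0 n p x)
      + 0 = _
    rw [hW.contractV_laurentOf δ j _ hp, contract_laurentOf,
      ← extD_laurentOf hW.isTotalForm δ j 0 hp x,
      ← wedge_laurentOf (W := W) δ j (Nat.add_comm 1 0) (Theta L n p x) p x, z3 1 (by norm_num),
      ite_self]
  · have h := ite_combine (P := ((2 : ℕ) : ℤ) + δ = -2 * j + 1) (hd 1) (hc 2) (hd 1) Iff.rfl
      (d (W n p) x 2) (comap (zeroSlice n) (ctr (timeVec n)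
        (W (n + 1) (flowOut flowT p) (zeroSlice n x))) 2)
      ((single 1 (Theta L n p x) * W n p x) 2) ((single 3 (𝒢.H n (proj p) x) * W n p x) 2)
    refine Eq.trans ?_ h
    show extD (laurentOf δ W j 1) n p x - contractV (laurentOf δ W j (2 + 1)) n p x
      - contract flowT (laurentOf δ W (j - 1) (2 + 1)) n p x
      + wedge (Nat.add_comm 1 1) (Theta L n p x) (laurentOf δ W j 1 n p x)
      + 0 = _
    rw [hW.contractV_laurentOf δ j _ hp, contract_laurentOf,
      ← extD_laurentOf hW.isTotalForm δ j 1 hp x,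
      ← wedge_laurentOf (W := W) δ j (Nat.add_comm 1 1) (Theta L n p x) p x, z3 2 (by norm_num),
      ite_self]
  · have h := ite_combine (P := ((k + 3 : ℕ) : ℤ) + δ = -2 * j + 1) (hd (k + 2)) (hc (k + 3))
      (hd (k + 2)) (hh k)
      (d (W n p) x (k + 3)) (comap (zeroSlice n) (ctr (timeVec n)
        (W (n + 1) (flowOut flowT p) (zeroSlice n x))) (k + 3))
      ((single 1 (Theta L n p x) * W n p x) (k + 3))
      ((single 3 (𝒢.H n (proj p) x) * W n p x) (k + 3))
    refine Eq.trans ?_ h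
    show extD (laurentOf δ W j (k + 2)) n p x - contractV (laurentOf δ W j ((k + 3) + 1)) n p x
      - contract flowT (laurentOf δ W (j - 1) ((k + 3) + 1)) n p x
      + wedge (Nat.add_comm 1 (k + 2)) (Theta L n p x) (laurentOf δ W j (k + 2) n p x)
      + wedge (Nat.add_comm 3 k) (𝒢.H n (proj p) x) (laurentOf δ W (j + 1) k n p x) = _
    rw [hW.contractV_laurentOf δ j _ hp, contract_laurentOf,
      ← extD_laurentOf hW.isTotalForm δ j (k + 2) hp x,
      ← wedge_laurentOf (W := W) δ j (Nat.add_comm 1 (k + 2)) (Theta L n p x) p x,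
      ← wedge_laurentOf (W := W) δ (j + 1) (Nat.add_comm 3 k) (𝒢.H n (proj p) x) p x]

end LaurentForms
end

noncomputable section

section PulledBackConnections

open Om

variable {Q Q' H : Type u} [NormedAddCommGroup H] [InnerProductSpace ℂ H] [CompleteSpace H]
  [DiffeologicalSpace Q] [MulAction (Circle × Circle) Q] [DiffeologicalSpace Q']
  [MulAction (Circle × Circle) Q'] {n m : ℕ}

/-- The pullback of a form under `f`. -/
def pullForm {X Y F : Type*} [NormedAddCommGroup F] [NormedSpace ℝ F] {k : ℕ} (f : Y → X)
    (w : FormFamily X F k) : FormFamily Y F k := fun n p x => w n (fun y => f (p y)) x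

theorem IsFormOn.pullForm {X Y F : Type*} [DiffeologicalSpace X] [DiffeologicalSpace Y]
    [NormedAddCommGroup F] [NormedSpace ℝ F] {k : ℕ} {f : Y → X} (hf : DSmooth f)
    {w : FormFamily X F k} (hw : IsFormOn Set.univ w) : IsFormOn Set.univ (pullForm f w) :=
  ⟨fun n p hp x _ => hw.1 n _ (hf n p hp) x trivial,
    fun n m p h hp hh y _ => hw.2 n m _ h (hf n p hp) hh y trivial⟩

variable {A : FormFamily Q' (TraceClass H) 1} {f : Q → Q'}

theorem flowOut_equivariant (heq : ∀ (t : Circle × Circle) q, f (t • q) = t • f q) (q : Eu n → Q) :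
    flowOut flowT (fun y => f (q y)) = fun z => f (flowOut flowT q z) :=
  funext fun _ => (heq _ _).symm

theorem InvariantConnection.pullForm (hA : InvariantConnection A) (hf : DSmooth f)
    (heq : ∀ (t : Circle × Circle) q, f (t • q) = t • f q) : InvariantConnection (pullForm f A) where
  isForm := hA.isForm.pullForm hf
  invariant t n p hp x _ := by
    show A n (fun y => f (t • p y)) x = A n (fun y => f (p y)) x
    simp only [heq]
    exact hA.invariant t n _ (hf n p hp) x trivial
  horizontal n q hq x := by
    have h := hA.horizontal n _ (hf n q hq) x
    have e : flowOut flowU (f ∘ q) = fun z => f (flowOut flowU q z) :=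
      funext fun _ => (heq _ _).symm
    rw [contract_eq, e] at h
    exact h

theorem curvForm_pullForm (heq : ∀ (t : Circle × Circle) q, f (t • q) = t • f q) (q : Eu n → Q)
    (x : Eu n) : curvForm (pullForm f A) q x = curvForm A (fun y => f (q y)) x := by
  have h : contract flowT (pullForm f A) n q x = contract flowT A n (fun y => f (q y)) x := by
    rw [contract_eq, contract_eq, flowOut_equivariant heq]
    rfl
  rw [curvForm, curvForm, h]
  rfl

theorem chernTrace_pullForm (heq : ∀ (t : Circle × Circle) q, f (t • q) = t • f q) (q : Eu n → Q)
    (x : Eu n) : chernTrace (pullForm f A) q x = chernTrace A (fun y => f (q y)) x := by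
  rw [chernTrace, curvForm_pullForm heq, chernTrace]

theorem csTrace_pullForm {A' : FormFamily Q' (TraceClass H) 1}
    (heq : ∀ (t : Circle × Circle) q, f (t • q) = t • f q) (q : Eu n → Q)
    (x : Eu n) : csTrace (pullForm f A) (pullForm f A') q x = csTrace A A' (fun y => f (q y)) x := by
  have h : ∀ t, curvForm (interpolate (pullForm f A) (pullForm f A') t) q x
      = curvForm (interpolate A A' t) (fun y => f (q y)) x :=
    fun t => curvForm_pullForm (A := interpolate A A' t) heq q x
  simp only [csTrace, transForm, h]
  rfl

end PulledBackConnections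

section FrameSpaces

open Om

variable {M : Type u} [DiffeologicalSpace M] [MulAction Circle M] {ι : Type u}
  {𝒰 : GoodCover M ι} {L : HermitianLineBundle 𝒰} {𝒢 : WeakInvariantGerbe 𝒰} {H : Type u}
  [NormedAddCommGroup H] [InnerProductSpace ℂ H] [CompleteSpace H] {n m : ℕ}

/-- Families of frames of the modules `𝔼 k` over `π⁻¹(U_{a k})`, at a common point. -/
structure Frames {κ : Type} (𝔼 : κ → GerbeModule L 𝒢 H) (a : κ → ι) : Type u where
  base : CircleBundle L
  frame : ∀ k, ((𝔼 k).E (a k)).Q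
  pr_frame : ∀ k, ((𝔼 k).E (a k)).pr (frame k) = base

namespace Frames

variable {κ : Type} {𝔼 : κ → GerbeModule L 𝒢 H} {a : κ → ι}

theorem ext' {q r : Frames 𝔼 a} (h : q.base = r.base) (h' : q.frame = r.frame) : q = r := by
  cases q
  cases r
  cases h
  cases h'
  rfl

instance : DiffeologicalSpace (Frames 𝔼 a) where
  plots n := {q | IsPlot (fun y => (q y).base) ∧ ∀ k, IsPlot fun y => (q y).frame k}
  constant_plots _ := ⟨isPlot_const, fun _ => isPlot_const⟩
  plot_reparam := fun hq hf => ⟨isPlot_reparam hq.1 hf, fun k => isPlot_reparam (hq.2 k) hf⟩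
  locality := fun {n q} hq => by
    refine ⟨DiffeologicalSpace.locality fun x => ?_, fun k => DiffeologicalSpace.locality fun x => ?_⟩
    · obtain ⟨u, hu, hxu, h⟩ := hq x
      exact ⟨u, hu, hxu, fun hf hf' => (h hf hf').1⟩
    · obtain ⟨u, hu, hxu, h⟩ := hq x
      exact ⟨u, hu, hxu, fun hf hf' => (h hf hf').2 k⟩

instance : MulAction (Circle × Circle) (Frames 𝔼 a) where
  smul t q :=
    { base := t • q.base
      frame := fun k => t • q.frame k
      pr_frame := fun k => by rw [((𝔼 k).E (a k)).pr_smul, q.pr_frame] }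
  one_smul q := ext' (one_smul _ q.base) (funext fun k => one_smul _ (q.frame k))
  mul_smul s t q := ext' (mul_smul s t q.base) (funext fun k => mul_smul s t (q.frame k))

theorem dSmooth_base : DSmooth (base : Frames 𝔼 a → _) := fun _ _ hq => hq.1

theorem dSmooth_frame (k : κ) : DSmooth fun q : Frames 𝔼 a => q.frame k := fun _ _ hq => hq.2 k

theorem isSmoothTorusAction (hM : IsSmoothCircleAction M) : IsSmoothTorusAction (Frames 𝔼 a) :=
  fun n c d q hc hd hq => ⟨isSmoothTorusAction_circleBundle hM n c d _ hc hd hq.1,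
    fun k => ((𝔼 k).E (a k)).smooth_torusAction n c d _ hc hd (hq.2 k)⟩

theorem base_mem (k : κ) (q : Frames 𝔼 a) : q.base ∈ CircleBundle.over L (a k) :=
  q.pr_frame k ▸ ((𝔼 k).E (a k)).pr_mem (q.frame k)

theorem exists_lift [Finite κ] {p : Eu n → CircleBundle L} (hp : IsPlot p) (x : Eu n)
    (hx : ∀ k, p x ∈ CircleBundle.over L (a k)) :
    ∃ q : Eu n → Frames 𝔼 a, IsPlot q ∧ ∀ᶠ y in 𝓝 x, (q y).base = p y := by
  choose q hq hqp using fun k => ((𝔼 k).E (a k)).exists_lift n p hp x (hx k)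
  obtain ⟨h, hh, hhx, hhU⟩ := exists_cutoff x (Filter.eventually_all.2 hqp)
  refine ⟨fun y => ⟨p (h y), fun k => q k (h y), fun k => hhU y k⟩,
    ⟨isPlot_reparam hp hh, fun k => isPlot_reparam (hq k) hh⟩, ?_⟩
  filter_upwards [hhx] with y hy
  exact congrArg p hy

theorem isLocalFrames [Finite κ] [Nonempty κ] (hM : IsSmoothCircleAction M) :
    IsLocalFrames L (fun α => Frames 𝔼 fun _ => α) fun _ => base where
  smooth_action _ := isSmoothTorusAction hM
  smooth_pr _ := dSmooth_base
  pr_mem _ q := q.base_mem (Classical.arbitrary κ)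
  pr_smul _ _ _ := rfl
  exists_lift _ _ _ hp x hx := exists_lift hp x fun _ => hx

/-- The connection form of the `k`-th module. -/
def conn (k : κ) (c : HorizontalConnection (𝔼 k)) : FormFamily (Frames 𝔼 a) (TraceClass H) 1 :=
  pullForm (fun q => q.frame k) (c.A (a k))

/-- Two families of frames at the same point. -/
def glue {α β : ι} (q : Frames 𝔼 fun _ => α) (r : Frames 𝔼 fun _ => β) (h : q.base = r.base) :
    Frames (Sum.elim 𝔼 𝔼) (Sum.elim (fun _ => α) fun _ => β) where
  base := q.base
  frame k := match k with
    | .inl k => q.frame k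
    | .inr k => r.frame k
  pr_frame k := match k with
    | .inl k => q.pr_frame k
    | .inr k => (r.pr_frame k).trans h.symm

theorem isPlot_glue {α β : ι} {q : Eu n → Frames 𝔼 fun _ => α} {r : Eu n → Frames 𝔼 fun _ => β}
    (hq : IsPlot q) (hr : IsPlot r) (h : ∀ y, (q y).base = (r y).base) :
    IsPlot fun y => glue (q y) (r y) (h y) :=
  ⟨hq.1, fun k => match k with
    | .inl k => hq.2 k
    | .inr k => hr.2 k⟩

end Frames

theorem HorizontalConnection.invariantConnection {E : GerbeModule L 𝒢 H}
    (c : HorizontalConnection E) (α : ι) : InvariantConnection (c.A α) :=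
  ⟨c.isForm α, c.invariant α, c.horizontal α⟩

namespace Frames

variable {κ : Type} {𝔼 : κ → GerbeModule L 𝒢 H} {a : κ → ι}

theorem invariantConnection_conn (k : κ) (c : HorizontalConnection (𝔼 k)) :
    InvariantConnection (conn (a := a) k c) :=
  (c.invariantConnection (a k)).pullForm (dSmooth_frame k) fun _ _ => rfl

theorem chernTrace_conn (k : κ) (c : HorizontalConnection (𝔼 k)) (q : Eu n → Frames 𝔼 a)
    (x : Eu n) : chernTrace (conn k c) q x = chernTrace (c.A (a k)) (fun y => (q y).frame k) x :=
  chernTrace_pullForm (f := fun q : Frames 𝔼 a => q.frame k) (fun _ _ => rfl) q x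

theorem csTrace_conn (k : κ) (c c' : HorizontalConnection (𝔼 k)) (q : Eu n → Frames 𝔼 a)
    (x : Eu n) : csTrace (conn k c) (conn k c') q x
      = csTrace (c.A (a k)) (c'.A (a k)) (fun y => (q y).frame k) x :=
  csTrace_pullForm (f := fun q : Frames 𝔼 a => q.frame k) (fun _ _ => rfl) q x

variable {α β : ι}

theorem gaugeRel_conn (k : κ) (c : HorizontalConnection (𝔼 k)) :
    GaugeRel (Q := Frames (Sum.elim 𝔼 𝔼) (Sum.elim (fun _ => α) fun _ => β))
      (conn (𝔼 := Sum.elim 𝔼 𝔼) (Sum.inl k) c) (conn (𝔼 := Sum.elim 𝔼 𝔼) (Sum.inr k) c) Eq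
      (fun q r => (𝔼 k).φ α β (q.frame (Sum.inl k)) (r.frame (Sum.inr k))) (pullA 𝒢 base α β) where
  rel_smul h t := congrArg (t • ·) h
  φ_smul {q r} h t := by
    subst h
    exact (𝔼 k).φ_smul α β _ _ t ((q.pr_frame (Sum.inl k)).trans (q.pr_frame (Sum.inr k)).symm)
  contDiff {n q r} hq hr h := (𝔼 k).smooth_φ α β n _ _ (hq.2 (Sum.inl k)) (hr.2 (Sum.inr k))
    fun y => by
      obtain rfl : q = r := funext h
      exact ((q y).pr_frame (Sum.inl k)).trans ((q y).pr_frame (Sum.inr k)).symm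
  isForm := isFormOn_pullA dSmooth_base (fun q => q.base_mem (Sum.inl k))
    fun q => q.base_mem (Sum.inr k)
  parallel {n q r} hq hr h x v := by
    obtain rfl : q = r := funext h
    have e := c.φ_parallel α β n _ _ (hq.2 (Sum.inl k)) (hr.2 (Sum.inr k))
      (fun y => ((q y).pr_frame (Sum.inl k)).trans ((q y).pr_frame (Sum.inr k)).symm) x v
    have e1 : (fun y => ((𝔼 k).E α).pr ((q y).frame (Sum.inl k))) = fun y => (q y).base :=
      funext fun y => (q y).pr_frame (Sum.inl k)
    refine e.trans ?_
    rw [e1]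
    rfl

/-- Transition formulas with factor `exp(dA_{αβ} - ι_K A_{αβ})` are gluing conditions. -/
theorem glue_of_eq_exp [Nonempty κ] (hc : IsCoupled L 𝒢) {q : Eu n → Frames 𝔼 fun _ => α}
    {r : Eu n → Frames 𝔼 fun _ => β} (hq : IsPlot q) (hr : IsPlot r)
    (h : ∀ y, (q y).base = (r y).base) (x : Eu n) {t t' : Om n ℂ}
    (ht : t = NormedSpace.exp (gaugeScalar (pullA 𝒢 base α β)
      (fun y => glue (q y) (r y) (h y)) x) * t') :
    expFactor 𝒢 α (fun y => (q y).base) x * t = expFactor 𝒢 β (fun y => (r y).base) x * t' := by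
  have k : κ := Classical.arbitrary κ
  have hs := isPlot_glue hq hr h
  have hα : ∀ s : Frames (Sum.elim 𝔼 𝔼) (Sum.elim (fun _ => α) fun _ => β),
      s.base ∈ CircleBundle.over L α := fun s => s.base_mem (Sum.inl k)
  have hβ : ∀ s : Frames (Sum.elim 𝔼 𝔼) (Sum.elim (fun _ => α) fun _ => β),
      s.base ∈ CircleBundle.over L β := fun s => s.base_mem (Sum.inr k)
  have e := exp_neg_gaugeScalar_mul_expFactor hc dSmooth_base (fun _ _ => rfl) hα hβ hs x
  have hr' : (fun y => (r y).base) = fun y => (q y).base := funext fun y => (h y).symm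
  rw [hr']
  exact glue_of_gauge (par_gaugeScalar (isFormOn_pullA dSmooth_base hα hβ) hs x) e ht

theorem isGluing_csTrace [Nonempty κ] (hM : IsSmoothCircleAction M) (hc : IsCoupled L 𝒢) (k : κ)
    (c c' : HorizontalConnection (𝔼 k)) :
    IsGluing 𝒢 (fun α => (base : (Frames 𝔼 fun _ => α) → _))
      fun _ _ q x => csTrace (conn k c) (conn k c') q x where
  isTotalForm α := isTotalForm_csTrace (isSmoothTorusAction hM) (invariantConnection_conn k c)
    (invariantConnection_conn k c')
  twist α _ _ _ hq hd t x := csTrace_twist (isSmoothTorusAction hM) (invariantConnection_conn k c)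
    (invariantConnection_conn k c') t hd hq x
  glue α β {n q r} hq hr h x := by
    refine glue_of_eq_exp hc hq hr h x ?_
    have hs := isPlot_glue hq hr h
    have e := csTrace_gauge (isSmoothTorusAction hM) (isSmoothTorusAction hM)
      (invariantConnection_conn (Sum.inl k) c) (invariantConnection_conn (Sum.inl k) c')
      (invariantConnection_conn (Sum.inr k) c) (invariantConnection_conn (Sum.inr k) c')
      (gaugeRel_conn (α := α) (β := β) k c) (gaugeRel_conn k c') hs hs (fun _ => rfl) x
    have e₁ := csTrace_conn (𝔼 := Sum.elim 𝔼 𝔼) (a := Sum.elim (fun _ => α) fun _ => β)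
      (Sum.inl k) c c' (fun y => glue (q y) (r y) (h y)) x
    have e₂ := csTrace_conn (𝔼 := Sum.elim 𝔼 𝔼) (a := Sum.elim (fun _ => α) fun _ => β)
      (Sum.inr k) c c' (fun y => glue (q y) (r y) (h y)) x
    exact (csTrace_conn k c c' q x).trans (e₁.symm.trans (e.trans
      (congrArg _ (e₂.trans (csTrace_conn k c c' r x).symm))))

theorem isGluing_chernTrace_sub [Nonempty κ] (hM : IsSmoothCircleAction M) (hc : IsCoupled L 𝒢)
    (k l : κ) (c : HorizontalConnection (𝔼 k)) (c' : HorizontalConnection (𝔼 l)) :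
    IsGluing 𝒢 (fun α => (base : (Frames 𝔼 fun _ => α) → _))
      fun _ _ q x => chernTrace (conn k c) q x - chernTrace (conn l c') q x where
  isTotalForm α := ((invariantConnection_conn k c).isTotalForm_chernTrace
    (isSmoothTorusAction hM)).sub ((invariantConnection_conn l c').isTotalForm_chernTrace
    (isSmoothTorusAction hM))
  twist α n q _ hq hd t x := by
    rw [(invariantConnection_conn k c).chernTrace_twist (isSmoothTorusAction hM) t hd hq,
      (invariantConnection_conn l c').chernTrace_twist (isSmoothTorusAction hM) t hd hq]
  glue α β {n q r} hq hr h x := by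
    refine glue_of_eq_exp hc hq hr h x ?_
    have hs := isPlot_glue hq hr h
    have e := chernTrace_sub_gauge (isSmoothTorusAction hM) (isSmoothTorusAction hM)
      (isSmoothTorusAction hM) (isSmoothTorusAction hM)
      (invariantConnection_conn (Sum.inl k) c) (invariantConnection_conn (Sum.inr k) c)
      (gaugeRel_conn (α := α) (β := β) k c)
      (invariantConnection_conn (Sum.inl l) c') (invariantConnection_conn (Sum.inr l) c')
      (gaugeRel_conn (α := α) (β := β) l c') hs hs (fun _ => rfl) hs hs (fun _ => rfl) x rfl
    simp only [chernTrace_conn] at e ⊢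
    exact e

end Frames

end FrameSpaces
end

noncomputable section

section ChernForms

open Om

variable {M : Type u} [DiffeologicalSpace M] [MulAction Circle M] {ι : Type u}
  {𝒰 : GoodCover M ι} {L : HermitianLineBundle 𝒰} {𝒢 : WeakInvariantGerbe 𝒰} {H : Type u}
  [NormedAddCommGroup H] [InnerProductSpace ℂ H] [CompleteSpace H] {n m : ℕ}

theorem twistD_congr_germ (hM : IsSmoothCircleAction M) {W : TotalFamily (CircleBundle L) ℂ}
    (hW : IsTotalForm W) {p p' : Eu n → CircleBundle L} (hp : IsPlot p) (hp' : IsPlot p')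
    {x : Eu n} (h : ∀ᶠ y in 𝓝 x, p y = p' y) : twistD 𝒢 W n p x = twistD 𝒢 W n p' x := by
  have hfl := smoothFlow_flowT (isSmoothTorusAction_circleBundle (L := L) hM)
  have hx : p x = p' x := h.self_of_nhds
  obtain ⟨α, hα⟩ := 𝒰.exists_mem (p x).base
  have hα' : (p' x).base ∈ 𝒰.U α := hx ▸ hα
  have hbase : ∀ᶠ y in 𝓝 x, proj p y = proj p' y := h.mono fun y hy => congrArg _ hy
  have e1 := hW.d.congr_germ hp hp' h
  have e2 : W (n + 1) (flowOut flowT p) (zeroSlice n x)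
      = W (n + 1) (flowOut flowT p') (zeroSlice n x) := by
    refine hW.congr_germ (hfl.plot hp) (hfl.plot hp') ?_
    have ht : Filter.Tendsto (tailL n) (𝓝 (zeroSlice n x)) (𝓝 x) := by
      have := (tailL n).continuous.tendsto (zeroSlice n x)
      rwa [tailL_zeroSlice] at this
    filter_upwards [ht.eventually h] with z hz
    rw [flowOut_apply, flowOut_apply, hz]
  have e3 : Theta L n p x = Theta L n p' x := by
    rw [Theta_eq hp hα, Theta_eq hp' hα',
      (L.isForm_η α).congr_germ (isPlot_proj hp) (isPlot_proj hp') hα hbase]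
    congr 1
    exact dlog_congr (h.mono fun y hy => congrArg _ hy)
  have e4 := 𝒢.isForm_H.congr_germ (isPlot_proj hp) (isPlot_proj hp') trivial hbase
  rw [twistD, twistD, e1, e2, e3, e4, hW.congr_germ hp hp' h]

variable {Q : ι → Type u} [∀ α, DiffeologicalSpace (Q α)] [∀ α, MulAction (Circle × Circle) (Q α)]
  {pr : ∀ α, Q α → CircleBundle L} {T T' : ∀ α, TotalFamily (Q α) ℂ}

theorem IsGluing.twistD_eq_mul (hM : IsSmoothCircleAction M) (hc : IsCoupled L 𝒢)
    (hQ : IsLocalFrames L Q pr) (hT : IsGluing 𝒢 pr T) {W : TotalFamily (CircleBundle L) ℂ}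
    (hW : IsTwisted W) {α : ι} (hWq : ∀ (n : ℕ) (q : Eu n → Q α), IsPlot q →
      ∀ x, W n (fun y => pr α (q y)) x = expFactor 𝒢 α (fun y => pr α (q y)) x * T α n q x)
    {S : TotalFamily (Q α) ℂ} (hS : IsTotalForm S) {q : Eu n → Q α} (hq : IsPlot q)
    (hs : ∀ z, d (T α (n + 1) (flowOut flowT q)) z
      - ctr (timeVec n) (T α (n + 1) (flowOut flowT q) z) = S (n + 1) (flowOut flowT q) z)
    (x : Eu n) : twistD 𝒢 W n (fun y => pr α (q y)) x
      = expFactor 𝒢 α (fun y => pr α (q y)) x * S n q x := by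
  rw [hT.twistD_eq hM hc hQ hW hWq hq hs,
    hS.zeroSlice (smoothFlow_flowT (hQ.smooth_action α)) hq x]

theorem d_sub_ctr_sub {f g : Eu n → Om n ℂ} {s t : Om n ℂ} (hf : ContDiff ℝ ∞ f)
    (hg : ContDiff ℝ ∞ g) {v z : Eu n} (h : d f z - ctr v (f z) = s) (h' : d g z - ctr v (g z) = t) :
    d (fun y => f y - g y) z - ctr v (f z - g z) = s - t := by
  rw [d_sub (hf.contDiffAt.differentiableAt (by simp)) (hg.contDiffAt.differentiableAt (by simp)),
    map_sub, ← h, ← h']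
  exact sub_sub_sub_comm _ _ _ _

theorem mul_sub_sub_sub {R : Type*} [Ring R] (e a b c d : R) :
    e * (a - b - (c - d)) = e * (a - c) - e * (b - d) := by noncomm_ring

theorem mul_sub_eq_of_eq {R : Type*} [Ring R] {a b s s' t t' : R} (h : a * s = b * t)
    (h' : a * s' = b * t') : a * (s - s') = b * (t - t') := by
  rw [mul_sub, mul_sub, h, h']

theorem IsGluing.sub (hT : IsGluing 𝒢 pr T) (hT' : IsGluing 𝒢 pr T') :
    IsGluing 𝒢 pr fun α n q x => T α n q x - T' α n q x where
  isTotalForm α := (hT.isTotalForm α).sub (hT'.isTotalForm α)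
  twist α _ _ _ hq hc t x := by rw [hT.twist α hq hc, hT'.twist α hq hc]
  glue α β _ _ _ hq hr h x := mul_sub_eq_of_eq (hT.glue α β hq hr h x) (hT'.glue α β hq hr h x)

/-- The family of two modules. -/
def pairModule (E E' : GerbeModule L 𝒢 H) : Bool → GerbeModule L 𝒢 H
  | true => E
  | false => E'

variable {E E' : GerbeModule L 𝒢 H}

/-- Frames of two modules at the same point. -/
def pairFrame {α : ι} (q : (E.E α).Q) (q' : (E'.E α).Q) (h : (E.E α).pr q = (E'.E α).pr q') :
    Frames (pairModule E E') fun _ => α where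
  base := (E.E α).pr q
  frame k := match k with
    | true => q
    | false => q'
  pr_frame k := match k with
    | true => rfl
    | false => h.symm

theorem isPlot_pairFrame {α : ι} {q : Eu n → (E.E α).Q} {q' : Eu n → (E'.E α).Q} (hq : IsPlot q)
    (hq' : IsPlot q') (h : ∀ y, (E.E α).pr (q y) = (E'.E α).pr (q' y)) :
    IsPlot fun y => pairFrame (q y) (q' y) (h y) :=
  ⟨(E.E α).smooth_pr n q hq, fun k => match k with
    | true => hq
    | false => hq'⟩

theorem exists_pair_lift (E E' : GerbeModule L 𝒢 H) {p : Eu n → CircleBundle L} (hp : IsPlot p)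
    (x : Eu n) : ∃ α, ∃ (q : Eu n → (E.E α).Q) (q' : Eu n → (E'.E α).Q), IsPlot q ∧ IsPlot q' ∧
      (∀ y, (E.E α).pr (q y) = (E'.E α).pr (q' y)) ∧ ∀ᶠ y in 𝓝 x, (E.E α).pr (q y) = p y := by
  obtain ⟨α, hα⟩ := 𝒰.exists_mem (p x).base
  obtain ⟨s, hs, hsp⟩ := Frames.exists_lift (𝔼 := pairModule E E') (a := fun _ => α) hp x
    fun _ => hα
  have h1 : ∀ y, (E.E α).pr ((s y).frame true) = (s y).base := fun y => (s y).pr_frame true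
  have h2 : ∀ y, (E'.E α).pr ((s y).frame false) = (s y).base := fun y => (s y).pr_frame false
  refine ⟨α, fun y => (s y).frame true, fun y => (s y).frame false, hs.2 true, hs.2 false,
    fun y => (h1 y).trans (h2 y).symm, hsp.mono fun y hy => (h1 y).trans hy⟩

/-- `W` is the total form of the Chern character form. -/
def IsChernTotal (a : HorizontalConnection E) (a' : HorizontalConnection E')
    (W : TotalFamily (CircleBundle L) ℂ) : Prop :=
  ∀ α (n : ℕ) (q : Eu n → (E.E α).Q) (q' : Eu n → (E'.E α).Q), IsPlot q → IsPlot q' →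
    (∀ y, (E.E α).pr (q y) = (E'.E α).pr (q' y)) → ∀ x,
      W n (fun y => (E.E α).pr (q y)) x = expFactor 𝒢 α (fun y => (E.E α).pr (q y)) x
        * (chernTrace (a.A α) q x - chernTrace (a'.A α) q' x)

theorem exists_isChernTotal (hM : IsSmoothCircleAction M) (hc : IsCoupled L 𝒢)
    (a : HorizontalConnection E) (a' : HorizontalConnection E') :
    ∃ W : TotalFamily (CircleBundle L) ℂ, IsTwisted W ∧ IsChernTotal a a' W ∧
      ∀ (n : ℕ) (p : Eu n → CircleBundle L), IsPlot p → ∀ x, twistD 𝒢 W n p x = 0 := by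
  have hQ := Frames.isLocalFrames (𝔼 := pairModule E E') hM
  have hT := Frames.isGluing_chernTrace_sub (𝔼 := pairModule E E') hM hc true false a a'
  obtain ⟨W, hW, hWq⟩ := hT.exists_isTwisted hM hQ
  refine ⟨W, hW, fun α n q q' hq hq' h x => ?_, fun n p hp x => ?_⟩
  · have e := hWq α n _ (isPlot_pairFrame hq hq' h) x
    have e₁ := Frames.chernTrace_conn (𝔼 := pairModule E E') (a := fun _ => α) true a
      (fun y => pairFrame (q y) (q' y) (h y)) x
    have e₂ := Frames.chernTrace_conn (𝔼 := pairModule E E') (a := fun _ => α) false a'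
      (fun y => pairFrame (q y) (q' y) (h y)) x
    exact e.trans (congrArg₂ (fun s t => expFactor 𝒢 α (fun y => (E.E α).pr (q y)) x * (s - t)) e₁ e₂)
  · obtain ⟨α, hα⟩ := 𝒰.exists_mem (p x).base
    obtain ⟨s, hs, hsp⟩ := hQ.exists_lift α n p hp x hα
    rw [twistD_congr_germ hM hW.isTotalForm hp (hQ.plot hs) (hsp.mono fun _ hy => hy.symm)]
    have hd := hT.twistD_eq hM hc hQ hW (hWq α) hs (s := fun _ => 0) (fun z => ?_) x
    · refine hd.trans ?_
      rw [ContinuousLinearMap.map_zero (comap (zeroSlice n))]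
      exact mul_zero _
    · have hF := (smoothFlow_flowT (hQ.smooth_action α)).plot hs
      have i₁ := Frames.invariantConnection_conn (𝔼 := pairModule E E') (a := fun _ => α) true a
      have i₂ := Frames.invariantConnection_conn (𝔼 := pairModule E E') (a := fun _ => α) false a'
      exact (d_sub_ctr_sub ((i₁.isTotalForm_chernTrace (hQ.smooth_action α)).contDiff hF)
        ((i₂.isTotalForm_chernTrace (hQ.smooth_action α)).contDiff hF)
        (i₁.d_chernTrace (hQ.smooth_action α) hs z)
        (i₂.d_chernTrace (hQ.smooth_action α) hs z)).trans (sub_zero _)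

theorem IsChernTotal.eq {a : HorizontalConnection E} {a' : HorizontalConnection E'}
    {W : TotalFamily (CircleBundle L) ℂ} (h : IsChernTotal a a' W) {α : ι} {q : Eu n → (E.E α).Q}
    {q' : Eu n → (E'.E α).Q} (hq : IsPlot q) (hq' : IsPlot q') {p : Eu n → CircleBundle L}
    (hqp : ∀ y, (E.E α).pr (q y) = p y) (hqp' : ∀ y, (E'.E α).pr (q' y) = p y) (x : Eu n) :
    W n p x = expFactor 𝒢 α p x * (chernTrace (a.A α) q x - chernTrace (a'.A α) q' x) := by
  obtain rfl : (fun y => (E.E α).pr (q y)) = p := funext hqp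
  exact h α n q q' hq hq' (fun y => (hqp' y).symm) x

theorem IsChernTotal.isChernForm {a : HorizontalConnection E} {a' : HorizontalConnection E'}
    {W : TotalFamily (CircleBundle L) ℂ} (hW : IsTotalForm W) (h : IsChernTotal a a' W) :
    IsChernForm a a' (laurentOf 0 W) := by
  refine ⟨fun j k => (isLaurentOn_laurentOf hW 0 _).1 j k, fun α n q q' hq hq' hqq x j k => ?_⟩
  rw [chLocal_eq a a' α ((a.invariantConnection α).differentiableAt hq x)
    ((a'.invariantConnection α).differentiableAt hq' x), ← h α n q q' hq hq' hqq x,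
    ← laurentOf_natCast]
  rfl

theorem IsChernForm.eq {a : HorizontalConnection E} {a' : HorizontalConnection E'}
    {ch ch' : Laurent (CircleBundle L)} (h : IsChernForm a a' ch) (h' : IsChernForm a a' ch')
    (j : ℤ) (k : ℕ) {p : Eu n → CircleBundle L} (hp : IsPlot p) (x : Eu n) :
    ch' j k n p x = ch j k n p x := by
  obtain ⟨α, q, q', hq, hq', hqq, hqp⟩ := exists_pair_lift E E' hp x
  have hpr : IsPlot fun y => (E.E α).pr (q y) := (E.E α).smooth_pr n q hq
  have hg := hqp.mono fun _ hy => hy.symm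
  rw [(h.1 j k).congr_germ hp hpr trivial hg, (h'.1 j k).congr_germ hp hpr trivial hg,
    h.2 α n q q' hq hq' hqq, h'.2 α n q q' hq hq' hqq]

/-- The Chern character form is globally well defined and closed. -/
theorem exists_isChernForm (hM : IsSmoothCircleAction M) (hc : IsCoupled L 𝒢)
    (a : HorizontalConnection E) (a' : HorizontalConnection E') :
    ∃ ch : Laurent (CircleBundle L), IsChernForm a a' ch ∧
      (∀ ch', IsChernForm a a' ch' → ∀ j k (n : ℕ) (p : Eu n → CircleBundle L), IsPlot p →
        ∀ x, ch' j k n p x = ch j k n p x) ∧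
      InOmegaTilde ch ∧ IsTInvariant ch ∧
      ∀ j k (n : ℕ) (p : Eu n → CircleBundle L), IsPlot p → ∀ x,
        circleD L 𝒢 ch j k n p x = 0 := by
  obtain ⟨W, hW, hWc, hWd⟩ := exists_isChernTotal hM hc a a'
  have h := hWc.isChernForm hW.isTotalForm
  refine ⟨laurentOf 0 W, h, fun ch' h' j k n p hp x => h.eq h' j k hp x, hW.inOmegaTilde 0,
    hW.isTInvariant 0, fun j k n p hp x => ?_⟩
  rw [hW.circleD_laurentOf 0 j k hp, hWd n p hp]
  exact ite_self _

/-- The total form of a Chern-Simons form, whose derivative is `W₁ - W₀`. -/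
theorem exists_chernSimonsTotal (hM : IsSmoothCircleAction M) (hc : IsCoupled L 𝒢)
    (a₀ a₁ : HorizontalConnection E) (a₀' a₁' : HorizontalConnection E')
    {W₀ W₁ : TotalFamily (CircleBundle L) ℂ} (h₀ : IsTotalForm W₀) (h₁ : IsTotalForm W₁)
    (hW₀ : IsChernTotal a₀ a₀' W₀) (hW₁ : IsChernTotal a₁ a₁' W₁) :
    ∃ W : TotalFamily (CircleBundle L) ℂ, IsTwisted W ∧ IsChernSimonsForm a₀ a₁ a₀' a₁'
      (laurentOf 1 W) ∧ ∀ (n : ℕ) (p : Eu n → CircleBundle L), IsPlot p → ∀ x,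
        twistD 𝒢 W n p x = W₁ n p x - W₀ n p x := by
  have hQ := Frames.isLocalFrames (𝔼 := pairModule E E') hM
  have hT := (Frames.isGluing_csTrace (𝔼 := pairModule E E') hM hc true a₀ a₁).sub
    (Frames.isGluing_csTrace (𝔼 := pairModule E E') hM hc false a₀' a₁')
  obtain ⟨W, hW, hWq⟩ := hT.exists_isTwisted hM hQ
  refine ⟨W, hW, ⟨fun j k => (isLaurentOn_laurentOf hW.isTotalForm 1 _).1 j k,
    fun α n q q' hq hq' hqq x j k => ?_⟩, fun n p hp x => ?_⟩
  · have e := hWq α n _ (isPlot_pairFrame hq hq' hqq) x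
    have e₁ := Frames.csTrace_conn (𝔼 := pairModule E E') (a := fun _ => α) true a₀ a₁
      (fun y => pairFrame (q y) (q' y) (hqq y)) x
    have e₂ := Frames.csTrace_conn (𝔼 := pairModule E E') (a := fun _ => α) false a₀' a₁'
      (fun y => pairFrame (q y) (q' y) (hqq y)) x
    have e₃ := e.trans (congrArg₂
      (fun s t => expFactor 𝒢 α (fun y => (E.E α).pr (q y)) x * (s - t)) e₁ e₂)
    have i₀ := a₀.invariantConnection α
    have i₁ := a₁.invariantConnection α
    have i₀' := a₀'.invariantConnection α
    have i₁' := a₁'.invariantConnection α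
    rw [csLocal_eq a₀ a₁ a₀' a₁' α (i₀.differentiableAt hq x) (i₁.differentiableAt hq x)
      (i₀'.differentiableAt hq' x) (i₁'.differentiableAt hq' x)
      (continuous_transForm (E.E α).smooth_torusAction i₀ i₁ hq x)
      (continuous_transForm (E'.E α).smooth_torusAction i₀' i₁' hq' x)]
    refine Eq.trans ?_ (laurentOf_natCast 1 _ j k)
    show (if (k : ℤ) + 1 = -2 * j then W n (fun y => (E.E α).pr (q y)) x k else 0) = _
    exact congrArg (fun w : Om n ℂ => if (k : ℤ) + 1 = -2 * j then w k else 0) e₃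
  · obtain ⟨α, hα⟩ := 𝒰.exists_mem (p x).base
    obtain ⟨s, hs, hsp⟩ := hQ.exists_lift α n p hp x hα
    have hg : ∀ᶠ y in 𝓝 x, p y = (s y).base := hsp.mono fun _ hy => hy.symm
    rw [twistD_congr_germ hM hW.isTotalForm hp (hQ.plot hs) hg, h₀.congr_germ hp (hQ.plot hs) hg,
      h₁.congr_germ hp (hQ.plot hs) hg]
    have i₀ := Frames.invariantConnection_conn (𝔼 := pairModule E E') (a := fun _ => α) true a₀
    have i₁ := Frames.invariantConnection_conn (𝔼 := pairModule E E') (a := fun _ => α) true a₁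
    have i₀' := Frames.invariantConnection_conn (𝔼 := pairModule E E') (a := fun _ => α) false a₀'
    have i₁' := Frames.invariantConnection_conn (𝔼 := pairModule E E') (a := fun _ => α) false a₁'
    have hα := hQ.smooth_action α
    have hF := (smoothFlow_flowT hα).plot hs
    have hd := hT.twistD_eq_mul hM hc hQ hW (hWq α)
      (((i₁.isTotalForm_chernTrace hα).sub (i₀.isTotalForm_chernTrace hα)).sub
        ((i₁'.isTotalForm_chernTrace hα).sub (i₀'.isTotalForm_chernTrace hα))) hs
      (fun z => d_sub_ctr_sub ((isTotalForm_csTrace hα i₀ i₁).contDiff hF)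
        ((isTotalForm_csTrace hα i₀' i₁').contDiff hF) (d_csTrace hα i₀ i₁ hs z)
        (d_csTrace hα i₀' i₁' hs z)) x
    have c₀ := Frames.chernTrace_conn (𝔼 := pairModule E E') true a₀ s x
    have c₁ := Frames.chernTrace_conn (𝔼 := pairModule E E') true a₁ s x
    have c₀' := Frames.chernTrace_conn (𝔼 := pairModule E E') false a₀' s x
    have c₁' := Frames.chernTrace_conn (𝔼 := pairModule E E') false a₁' s x
    rw [c₀, c₁, c₀', c₁'] at hd
    rw [hd, hW₀.eq (hs.2 true) (hs.2 false) (fun y => (s y).pr_frame true)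
      (fun y => (s y).pr_frame false), hW₁.eq (hs.2 true) (hs.2 false)
      (fun y => (s y).pr_frame true) (fun y => (s y).pr_frame false)]
    exact mul_sub_sub_sub _ _ _ _ _

theorem IsTwisted.sub_eq_circleD
    {W W₀ W₁ : TotalFamily (CircleBundle L) ℂ} (hW : IsTwisted W)
    (h : ∀ (n : ℕ) (p : Eu n → CircleBundle L), IsPlot p → ∀ x,
        twistD 𝒢 W n p x = W₁ n p x - W₀ n p x) (j : ℤ) (k : ℕ) {p : Eu n → CircleBundle L}
    (hp : IsPlot p) (x : Eu n) : laurentOf 0 W₁ j k n p x - laurentOf 0 W₀ j k n p x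
      = circleD L 𝒢 (laurentOf 1 W) j k n p x := by
  rw [hW.circleD_laurentOf 1 j k hp, h n p hp, laurentOf_sub, laurentOf]
  have e : (k : ℤ) + 0 = -2 * j ↔ (k : ℤ) + 1 = -2 * j + 1 := by omega
  by_cases hk : (k : ℤ) + 0 = -2 * j
  · rw [if_pos hk, if_pos (e.1 hk)]
  · rw [if_neg hk, if_neg (mt e.2 hk)]

/-- Chern character forms of different connections differ by exact forms. -/
theorem exists_isChernSimonsForm (hM : IsSmoothCircleAction M) (hc : IsCoupled L 𝒢)
    (a₀ a₁ : HorizontalConnection E) (a₀' a₁' : HorizontalConnection E')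
    (ch₀ ch₁ : Laurent (CircleBundle L)) (h₀ : IsChernForm a₀ a₀' ch₀)
    (h₁ : IsChernForm a₁ a₁' ch₁) :
    ∃ cs : Laurent (CircleBundle L), IsChernSimonsForm a₀ a₁ a₀' a₁' cs ∧
      InOmegaTilde cs ∧ IsTInvariant cs ∧
      ∀ j k (n : ℕ) (p : Eu n → CircleBundle L), IsPlot p → ∀ x,
        ch₁ j k n p x - ch₀ j k n p x = circleD L 𝒢 cs j k n p x := by
  obtain ⟨W₀, hW₀, hc₀, -⟩ := exists_isChernTotal hM hc a₀ a₀'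
  obtain ⟨W₁, hW₁, hc₁, -⟩ := exists_isChernTotal hM hc a₁ a₁'
  obtain ⟨W, hW, hcs, hd⟩ := exists_chernSimonsTotal hM hc a₀ a₁ a₀' a₁' hW₀.isTotalForm
    hW₁.isTotalForm hc₀ hc₁
  refine ⟨laurentOf 1 W, hcs, hW.inOmegaTilde 1, hW.isTInvariant 1, fun j k n p hp x => ?_⟩
  rw [← hW.sub_eq_circleD hd j k hp, (hc₀.isChernForm hW₀.isTotalForm).eq h₀ j k hp,
    (hc₁.isChernForm hW₁.isTotalForm).eq h₁ j k hp]

end ChernForms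
end

noncomputable section

section XiForms

open Om

variable {M : Type u} [DiffeologicalSpace M] [MulAction Circle M] {ι : Type u}
  {𝒰 : GoodCover M ι} {L : HermitianLineBundle 𝒰} {𝒢 : WeakInvariantGerbe 𝒰} {n : ℕ}

theorem CircleBundle.ext_coord {s s' : CircleBundle L} (h : s.base = s'.base)
    (h' : ∀ β hs hs', s.coord β hs = s'.coord β hs') : s = s' := by
  obtain ⟨b, c, hc⟩ := s
  obtain ⟨b', c', hc'⟩ := s'
  obtain rfl : b = b' := h
  obtain rfl : c = c' := funext fun β => funext fun hβ => h' β hβ hβ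
  rfl

theorem HermitianLineBundle.g_self (L : HermitianLineBundle 𝒰) {α : ι} {y : M} (h : y ∈ 𝒰.U α) :
    L.g α α y = 1 := by
  have := L.cocycle α α α y h h h
  rwa [mul_eq_left] at this

/-- The section `s_α` of `Sξ` over `U_α`. -/
def unitSection (L : HermitianLineBundle 𝒰) (α : ι) (y : M) (h : y ∈ 𝒰.U α) : CircleBundle L where
  base := y
  coord β _ := L.g β α y
  compat β γ hβ hγ := (L.cocycle β γ α y hβ hγ h).symm

variable {α β : ι}

theorem coordAt_unitSection {y : M} (h : y ∈ 𝒰.U α) (hβ : y ∈ 𝒰.U β) :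
    (unitSection L α y h).coordAt β = L.g β α y :=
  coordAt_of_mem (s := unitSection L α y h) hβ

theorem unitSection_smul {y : M} (h : y ∈ 𝒰.U α) (t : Circle) :
    unitSection L α (t • y) ((𝒰.smul_mem_iff α t y).2 h) = (t, (1 : Circle)) • unitSection L α y h := by
  refine CircleBundle.ext_coord rfl fun β hs _ => ?_
  show L.g β α (t • y) = 1 * L.g β α y
  rw [one_mul, L.invariant_g β α t y ((𝒰.smul_mem_iff β t y).1 hs) h]

theorem unitSection_change {y : M} (h : y ∈ 𝒰.U α) (hβ : y ∈ 𝒰.U β) :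
    unitSection L β y hβ = ((1 : Circle), L.g α β y) • unitSection L α y h := by
  refine CircleBundle.ext_coord (one_smul _ _).symm fun γ hs _ => ?_
  show L.g γ β y = L.g α β y * L.g γ α y
  rw [mul_comm, L.cocycle γ α β y hs h hβ]

theorem eq_smul_unitSection {s : CircleBundle L} (h : s.base ∈ 𝒰.U α) :
    s = ((1 : Circle), s.coordAt α) • unitSection L α s.base h := by
  refine CircleBundle.ext_coord (one_smul _ _).symm fun γ hs _ => ?_
  show s.coord γ hs = s.coordAt α * L.g γ α s.base
  rw [coordAt_of_mem h, s.compat γ α hs h, mul_comm]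

theorem isPlot_unitSection {m : Eu n → M} (hm : IsPlot m) (h : ∀ y, m y ∈ 𝒰.U α) :
    IsPlot fun y => unitSection L α (m y) (h y) := by
  refine ⟨hm, fun β x hx => ?_⟩
  refine (L.smooth_g β α n m hm x ⟨hx, h x⟩).congr_of_eventuallyEq ?_
  filter_upwards [eventually_mem hm hx] with y hy
  rw [coordAt_unitSection (h y) hy]

theorem flowOut_unitSection {m : Eu n → M} (h : ∀ y, m y ∈ 𝒰.U α) :
    flowOut flowT (fun y => unitSection L α (m y) (h y))
      = fun z => unitSection L α (flowOut flowK m z) (flowK_mem α _ _ (h _)) :=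
  funext fun _ => (unitSection_smul (h _) _).symm

/-- The pullback of a form on `Sξ` under the section `s_α`. -/
def sectionPull (W : TotalFamily (CircleBundle L) ℂ) (α : ι) : TotalFamily M ℂ := fun n m x =>
  open scoped Classical in
  if h : IsPlot m ∧ m x ∈ 𝒰.U α then
    W n (fun y => unitSection L α (m ((exists_cutoff x (eventually_mem h.1 h.2)).choose y))
      ((exists_cutoff x (eventually_mem h.1 h.2)).choose_spec.2.2 y)) x
  else 0

variable {W : TotalFamily (CircleBundle L) ℂ}

theorem sectionPull_eq (hW : IsTotalForm W) {m m' : Eu n → M} (hm : IsPlot m) (hm' : IsPlot m')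
    {x : Eu n} (h : ∀ y, m' y ∈ 𝒰.U α) (hmm : ∀ᶠ y in 𝓝 x, m y = m' y) :
    sectionPull W α n m x = W n (fun y => unitSection L α (m' y) (h y)) x := by
  have hx : m x ∈ 𝒰.U α := by
    rw [hmm.self_of_nhds]
    exact h x
  have hc := (exists_cutoff x (eventually_mem hm hx)).choose_spec
  rw [sectionPull, dif_pos ⟨hm, hx⟩]
  refine hW.congr_germ (isPlot_unitSection (isPlot_reparam hm hc.1) _) (isPlot_unitSection hm' h) ?_
  filter_upwards [hc.2.1, hmm] with y h1 h2
  refine CircleBundle.ext_coord ((congrArg m h1).trans h2) fun β _ _ => ?_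
  show L.g β α (m _) = L.g β α (m' y)
  rw [h1, h2]

theorem isFormOn_sectionPull (hW : IsTotalForm W) (α : ι) (k : ℕ) :
    IsFormOn (𝒰.U α) fun n m x => sectionPull W α n m x k := by
  refine ⟨fun n m hm x hx => ?_, fun n l m h hm hh y hy => ?_⟩
  · obtain ⟨c, hc, hcx, hcU⟩ := exists_cutoff x (eventually_mem hm hx)
    refine ((hW.isFormOn Set.univ k).1 n _ (isPlot_unitSection (isPlot_reparam hm hc) hcU) x
      trivial).congr_of_eventuallyEq ?_
    filter_upwards [hcx.eventually_nhds] with y hy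
    rw [sectionPull_eq hW hm (isPlot_reparam hm hc) hcU (hy.mono fun z hz => congrArg m hz.symm)]
  · obtain ⟨c, hc, hcx, hcU⟩ := exists_cutoff (h y) (eventually_mem hm hy)
    have hg : ∀ᶠ z in 𝓝 (h y), m z = m (c z) := hcx.mono fun z hz => congrArg m hz.symm
    have hp := isPlot_unitSection (L := L) (isPlot_reparam hm hc) hcU
    show sectionPull W α l (m ∘ h) y k = (sectionPull W α n m (h y) k).compContinuousLinearMap _
    rw [sectionPull_eq hW hm (isPlot_reparam hm hc) hcU hg,
      sectionPull_eq hW (isPlot_reparam hm hh) (isPlot_reparam (isPlot_reparam hm hc) hh)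
        (fun z => hcU (h z)) (hh.continuous.continuousAt.eventually hg)]
    exact (hW.isFormOn Set.univ k).2 n l _ h hp hh y trivial

/-- The form on `M` with values in `ξ` that corresponds to the form `W` on `Sξ`. -/
def xiOf (δ : ℤ) (W : TotalFamily (CircleBundle L) ℂ) : ι → Laurent M :=
  fun α => laurentOf δ (sectionPull W α)

theorem scal_inv_mul_cancel {w : Om n ℂ} (g : Circle) :
    w = scal n (g : ℂ) * (scal n (g : ℂ)⁻¹ * w) := by
  have h : scal n (g : ℂ) * scal n (g : ℂ)⁻¹ = 1 := by
    rw [scal_mul_scal, mul_inv_cancel₀ (Circle.coe_ne_zero g), scal_one]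
  have := mul_assoc (scal n (g : ℂ)) (scal n (g : ℂ)⁻¹) w
  rw [h] at this
  exact (one_mul w).symm.trans this

theorem IsTwisted.isInvariantXiForm (hM : IsSmoothCircleAction M) (hW : IsTwisted W) (δ : ℤ) :
    IsInvariantXiForm L (xiOf δ W) := by
  have hT := hW.isTotalForm
  refine ⟨fun α j k => ?_, fun j => ⟨(-2 * j - δ).toNat + 1, fun k hk α n p _ x _ =>
    if_neg (by omega)⟩, fun α β j k n m hm x hx => ?_, fun α j k t n m hm x hx => ?_⟩
  · by_cases h : (k : ℤ) + δ = -2 * j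
    · have e : xiOf δ W α j k = fun n m x => sectionPull W α n m x k := by
        funext n p x
        exact if_pos h
      rw [e]
      exact isFormOn_sectionPull hT α k
    · have e : xiOf δ W α j k = fun n p x => 0 := by
        funext n p x
        exact if_neg h
      rw [e]
      exact ⟨fun _ _ _ _ _ => contDiffAt_const, fun _ _ _ _ _ _ _ _ => rfl⟩
  · obtain ⟨c, hc, hcx, hcU⟩ := exists_cutoff x
      ((eventually_mem hm hx.1).and (eventually_mem hm hx.2))
    have hmc := isPlot_reparam hm hc
    have hg : ∀ᶠ y in 𝓝 x, m y = m (c y) := hcx.mono fun z hz => congrArg m hz.symm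
    have hgs : SmoothCircleMap fun y => L.g α β (m (c y)) :=
      contDiff_iff_contDiffAt.2 fun y => L.smooth_g α β n _ hmc y (hcU y)
    have e1 := hW.smul (isPlot_unitSection (L := L) hmc fun y => (hcU y).1) hgs 1 x
    have e2 : (fun y => ((1 : Circle), L.g α β (m (c y)))
        • unitSection L α (m (c y)) (hcU y).1) = fun y => unitSection L β (m (c y)) (hcU y).2 :=
      funext fun y => (unitSection_change (hcU y).1 (hcU y).2).symm
    have e5 : W n (fun y => unitSection L β (m (c y)) (hcU y).2) x
        = scal n (L.g α β (m x) : ℂ)⁻¹ * W n (fun y => unitSection L α (m (c y)) (hcU y).1) x := by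
      refine (congrArg (fun q => W n q x) e2.symm).trans (e1.trans ?_)
      rw [hcx.self_of_nhds]
      rfl
    have e3 := scal_inv_mul_cancel (w := W n (fun y => unitSection L α (m (c y)) (hcU y).1) x)
      (L.g α β (m x))
    have e4 : sectionPull W α n m x = scal n (L.g α β (m x) : ℂ) * sectionPull W β n m x := by
      rw [sectionPull_eq hT hm hmc (fun y => (hcU y).1) hg,
        sectionPull_eq hT hm hmc (fun y => (hcU y).2) hg]
      exact e3.trans (congrArg (scal n (L.g α β (m x) : ℂ) * ·) e5.symm)
    show (if _ then sectionPull W α n m x k else 0)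
      = (L.g α β (m x) : ℂ) • (if _ then sectionPull W β n m x k else 0)
    rw [e4, scal_mul_apply]
    split_ifs
    · rfl
    · exact (smul_zero _).symm
  · obtain ⟨c, hc, hcx, hcU⟩ := exists_cutoff x (eventually_mem hm hx)
    have hmc := isPlot_reparam hm hc
    have hg : ∀ᶠ y in 𝓝 x, m y = m (c y) := hcx.mono fun z hz => congrArg m hz.symm
    have ht : ∀ {l : Eu n → M}, IsPlot l → IsPlot fun y => t • l y :=
      fun hl => hM n (fun _ => t) _ contDiff_const hl
    have e1 : sectionPull W α n (fun y => t • m y) x = sectionPull W α n m x := by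
      rw [sectionPull_eq hT (ht hm) (ht hmc) (fun y => (𝒰.smul_mem_iff α t _).2 (hcU y))
        (hg.mono fun y hy => congrArg (t • ·) hy), sectionPull_eq hT hm hmc hcU hg,
        ← hW.smul_const t (isPlot_unitSection hmc hcU)]
      congr 1
      exact funext fun y => unitSection_smul (hcU y) t
    show (if _ then sectionPull W α n _ x k else 0) = if _ then sectionPull W α n m x k else 0
    rw [e1]

theorem IsTwisted.mapsTo (hW : IsTwisted W) (δ : ℤ) : MapsTo (xiOf δ W) (laurentOf δ W) := by
  intro α j k n p hp x hx
  have hT := hW.isTotalForm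
  have hm := isPlot_proj hp
  obtain ⟨c, hc, hcx, hcU⟩ := exists_cutoff x (eventually_mem hm hx)
  have hmc := isPlot_reparam hm hc
  have hpc := isPlot_reparam hp hc
  have hg : ∀ᶠ y in 𝓝 x, proj p y = proj p (c y) := hcx.mono fun z hz => congrArg _ hz.symm
  have hgs : SmoothCircleMap fun y => (p (c y)).coordAt α := contDiff_coordAt hpc hcU
  have e1 := hW.smul (isPlot_unitSection (L := L) hmc hcU) hgs 1 x
  have e2 : (fun y => ((1 : Circle), (p (c y)).coordAt α) • unitSection L α (proj p (c y)) (hcU y))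
      = p ∘ c := funext fun y => (eq_smul_unitSection (hcU y)).symm
  have e3 := hT.congr_germ hp hpc (x := x) (hcx.mono fun y hy => congrArg p hy.symm)
  have e4 : W n p x = scal n ((p x).coordAt α : ℂ)⁻¹ * sectionPull W α n (proj p) x := by
    rw [sectionPull_eq hT hm hmc hcU hg, e3]
    refine (congrArg (fun q => W n q x) e2.symm).trans (e1.trans ?_)
    rw [hcx.self_of_nhds]
  show (if _ then W n p x k else 0)
    = ((p x).coordAt α : ℂ)⁻¹ • (if _ then sectionPull W α n (proj p) x k else 0)
  rw [e4, scal_mul_apply]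
  split_ifs
  · rfl
  · exact (smul_zero _).symm

theorem MapsTo.eq_unitSection {w : ι → Laurent M} {ch : Laurent (CircleBundle L)} (h : MapsTo w ch)
    (j : ℤ) (k : ℕ) {m : Eu n → M} (hm : IsPlot m) (hU : ∀ y, m y ∈ 𝒰.U α) (x : Eu n) :
    ch j k n (fun y => unitSection L α (m y) (hU y)) x = w α j k n m x := by
  rw [h α j k n _ (isPlot_unitSection hm hU) x (hU x), coordAt_unitSection (hU x) (hU x),
    L.g_self (hU x), Circle.coe_one, inv_one, one_smul]
  rfl

theorem Theta_unitSection {m : Eu n → M} (hm : IsPlot m) (hU : ∀ y, m y ∈ 𝒰.U α) (x : Eu n) :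
    Theta L n (fun y => unitSection L α (m y) (hU y)) x = L.η α n m x := by
  have h1 : (fun y => (unitSection L α (m y) (hU y)).coordAt α) = fun _ => 1 := by
    funext y
    rw [coordAt_unitSection (hU y) (hU y), L.g_self (hU y)]
  rw [Theta_eq (isPlot_unitSection hm hU) (hU x), h1]
  have h2 : dlog (fun _ : Eu n => (1 : Circle)) x = 0 := by
    rw [dlog, fderiv_fun_const]
    ext v
    show _ * (0 : ℂ) = 0
    exact mul_zero _
  rw [h2]
  exact zero_add _

/-- The operators on `M` and on `Sξ` correspond to each other. -/
theorem MapsTo.xiD_eq {w : ι → Laurent M} {ch : Laurent (CircleBundle L)} (h : MapsTo w ch)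
    (hM : IsSmoothCircleAction M) (hch : InOmegaTilde ch) (j : ℤ) (k : ℕ) {m : Eu n → M}
    (hm : IsPlot m) (hU : ∀ y, m y ∈ 𝒰.U α) (x : Eu n) :
    circleD L 𝒢 ch j k n (fun y => unitSection L α (m y) (hU y)) x = xiD L 𝒢 w α j k n m x := by
  have hp := isPlot_unitSection (L := L) hm hU
  have hF := (smoothFlow_flowK hM).plot hm
  have hFU : ∀ z, flowOut flowK m z ∈ 𝒰.U α := fun z => flowK_mem α _ _ (hU _)
  have e1 : ∀ k, extD (ch j k) n (fun y => unitSection L α (m y) (hU y)) x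
      = extD (w α j k) n m x := fun k => by
    rw [extD, extD]
    congr 1
    exact funext fun y => h.eq_unitSection j k hm hU y
  have e2 : contract flowT (ch (j - 1) (k + 1)) n (fun y => unitSection L α (m y) (hU y)) x
      = contract flowK (w α (j - 1) (k + 1)) n m x := by
    rw [contract_eq, contract_eq, flowOut_unitSection,
      h.eq_unitSection (j - 1) (k + 1) hF hFU]
  have e3 := (hch.2 j k n _ hp x).1
  have e4 := Theta_unitSection (L := L) hm hU x
  have e5 : proj (fun y => unitSection L α (m y) (hU y)) = m := rfl
  rcases k with _ | _ | _ | k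
  · show 0 - contractV (ch j 1) n _ x - contract flowT (ch (j - 1) 1) n _ x + 0 + 0
      = 0 - contract flowK (w α (j - 1) 1) n m x + 0
    rw [e2, e3, sub_zero, add_zero]
  · show extD (ch j 0) n _ x - contractV (ch j 2) n _ x - contract flowT (ch (j - 1) 2) n _ x
        + wedge _ (Theta L n _ x) (ch j 0 n _ x) + 0
      = extD (w α j 0) n m x + wedge _ (L.η α n m x) (w α j 0 n m x)
        - contract flowK (w α (j - 1) 2) n m x + 0
    rw [e1, e2, e3, e4, h.eq_unitSection j 0 hm hU]
    abel
  · show extD (ch j 1) n _ x - contractV (ch j 3) n _ x - contract flowT (ch (j - 1) 3) n _ x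
        + wedge _ (Theta L n _ x) (ch j 1 n _ x) + 0
      = extD (w α j 1) n m x + wedge _ (L.η α n m x) (w α j 1 n m x)
        - contract flowK (w α (j - 1) 3) n m x + 0
    rw [e1, e2, e3, e4, h.eq_unitSection j 1 hm hU]
    abel
  · show extD (ch j (k + 2)) n _ x - contractV (ch j (k + 4)) n _ x
        - contract flowT (ch (j - 1) (k + 4)) n _ x
        + wedge _ (Theta L n _ x) (ch j (k + 2) n _ x)
        + wedge _ (𝒢.H n (proj _) x) (ch (j + 1) k n _ x)
      = extD (w α j (k + 2)) n m x + wedge _ (L.η α n m x) (w α j (k + 2) n m x)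
        - contract flowK (w α (j - 1) (k + 4)) n m x
        + wedge _ (𝒢.H n m x) (w α (j + 1) k n m x)
    rw [e1, e2, e3, e4, e5, h.eq_unitSection j (k + 2) hm hU, h.eq_unitSection (j + 1) k hm hU]
    abel

theorem extDeriv_congr {F : Type*} [NormedAddCommGroup F] [NormedSpace ℝ F] {k : ℕ}
    {f g : Eu n → Alt n F k} {x : Eu n} (h : f =ᶠ[𝓝 x] g) : extDeriv f x = extDeriv g x := by
  rw [extDeriv, extDeriv, h.fderiv_eq]

theorem xiD_congr_germ (hM : IsSmoothCircleAction M) {w : ι → Laurent M}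
    (hw : ∀ j k, IsFormOn (𝒰.U α) (w α j k)) (j : ℤ) (k : ℕ) {m m' : Eu n → M} (hm : IsPlot m)
    (hm' : IsPlot m') {x : Eu n} (hx : m x ∈ 𝒰.U α) (hg : ∀ᶠ y in 𝓝 x, m y = m' y) :
    xiD L 𝒢 w α j k n m x = xiD L 𝒢 w α j k n m' x := by
  have e0 : ∀ j k, w α j k n m x = w α j k n m' x :=
    fun j k => (hw j k).congr_germ hm hm' hx hg
  have e1 : ∀ k, extD (w α j k) n m x = extD (w α j k) n m' x := fun k => by
    refine extDeriv_congr ?_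
    filter_upwards [hg.eventually_nhds, eventually_mem hm hx] with y h1 h2
    exact (hw j k).congr_germ hm hm' h2 h1
  have e2 := ((smoothFlow_flowK hM).isFormOn_contract (hw (j - 1) (k + 1))).congr_germ hm hm' hx hg
  have e3 := (L.isForm_η α).congr_germ hm hm' hx hg
  have e4 := 𝒢.isForm_H.congr_germ hm hm' trivial hg
  rcases k with _ | _ | _ | k <;> simp only [xiD, e0, e1, e2, e3, e4]

theorem MapsTo.isClosed {w : ι → Laurent M} {ch : Laurent (CircleBundle L)} (h : MapsTo w ch)
    (hM : IsSmoothCircleAction M) (hch : InOmegaTilde ch) (hw : IsInvariantXiForm L w)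
    (hD : ∀ j k (n : ℕ) (p : Eu n → CircleBundle L), IsPlot p → ∀ x,
      circleD L 𝒢 ch j k n p x = 0) (α : ι) (j : ℤ) (k n : ℕ) (m : Eu n → M) (hm : IsPlot m)
    (x : Eu n) (hx : m x ∈ 𝒰.U α) : xiD L 𝒢 w α j k n m x = 0 := by
  obtain ⟨c, hc, hcx, hcU⟩ := exists_cutoff x (eventually_mem hm hx)
  have hmc := isPlot_reparam hm hc
  have hg : ∀ᶠ y in 𝓝 x, m y = (m ∘ c) y := hcx.mono fun z hz => congrArg m hz.symm
  rw [xiD_congr_germ hM (hw.1 α) j k hm hmc hx hg, ← h.xiD_eq hM hch j k hmc hcU]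
  exact hD j k n _ (isPlot_unitSection hmc hcU) x

theorem exists_closedXiForm (hM : IsSmoothCircleAction M) (hW : IsTwisted W)
    (hD : ∀ (n : ℕ) (p : Eu n → CircleBundle L), IsPlot p → ∀ x, twistD 𝒢 W n p x = 0) :
    ∃ w : ClosedXiForm L 𝒢, MapsTo w.1 (laurentOf 0 W) :=
  ⟨⟨xiOf 0 W, hW.isInvariantXiForm hM 0, (hW.mapsTo 0).isClosed hM (hW.inOmegaTilde 0)
    (hW.isInvariantXiForm hM 0) fun j k n p hp x => by
      rw [hW.circleD_laurentOf 0 j k hp, hD n p hp]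
      exact ite_self _⟩, hW.mapsTo 0⟩

/-- Closed forms that correspond to forms on `Sξ` with exact difference are cohomologous. -/
theorem xiCohomologous_of_twistD (hM : IsSmoothCircleAction M)
    {W₀ W₁ : TotalFamily (CircleBundle L) ℂ} (hW : IsTwisted W)
    (hd : ∀ (n : ℕ) (p : Eu n → CircleBundle L), IsPlot p → ∀ x,
        twistD 𝒢 W n p x = W₁ n p x - W₀ n p x) {w₀ w₁ : ClosedXiForm L 𝒢}
    (h₀ : MapsTo w₀.1 (laurentOf 0 W₀)) (h₁ : MapsTo w₁.1 (laurentOf 0 W₁)) :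
    XiCohomologous L 𝒢 w₁ w₀ := by
  refine ⟨xiOf 1 W, hW.isInvariantXiForm hM 1, fun α j k n m hm x hx => ?_⟩
  obtain ⟨c, hc, hcx, hcU⟩ := exists_cutoff x (eventually_mem hm hx)
  have hmc := isPlot_reparam hm hc
  have hg : ∀ᶠ y in 𝓝 x, m y = (m ∘ c) y := hcx.mono fun z hz => congrArg m hz.symm
  rw [xiD_congr_germ hM ((hW.isInvariantXiForm hM 1).1 α) j k hm hmc hx hg,
    ← (hW.mapsTo 1).xiD_eq hM (hW.inOmegaTilde 1) j k hmc hcU,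
    ← hW.sub_eq_circleD hd j k (isPlot_unitSection hmc hcU),
    (w₁.2.1.1 α j k).congr_germ hm hmc hx hg, (w₀.2.1.1 α j k).congr_germ hm hmc hx hg]
  exact congrArg₂ (· - ·) (h₁.eq_unitSection j k hmc hcU x).symm
    (h₀.eq_unitSection j k hmc hcU x).symm

end XiForms
end

noncomputable section

section OrthogonalSums

theorem sum_pow_succ_of_mul_eq_zero {R κ : Type*} [Ring R] [Fintype κ] {a : κ → R}
    (h : ∀ i j, i ≠ j → a i * a j = 0) (m : ℕ) : (∑ i, a i) ^ (m + 1) = ∑ i, a i ^ (m + 1) := by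
  induction m with
  | zero => simp
  | succ m ih =>
    rw [pow_succ, ih, Finset.sum_mul_sum]
    refine Finset.sum_congr rfl fun i _ => ?_
    rw [Finset.sum_eq_single i (fun j _ hj => ?_) (fun hi => absurd (Finset.mem_univ i) hi),
      ← pow_succ]
    rw [pow_succ, mul_assoc, h i j hj.symm, mul_zero]

/-- The exponential of a sum of elements with vanishing products. -/
theorem exp_sum_of_mul_eq_zero {R κ : Type*} [NormedRing R] [NormedAlgebra ℝ R] [CompleteSpace R]
    [Fintype κ] {a : κ → R} (h : ∀ i j, i ≠ j → a i * a j = 0) :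
    NormedSpace.exp (∑ i, a i) - ∑ i, NormedSpace.exp (a i) = 1 - ∑ _i : κ, 1 := by
  have h1 := (hasSum_exp (∑ i, a i)).sub (hasSum_sum (s := Finset.univ) fun i _ => hasSum_exp (a i))
  refine h1.unique ?_
  have h2 : 1 - ∑ _i : κ, (1 : R) = ((0 : ℕ).factorial : ℝ)⁻¹ • (∑ i, a i) ^ 0
      - ∑ i, ((0 : ℕ).factorial : ℝ)⁻¹ • a i ^ 0 := by simp
  rw [h2]
  refine hasSum_single (f := fun m : ℕ => (m.factorial : ℝ)⁻¹ • (∑ i, a i) ^ m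
    - ∑ i, (m.factorial : ℝ)⁻¹ • a i ^ m) 0 ?_
  rintro (_ | m) hm
  · exact absurd rfl hm
  · rw [sum_pow_succ_of_mul_eq_zero h, Finset.smul_sum, sub_self]

theorem sum_mul_sum_of_mul_eq_zero {R κ : Type*} [Ring R] [Fintype κ] {a : κ → R}
    (h : ∀ i j, i ≠ j → a i * a j = 0) : (∑ i, a i) * (∑ i, a i) = ∑ i, a i * a i := by
  simpa only [one_add_one_eq_two, pow_two] using sum_pow_succ_of_mul_eq_zero h 1

end OrthogonalSums

namespace UnitalTraceClass

variable {H V : Type u} [NormedAddCommGroup H] [InnerProductSpace ℂ H] [CompleteSpace H]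
  [NormedAddCommGroup V] [InnerProductSpace ℂ V] [CompleteSpace V]

/-- The homomorphism of the unital algebras induced by an inclusion `L` and a projection `R`. -/
def corner (L : H →L[ℂ] V) (R : V →L[ℂ] H) : UnitalTraceClass H →L[ℝ] UnitalTraceClass V :=
  (inl V).comp (fst (H := H)) + (inr (H := V)).comp
    (((TraceClass.sandwich L R).restrictScalars ℝ).comp (snd (H := H)))

variable {L : H →L[ℂ] V} {R : V →L[ℂ] H}

theorem corner_apply (x : UnitalTraceClass H) :
    corner L R x = inl V (fst x) + inr (TraceClass.sandwich L R (snd x)) := rfl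

theorem fst_corner (x : UnitalTraceClass H) : fst (corner L R x) = fst x := by
  rw [corner_apply, map_add, fst_inr, add_zero, inl_apply]
  exact mul_one _

theorem op_corner (x : UnitalTraceClass H) :
    op (corner L R x) = fst x • (1 : V →L[ℂ] V) + L.comp ((snd x).op.comp R) := by
  rw [corner_apply, map_add, op_inr, op_inl, TraceClass.op_sandwich]

theorem corner_inr (T : TraceClass H) : corner L R (inr T) = inr (TraceClass.sandwich L R T) := by
  rw [corner_apply, fst_inr, snd_inr, map_zero, zero_add]

theorem corner_of_fst_eq_zero {x : UnitalTraceClass H} (h : fst x = 0) :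
    corner L R x = inr (TraceClass.sandwich L R (snd x)) := by
  rw [corner_apply, h, map_zero, zero_add]

theorem corner_one : corner L R 1 = 1 := by
  refine ext_fst_op ?_ ?_
  · rw [fst_corner, fst_one, fst_one]
  · rw [op_corner, fst_one, snd_one, TraceClass.op_zero, op_one, one_smul,
      ContinuousLinearMap.zero_comp, ContinuousLinearMap.comp_zero, add_zero]

theorem corner_mul (h : R.comp L = .id ℂ H) (x y : UnitalTraceClass H) :
    corner L R (x * y) = corner L R x * corner L R y := by
  refine ext_fst_op ?_ ?_
  · rw [fst_mul, fst_corner, fst_corner, fst_corner, fst_mul]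
  · have h' : ∀ v, R (L v) = v := fun v => congrArg (fun T : H →L[ℂ] H => T v) h
    rw [op_mul, op_corner, op_corner, op_corner, fst_mul, snd_mul]
    ext v
    simp only [TraceClass.op_add, TraceClass.op_smul, TraceClass.op_mul, add_apply, smul_apply,
      ContinuousLinearMap.comp_apply, mul_apply_eq_comp, one_apply_eq_self, map_add, map_smul, h',
      smul_add, smul_smul]
    rw [mul_comm (fst y) (fst x)]
    abel

theorem inr_mul_inr_eq_zero {S T : TraceClass V} (h : S.op * T.op = 0) : inr S * inr T = 0 := by
  refine ext_fst_op ?_ ?_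
  · rw [fst_mul, fst_inr, zero_mul, map_zero]
  · rw [op_mul, op_inr, op_inr, h, map_zero]

theorem trace_corner (h : R.comp L = .id ℂ H) (x : UnitalTraceClass H) :
    trace V (corner L R x) = trace H x := by
  rw [trace_apply, trace_apply, corner_apply, map_add, snd_inr, snd_inl, zero_add,
    TraceClass.tr_sandwich, h]
  rfl

end UnitalTraceClass

section SumConnections

open Om

variable {H V Q : Type u} [NormedAddCommGroup H] [InnerProductSpace ℂ H] [CompleteSpace H]
  [NormedAddCommGroup V] [InnerProductSpace ℂ V] [CompleteSpace V] {κ : Type} [Fintype κ] {n : ℕ}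
  {L : κ → H →L[ℂ] V} {R : κ → V →L[ℂ] H}

/-- The connection form `∑ᵢ Lᵢ Aᵢ Rᵢ`. -/
def sumForm (L : κ → H →L[ℂ] V) (R : κ → V →L[ℂ] H) (A : κ → FormFamily Q (TraceClass H) 1) :
    FormFamily Q (TraceClass V) 1 := fun n q x =>
  ∑ i, ((TraceClass.sandwich (L i) (R i)).restrictScalars ℝ).compContinuousAlternatingMap (A i n q x)

/-- Projections and inclusions of orthogonal summands. -/
structure IsOrthogonal (L : κ → H →L[ℂ] V) (R : κ → V →L[ℂ] H) : Prop where
  comp_self : ∀ i, (R i).comp (L i) = .id ℂ H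
  comp_of_ne : ∀ i j, i ≠ j → (R i).comp (L j) = 0

theorem sumForm_apply (A : κ → FormFamily Q (TraceClass H) 1) (q : Eu n → Q) (x : Eu n)
    (v : Fin 1 → Eu n) :
    sumForm L R A n q x v = ∑ i, TraceClass.sandwich (L i) (R i) (A i n q x v) := by
  rw [sumForm, ContinuousAlternatingMap.sum_apply]
  rfl

theorem contract_sumForm [MulAction (Circle × Circle) Q] (fl : ℝ → Q → Q)
    (A : κ → FormFamily Q (TraceClass H) 1) (q : Eu n → Q) (x : Eu n) :
    contract fl (sumForm L R A) n q x = ∑ i, ((TraceClass.sandwich (L i)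
      (R i)).restrictScalars ℝ).compContinuousAlternatingMap (contract fl (A i) n q x) := by
  ext v : 1
  rw [ContinuousAlternatingMap.sum_apply]
  exact sumForm_apply A _ _ _

theorem connForm_sumForm (A : κ → FormFamily Q (TraceClass H) 1) (q : Eu n → Q) (x : Eu n) :
    connForm (sumForm L R A) q x = ∑ i, map (UnitalTraceClass.corner (L i) (R i))
      (connForm (A i) q x) := by
  have h : ∀ i, (UnitalTraceClass.corner (L i) (R i)).comp UnitalTraceClass.inr
      = UnitalTraceClass.inr.comp ((TraceClass.sandwich (L i) (R i)).restrictScalars ℝ) :=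
    fun i => ContinuousLinearMap.ext fun T => UnitalTraceClass.corner_inr T
  simp only [connForm_eq, map_map, h]
  rw [sumForm, map_sum, map_sum]
  refine Finset.sum_congr rfl fun i _ => ?_
  rw [← map_map, map_single, map_single, map_single]

theorem inr_sandwich_mul_eq_zero {L L' : H →L[ℂ] V} {R R' : V →L[ℂ] H} (h : R.comp L' = 0)
    (S T : TraceClass H) : UnitalTraceClass.inr (TraceClass.sandwich L R S)
      * UnitalTraceClass.inr (TraceClass.sandwich L' R' T) = 0 := by
  refine UnitalTraceClass.inr_mul_inr_eq_zero ?_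
  have h' : ∀ v, R (L' v) = 0 := fun v => congrArg (fun T : H →L[ℂ] H => T v) h
  ext v
  simp [h']

theorem map_corner_mul_of_ne (hLR : IsOrthogonal L R) {i j : κ} (hij : i ≠ j)
    {a b : Om n (UnitalTraceClass H)} (ha : map UnitalTraceClass.fst a = 0)
    (hb : map UnitalTraceClass.fst b = 0) :
    map (UnitalTraceClass.corner (L i) (R i)) a * map (UnitalTraceClass.corner (L j) (R j)) b = 0 := by
  have key : ∀ (i : κ) {a : Om n (UnitalTraceClass H)}, map UnitalTraceClass.fst a = 0 →
      map (UnitalTraceClass.corner (L i) (R i)) a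
        = map (UnitalTraceClass.inr.comp (((TraceClass.sandwich (L i) (R i)).restrictScalars ℝ).comp
          (UnitalTraceClass.snd (H := H)))) a := fun i a ha => by
    ext k v : 2
    have h0 : UnitalTraceClass.fst (a k v) = 0 := by
      simpa using congrArg (fun a : Om n ℂ => a k v) ha
    rw [map_apply, map_apply]; exact UnitalTraceClass.corner_of_fst_eq_zero (L := L i) (R := R i) h0
  rw [key i ha, key j hb]
  have h0 : map (0 : UnitalTraceClass H →L[ℝ] UnitalTraceClass V) a = 0 := by
    ext k v
    rw [map_apply]; rfl
  have h := map_mul_map (n := n) (UnitalTraceClass.inr.comp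
      (((TraceClass.sandwich (L i) (R i)).restrictScalars ℝ).comp
        (UnitalTraceClass.snd (H := H))))
    (UnitalTraceClass.inr.comp
      (((TraceClass.sandwich (L j) (R j)).restrictScalars ℝ).comp
        (UnitalTraceClass.snd (H := H))))
    (.id ℝ (UnitalTraceClass V)) 0 0 (fun x y => (inr_sandwich_mul_eq_zero (hLR.comp_of_ne i j hij) _ _).trans
      (zero_mul _).symm) a b
  rw [map_id, h0] at h
  exact h.trans (zero_mul _)

variable [DiffeologicalSpace Q] [MulAction (Circle × Circle) Q]
  {A : κ → FormFamily Q (TraceClass H) 1}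

theorem curvForm_sumForm (hLR : IsOrthogonal L R) {q : Eu n → Q} {x : Eu n}
    (hA : ∀ i, Differentiable ℝ (A i n q)) :
    curvForm (sumForm L R A) q x
      = ∑ i, map (UnitalTraceClass.corner (L i) (R i)) (curvForm (A i) q x) := by
  have hc : ∀ i, DifferentiableAt ℝ (connForm (A i) q) x := fun i =>
    differentiableAt_connForm (hA i x)
  have hi : ∀ i, (UnitalTraceClass.corner (L i) (R i)).comp UnitalTraceClass.inr
      = UnitalTraceClass.inr.comp ((TraceClass.sandwich (L i) (R i)).restrictScalars ℝ) :=
    fun i => ContinuousLinearMap.ext fun T => UnitalTraceClass.corner_inr T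
  have h1 : map UnitalTraceClass.inr (single 0 (contract flowT (sumForm L R A) n q x))
      = ∑ i, map (UnitalTraceClass.corner (L i) (R i))
        (map UnitalTraceClass.inr (single 0 (contract flowT (A i) n q x))) := by
    rw [contract_sumForm, map_sum, map_sum]
    refine Finset.sum_congr rfl fun i _ => ?_
    rw [map_map, hi, ← map_map, map_single, map_single, map_single]
  have h2 : d (connForm (sumForm L R A) q) x
      = ∑ i, map (UnitalTraceClass.corner (L i) (R i)) (d (connForm (A i) q) x) := by
    rw [funext (connForm_sumForm A q)]
    have : fderiv ℝ (fun y => ∑ i, map (UnitalTraceClass.corner (L i) (R i)) (connForm (A i) q y)) x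
        = ∑ i, fderiv ℝ (fun y => map (UnitalTraceClass.corner (L i) (R i)) (connForm (A i) q y)) x :=
      fderiv_fun_sum fun i _ => (map _).differentiableAt.comp x (hc i)
    rw [d, this, ← dOpL_apply, map_sum]
    refine Finset.sum_congr rfl fun i _ => ?_
    rw [dOpL_apply, ← d_map _ (hc i)]
    rfl
  have h3 := sum_mul_sum_of_mul_eq_zero (R := Om n (UnitalTraceClass V))
    (a := fun i => map (UnitalTraceClass.corner (L i) (R i)) (connForm (A i) q x))
    fun i j hij => map_corner_mul_of_ne hLR hij (map_fst_connForm _ _ _) (map_fst_connForm _ _ _)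
  rw [curvForm, h1, h2, connForm_sumForm, h3, ← Finset.sum_sub_distrib, ← Finset.sum_sub_distrib]
  refine Finset.sum_congr rfl fun i _ => ?_
  rw [curvForm, map_sub, map_sub, map_mul _ (UnitalTraceClass.corner_mul (hLR.comp_self i))]

theorem map_trace_one : map (UnitalTraceClass.trace V) (1 : Om n (UnitalTraceClass V)) = 0 := by
  rw [← scal_one, map_scal]
  have : UnitalTraceClass.trace V 1 = 0 := by
    rw [UnitalTraceClass.trace_apply, UnitalTraceClass.snd_one, map_zero]
  rw [this, scal]
  exact ContinuousLinearMap.map_zero (single 0)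

theorem chernTrace_sumForm (hLR : IsOrthogonal L R) {q : Eu n → Q} {x : Eu n}
    (hA : ∀ i, Differentiable ℝ (A i n q)) :
    chernTrace (sumForm L R A) q x = ∑ i, chernTrace (A i) q x := by
  have h1 := exp_sum_of_mul_eq_zero (R := Om n (UnitalTraceClass V))
    (a := fun i => map (UnitalTraceClass.corner (L i) (R i)) (curvForm (A i) q x))
    fun i j hij => map_corner_mul_of_ne hLR hij (map_fst_curvForm (hA i x))
      (map_fst_curvForm (hA j x))
  have h2 := congrArg (map (UnitalTraceClass.trace V)) h1
  rw [map_sub, map_sub, map_sum, map_sum, map_trace_one, Finset.sum_const_zero, sub_self,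
    sub_eq_zero] at h2
  rw [chernTrace, curvForm_sumForm hLR hA, h2]
  refine Finset.sum_congr rfl fun i _ => ?_
  have h3 : map (UnitalTraceClass.corner (L i) (R i)) (NormedSpace.exp (curvForm (A i) q x))
      = NormedSpace.exp (map (UnitalTraceClass.corner (L i) (R i)) (curvForm (A i) q x)) :=
    map_exp_real (R := Om n (UnitalTraceClass H)) (R' := Om n (UnitalTraceClass V)) _
      (map_one _ UnitalTraceClass.corner_one)
      (map_mul _ (UnitalTraceClass.corner_mul (hLR.comp_self i))) _
  rw [← h3, map_map, chernTrace]
  congr 2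
  exact ContinuousLinearMap.ext fun x => UnitalTraceClass.trace_corner (hLR.comp_self i) x

theorem InvariantConnection.sumForm (hA : ∀ i, InvariantConnection (A i)) :
    InvariantConnection (sumForm L R A) where
  isForm := by
    refine ⟨fun n p hp x hx => ?_, fun n m p h hp hh y hy => ?_⟩
    · exact ContDiffAt.sum fun i _ => (ContinuousLinearMap.compContinuousAlternatingMapCLM ℝ (Eu n)
        (TraceClass H) (TraceClass V) (ι := Fin 1)
        ((TraceClass.sandwich (L i) (R i)).restrictScalars ℝ)).contDiff.contDiffAt.comp x
          ((hA i).isForm.1 n p hp x hx)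
    · ext v : 1
      rw [sumForm_apply, ContinuousAlternatingMap.compContinuousLinearMap_apply, sumForm_apply]
      refine Finset.sum_congr rfl fun i _ => ?_
      rw [(hA i).isForm.2 n m p h hp hh y hy]
      rfl
  invariant t n p hp x hx := by
    ext v : 1
    rw [sumForm_apply, sumForm_apply]
    refine Finset.sum_congr rfl fun i _ => ?_
    rw [(hA i).invariant t n p hp x hx]
  horizontal n q hq x := by
    rw [contract_sumForm]
    refine Finset.sum_eq_zero fun i _ => ?_
    rw [(hA i).horizontal n q hq x]
    ext v
    simp

end SumConnections
end

noncomputable section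

namespace UnitalTraceClass

variable {V : Type u} [NormedAddCommGroup V] [InnerProductSpace ℂ V] [CompleteSpace V] {n : ℕ}

/-- The elements of `U_𝔍` as elements of the unital algebra generated by `𝔍`. -/
def ofUnitary : UnitaryTraceClass V →* UnitalTraceClass V where
  toFun g := 1 + inr (utcSubOne g)
  map_one' := by
    refine ext_fst_op ?_ ?_
    · rw [map_add, fst_inr, add_zero]
    · rw [map_add, op_inr, op_one]
      exact add_sub_cancel 1 (1 : V →L[ℂ] V)
  map_mul' g h := by
    have hop : ∀ g : UnitaryTraceClass V, op (1 + inr (utcSubOne g)) = utcOp g := fun g => by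
      rw [map_add, op_inr, op_one]
      exact add_sub_cancel 1 (utcOp g)
    refine ext_fst_op ?_ ?_
    · simp only [fst_mul, map_add, fst_inr, fst_one, add_zero, mul_one]
    · rw [op_mul, hop, hop, hop]
      rfl

theorem ofUnitary_apply (g : UnitaryTraceClass V) : ofUnitary g = 1 + inr (utcSubOne g) := rfl

theorem fst_ofUnitary (g : UnitaryTraceClass V) : fst (ofUnitary g) = 1 := by
  rw [ofUnitary_apply, map_add, fst_inr, add_zero, fst_one]

theorem op_ofUnitary (g : UnitaryTraceClass V) : op (ofUnitary g) = utcOp g := by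
  rw [ofUnitary_apply, map_add, op_inr, op_one]
  exact add_sub_cancel 1 (utcOp g)

theorem contDiff_ofUnitary {g : Eu n → UnitaryTraceClass V} (hg : SmoothUnitaryMap g) :
    ContDiff ℝ ∞ fun y => ofUnitary (g y) :=
  contDiff_const.add ((inr (H := V)).contDiff.comp hg)

theorem contDiff_ofUnitary_inv {g : Eu n → UnitaryTraceClass V} (hg : SmoothUnitaryMap g) :
    ContDiff ℝ ∞ fun y => ofUnitary (g y)⁻¹ := by
  have h : ∀ g : UnitaryTraceClass V, ofUnitary g⁻¹ = Ring.inverse (ofUnitary g) := fun g => by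
    have := Ring.inverse_unit ((ofUnitary (V := V)).toHomUnits g)
    rw [← map_inv] at this
    exact this.symm
  simp only [h]
  refine contDiff_iff_contDiffAt.2 fun x => ?_
  exact (contDiffAt_ringInverse ℝ ((ofUnitary (V := V)).toHomUnits (g x))).comp x
    (contDiff_ofUnitary hg).contDiffAt

end UnitalTraceClass

section GaugeTransformations

open Om UnitalTraceClass

variable {Q V : Type u} [NormedAddCommGroup V] [InnerProductSpace ℂ V] [CompleteSpace V]
  {n m : ℕ}

theorem Om.mul_scal_apply_apply {R : Type*} [NormedRing R] [NormedAlgebra ℝ R] (c : R) (w : Om n R)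
    (k : ℕ) (v : Fin k → Eu n) : (w * scal n c) k v = w k v * c := by
  rw [← map_mul_right, map_apply]
  rfl

/-- The gauge transform of a connection form. -/
def gaugeForm (B : FormFamily Q (TraceClass V) 1) (ψ : Q → UnitaryTraceClass V) :
    TotalFamily Q (UnitalTraceClass V) := fun n q x =>
  scal n (ofUnitary (ψ (q x))⁻¹) * (connForm B q x * scal n (ofUnitary (ψ (q x)))
    + d (fun y => scal n (ofUnitary (ψ (q y)))) x)

/-- The gauge transform of a connection form. -/
def gaugeTransform (B : FormFamily Q (TraceClass V) 1) (ψ : Q → UnitaryTraceClass V) :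
    FormFamily Q (TraceClass V) 1 := fun n q x => map snd (gaugeForm B ψ n q x) 1

theorem gaugeForm_apply (B : FormFamily Q (TraceClass V) 1) (ψ : Q → UnitaryTraceClass V)
    {q : Eu n → Q} (hψ : SmoothUnitaryMap fun y => ψ (q y)) (x : Eu n) (v : Fin 1 → Eu n) :
    gaugeForm B ψ n q x 1 v = ofUnitary (ψ (q x))⁻¹ * (inr (B n q x v) * ofUnitary (ψ (q x))
      + fderiv ℝ (fun y => ofUnitary (ψ (q y))) x (v 0)) := by
  rw [gaugeForm, scal_mul_apply_apply, Om.add_apply, ContinuousAlternatingMap.add_apply,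
    mul_scal_apply_apply, d_scal ((contDiff_ofUnitary hψ).contDiffAt.differentiableAt (by simp)),
    single_same, connForm_eq, map_apply, single_same]
  rfl

theorem gaugeTransform_apply (B : FormFamily Q (TraceClass V) 1) (ψ : Q → UnitaryTraceClass V)
    {q : Eu n → Q} (hψ : SmoothUnitaryMap fun y => ψ (q y)) (x : Eu n) (v : Fin 1 → Eu n) :
    gaugeTransform B ψ n q x v = snd (ofUnitary (ψ (q x))⁻¹ * (inr (B n q x v)
      * ofUnitary (ψ (q x)) + fderiv ℝ (fun y => ofUnitary (ψ (q y))) x (v 0))) := by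
  rw [← gaugeForm_apply B ψ hψ, gaugeTransform, map_apply]
  rfl

theorem opForm_gaugeTransform (B : FormFamily Q (TraceClass V) 1) (ψ : Q → UnitaryTraceClass V)
    {q : Eu n → Q} (hψ : SmoothUnitaryMap fun y => ψ (q y)) (x : Eu n) (v : Fin 1 → Eu n) :
    utcOp (ψ (q x)) * opForm (gaugeTransform B ψ) n q x v = opForm B n q x v * utcOp (ψ (q x))
      + fderiv ℝ (fun y => utcOp (ψ (q y))) x (v 0) := by
  have hd : DifferentiableAt ℝ (fun y => ofUnitary (ψ (q y))) x :=
    (contDiff_ofUnitary hψ).contDiffAt.differentiableAt (by simp)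
  have h1 : fst (fderiv ℝ (fun y => ofUnitary (ψ (q y))) x (v 0)) = 0 := by
    have h := (fst (H := V)).hasFDerivAt.comp x hd.hasFDerivAt
    have h' : (fst ∘ fun y => ofUnitary (ψ (q y))) = fun _ => 1 := funext fun y => fst_ofUnitary _
    rw [h'] at h
    exact congrArg (fun T : Eu n →L[ℝ] ℂ => T (v 0)) (h.unique (hasFDerivAt_const 1 x))
  have h2 : op (fderiv ℝ (fun y => ofUnitary (ψ (q y))) x (v 0))
      = fderiv ℝ (fun y => utcOp (ψ (q y))) x (v 0) := by
    have h := (op (H := V)).hasFDerivAt.comp x hd.hasFDerivAt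
    have h' : (op ∘ fun y => ofUnitary (ψ (q y))) = fun y => utcOp (ψ (q y)) :=
      funext fun y => op_ofUnitary _
    rw [h'] at h
    rw [h.fderiv]
    rfl
  have h3 : opForm (gaugeTransform B ψ) n q x v = op (ofUnitary (ψ (q x))⁻¹ * (inr (B n q x v)
      * ofUnitary (ψ (q x)) + fderiv ℝ (fun y => ofUnitary (ψ (q y))) x (v 0))) := by
    rw [op_apply, fst_mul, map_add, h1, fst_mul, fst_inr, zero_mul, add_zero, mul_zero, zero_smul,
      zero_add, ← gaugeTransform_apply B ψ hψ]
    rfl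
  rw [h3, ← op_ofUnitary, ← op_mul, ← mul_assoc, ← _root_.map_mul, mul_inv_cancel, _root_.map_one, one_mul,
    map_add, op_mul, op_inr, op_ofUnitary, h2]
  rfl

variable [DiffeologicalSpace Q] [MulAction (Circle × Circle) Q]

theorem isTotalForm_scal {F : Type*} [NormedAddCommGroup F] [NormedSpace ℝ F] {f : Q → F}
    (hf : ∀ {n : ℕ} {q : Eu n → Q}, IsPlot q → ContDiff ℝ ∞ fun y => f (q y)) :
    IsTotalForm fun n q x => scal n (f (q x)) :=
  ⟨fun hq => contDiff_scal (hf hq), fun _ _ _ => (comap_scal _ _).symm⟩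

variable {A : FormFamily Q (TraceClass V) 1} {ψ : Q → UnitaryTraceClass V}

theorem InvariantConnection.gaugeTransform (hA : InvariantConnection A)
    (hψ : ∀ {n : ℕ} {q : Eu n → Q}, IsPlot q → SmoothUnitaryMap fun y => ψ (q y))
    (hψ' : ∀ (t : Circle × Circle) q, ψ (t • q) = ψ q) (hQ : IsSmoothTorusAction Q) :
    InvariantConnection (gaugeTransform A ψ) where
  isForm := by
    have h := isTotalForm_scal (Q := Q) (f := fun q => ofUnitary (ψ q))
      fun {n q} hq => contDiff_ofUnitary (hψ (n := n) (q := q) hq)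
    have h' := isTotalForm_scal (Q := Q) (f := fun q => ofUnitary (ψ q)⁻¹)
      fun {n q} hq => contDiff_ofUnitary_inv (hψ (n := n) (q := q) hq)
    have hg : IsTotalForm (gaugeForm A ψ) :=
      IsTotalForm.mul (R := UnitalTraceClass V) h' ((hA.isTotalForm_connForm.mul h).add h.d)
    exact (IsTotalForm.map (F := UnitalTraceClass V) (G := TraceClass V) snd hg).isFormOn Set.univ 1
  invariant t n p hp x _ := by
    have h : connForm A (fun y => t • p y) x = connForm A p x := by
      rw [connForm, connForm, hA.invariant t n p hp x trivial]
    simp only [_root_.gaugeTransform, gaugeForm, hψ', h]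
  horizontal n q hq x := by
    have hF := (smoothFlow_flowU hQ).plot hq
    ext v : 1
    have h := gaugeTransform_apply A ψ (hψ hF) (zeroSlice n x)
      (Fin.cons (timeVec n) fun i => zeroSlice n (v i) : Fin 1 → Eu (n + 1))
    have h1 : A (n + 1) (flowOut flowU q) (zeroSlice n x)
        (Fin.cons (timeVec n) fun i => zeroSlice n (v i)) = 0 :=
      congrArg (fun a : Alt n (TraceClass V) 0 => a v) (hA.horizontal n q hq x)
    have h2 : (fun y => ofUnitary (ψ (flowOut flowU q y)))
        = fun z => ofUnitary (ψ (q (tailL n z))) := funext fun z => by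
      obtain ⟨c, hc⟩ := exists_flowU_eq (Q := Q) (timeL n z)
      rw [flowOut_apply]
      exact congrArg ofUnitary ((congrArg ψ (hc _)).trans (hψ' _ _))
    have h3 : fderiv ℝ (fun y => ofUnitary (ψ (flowOut flowU q y))) (zeroSlice n x) (timeVec n)
        = 0 := by
      have hd : DifferentiableAt ℝ (fun y => ofUnitary (ψ (q y))) (tailL n (zeroSlice n x)) :=
        (contDiff_ofUnitary (hψ hq)).contDiffAt.differentiableAt (by simp)
      have hf := hd.hasFDerivAt.comp (zeroSlice n x) (tailL n).hasFDerivAt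
      rw [h2]
      refine (congrArg (fun T : Eu (n + 1) →L[ℝ] UnitalTraceClass V => T (timeVec n))
        hf.fderiv).trans ?_
      rw [ContinuousLinearMap.comp_apply, tailL_timeVec, map_zero]
    rw [h1, Fin.cons_zero, h3, map_zero, zero_mul, add_zero, mul_zero, map_zero] at h
    exact h

/-- The connection form conjugated with a constant unitary operator. -/
def conjForm (w : unitary (V →L[ℂ] V)) (A : FormFamily Q (TraceClass V) 1) :
    FormFamily Q (TraceClass V) 1 :=
  sumForm (fun _ : Unit => star (w : V →L[ℂ] V)) (fun _ => w) fun _ => A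

theorem opForm_conjForm (w : unitary (V →L[ℂ] V)) (A : FormFamily Q (TraceClass V) 1)
    (q : Eu n → Q) (x : Eu n) (v : Fin 1 → Eu n) :
    w * opForm (conjForm w A) n q x v = opForm A n q x v * w := by
  have h : opForm (conjForm w A) n q x v = star (w : V →L[ℂ] V) * (opForm A n q x v * w) := by
    show TraceClass.op (conjForm w A n q x v) = _
    rw [conjForm, sumForm_apply, Fintype.sum_unique]
    rfl
  rw [h, ← mul_assoc, show (w : V →L[ℂ] V) * star (w : V →L[ℂ] V) = 1 from
    Unitary.coe_mul_star_self w, one_mul]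

theorem isFormOn_zero {F : Type*} [NormedAddCommGroup F] [NormedSpace ℝ F] {k : ℕ} :
    IsFormOn Set.univ (0 : FormFamily Q F k) :=
  ⟨fun _ _ _ _ _ => contDiffAt_const, fun _ _ _ _ _ _ _ _ => by ext; rfl⟩

theorem gaugeScalar_zero (q : Eu n → Q) (x : Eu n) : gaugeScalar 0 q x = 0 := by
  have h1 : (fun y => single 1 ((0 : FormFamily Q ℂ 1) n q y)) = fun _ : Eu n => (0 : Om n ℂ) :=
    funext fun y => ContinuousLinearMap.map_zero (single 1)
  have h2 : contract flowT (0 : FormFamily Q ℂ 1) n q x = 0 := by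
    ext v
    rfl
  rw [gaugeScalar, h1, d_const, h2]
  exact (congrArg _ (ContinuousLinearMap.map_zero (single 0))).trans (sub_zero _)

theorem gaugeRel_gaugeTransform (w : unitary (V →L[ℂ] V))
    (hψ : ∀ {n : ℕ} {q : Eu n → Q}, IsPlot q → SmoothUnitaryMap fun y => ψ (q y))
    (hψ' : ∀ (t : Circle × Circle) q, ψ (t • q) = ψ q) :
    GaugeRel A (gaugeTransform (conjForm w A) ψ) Eq (fun q _ => w * (ψ q).1) 0 where
  rel_smul h t := congrArg (t • ·) h
  φ_smul h t := by rw [hψ']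
  contDiff {n q r} hq hr h := by
    have h1 : ContDiff ℝ ∞ fun y => utcOp (ψ (q y)) := by
      have := (op (H := V)).contDiff.comp (contDiff_ofUnitary (hψ hq))
      exact (funext fun y => op_ofUnitary (ψ (q y)) : (op ∘ fun y => ofUnitary (ψ (q y))) = _) ▸ this
    exact contDiff_const.mul h1
  isForm := isFormOn_zero
  parallel {n q r} hq hr h x v := by
    obtain rfl : q = r := funext h
    have h1 : DifferentiableAt ℝ (fun y => utcOp (ψ (q y))) x := by
      have := (op (H := V)).differentiableAt.comp x
        ((contDiff_ofUnitary (hψ hq)).contDiffAt.differentiableAt (x := x) (by simp))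
      exact (funext fun y => op_ofUnitary (ψ (q y)) : (op ∘ fun y => ofUnitary (ψ (q y))) = _) ▸ this
    have h2 := opForm_gaugeTransform (conjForm w A) ψ (hψ hq) x v
    have h3 := opForm_conjForm w A q x v
    have h4 : fderiv ℝ (fun y => (w : V →L[ℂ] V) * utcOp (ψ (q y))) x (v 0)
        = w * fderiv ℝ (fun y => utcOp (ψ (q y))) x (v 0) := by
      rw [fderiv_const_mul h1]
      rfl
    have h5 : (0 : FormFamily Q ℂ 1) n q x v • ((w : V →L[ℂ] V) * utcOp (ψ (q x))) = 0 :=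
      zero_smul ℂ _
    show fderiv ℝ (fun y => (w : V →L[ℂ] V) * utcOp (ψ (q y))) x (v 0)
      = w * utcOp (ψ (q x)) * _ - _ * (w * utcOp (ψ (q x))) - _ • (w * utcOp (ψ (q x)))
    rw [h4, h5, sub_zero, mul_assoc, h2, mul_add, ← mul_assoc, h3, mul_assoc, add_sub_cancel_left]

theorem mul_eq_of_gauge {R : Type*} [Ring R] {Ψ Ψ' φ χ a a' b b' dΨ dΨ' dφ dχ s S : R}
    (hφ : dφ = φ * a' - a * φ - s * φ) (h : dΨ = Ψ * b - a * Ψ) (h' : dΨ' = Ψ' * b' - a' * Ψ')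
    (hs : s * Ψ = Ψ * s) (hS : S * Ψ = 1) (hχ : φ * Ψ' = Ψ * χ)
    (hd : φ * dΨ' + dφ * Ψ' = Ψ * dχ + dΨ * χ) : dχ = χ * b' - b * χ - s * χ := by
  have key : Ψ * dχ = Ψ * (χ * b' - b * χ - s * χ) := by
    have e1 : s * (φ * Ψ') = Ψ * (s * χ) := by rw [hχ, ← mul_assoc, hs, mul_assoc]
    have e2 : φ * Ψ' * b' = Ψ * (χ * b') := by rw [hχ, mul_assoc]
    have e3 : a * (φ * Ψ') = a * Ψ * χ := by rw [hχ, mul_assoc]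
    rw [← sub_eq_iff_eq_add] at hd
    calc Ψ * dχ = φ * Ψ' * b' - a * (φ * Ψ') - s * (φ * Ψ') - Ψ * (b * χ) + a * Ψ * χ := by
          rw [← hd, hφ, h, h']
          noncomm_ring
      _ = Ψ * (χ * b' - b * χ - s * χ) := by
          rw [e1, e2, e3]
          noncomm_ring
  have := congrArg (S * ·) key
  simpa only [← mul_assoc, hS, one_mul] using this

theorem GaugeRel.contDiff_of_conj {A A' B B' : FormFamily Q (TraceClass V) 1} {c : FormFamily Q ℂ 1}
    {Ψ Ψ' φ χ : Q → unitary (V →L[ℂ] V)} (h : GaugeRel A A' Eq (fun q _ => φ q) c)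
    (h₁ : GaugeRel A B Eq (fun q _ => Ψ q) 0) (h₂ : GaugeRel A' B' Eq (fun q _ => Ψ' q) 0)
    (hχ : ∀ q, φ q * Ψ' q = Ψ q * χ q) {q r : Eu n → Q} (hq : IsPlot q) (hr : IsPlot r)
    (hqr : ∀ y, q y = r y) : ContDiff ℝ ∞ fun y => (χ (q y) : V →L[ℂ] V) := by
  have e : ∀ q, (χ q : V →L[ℂ] V) = star (Ψ q : V →L[ℂ] V) * (φ q * Ψ' q) := fun q => by
    have := congrArg (fun U : unitary (V →L[ℂ] V) => star (Ψ q : V →L[ℂ] V) * (U : V →L[ℂ] V)) (hχ q)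
    refine Eq.trans ?_ this.symm
    show _ = star (Ψ q : V →L[ℂ] V) * (Ψ q * χ q)
    rw [← mul_assoc, show star (Ψ q : V →L[ℂ] V) * Ψ q = 1 from Unitary.coe_star_mul_self _, one_mul]
  simp only [e]
  exact ((starL' ℝ : (V →L[ℂ] V) ≃L[ℝ] (V →L[ℂ] V)).contDiff.comp (h₁.contDiff hq hr hqr)).mul
    ((h.contDiff hq hr hqr).mul (h₂.contDiff hq hr hqr))

/-- Gauge transformations of two connections that intertwine isomorphisms `φ` and `χ`. -/
theorem GaugeRel.conj {A A' B B' : FormFamily Q (TraceClass V) 1} {c : FormFamily Q ℂ 1}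
    {Ψ Ψ' φ χ : Q → unitary (V →L[ℂ] V)} (h : GaugeRel A A' Eq (fun q _ => φ q) c)
    (h₁ : GaugeRel A B Eq (fun q _ => Ψ q) 0) (h₂ : GaugeRel A' B' Eq (fun q _ => Ψ' q) 0)
    (hχ : ∀ q, φ q * Ψ' q = Ψ q * χ q) : GaugeRel B B' Eq (fun q _ => χ q) c where
  rel_smul h t := congrArg (t • ·) h
  φ_smul {q r} hr t := by
    have hq : ∀ q, χ q = (Ψ q)⁻¹ * (φ q * Ψ' q) := fun q => by rw [hχ, inv_mul_cancel_left]
    rw [hq, hq, h.φ_smul hr t, h₁.φ_smul hr t, h₂.φ_smul hr t]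
  contDiff hq hr hqr := h.contDiff_of_conj h₁ h₂ hχ hq hr hqr
  isForm := h.isForm
  parallel {n q r} hq hr hqr x v := by
    obtain rfl : q = r := funext hqr
    have hd : ∀ {f : Eu n → V →L[ℂ] V}, ContDiff ℝ ∞ f → HasFDerivAt f (fderiv ℝ f x) x :=
      fun hf => (hf.contDiffAt.differentiableAt (by simp)).hasFDerivAt
    have e₁ := (hd (h.contDiff hq hr hqr)).mul' (hd (h₂.contDiff hq hr hqr))
    have e₂ := (hd (h₁.contDiff hq hr hqr)).mul' (hd (h.contDiff_of_conj h₁ h₂ hχ hq hr hqr))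
    have e : (fun y => (φ (q y) : V →L[ℂ] V)) * (fun y => (Ψ' (q y) : V →L[ℂ] V))
        = (fun y => (Ψ (q y) : V →L[ℂ] V)) * fun y => (χ (q y) : V →L[ℂ] V) :=
      funext fun y => congrArg (fun U : unitary (V →L[ℂ] V) => (U : V →L[ℂ] V)) (hχ (q y))
    rw [e] at e₁
    have e' := congrArg (fun T : Eu n →L[ℝ] V →L[ℂ] V => T (v 0)) (e₁.unique e₂)
    have z : ∀ T : V →L[ℂ] V, (0 : FormFamily Q ℂ 1) n q x v • T = 0 := zero_smul ℂ
    have p₁ := h₁.parallel hq hr hqr x v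
    have p₂ := h₂.parallel hq hr hqr x v
    rw [z, sub_zero] at p₁ p₂
    have p := h.parallel hq hr hqr x v
    rw [← smul_one_mul] at p ⊢
    exact mul_eq_of_gauge p p₁ p₂ (by rw [smul_one_mul, mul_smul_one])
      (Unitary.coe_star_mul_self (Ψ (q x)))
      (congrArg (fun U : unitary (V →L[ℂ] V) => (U : V →L[ℂ] V)) (hχ (q x))) e'

end GaugeTransformations
end

noncomputable section

section BlockDiagonal

variable {H V : Type u} [NormedAddCommGroup H] [InnerProductSpace ℂ H] [CompleteSpace H]
  [NormedAddCommGroup V] [InnerProductSpace ℂ V] [CompleteSpace V] {m n : ℕ}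

/-- The map `T ↦ L T R`. -/
def opSandwich (L : H →L[ℂ] V) (R : V →L[ℂ] H) : (H →L[ℂ] H) →L[ℝ] (V →L[ℂ] V) :=
  LinearMap.mkContinuous
    { toFun := fun T => L.comp (T.comp R)
      map_add' := fun S T => by rw [ContinuousLinearMap.add_comp, ContinuousLinearMap.comp_add]
      map_smul' := fun c T => ContinuousLinearMap.ext fun v => by
        show L (c • T (R v)) = c • L (T (R v))
        rw [← Complex.coe_smul, ← Complex.coe_smul, map_smul] } (‖L‖ * ‖R‖) fun T => by
    refine (ContinuousLinearMap.opNorm_comp_le _ _).trans ?_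
    rw [mul_assoc, mul_comm ‖R‖]
    exact mul_le_mul_of_nonneg_left (ContinuousLinearMap.opNorm_comp_le _ _) (norm_nonneg _)

/-- Inclusions and projections that identify `V` with a sum of copies of `H`. -/
structure IsDirectSum (L : Fin m → H →L[ℂ] V) (R : Fin m → V →L[ℂ] H) : Prop extends
    IsOrthogonal L R where
  sum_apply : ∀ x, ∑ i, L i (R i x) = x
  inner_eq : ∀ i x y, ⟪L i x, y⟫_ℂ = ⟪x, R i y⟫_ℂ

/-- The block diagonal operator with blocks `T i`. -/
def blockDiag (L : Fin m → H →L[ℂ] V) (R : Fin m → V →L[ℂ] H) (T : Fin m → H →L[ℂ] H) :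
    V →L[ℂ] V :=
  ∑ i, opSandwich (L i) (R i) (T i)

variable {L : Fin m → H →L[ℂ] V} {R : Fin m → V →L[ℂ] H}

theorem blockDiag_apply (T : Fin m → H →L[ℂ] H) (x : V) :
    blockDiag L R T x = ∑ i, L i (T i (R i x)) := by
  rw [blockDiag, _root_.sum_apply]
  rfl

theorem IsOrthogonal.apply_sum (hLR : IsOrthogonal L R) (x : Fin m → H) (i : Fin m) :
    R i (∑ j, L j (x j)) = x i := by
  rw [map_sum, Finset.sum_eq_single i]
  · exact congrArg (fun T : H →L[ℂ] H => T (x i)) (hLR.comp_self i)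
  · exact fun j _ hj => congrArg (fun T : H →L[ℂ] H => T (x j)) (hLR.comp_of_ne i j hj.symm)
  · exact fun hi => absurd (Finset.mem_univ i) hi

theorem blockDiag_mul (hLR : IsOrthogonal L R) (S T : Fin m → H →L[ℂ] H) :
    blockDiag L R S * blockDiag L R T = blockDiag L R fun i => S i * T i :=
  ContinuousLinearMap.ext fun x => by
    rw [mul_apply_eq_comp, blockDiag_apply, blockDiag_apply, blockDiag_apply]
    simp only [hLR.apply_sum, mul_apply_eq_comp]

theorem blockDiag_one (hLR : IsDirectSum L R) : blockDiag L R (fun _ => 1) = 1 :=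
  ContinuousLinearMap.ext fun x => (blockDiag_apply _ x).trans (hLR.sum_apply x)

theorem blockDiag_sub (S T : Fin m → H →L[ℂ] H) :
    blockDiag L R S - blockDiag L R T = blockDiag L R fun i => S i - T i := by
  simp only [blockDiag, map_sub, Finset.sum_sub_distrib]

theorem blockDiag_smul (c : ℂ) (T : Fin m → H →L[ℂ] H) :
    c • blockDiag L R T = blockDiag L R fun i => c • T i :=
  ContinuousLinearMap.ext fun x => by
    rw [blockDiag_apply, smul_apply, blockDiag_apply, Finset.smul_sum]
    simp only [smul_apply, map_smul]

theorem star_blockDiag (hLR : IsDirectSum L R) (T : Fin m → H →L[ℂ] H) :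
    star (blockDiag L R T) = blockDiag L R fun i => star (T i) := by
  symm
  rw [ContinuousLinearMap.star_eq_adjoint, ContinuousLinearMap.eq_adjoint_iff]
  intro x y
  have h : ∀ i x y, ⟪y, L i x⟫_ℂ = ⟪R i y, x⟫_ℂ := fun i x y => by
    rw [← inner_conj_symm, hLR.inner_eq, inner_conj_symm]
  rw [blockDiag_apply, blockDiag_apply, sum_inner, inner_sum]
  refine Finset.sum_congr rfl fun i _ => ?_
  rw [hLR.inner_eq, h, ContinuousLinearMap.star_eq_adjoint, ContinuousLinearMap.adjoint_inner_left]

/-- The block diagonal unitary operator with blocks `U i`. -/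
def blockUnitary (hLR : IsDirectSum L R) (U : Fin m → unitary (H →L[ℂ] H)) :
    unitary (V →L[ℂ] V) :=
  ⟨blockDiag L R fun i => U i, by
    rw [Unitary.mem_iff, star_blockDiag hLR, blockDiag_mul hLR.toIsOrthogonal,
      blockDiag_mul hLR.toIsOrthogonal]
    exact ⟨(congrArg (blockDiag L R) (funext fun i => Unitary.coe_star_mul_self (U i))).trans
        (blockDiag_one hLR),
      (congrArg (blockDiag L R) (funext fun i => Unitary.coe_mul_star_self (U i))).trans
        (blockDiag_one hLR)⟩⟩

theorem coe_blockUnitary (hLR : IsDirectSum L R) (U : Fin m → unitary (H →L[ℂ] H)) :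
    (blockUnitary hLR U : V →L[ℂ] V) = blockDiag L R fun i => U i := rfl

theorem contDiff_blockDiag {T : Fin m → Eu n → H →L[ℂ] H} (hT : ∀ i, ContDiff ℝ ∞ (T i)) :
    ContDiff ℝ ∞ fun y => blockDiag L R fun i => T i y :=
  ContDiff.sum fun i _ => (opSandwich (L i) (R i)).contDiff.comp (hT i)

theorem fderiv_blockDiag {T : Fin m → Eu n → H →L[ℂ] H} {x : Eu n}
    (hT : ∀ i, DifferentiableAt ℝ (T i) x) (v : Eu n) :
    fderiv ℝ (fun y => blockDiag L R fun i => T i y) x v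
      = blockDiag L R fun i => fderiv ℝ (T i) x v := by
  have h : HasFDerivAt (fun y => blockDiag L R fun i => T i y)
      (∑ i, (opSandwich (L i) (R i)).comp (fderiv ℝ (T i) x)) x :=
    HasFDerivAt.fun_sum fun i _ =>
      (opSandwich (L i) (R i)).hasFDerivAt.comp x (hT i).hasFDerivAt
  rw [h.fderiv, _root_.sum_apply]
  rfl

variable {Q Q' : Type u}

theorem opForm_sumForm (A : Fin m → FormFamily Q (TraceClass H) 1) (q : Eu n → Q) (x : Eu n)
    (v : Fin 1 → Eu n) : opForm (sumForm L R A) n q x v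
      = blockDiag L R fun i => opForm (A i) n q x v := by
  show TraceClass.op (sumForm L R A n q x v) = _
  rw [sumForm_apply, TraceClass.op_sum]
  rfl

variable [DiffeologicalSpace Q] [MulAction (Circle × Circle) Q] [DiffeologicalSpace Q']
  [MulAction (Circle × Circle) Q']

/-- Sums of identifications of connections. -/
theorem GaugeRel.sum (hLR : IsDirectSum L R) {A : Fin m → FormFamily Q (TraceClass H) 1}
    {A' : Fin m → FormFamily Q' (TraceClass H) 1} {rel : Q → Q' → Prop}
    {φ : Fin m → Q → Q' → unitary (H →L[ℂ] H)} {c : FormFamily Q ℂ 1} (hc : IsFormOn Set.univ c)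
    (hrel : ∀ {q r}, rel q r → ∀ t : Circle × Circle, rel (t • q) (t • r))
    (h : ∀ i, GaugeRel (A i) (A' i) rel (φ i) c) :
    GaugeRel (sumForm L R A) (sumForm L R A') rel
      (fun q r => blockUnitary hLR fun i => φ i q r) c where
  rel_smul := hrel
  φ_smul hr t := congrArg (blockUnitary hLR) (funext fun i => (h i).φ_smul hr t)
  contDiff hq hr hqr := contDiff_blockDiag fun i => (h i).contDiff hq hr hqr
  isForm := hc
  parallel {n q r} hq hr hqr x v := by
    rw [opForm_sumForm, opForm_sumForm]
    refine (fderiv_blockDiag (fun i => ((h i).contDiff hq hr hqr).contDiffAt.differentiableAt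
      (by simp)) (v 0)).trans ?_
    rw [coe_blockUnitary, blockDiag_mul hLR.toIsOrthogonal, blockDiag_mul hLR.toIsOrthogonal,
      blockDiag_smul, blockDiag_sub, blockDiag_sub]
    exact congrArg (blockDiag L R) (funext fun i => (h i).parallel hq hr hqr x v)

/-- The inclusion of the `i`-th summand. -/
def blockIncl (i : Fin m) : H →L[ℂ] PiLp 2 fun _ : Fin m => H :=
  LinearMap.mkContinuous
    { toFun := fun x => PiLp.single (β := fun _ : Fin m => H) 2 i x
      map_add' := fun _ _ => PiLp.single_add (β := fun _ : Fin m => H) 2 i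
      map_smul' := fun c x => PiLp.ext fun j => by
        by_cases h : j = i
        · subst h
          simp
        · simp [h] } 1 fun x => by
    rw [one_mul]
    exact (PiLp.norm_single (β := fun _ : Fin m => H) 2 i x).le

theorem blockIncl_apply_same (i : Fin m) (x : H) : blockIncl i x i = x :=
  PiLp.single_eq_same (β := fun _ : Fin m => H) 2 i x

theorem blockIncl_apply_of_ne {i j : Fin m} (h : j ≠ i) (x : H) : blockIncl i x j = 0 :=
  PiLp.single_eq_of_ne (β := fun _ : Fin m => H) 2 h x

/-- The projection onto the `i`-th summand. -/
def blockProj (i : Fin m) : (PiLp 2 fun _ : Fin m => H) →L[ℂ] H := PiLp.proj 2 (fun _ => H) i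

theorem isOrthogonal_block : IsOrthogonal (blockIncl (H := H) (m := m)) blockProj where
  comp_self i := ContinuousLinearMap.ext fun x => blockIncl_apply_same i x
  comp_of_ne _ _ h := ContinuousLinearMap.ext fun x => blockIncl_apply_of_ne h x

theorem isDirectSum_block : IsDirectSum (blockIncl (H := H) (m := m)) blockProj where
  toIsOrthogonal := isOrthogonal_block
  sum_apply x := PiLp.ext fun i => isOrthogonal_block.apply_sum (fun i => x i) i
  inner_eq i x y := by
    rw [PiLp.inner_apply, Finset.sum_eq_single i]
    · rw [blockIncl_apply_same]
      rfl
    · intro j _ hj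
      rw [blockIncl_apply_of_ne hj, inner_zero_left]
    · exact fun hi => absurd (Finset.mem_univ i) hi

theorem blockDiag_eq_diagApply (T : Fin m → H →L[ℂ] H) (x : PiLp 2 fun _ : Fin m => H) :
    blockDiag blockIncl blockProj T x = diagApply T x :=
  PiLp.ext fun i => (congrArg (fun y : PiLp 2 fun _ : Fin m => H => y i) (blockDiag_apply T x)).trans
    (isOrthogonal_block.apply_sum (fun i => T i (x i)) i)

end BlockDiagonal
end

noncomputable section

section PullbackGauge

open Om

variable {Q P V : Type u} [NormedAddCommGroup V] [InnerProductSpace ℂ V] [CompleteSpace V]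
  [DiffeologicalSpace Q] [MulAction (Circle × Circle) Q]
  [DiffeologicalSpace P] [MulAction (Circle × Circle) P] {n : ℕ}
  {A A' : FormFamily Q (TraceClass V) 1}

theorem GaugeRel.pullForm {φ : Q → unitary (V →L[ℂ] V)} (h : GaugeRel A A' Eq (fun q _ => φ q) 0)
    {f : P → Q} (hf : DSmooth f) (heq : ∀ (t : Circle × Circle) s, f (t • s) = t • f s) :
    GaugeRel (pullForm f A) (pullForm f A') Eq (fun s _ => φ (f s)) 0 where
  rel_smul h t := congrArg (t • ·) h
  φ_smul {q r} _ t := (congrArg φ (heq t q)).trans (h.φ_smul (r := f q) rfl t)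
  contDiff hq _ _ := h.contDiff (hf _ _ hq) (hf _ _ hq) fun _ => rfl
  isForm := isFormOn_zero
  parallel {n q r} hq _ hqr x v := by
    obtain rfl : q = r := funext hqr
    exact h.parallel (hf _ _ hq) (hf _ _ hq) (fun _ => rfl) x v

theorem GaugeRel.diag {φ : Q → Q → unitary (V →L[ℂ] V)} {c : FormFamily Q ℂ 1}
    (h : GaugeRel A A' Eq φ c) : GaugeRel A A' Eq (fun q _ => φ q q) c where
  rel_smul := h.rel_smul
  φ_smul {q r} _ t := h.φ_smul (r := q) rfl t
  contDiff hq _ _ := h.contDiff hq hq fun _ => rfl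
  isForm := h.isForm
  parallel {n q r} hq hr hqr x v := by
    obtain rfl : q = r := funext hqr
    exact h.parallel hq hr hqr x v

end PullbackGauge

section DirectSums

open Om

variable {M : Type u} [DiffeologicalSpace M] [MulAction Circle M] {ι : Type u}
  {𝒰 : GoodCover M ι} {L : HermitianLineBundle 𝒰} {𝒢 : WeakInvariantGerbe 𝒰} {H V : Type u}
  [NormedAddCommGroup H] [InnerProductSpace ℂ H] [CompleteSpace H]
  [NormedAddCommGroup V] [InnerProductSpace ℂ V] [CompleteSpace V] {m n : ℕ}

namespace Frames

variable {κ : Type} {𝔼 : κ → GerbeModule L 𝒢 H} {α β : ι}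

/-- The frames of the modules over the first open set. -/
def left (s : Frames (Sum.elim 𝔼 𝔼) (Sum.elim (fun _ => α) fun _ => β)) :
    Frames 𝔼 fun _ => α := ⟨s.base, fun k => s.frame (.inl k), fun k => s.pr_frame (.inl k)⟩

/-- The frames of the modules over the second open set. -/
def right (s : Frames (Sum.elim 𝔼 𝔼) (Sum.elim (fun _ => α) fun _ => β)) :
    Frames 𝔼 fun _ => β := ⟨s.base, fun k => s.frame (.inr k), fun k => s.pr_frame (.inr k)⟩

theorem right_glue (q : Frames 𝔼 fun _ => α) (r : Frames 𝔼 fun _ => β) (h : q.base = r.base) :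
    right (glue q r h) = r := ext' h rfl

theorem dSmooth_left : DSmooth (left (𝔼 := 𝔼) (α := α) (β := β)) :=
  fun _ _ hq => ⟨hq.1, fun k => hq.2 (.inl k)⟩

theorem dSmooth_right : DSmooth (right (𝔼 := 𝔼) (α := α) (β := β)) :=
  fun _ _ hq => ⟨hq.1, fun k => hq.2 (.inr k)⟩

variable {K : Fin m → H →L[ℂ] V} {R : Fin m → V →L[ℂ] H} {E : Fin m → GerbeModule L 𝒢 H}

/-- The connection on the sum of the modules `𝔼 (k i)`. -/
def sumConn (K : Fin m → H →L[ℂ] V) (R : Fin m → V →L[ℂ] H) (k : Fin m → κ)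
    (c : ∀ i, HorizontalConnection (𝔼 (k i))) (α : ι) :
    FormFamily (Frames 𝔼 fun _ => α) (TraceClass V) 1 :=
  sumForm K R fun i => conn (k i) (c i)

theorem invariantConnection_sumConn (k : Fin m → κ) (c : ∀ i, HorizontalConnection (𝔼 (k i))) :
    InvariantConnection (sumConn K R k c α) :=
  InvariantConnection.sumForm fun i => invariantConnection_conn (k i) (c i)

theorem chernTrace_sumConn (hKR : IsOrthogonal K R) (k : Fin m → κ)
    (c : ∀ i, HorizontalConnection (𝔼 (k i))) {q : Eu n → Frames 𝔼 fun _ => α} (hq : IsPlot q)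
    (x : Eu n) : chernTrace (sumConn K R k c α) q x
      = ∑ i, chernTrace ((c i).A α) (fun y => (q y).frame (k i)) x := by
  rw [sumConn, chernTrace_sumForm hKR fun i x =>
    (invariantConnection_conn (k i) (c i)).differentiableAt hq x]
  exact Finset.sum_congr rfl fun i _ => chernTrace_conn (k i) (c i) q x

theorem gaugeRel_sumConn (hKR : IsDirectSum K R) [Nonempty κ] (k : Fin m → κ)
    (c : ∀ i, HorizontalConnection (𝔼 (k i))) :
    GaugeRel (pullForm left (sumConn K R k c α)) (pullForm right (sumConn K R k c β)) Eq
      (fun s _ => blockUnitary hKR fun i =>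
        (𝔼 (k i)).φ α β (s.left.frame (k i)) (s.right.frame (k i))) (pullA 𝒢 base α β) :=
  (GaugeRel.sum hKR (isFormOn_pullA dSmooth_base
      (fun q => q.base_mem (Sum.inl (Classical.arbitrary κ)))
      fun q => q.base_mem (Sum.inr (Classical.arbitrary κ)))
    (fun h t => congrArg (t • ·) h) fun i => gaugeRel_conn (k i) (c i)).diag

end Frames

/-- Isomorphisms between the sums of the modules `𝔼 (k i)` and `𝔼 (l i)`. -/
structure FrameIso {κ : Type} (𝔼 : κ → GerbeModule L 𝒢 H) {K : Fin m → H →L[ℂ] V}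
    {R : Fin m → V →L[ℂ] H} (hKR : IsDirectSum K R) (k l : Fin m → κ) where
  w : ι → unitary (V →L[ℂ] V)
  ψ : ∀ α, (Frames 𝔼 fun _ => α) → UnitaryTraceClass V
  smooth : ∀ α {n : ℕ} {q : Eu n → Frames 𝔼 fun _ => α}, IsPlot q →
    SmoothUnitaryMap fun y => ψ α (q y)
  smul : ∀ α (t : Circle × Circle) q, ψ α (t • q) = ψ α q
  comm : ∀ α β (s : Frames (Sum.elim 𝔼 𝔼) (Sum.elim (fun _ => α) fun _ => β)),
    blockUnitary hKR (fun i => (𝔼 (l i)).φ α β (s.left.frame (l i)) (s.right.frame (l i)))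
        * (w β * (ψ β s.right).1)
      = w α * (ψ α s.left).1
        * blockUnitary hKR fun i => (𝔼 (k i)).φ α β (s.left.frame (k i)) (s.right.frame (k i))

namespace FrameIso

variable {κ : Type} {𝔼 : κ → GerbeModule L 𝒢 H} {K : Fin m → H →L[ℂ] V}
  {R : Fin m → V →L[ℂ] H} {hKR : IsDirectSum K R} {k l : Fin m → κ} (I : FrameIso 𝔼 hKR k l)
  (c : ∀ i, HorizontalConnection (𝔼 (k i))) (c' : ∀ i, HorizontalConnection (𝔼 (l i))) {α β : ι}

/-- The pullback of the sum of the connections `c'`. -/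
def pullConn (α : ι) : FormFamily (Frames 𝔼 fun _ => α) (TraceClass V) 1 :=
  gaugeTransform (conjForm (I.w α) (Frames.sumConn K R l c' α)) (I.ψ α)

theorem gaugeRel_pullConn (α : ι) : GaugeRel (Frames.sumConn K R l c' α) (I.pullConn c' α) Eq
    (fun q _ => I.w α * (I.ψ α q).1) 0 :=
  gaugeRel_gaugeTransform (I.w α) (I.smooth α) (I.smul α)

theorem invariantConnection_pullConn (hM : IsSmoothCircleAction M) (α : ι) :
    InvariantConnection (I.pullConn c' α) :=
  InvariantConnection.gaugeTransform
    (InvariantConnection.sumForm fun _ => Frames.invariantConnection_sumConn l c')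
    (I.smooth α) (I.smul α) (Frames.isSmoothTorusAction hM)

theorem gaugeRel_pullConn_pullConn [Nonempty κ] : GaugeRel (pullForm Frames.left (I.pullConn c' α))
    (pullForm Frames.right (I.pullConn c' β)) Eq (fun s _ => blockUnitary hKR fun i =>
      (𝔼 (k i)).φ α β (s.left.frame (k i)) (s.right.frame (k i))) (pullA 𝒢 Frames.base α β) :=
  GaugeRel.conj (Frames.gaugeRel_sumConn hKR l c')
    ((I.gaugeRel_pullConn c' α).pullForm Frames.dSmooth_left fun _ _ => rfl)
    ((I.gaugeRel_pullConn c' β).pullForm Frames.dSmooth_right fun _ _ => rfl) (I.comm α β)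

theorem isGluing_csTrace [Nonempty κ] (hM : IsSmoothCircleAction M) (hc : IsCoupled L 𝒢) :
    IsGluing 𝒢 (fun α => (Frames.base : (Frames 𝔼 fun _ => α) → _))
      fun α _ q x => csTrace (I.pullConn c' α) (Frames.sumConn K R k c α) q x where
  isTotalForm α := isTotalForm_csTrace (Frames.isSmoothTorusAction hM)
    (I.invariantConnection_pullConn c' hM α) (Frames.invariantConnection_sumConn k c)
  twist α _ _ _ hq hd t x := csTrace_twist (Frames.isSmoothTorusAction hM)
    (I.invariantConnection_pullConn c' hM α) (Frames.invariantConnection_sumConn k c) t hd hq x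
  glue α β {n q r} hq hr h x := by
    refine Frames.glue_of_eq_exp hc hq hr h x ?_
    have hs := Frames.isPlot_glue hq hr h
    have e := csTrace_gauge (Frames.isSmoothTorusAction hM) (Frames.isSmoothTorusAction hM)
      ((I.invariantConnection_pullConn c' hM α).pullForm Frames.dSmooth_left fun _ _ => rfl)
      ((Frames.invariantConnection_sumConn k c).pullForm Frames.dSmooth_left fun _ _ => rfl)
      ((I.invariantConnection_pullConn c' hM β).pullForm Frames.dSmooth_right fun _ _ => rfl)
      ((Frames.invariantConnection_sumConn k c).pullForm Frames.dSmooth_right fun _ _ => rfl)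
      (I.gaugeRel_pullConn_pullConn c') (Frames.gaugeRel_sumConn hKR k c) hs hs (fun _ => rfl) x
    rw [csTrace_pullForm fun _ _ => rfl, csTrace_pullForm fun _ _ => rfl] at e
    have hr' : (fun y => Frames.right (Frames.glue (q y) (r y) (h y))) = r :=
      funext fun y => Frames.right_glue _ _ _
    rw [hr'] at e
    exact e

/-- The Chern characters of isomorphic sums of modules differ by an exact form. -/
theorem exists_isTwisted (I : FrameIso 𝔼 hKR k l) [Finite κ] [Nonempty κ] (hM : IsSmoothCircleAction M)
    (hc : IsCoupled L 𝒢) :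
    ∃ W : TotalFamily (CircleBundle L) ℂ, IsTwisted W ∧
      ∀ α (n : ℕ) (q : Eu n → Frames 𝔼 fun _ => α), IsPlot q → ∀ x,
        twistD 𝒢 W n (fun y => (q y).base) x = expFactor 𝒢 α (fun y => (q y).base) x
          * (∑ i, chernTrace ((c i).A α) (fun y => (q y).frame (k i)) x
            - ∑ i, chernTrace ((c' i).A α) (fun y => (q y).frame (l i)) x) := by
  have hQ := Frames.isLocalFrames (𝔼 := 𝔼) hM
  have hT := I.isGluing_csTrace c c' hM hc
  obtain ⟨W, hW, hWq⟩ := hT.exists_isTwisted hM hQ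
  refine ⟨W, hW, fun α n q hq x => ?_⟩
  have hα := hQ.smooth_action α
  have i₀ := I.invariantConnection_pullConn c' hM α
  have i₁ := Frames.invariantConnection_sumConn (K := K) (R := R) (α := α) k c
  have hd := hT.twistD_eq_mul hM hc hQ hW (hWq α)
    ((i₁.isTotalForm_chernTrace hα).sub (i₀.isTotalForm_chernTrace hα)) hq
    (d_csTrace hα i₀ i₁ hq) x
  have e := chernTrace_gauge hα hα (Frames.invariantConnection_sumConn l c') i₀
    (I.gaugeRel_pullConn c' α) hq hq (fun _ => rfl) x (gaugeScalar_zero q x)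
  rw [← e, Frames.chernTrace_sumConn hKR.toIsOrthogonal k c hq,
    Frames.chernTrace_sumConn hKR.toIsOrthogonal l c' hq] at hd
  exact hd

end FrameIso

variable {E F : Fin m → GerbeModule L 𝒢 H}

theorem SumIso.comm (I : SumIso E F) {α β : ι} {e : ∀ i, ((E i).E α).Q} {f : ∀ i, ((F i).E α).Q}
    {e' : ∀ i, ((E i).E β).Q} {f' : ∀ i, ((F i).E β).Q} {s : CircleBundle L}
    (he : ∀ i, ((E i).E α).pr (e i) = s) (hf : ∀ i, ((F i).E α).pr (f i) = s)
    (he' : ∀ i, ((E i).E β).pr (e' i) = s) (hf' : ∀ i, ((F i).E β).pr (f' i) = s) :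
    blockUnitary isDirectSum_block (fun i => (F i).φ α β (f i) (f' i))
        * (I.w β * (I.ψ β e' f').1)
      = I.w α * (I.ψ α e f).1 * blockUnitary isDirectSum_block fun i => (E i).φ α β (e i) (e' i) := by
  rw [← I.Ψ_eq, ← I.Ψ_eq]
  refine Subtype.ext (ContinuousLinearMap.ext fun x => ?_)
  refine (blockDiag_eq_diagApply _ _).trans ((I.Ψ_φ α β e f e' f' s he hf he' hf' x).trans ?_)
  exact congrArg (I.Ψ α e f).1 (blockDiag_eq_diagApply _ x).symm

/-- The isomorphism of frames underlying an isomorphism of sums of modules. -/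
def SumIso.frameIso (I : SumIso E F) :
    FrameIso (Sum.elim E F) (isDirectSum_block (H := H) (m := m)) Sum.inl Sum.inr where
  w := I.w
  ψ α q := I.ψ α (fun i => q.frame (.inl i)) fun i => q.frame (.inr i)
  smooth α {n q} hq := I.smooth_ψ α n _ _ (fun y => (q y).base) (fun i => hq.2 (.inl i))
    (fun i => hq.2 (.inr i)) (fun y i => (q y).pr_frame (.inl i)) fun y i => (q y).pr_frame (.inr i)
  smul α t q := by
    have h := I.Ψ_smul α _ _ q.base t (fun i => q.pr_frame (.inl i)) fun i => q.pr_frame (.inr i)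
    exact Subtype.ext (mul_left_cancel ((I.Ψ_eq α _ _).symm.trans (h.trans (I.Ψ_eq α _ _))))
  comm α β s := I.comm (s := s.base) (fun i => s.pr_frame (.inl (.inl i)))
    (fun i => s.pr_frame (.inl (.inr i))) (fun i => s.pr_frame (.inr (.inl i)))
    fun i => s.pr_frame (.inr (.inr i))

end DirectSums
end

noncomputable section

section CharacterMap

open Om

variable {M : Type u} [DiffeologicalSpace M] [MulAction Circle M] {ι : Type u}
  {𝒰 : GoodCover M ι} {L : HermitianLineBundle 𝒰} {𝒢 : WeakInvariantGerbe 𝒰} {H : Type u}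
  [NormedAddCommGroup H] [InnerProductSpace ℂ H] [CompleteSpace H] {n : ℕ}

theorem mul_three_sub_three {R : Type*} [Ring R] {e a b c a' b' c' v w : R}
    (hv : v = e * (a - a')) (hw : w = e * (b' - b)) (h : 0 = e * (c - c')) :
    e * (a + b + c - (a' + b' + c')) = v - w := by
  have e₁ : e * (a + b + c - (a' + b' + c')) = e * (a - a') - e * (b' - b) + e * (c - c') := by
    noncomm_ring
  rw [e₁, ← h, ← hv, ← hw, add_zero]

/-- Chern characters of stably equivalent pairs differ by an exact form. -/
theorem exists_isTwisted_of_sumIso (hM : IsSmoothCircleAction M) (hc : IsCoupled L 𝒢)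
    {E E' G G' K : GerbeModule L 𝒢 H} (I : SumIso ![E, G', K] ![E', G, K])
    (a : HorizontalConnection E) (a' : HorizontalConnection E') (b : HorizontalConnection G)
    (b' : HorizontalConnection G') (c : HorizontalConnection K)
    {W₁ W₀ : TotalFamily (CircleBundle L) ℂ} (h₁ : IsTwisted W₁) (h₀ : IsTwisted W₀)
    (hW₁ : IsChernTotal a a' W₁) (hW₀ : IsChernTotal b b' W₀) :
    ∃ W : TotalFamily (CircleBundle L) ℂ, IsTwisted W ∧ ∀ (n : ℕ) (p : Eu n → CircleBundle L),
      IsPlot p → ∀ x, twistD 𝒢 W n p x = W₁ n p x - W₀ n p x := by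
  let d : ∀ i : Fin 3, HorizontalConnection (![E, G', K] i) := fun i => match i with
    | 0 => a
    | 1 => b'
    | 2 => c
  let d' : ∀ i : Fin 3, HorizontalConnection (![E', G, K] i) := fun i => match i with
    | 0 => a'
    | 1 => b
    | 2 => c
  obtain ⟨W, hW, hWd⟩ := FrameIso.exists_isTwisted (𝔼 := Sum.elim ![E, G', K] ![E', G, K])
    (k := Sum.inl) (l := Sum.inr) d d' I.frameIso hM hc
  obtain ⟨W₂, -, hW₂, -⟩ := exists_isChernTotal hM hc c c
  have hQ := Frames.isLocalFrames (𝔼 := Sum.elim ![E, G', K] ![E', G, K]) hM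
  refine ⟨W, hW, fun n p hp x => ?_⟩
  obtain ⟨α, hα⟩ := 𝒰.exists_mem (p x).base
  obtain ⟨s, hs, hsp⟩ := hQ.exists_lift α n p hp x hα
  have hg : ∀ᶠ y in 𝓝 x, p y = (s y).base := hsp.mono fun _ hy => hy.symm
  rw [twistD_congr_germ hM hW.isTotalForm hp (hQ.plot hs) hg,
    h₀.isTotalForm.congr_germ hp (hQ.plot hs) hg, h₁.isTotalForm.congr_germ hp (hQ.plot hs) hg]
  refine (hWd α n s hs x).trans ?_
  rw [Fin.sum_univ_three, Fin.sum_univ_three]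
  have e₁ := hW₁.eq (hs.2 (.inl 0)) (hs.2 (.inr 0)) (fun y => (s y).pr_frame (.inl 0))
    (fun y => (s y).pr_frame (.inr 0)) x
  have e₀ := hW₀.eq (hs.2 (.inr 1)) (hs.2 (.inl 1)) (fun y => (s y).pr_frame (.inr 1))
    (fun y => (s y).pr_frame (.inl 1)) x
  have e₂ := hW₂.eq (hs.2 (.inl 2)) (hs.2 (.inr 2)) (fun y => (s y).pr_frame (.inl 2))
    (fun y => (s y).pr_frame (.inr 2)) x
  have e₃ := hW₂.eq (hs.2 (.inl 2)) (hs.2 (.inl 2)) (fun y => (s y).pr_frame (.inl 2))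
    (fun y => (s y).pr_frame (.inl 2)) x
  rw [sub_self] at e₃
  exact mul_three_sub_three e₁ e₀ ((mul_zero _).symm.trans (e₃.symm.trans e₂))

end CharacterMap
end

noncomputable section

section CharacterMap

variable {M : Type u} [DiffeologicalSpace M] [MulAction Circle M] {ι : Type u}
  {𝒰 : GoodCover M ι} {L : HermitianLineBundle 𝒰} {𝒢 : WeakInvariantGerbe 𝒰} {H : Type u}
  [NormedAddCommGroup H] [InnerProductSpace ℂ H] [CompleteSpace H]

theorem MapsTo.congr {w : ι → Laurent M} {ch ch' : Laurent (CircleBundle L)} (h : MapsTo w ch)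
    (e : ∀ j k (n : ℕ) (p : Eu n → CircleBundle L), IsPlot p → ∀ x,
      ch' j k n p x = ch j k n p x) : MapsTo w ch' :=
  fun α j k n p hp x hx => (e j k n p hp x).trans (h α j k n p hp x hx)

/-- The closed form `w` represents the Chern character of `(E, E')` computed from `a`, `a'`. -/
def Represents {E E' : GerbeModule L 𝒢 H} (a : HorizontalConnection E)
    (a' : HorizontalConnection E') (w : ClosedXiForm L 𝒢) : Prop :=
  ∃ ch : Laurent (CircleBundle L), IsChernForm a a' ch ∧ MapsTo w.1 ch

section

variable {E E' G G' K : GerbeModule L 𝒢 H}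

theorem exists_mapsTo_of_isChernForm (hM : IsSmoothCircleAction M) (hc : IsCoupled L 𝒢)
    (a : HorizontalConnection E) (a' : HorizontalConnection E') (ch : Laurent (CircleBundle L))
    (h : IsChernForm a a' ch) : ∃ w : ClosedXiForm L 𝒢, MapsTo w.1 ch := by
  obtain ⟨W, hW, hWc, hWd⟩ := exists_isChernTotal hM hc a a'
  obtain ⟨w, hw⟩ := exists_closedXiForm hM hW hWd
  exact ⟨w, hw.congr fun j k n p hp x => (hWc.isChernForm hW.isTotalForm).eq h j k hp x⟩

theorem exists_represents (hM : IsSmoothCircleAction M) (hc : IsCoupled L 𝒢)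
    (a : HorizontalConnection E) (a' : HorizontalConnection E') :
    ∃ w : ClosedXiForm L 𝒢, Represents a a' w := by
  obtain ⟨ch, h, -⟩ := exists_isChernForm hM hc a a'
  obtain ⟨w, hw⟩ := exists_mapsTo_of_isChernForm hM hc a a' ch h
  exact ⟨w, ch, h, hw⟩

theorem Represents.mapsTo {a : HorizontalConnection E} {a' : HorizontalConnection E'}
    {w : ClosedXiForm L 𝒢} (h : Represents a a' w) {W : TotalFamily (CircleBundle L) ℂ}
    (hW : IsTwisted W) (hWc : IsChernTotal a a' W) : MapsTo w.1 (laurentOf 0 W) := by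
  obtain ⟨ch, hch, hw⟩ := h
  exact hw.congr fun j k n p hp x => hch.eq (hWc.isChernForm hW.isTotalForm) j k hp x

theorem Represents.xiCohomologous (hM : IsSmoothCircleAction M) (hc : IsCoupled L 𝒢)
    {a₀ a₁ : HorizontalConnection E} {a₀' a₁' : HorizontalConnection E'}
    {w₀ w₁ : ClosedXiForm L 𝒢} (h₀ : Represents a₀ a₀' w₀) (h₁ : Represents a₁ a₁' w₁) :
    XiCohomologous L 𝒢 w₁ w₀ := by
  obtain ⟨W₀, hW₀, hc₀, -⟩ := exists_isChernTotal hM hc a₀ a₀'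
  obtain ⟨W₁, hW₁, hc₁, -⟩ := exists_isChernTotal hM hc a₁ a₁'
  obtain ⟨W, hW, -, hd⟩ := exists_chernSimonsTotal hM hc a₀ a₁ a₀' a₁' hW₀.isTotalForm
    hW₁.isTotalForm hc₀ hc₁
  exact xiCohomologous_of_twistD hM hW hd (h₀.mapsTo hW₀ hc₀) (h₁.mapsTo hW₁ hc₁)

theorem Represents.xiCohomologous_of_sumIso (hM : IsSmoothCircleAction M) (hc : IsCoupled L 𝒢)
    (I : SumIso ![E, G', K] ![E', G, K]) {a : HorizontalConnection E}
    {a' : HorizontalConnection E'} {b : HorizontalConnection G} {b' : HorizontalConnection G'}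
    (c : HorizontalConnection K) {w₁ w₀ : ClosedXiForm L 𝒢} (h₁ : Represents a a' w₁)
    (h₀ : Represents b b' w₀) : XiCohomologous L 𝒢 w₁ w₀ := by
  obtain ⟨W₁, hW₁, hc₁, -⟩ := exists_isChernTotal hM hc a a'
  obtain ⟨W₀, hW₀, hc₀, -⟩ := exists_isChernTotal hM hc b b'
  obtain ⟨W, hW, hd⟩ := exists_isTwisted_of_sumIso hM hc I a a' b b' c hW₁ hW₀ hc₁ hc₀
  exact xiCohomologous_of_twistD hM hW hd (h₀.mapsTo hW₀ hc₀) (h₁.mapsTo hW₁ hc₁)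

end

/-- The exotic twisted equivariant Chern character is well defined on K-theory. -/
theorem existsUnique_chernCharacter (hM : IsSmoothCircleAction M) (hc : IsCoupled L 𝒢) :
    ∃! Ch : ExoticK L 𝒢 H → ExoticCohomology L 𝒢,
      ∀ (E E' : GerbeModule L 𝒢 H) (a : HorizontalConnection E) (a' : HorizontalConnection E')
        (ch : Laurent (CircleBundle L)) (w : ClosedXiForm L 𝒢),
        IsChernForm a a' ch → MapsTo w.1 ch →
          Ch (kClass a a') = Quot.mk (XiCohomologous L 𝒢) w := by
  choose r hr using fun q : ConnectibleModule L 𝒢 H × ConnectibleModule L 𝒢 H =>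
    exists_represents hM hc q.1.2.some q.2.2.some
  refine ⟨Quot.lift (fun q => Quot.mk _ (r q)) ?_, ?_, ?_⟩
  · rintro q q' ⟨K, ⟨I⟩⟩
    exact Quot.sound ((hr q).xiCohomologous_of_sumIso hM hc I K.2.some (hr q'))
  · intro E E' a a' ch w h hw
    exact Quot.sound (Represents.xiCohomologous hM hc ⟨ch, h, hw⟩ (hr (⟨E, ⟨a⟩⟩, ⟨E', ⟨a'⟩⟩)))
  · intro Ch h
    funext z
    induction z using Quot.ind with
    | mk q =>
      obtain ⟨ch, hch, hw⟩ := hr q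
      exact h q.1.1 q.2.1 q.1.2.some q.2.2.some ch (r q) hch hw

end CharacterMap

theorem mainTheorem1 {M ι H : Type u} [DiffeologicalSpace M] [MulAction Circle M]
    [NormedAddCommGroup H] [InnerProductSpace ℂ H] [CompleteSpace H]
    (hM : IsSmoothCircleAction M) (𝒰 : GoodCover M ι) (𝒢 : WeakInvariantGerbe 𝒰)
    (L : HermitianLineBundle 𝒰) (hc : IsCoupled L 𝒢) :
    -- the Chern character form is globally well defined and closed, and lies in `Ω̃^*(Sξ)`
    (∀ (E E' : GerbeModule L 𝒢 H) (a : HorizontalConnection E) (a' : HorizontalConnection E'),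
      ∃ ch : Laurent (CircleBundle L), IsChernForm a a' ch ∧
        (∀ ch', IsChernForm a a' ch' → ∀ j k (n : ℕ) (p : Eu n → CircleBundle L), IsPlot p →
          ∀ x, ch' j k n p x = ch j k n p x) ∧
        InOmegaTilde ch ∧ IsTInvariant ch ∧
        ∀ j k (n : ℕ) (p : Eu n → CircleBundle L), IsPlot p → ∀ x,
          circleD L 𝒢 ch j k n p x = 0) ∧
    -- transgression
    (∀ (E E' : GerbeModule L 𝒢 H) (a₀ a₁ : HorizontalConnection E)
      (a₀' a₁' : HorizontalConnection E') (ch₀ ch₁ : Laurent (CircleBundle L)),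
      IsChernForm a₀ a₀' ch₀ → IsChernForm a₁ a₁' ch₁ →
      ∃ cs : Laurent (CircleBundle L), IsChernSimonsForm a₀ a₁ a₀' a₁' cs ∧
        InOmegaTilde cs ∧ IsTInvariant cs ∧
        ∀ j k (n : ℕ) (p : Eu n → CircleBundle L), IsPlot p → ∀ x,
          ch₁ j k n p x - ch₀ j k n p x = circleD L 𝒢 cs j k n p x) ∧
    -- the Chern character on exotic twisted equivariant K-theory is well defined
    (∀ (E E' : GerbeModule L 𝒢 H) (a : HorizontalConnection E) (a' : HorizontalConnection E')
      (ch : Laurent (CircleBundle L)), IsChernForm a a' ch →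
      ∃ w : ClosedXiForm L 𝒢, MapsTo w.1 ch) ∧
    ∃! Ch : ExoticK L 𝒢 H → ExoticCohomology L 𝒢,
      ∀ (E E' : GerbeModule L 𝒢 H) (a : HorizontalConnection E) (a' : HorizontalConnection E')
        (ch : Laurent (CircleBundle L)) (w : ClosedXiForm L 𝒢),
        IsChernForm a a' ch → MapsTo w.1 ch →
          Ch (kClass a a') = Quot.mk (XiCohomologous L 𝒢) w :=
  ⟨fun _ _ => exists_isChernForm hM hc, fun _ _ => exists_isChernSimonsForm hM hc,
    fun _ _ => exists_mapsTo_of_isChernForm hM hc, existsUnique_chernCharacter hM hc⟩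

end
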